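/- Let $M$ be a (Hausdorff, second countable) smooth 4-manifold, and give the set of smooth metrics of Lorentzian signature on $M$ the (weak) $C^\infty$ topology, i.e. uniform convergence of the components and all their derivatives on compact subsets of charts. A property holds for a *generic* metric if it holds on a residual set, one that contains a countable intersection of dense open sets. Terminology, for a Lorentzian metric $g$ on $M$ with a time orientation. A *clock* is a smooth embedding $\gamma:I\to M$ of an open real interval with timelike future-pointing tangent vectors; its parameter is its reading, and its image is its trajectory. An *adjustment of the tick rate* of a clock is an orientation-preserving smooth reparametrization of it. A *light ray* is a future-pointing null geodesic segment. Let $W\subseteq M$ be a geodesically convex open set (any two points of $W$ are joined within $W$ by exactly one geodesic segment, up to affine reparametrization, and it depends smoothly on its end points); all light rays below run within $W$. Two clocks *lie in the radar neighborhood* $W$ if their trajectories lie in $W$ and, for $(A,B)$ equal to the two clocks in either order, for every event $b$ on $B$ there are precisely one light ray from $A$ to $b$ and precisely one light ray from $b$ to $A$. Clock $B$ is *Einstein synchronized to* clock $A$ if for every reading $t_B$ of $B$ there is a light signal that $A$ emits at some reading $t_A$, that reaches $B$ at $t_B$, and whose echo returns to $A$ at some reading $t_A'$, and always $$t_A'-t_B=t_B-t_A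 .$$ A pair of clocks is *Einstein synchronized* if each is Einstein synchronized to the other. A set of pairs of clocks *can be synchronized* if the tick rates of the clocks can be adjusted, one adjustment per clock, so that all pairs in the set are Einstein synchronized. An *observer field* on an open set $U$ is a smooth timelike future-pointing vector field $V$ on $U$; the *clocks in $V$* are the clocks that are maximal integral curves of $V$ in $U$. **Proposition 2.4.** For a generic Lorentzian metric $g$ on $M$, every time orientation of $g$ and every $W$, the following hold. 1. Any two clocks with disjoint trajectories that lie in the radar neighborhood $W$ can be adjusted so as to be Einstein synchronized with one another. 2. Let $W$ be geodesically convex and open, let $U\subseteq W$ be open and non-empty, and let $V$ be an observer field on $U$ such that any two clocks in $V$ with disjoint trajectories lie in the radar neighborhood $W$. Then the clocks in $V$ cannot all be synchronized with one another, and selecting some pairs excludes others: there are three clocks in $V$ with pairwise disjoint trajectories, a non-empty set $S$ of pairs of them, and a further pair $p\notin S$ of them, such that $S$ can be synchronized and $\{p\}$ can be synchronized, but $S\cup\{p\}$ cannot. -/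

import Mathlib

open Set Filter Bundle
open scoped Manifold ContDiff Topology

namespace Spacetime

/-- The model space of 4-dimensional manifolds. -/
abbrev E4 : Type := EuclideanSpace ℝ (Fin 4)

section Metric

variable (M : Type*) [TopologicalSpace M] [ChartedSpace E4 M] [IsManifold (𝓡 4) ∞ M]

/-- A smooth metric tensor field of Lorentzian signature `(-,+,+,+)` on `M`: at every point there is
a vector of negative square on whose orthogonal complement the form is positive definite. -/
structure LorentzMetric where
  inner (x : M) : TangentSpace (𝓡 4) x →L[ℝ] TangentSpace (𝓡 4) x →L[ℝ] ℝ
  symm (x : M) (v w : TangentSpace (𝓡 4) x) : inner x v w = inner x w v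
  lorentzian (x : M) : ∃ v : TangentSpace (𝓡 4) x, inner x v v < 0 ∧
    ∀ w : TangentSpace (𝓡 4) x, inner x v w = 0 → w ≠ 0 → 0 < inner x w w
  smooth : ContMDiff (𝓡 4) ((𝓡 4).prod 𝓘(ℝ, E4 →L[ℝ] E4 →L[ℝ] ℝ)) ∞
    (fun x ↦ TotalSpace.mk' (E4 →L[ℝ] E4 →L[ℝ] ℝ) x (inner x))

variable {M}

/-- The components of the metric in the chart `φ`: the pullback of `g` under `φ⁻¹`, as a function on
the coordinate space (meaningful on `φ.target`). -/
noncomputable def LorentzMetric.inChart (g : LorentzMetric M) (φ : OpenPartialHomeomorph M E4)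
    (y : E4) : E4 →L[ℝ] E4 →L[ℝ] ℝ :=
  let D : E4 →L[ℝ] E4 := mfderiv (𝓡 4) (𝓡 4) φ.symm y
  let G : E4 →L[ℝ] E4 →L[ℝ] ℝ := g.inner (φ.symm y)
  G.bilinearComp D D

/-- The (weak) `C^∞` topology on the set of Lorentzian metrics: uniform convergence, on compact
subsets of chart domains, of the components and of all their partial derivatives. -/
noncomputable instance : TopologicalSpace (LorentzMetric M) :=
  ⨅ φ ∈ atlas E4 M, ⨅ (v : E4) (w : E4) (k : ℕ), TopologicalSpace.induced
    (fun g : LorentzMetric M ↦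
      UniformOnFun.ofFun {K : Set E4 | IsCompact K ∧ K ⊆ φ.target}
        (iteratedFDeriv ℝ k (fun y ↦ g.inChart φ y v w)))
    inferInstance

/-- A time orientation of `(M, g)`, given by a continuous timelike vector field, declared to be
future-pointing. -/
structure TimeOrientation (g : LorentzMetric M) where
  field (x : M) : TangentSpace (𝓡 4) x
  timelike (x : M) : g.inner x (field x) (field x) < 0
  continuous : Continuous (fun x ↦ (⟨x, field x⟩ : TangentBundle (𝓡 4) M))

/-- A causal vector is future-pointing if it lies in the same half-cone as the time orientation. -/
def TimeOrientation.IsFuture {g : LorentzMetric M} (T : TimeOrientation g) (x : M)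
    (v : TangentSpace (𝓡 4) x) : Prop :=
  g.inner x (T.field x) v < 0

/-- The velocity vector of a curve. -/
noncomputable def velocity (c : ℝ → M) (s : ℝ) : TangentSpace (𝓡 4) (c s) :=
  mfderiv 𝓘(ℝ, ℝ) (𝓡 4) c s (1 : ℝ)

/-- The affinely parametrized geodesic equation at the parameter value `s`, in every chart `φ`
around `c s`. With `x = φ ∘ c` it reads
`d/ds (g_{ij} x'^i) = (1/2) (∂_j g_{kl}) x'^k x'^l` for all `j`,
the Euler-Lagrange equation of the energy; it is equivalent to `∇_{c'} c' = 0`. -/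
def GeodesicEqAt (g : LorentzMetric M) (c : ℝ → M) (s : ℝ) : Prop :=
  ∀ φ ∈ atlas E4 M, c s ∈ φ.source → ∀ w : E4,
    HasDerivAt (fun r ↦ g.inChart φ (φ (c r)) (deriv (φ ∘ c) r) w)
      (1 / 2 * fderiv ℝ (fun y ↦ g.inChart φ y (deriv (φ ∘ c) s) (deriv (φ ∘ c) s))
        (φ (c s)) w) s

/-- `c`, restricted to `[0,1]`, is a smooth geodesic segment from `p` to `q` that lies in `W`. -/
structure IsGeodesicSegment (g : LorentzMetric M) (W : Set M) (p q : M) (c : ℝ → M) : Prop where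
  source : c 0 = p
  target : c 1 = q
  mem : ∀ s ∈ Icc (0 : ℝ) 1, c s ∈ W
  smooth : ∀ s ∈ Icc (0 : ℝ) 1, ContMDiffAt 𝓘(ℝ, ℝ) (𝓡 4) ∞ c s
  geodesic : ∀ᶠ s in 𝓝ˢ (Icc (0 : ℝ) 1), GeodesicEqAt g c s

/-- A geodesically convex open set: any two of its points are joined within it by exactly one
geodesic segment, and this segment depends smoothly on its end points. -/
def IsConvexNhd (g : LorentzMetric M) (W : Set M) : Prop :=
  IsOpen W ∧ ∃ Γ : M → M → ℝ → M,
    ContMDiffOn (((𝓡 4).prod (𝓡 4)).prod 𝓘(ℝ, ℝ)) (𝓡 4) ∞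
      (fun z : (M × M) × ℝ ↦ Γ z.1.1 z.1.2 z.2) ((W ×ˢ W) ×ˢ Icc (0 : ℝ) 1) ∧
    ∀ p ∈ W, ∀ q ∈ W, IsGeodesicSegment g W p q (Γ p q) ∧
      ∀ c, IsGeodesicSegment g W p q c → EqOn c (Γ p q) (Icc 0 1)

variable {g : LorentzMetric M}

/-- `c`, restricted to `[0,1]`, is a light ray in `W` from the event `p` to the event `q`: a
future-pointing null geodesic segment. -/
def IsLightRay (T : TimeOrientation g) (W : Set M) (p q : M) (c : ℝ → M) : Prop :=
  IsGeodesicSegment g W p q c ∧ ∀ s ∈ Icc (0 : ℝ) 1,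
    g.inner (c s) (velocity c s) (velocity c s) = 0 ∧ T.IsFuture (c s) (velocity c s)

/-- A clock: a smooth embedding of an open real interval whose tangent vectors are timelike and
future-pointing. The parameter is the reading of the clock. -/
structure Clock (T : TimeOrientation g) where
  dom : Set ℝ
  toFun : ℝ → M
  isOpen_dom : IsOpen dom
  ordConnected_dom : dom.OrdConnected
  nonempty_dom : dom.Nonempty
  smooth : ContMDiffOn 𝓘(ℝ, ℝ) (𝓡 4) ∞ toFun dom
  isEmbedding : Topology.IsEmbedding (dom.domRestrict toFun)
  timelike : ∀ t ∈ dom, g.inner (toFun t) (velocity toFun t) (velocity toFun t) < 0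
  future : ∀ t ∈ dom, T.IsFuture (toFun t) (velocity toFun t)

variable {T : TimeOrientation g}

/-- The set of events on a clock. -/
def Clock.trajectory (A : Clock T) : Set M := A.toFun '' A.dom

/-- `A'` arises from `A` by an adjustment of the tick rate: an orientation-preserving smooth
reparametrization of the same trajectory. -/
def Clock.IsAdjustmentOf (A' A : Clock T) : Prop :=
  ∃ θ : ℝ → ℝ, ContDiffOn ℝ ∞ θ A'.dom ∧ (∀ t ∈ A'.dom, 0 < deriv θ t) ∧
    θ '' A'.dom = A.dom ∧ EqOn A'.toFun (A.toFun ∘ θ) A'.dom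

/-- Light emitted by `A` at its reading `t` reaches, through `W`, the event `q`. -/
def Clock.Emits (A : Clock T) (W : Set M) (t : ℝ) (q : M) : Prop :=
  t ∈ A.dom ∧ ∃ c, IsLightRay T W (A.toFun t) q c

/-- Light emitted at the event `q` reaches `A`, through `W`, at its reading `t`. -/
def Clock.Receives (A : Clock T) (W : Set M) (t : ℝ) (q : M) : Prop :=
  t ∈ A.dom ∧ ∃ c, IsLightRay T W q (A.toFun t) c

/-- For every event `b` on `B` there are precisely one light ray in `W` from `A` to `b` and
precisely one light ray in `W` from `b` to `A`. -/
def HasRadarContact (W : Set M) (A B : Clock T) : Prop :=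
  ∀ b ∈ B.trajectory,
    ((∃ t, A.Emits W t b) ∧ ∀ t ∈ A.dom, ∀ t' ∈ A.dom, ∀ c c',
      IsLightRay T W (A.toFun t) b c → IsLightRay T W (A.toFun t') b c' →
        t = t' ∧ EqOn c c' (Icc 0 1)) ∧
    ((∃ t, A.Receives W t b) ∧ ∀ t ∈ A.dom, ∀ t' ∈ A.dom, ∀ c c',
      IsLightRay T W b (A.toFun t) c → IsLightRay T W b (A.toFun t') c' →
        t = t' ∧ EqOn c c' (Icc 0 1))

/-- The clocks `A` and `B` lie in the radar neighborhood `W`: `W` is a geodesically convex open set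
that contains both, and each has radar contact with the other, at all of its events. -/
def InRadarNhd (W : Set M) (A B : Clock T) : Prop :=
  IsConvexNhd g W ∧ A.trajectory ⊆ W ∧ B.trajectory ⊆ W ∧
    HasRadarContact W A B ∧ HasRadarContact W B A

/-- `B` is Einstein synchronized to `A`: for every reading `tB` of `B` there is a light signal sent
by `A` at some reading `tA` that reaches `B` at `tB` and whose echo reaches `A` at some reading
`tA'`, and always `tA' - tB = tB - tA`. -/
def EinsteinSynchronizedTo (W : Set M) (B A : Clock T) : Prop :=
  ∀ tB ∈ B.dom,
    (∃ tA tA', A.Emits W tA (B.toFun tB) ∧ A.Receives W tA' (B.toFun tB)) ∧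
    ∀ tA tA', A.Emits W tA (B.toFun tB) → A.Receives W tA' (B.toFun tB) →
      tA' - tB = tB - tA

/-- `A` and `B` are Einstein synchronized with one another. -/
def EinsteinSynchronized (W : Set M) (A B : Clock T) : Prop :=
  EinsteinSynchronizedTo W A B ∧ EinsteinSynchronizedTo W B A

/-- An observer field on `U`: a smooth, timelike, future-pointing vector field. -/
structure IsObserverField (T : TimeOrientation g) (U : Set M)
    (V : (x : M) → TangentSpace (𝓡 4) x) : Prop where
  smooth : ContMDiffOn (𝓡 4) (𝓡 4).tangent ∞ (fun x ↦ (⟨x, V x⟩ : TangentBundle (𝓡 4) M)) U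
  timelike : ∀ x ∈ U, g.inner x (V x) (V x) < 0
  future : ∀ x ∈ U, T.IsFuture x (V x)

/-- `A` is an integral curve in `U` of the vector field `V`. -/
def Clock.IsIntegralCurveIn (A : Clock T) (U : Set M) (V : (x : M) → TangentSpace (𝓡 4) x) : Prop :=
  A.trajectory ⊆ U ∧ IsMIntegralCurveOn A.toFun V A.dom

/-- `A` is a clock in `V`: a maximal integral curve, in `U`, of `V`. -/
def Clock.IsClockOf (A : Clock T) (U : Set M) (V : (x : M) → TangentSpace (𝓡 4) x) : Prop :=
  A.IsIntegralCurveIn U V ∧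
    ∀ B : Clock T, B.IsIntegralCurveIn U V → A.dom ⊆ B.dom → EqOn A.toFun B.toFun A.dom →
      B.dom = A.dom

/-- The clocks `K i` can be adjusted simultaneously so that every pair joined by an edge of the
graph `S` of selected pairs is Einstein synchronized. -/
def Synchronizable {ι : Type} (W : Set M) (K : ι → Clock T) (S : SimpleGraph ι) : Prop :=
  ∃ K' : ι → Clock T, (∀ i, (K' i).IsAdjustmentOf (K i)) ∧
    ∀ i j, S.Adj i j → EinsteinSynchronized W (K' i) (K' j)

end Metric

end Spacetime

/-! The first part rests on the echo map of a clock `A`, which sends the reading at which a light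
signal is emitted towards `B` to the reading at which its echo returns. It is an increasing
diffeomorphism of the domain of `A` without fixed points, for two events cannot be joined by
future-pointing light rays in both directions: a geodesic of the convex neighborhood is unique, so
the second light ray would be the first one reversed. Such a map is conjugate to a translation by
an increasing diffeomorphism (`exists_coordinate_translation`, `exists_translation`). If `A` is read
in the new coordinate, and the reading of `B` is the mean of the readings of `A` at which a signal
leaves `A` and its echo returns, the clocks are synchronized (`InRadarNhd.exists_synchronized`).

For the second part, the delay between the emission of a signal and its arrival at a synchronized
clock is constant (`EinsteinSynchronized.exists_delay`). Hence, for three clocks that are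
synchronized in pairs, echoes from one of them to the two others commute, and signals that run
around the triangle in opposite directions return simultaneously. These relations
(`IsSynchronousTriple`) compare events only, so they hold for the unadjusted clocks too. Suppose now
that any three disjoint clocks of `V` can be synchronized, and evaluate the relations for clocks at
distances proportional to `ε`. Expanding the world function
(`IsGeodesicFamily.hasJet_worldFunction`) gives the travel times of light to second order in `ε`
(`exists_signal_jet`). The echo relation then says that the congruence of clocks has no shear, and
the loop relation that it has no rotation: the covariant derivative of `V` on the orthogonal
complement of `V` is a multiple of the identity (`exists_covForm_eq`). By the Ricci identity
`R(a, b)V` equals `κ(a) b - κ(b) a` up to a multiple of `V`, for `a` and `b` orthogonal to `V`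
(`exists_curvature_eq`). So the magnetic part of the curvature is skew. Since the electric part and
the purely spatial part are symmetric, the traces of their products with it vanish, and the
Pontryagin form `tr R ∧ R`, which is composed of these traces, is zero on `U`
(`pontryaginForm_eq_zero`).

This is a closed condition on the 2-jet of the metric (`continuous_pontryaginForm`), and it is
destroyed by arbitrarily small local perturbations, since the form depends quadratically on the
second derivatives of the metric and the quadratic part is not zero
(`mem_closure_pontryaginForm_ne_zero`). With a countable basis of the topology of `M` it follows
that the Pontryagin form of a generic metric vanishes identically on no nonempty open set
(`eventually_residual_pontryaginForm_ne_zero`). For such a metric some three disjoint clocks of `V`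
cannot be synchronized; as a single pair can be, adding the pairs one at a time yields a set of
pairs that excludes another pair (`exists_exclusion`). -/

set_option linter.unusedSectionVars false

namespace Spacetime

/-! ### Lorentzian bilinear forms -/

section

section LorentzForm

variable {E : Type*} [AddCommGroup E] [Module ℝ E] [TopologicalSpace E]

/-- A symmetric bilinear form of signature `(-,+,…,+)`, described as in `LorentzMetric`. -/
def IsLorentzForm (b : E →L[ℝ] E →L[ℝ] ℝ) : Prop :=
  (∀ v w, b v w = b w v) ∧ ∃ v, b v v < 0 ∧ ∀ w, b v w = 0 → w ≠ 0 → 0 < b w w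

namespace IsLorentzForm

variable {b : E →L[ℝ] E →L[ℝ] ℝ} {t u v w k : E}

theorem pos_of_orthogonal (hb : IsLorentzForm b) (hv : b v v < 0) (hvw : b v w = 0)
    (hw : w ≠ 0) : 0 < b w w := by
  obtain ⟨hs, v₀, h₀, hpos⟩ := hb
  by_contra! hle
  have hv0 : v ≠ 0 := by rintro rfl; simp at hv
  have h1 : b v₀ v ≠ 0 := fun h => absurd (hpos v h hv0) (not_lt.2 hv.le)
  -- a vector of the negative semidefinite plane spanned by `v` and `w` that is orthogonal to `v₀`
  have key := hpos (b v₀ w • v - b v₀ v • w)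
    (by simp only [map_sub, map_smul, smul_eq_mul]; ring)
    (fun h => by
      have h2 : b v (b v₀ w • v - b v₀ v • w) = 0 := by rw [h, map_zero]
      simp only [map_sub, map_smul, smul_eq_mul, hvw, mul_zero, sub_zero] at h2
      have h3 : b v₀ w = 0 := (mul_eq_zero.1 h2).resolve_right hv.ne
      rw [h3, zero_smul, zero_sub, neg_eq_zero, smul_eq_zero] at h
      exact h.elim h1 hw)
  simp only [map_sub, map_smul, _root_.sub_apply, _root_.smul_apply,
    smul_eq_mul, hvw, hs w v] at key
  nlinarith [sq_nonneg (b v₀ w), sq_nonneg (b v₀ v),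
    mul_nonneg (sq_nonneg (b v₀ w)) (neg_nonneg.2 hv.le),
    mul_nonneg (sq_nonneg (b v₀ v)) (neg_nonneg.2 hle)]

theorem nonneg_of_orthogonal (hb : IsLorentzForm b) (hv : b v v < 0) (hvw : b v w = 0) :
    0 ≤ b w w := by
  rcases eq_or_ne w 0 with rfl | hw
  · simp
  · exact (hb.pos_of_orthogonal hv hvw hw).le

theorem ne_zero_of_causal (hb : IsLorentzForm b) (hv : b v v < 0) (hk : b k k ≤ 0)
    (hk0 : k ≠ 0) : b v k ≠ 0 := fun h => (hb.pos_of_orthogonal hv h hk0).not_ge hk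

/-- A timelike and a causal vector in the half-cone of `t` have a negative product. -/
theorem neg_of_future (hb : IsLorentzForm b) (ht : b t t < 0) (hu : b u u < 0) (hk : b k k ≤ 0)
    (htu : b t u < 0) (htk : b t k < 0) : b u k < 0 := by
  by_contra! h
  have hs := hb.1
  have h1 := hb.nonneg_of_orthogonal ht (w := b t k • u - b t u • k)
    (by simp only [map_sub, map_smul, smul_eq_mul]; ring)
  simp only [map_sub, map_smul, _root_.sub_apply, _root_.smul_apply,
    smul_eq_mul, hs k u] at h1
  have h2 : 0 < b t k * b t u := mul_pos_of_neg_of_neg htk htu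
  nlinarith [mul_nonneg h2.le h, mul_pos (pow_pos (neg_pos.2 htk) 2) (neg_pos.2 hu),
    mul_nonneg (sq_nonneg (b t u)) (neg_nonneg.2 hk)]

/-- Whether a causal vector is future-pointing does not depend on the choice of the future-pointing
timelike reference vector. -/
theorem neg_of_neg (hb : IsLorentzForm b) (ht : b t t < 0) (hu : b u u < 0) (htu : b t u < 0)
    (hk : b k k ≤ 0) (huk : b u k < 0) : b t k < 0 :=
  hb.neg_of_future hu ht hk (by rwa [hb.1]) huk

/-- A Lorentzian form is nondegenerate. -/
theorem eq_zero (hb : IsLorentzForm b) (h : ∀ w, b v w = 0) : v = 0 := by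
  obtain ⟨-, v₀, h₀, -⟩ := id hb
  by_contra hv
  exact (hb.pos_of_orthogonal h₀ ((hb.1 _ _).trans (h v₀)) hv).ne' (h v)

end IsLorentzForm

end LorentzForm

/-! ### Metrics and curves in a chart -/

variable {M : Type*} [TopologicalSpace M] [ChartedSpace E4 M] [IsManifold (𝓡 4) ∞ M]

theorem LorentzMetric.isLorentzForm (g : LorentzMetric M) (x : M) : IsLorentzForm (g.inner x) :=
  ⟨g.symm x, g.lorentzian x⟩

section Chart

variable {φ : OpenPartialHomeomorph M E4} {g : LorentzMetric M}

theorem mem_maximalAtlas (hφ : φ ∈ atlas E4 M) : φ ∈ IsManifold.maximalAtlas (𝓡 4) ∞ M :=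
  IsManifold.subset_maximalAtlas hφ

theorem contMDiffAt_chart (hφ : φ ∈ atlas E4 M) {x : M} (hx : x ∈ φ.source) :
    ContMDiffAt (𝓡 4) (𝓡 4) ∞ φ x :=
  contMDiffAt_of_mem_maximalAtlas (mem_maximalAtlas hφ) hx

theorem contMDiffAt_chart_symm (hφ : φ ∈ atlas E4 M) {y : E4} (hy : y ∈ φ.target) :
    ContMDiffAt (𝓡 4) (𝓡 4) ∞ φ.symm y :=
  contMDiffAt_symm_of_mem_maximalAtlas (mem_maximalAtlas hφ) hy

theorem isManifold_one : IsManifold (𝓡 4) 1 M := IsManifold.of_le (n := ∞) (by norm_num)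

theorem mdifferentiable_chart_of_mem (hφ : φ ∈ atlas E4 M) : φ.MDifferentiable (𝓡 4) (𝓡 4) :=
  haveI : IsManifold (𝓡 4) 1 M := isManifold_one
  mdifferentiable_of_mem_atlas hφ

/-- The tangent vector at `φ⁻¹ y` with given components in the chart `φ`. -/
noncomputable def ofComponents (φ : OpenPartialHomeomorph M E4) (y : E4) :
    E4 →L[ℝ] TangentSpace (𝓡 4) (φ.symm y) :=
  mfderiv (𝓡 4) (𝓡 4) φ.symm y

/-- The components in the chart `φ` of a tangent vector at `x`. -/
noncomputable def components (φ : OpenPartialHomeomorph M E4) (x : M) :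
    TangentSpace (𝓡 4) x →L[ℝ] E4 :=
  mfderiv (𝓡 4) (𝓡 4) φ x

theorem ofComponents_components (hφ : φ ∈ atlas E4 M) {y : E4} (hy : y ∈ φ.target)
    (v : TangentSpace (𝓡 4) (φ.symm y)) :
    ofComponents φ y (components φ (φ.symm y) v) = v := by
  have h := (mdifferentiable_chart_of_mem hφ).symm_comp_deriv (φ.map_target hy)
  rw [φ.right_inv hy] at h
  exact congrArg (fun L => L v) h

theorem components_ofComponents (hφ : φ ∈ atlas E4 M) {y : E4} (hy : y ∈ φ.target) (v : E4) :
    components φ (φ.symm y) (ofComponents φ y v) = v :=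
  congrArg (fun L => L v) ((mdifferentiable_chart_of_mem hφ).symm.symm_comp_deriv hy)

theorem inChart_apply (g : LorentzMetric M) (φ : OpenPartialHomeomorph M E4) (y v w : E4) :
    g.inChart φ y v w = g.inner (φ.symm y) (ofComponents φ y v) (ofComponents φ y w) := rfl

theorem inChart_symm (y v w : E4) : g.inChart φ y v w = g.inChart φ y w v := by
  rw [inChart_apply, inChart_apply, g.symm]

theorem inner_eq_inChart (hφ : φ ∈ atlas E4 M) {x : M} (hx : x ∈ φ.source)
    (u v : TangentSpace (𝓡 4) x) :
    g.inner x u v = g.inChart φ (φ x) (components φ x u) (components φ x v) := by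
  obtain ⟨y, hy, rfl⟩ : ∃ y ∈ φ.target, φ.symm y = x := ⟨φ x, φ.map_source hx, φ.left_inv hx⟩
  rw [φ.right_inv hy, inChart_apply, ofComponents_components hφ hy, ofComponents_components hφ hy]

theorem isLorentzForm_inChart (hφ : φ ∈ atlas E4 M) {y : E4} (hy : y ∈ φ.target) :
    IsLorentzForm (g.inChart φ y) := by
  refine ⟨inChart_symm y, ?_⟩
  obtain ⟨v, hv, hpos⟩ := g.lorentzian (φ.symm y)
  refine ⟨components φ _ v, ?_, fun w hw hw0 => hpos (ofComponents φ y w) ?_ ?_⟩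
  · rwa [inChart_apply, ofComponents_components hφ hy]
  · rwa [inChart_apply, ofComponents_components hφ hy] at hw
  · intro h
    apply hw0
    rw [← components_ofComponents hφ hy w, h, map_zero]

/-- The components of the velocity of `c` are the derivatives of the coordinates of `c`. -/
theorem components_velocity (hφ : φ ∈ atlas E4 M) {c : ℝ → M} {s : ℝ}
    (hc : MDifferentiableAt 𝓘(ℝ, ℝ) (𝓡 4) c s) (hs : c s ∈ φ.source) :
    components φ (c s) (velocity c s) = deriv (φ ∘ c) s := by
  have hd := mdifferentiable_chart_of_mem hφ
  have := mfderiv_comp s (hd.mdifferentiableAt hs) hc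
  rw [← fderiv_apply_one_eq_deriv, ← mfderiv_eq_fderiv]
  exact (congrArg (fun L => L (1 : ℝ)) this).symm

theorem differentiableAt_chart_comp (hφ : φ ∈ atlas E4 M) {c : ℝ → M} {s : ℝ}
    (hc : MDifferentiableAt 𝓘(ℝ, ℝ) (𝓡 4) c s) (hs : c s ∈ φ.source) :
    DifferentiableAt ℝ (φ ∘ c) s :=
  (((mdifferentiable_chart_of_mem hφ).mdifferentiableAt hs).comp s hc).differentiableAt

theorem inner_velocity_velocity (hφ : φ ∈ atlas E4 M) {c : ℝ → M} {s : ℝ}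
    (hc : MDifferentiableAt 𝓘(ℝ, ℝ) (𝓡 4) c s) (hs : c s ∈ φ.source) :
    g.inner (c s) (velocity c s) (velocity c s) =
      g.inChart φ (φ (c s)) (deriv (φ ∘ c) s) (deriv (φ ∘ c) s) := by
  rw [inner_eq_inChart hφ hs, components_velocity hφ hc hs]

theorem contMDiffAt_ofComponents (hφ : φ ∈ atlas E4 M) {y : E4} (hy : y ∈ φ.target) (u : E4) :
    ContMDiffAt (𝓡 4) ((𝓡 4).prod 𝓘(ℝ, E4)) ∞
      (fun y : E4 => TotalSpace.mk' E4 (E := TangentSpace (𝓡 4)) (φ.symm y)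
        (ofComponents φ y u)) y := by
  have h1 : ContMDiffAt (𝓡 4).tangent (𝓡 4).tangent ∞ (tangentMapWithin (𝓡 4) (𝓡 4) φ.symm φ.target)
      (⟨y, u⟩ : TangentBundle (𝓡 4) E4) := by
    refine ((contMDiffOn_symm_of_mem_maximalAtlas (mem_maximalAtlas hφ)).contMDiffOn_tangentMapWithin
      (m := ∞) (by simp) φ.open_target.uniqueMDiffOn).contMDiffAt ?_
    exact ((FiberBundle.continuous_proj E4 (TangentSpace (𝓡 4))).isOpen_preimage _
      φ.open_target).mem_nhds hy
  have h2 : ContMDiffAt 𝓘(ℝ, E4) 𝓘(ℝ, E4).tangent ∞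
      (fun y : E4 => (⟨y, u⟩ : TangentBundle (𝓡 4) E4)) y :=
    contMDiffAt_vectorSpace_iff_contDiffAt.2 contDiffAt_const
  refine (h1.comp y h2).congr_of_eventuallyEq ?_
  filter_upwards [φ.open_target.mem_nhds hy] with z hz
  simp only [Function.comp, tangentMapWithin, ofComponents,
    mfderivWithin_of_isOpen φ.open_target hz]
  rfl

theorem contDiffOn_inChart_apply (hφ : φ ∈ atlas E4 M) (v w : E4) :
    ContDiffOn ℝ ∞ (fun y => g.inChart φ y v w) φ.target := by
  intro y hy
  refine ContDiffAt.contDiffWithinAt ?_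
  rw [← contMDiffAt_iff_contDiffAt]
  have hg := (g.smooth (φ.symm y)).comp y (contMDiffAt_chart_symm hφ hy)
  have := ContMDiffAt.clm_bundle_apply₂ (E₃ := Bundle.Trivial M ℝ) (F₃ := ℝ)
    (b := φ.symm) (ψ := fun y => g.inner (φ.symm y)) hg (contMDiffAt_ofComponents hφ hy v)
      (contMDiffAt_ofComponents hφ hy w)
  rw [contMDiffAt_totalSpace] at this
  exact this.2

theorem contDiffOn_inChart (hφ : φ ∈ atlas E4 M) : ContDiffOn ℝ ∞ (g.inChart φ) φ.target := by
  rw [contDiffOn_clm_apply]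
  intro v
  rw [contDiffOn_clm_apply]
  exact fun w => contDiffOn_inChart_apply hφ v w

theorem contDiffAt_inChart (hφ : φ ∈ atlas E4 M) {y : E4} (hy : y ∈ φ.target) :
    ContDiffAt ℝ ∞ (g.inChart φ) y :=
  (contDiffOn_inChart hφ).contDiffAt (φ.open_target.mem_nhds hy)

theorem contDiffAt_components (hφ : φ ∈ atlas E4 M) {V : (x : M) → TangentSpace (𝓡 4) x}
    {n : ℕ∞ω} (hn : n ≤ ∞) {x : M} (hx : x ∈ φ.source) 
    (hV : ContMDiffAt (𝓡 4) (𝓡 4).tangent n (fun x ↦ (⟨x, V x⟩ : TangentBundle (𝓡 4) M)) x) :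
    ContDiffAt ℝ n (fun y => components φ (φ.symm y) (V (φ.symm y))) (φ x) := by
  have hx' := φ.map_source hx
  have h1 : ContMDiffAt (𝓡 4).tangent (𝓡 4).tangent n (tangentMapWithin (𝓡 4) (𝓡 4) φ φ.source)
      (⟨x, V x⟩ : TangentBundle (𝓡 4) M) := by
    refine (((contMDiffOn_of_mem_maximalAtlas (mem_maximalAtlas hφ)).contMDiffOn_tangentMapWithin
      (m := ∞) (by simp) φ.open_source.uniqueMDiffOn).contMDiffAt ?_).of_le hn
    exact ((FiberBundle.continuous_proj E4 (TangentSpace (𝓡 4))).isOpen_preimage _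
      φ.open_source).mem_nhds hx
  have h2 := (contMDiff_snd_tangentBundle_modelSpace E4 𝓘(ℝ, E4) (n := n)).contMDiffAt.comp x
    (h1.comp x hV)
  have h3 := (contMDiffAt_chart_symm hφ hx').of_le hn
  rw [← φ.left_inv hx] at h2
  rw [← contMDiffAt_iff_contDiffAt]
  refine (h2.comp (φ x) h3).congr_of_eventuallyEq ?_
  filter_upwards [φ.open_target.mem_nhds hx'] with z hz
  simp only [Function.comp, tangentMapWithin, components,
    mfderivWithin_of_isOpen φ.open_source (φ.map_target hz)]
  rfl

end Chart

end

/-! ### Energy and first variation -/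

section

section EulerLagrange

variable {E : Type*} [NormedAddCommGroup E] [NormedSpace ℝ E] {G : E → E →L[ℝ] E →L[ℝ] ℝ}

theorem hasDerivAt_comp_curve {F : Type*} [NormedAddCommGroup F] [NormedSpace ℝ F] {f : E → F}
    {x : ℝ → E} {x' : E} {r : ℝ} (hf : DifferentiableAt ℝ f (x r)) (hx : HasDerivAt x x' r) :
    HasDerivAt (fun r => f (x r)) (fderiv ℝ f (x r) x') r :=
  hf.hasFDerivAt.comp_hasDerivAt r hx

theorem fderiv_form_apply {x v w : E} (hG : DifferentiableAt ℝ G x) :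
    fderiv ℝ (fun y => G y v w) x = ((fderiv ℝ G x).flip v).flip w := by
  ext u
  have h := ((hG.hasFDerivAt.clm_apply (hasFDerivAt_const v x)).clm_apply
    (hasFDerivAt_const w x)).fderiv
  rw [h]
  simp

/-- The kinetic energy is constant along a solution of the Euler-Lagrange equation. -/
theorem hasDerivAt_energy {x : ℝ → E} {r : ℝ} {a : E} (hx : DifferentiableAt ℝ x r)
    (ha : HasDerivAt (deriv x) a r) (hG : DifferentiableAt ℝ G (x r))
    (hs : ∀ v w, G (x r) v w = G (x r) w v)
    (hEL : ∀ w, HasDerivAt (fun r => G (x r) (deriv x r) w)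
      (1 / 2 * fderiv ℝ (fun y => G y (deriv x r) (deriv x r)) (x r) w) r) :
    HasDerivAt (fun r => G (x r) (deriv x r) (deriv x r)) 0 r := by
  have h0 : HasDerivAt (fun r => G (x r)) (fderiv ℝ G (x r) (deriv x r)) r :=
    hasDerivAt_comp_curve (f := G) hG hx.hasDerivAt
  have h1 : HasDerivAt (fun r => G (x r) (deriv x r))
      (fderiv ℝ G (x r) (deriv x r) (deriv x r) + G (x r) a) r := h0.clm_apply ha
  have h2 := h1.clm_apply ha
  have h3 := (hEL (deriv x r)).unique
    ((h1.clm_apply (hasDerivAt_const r (deriv x r))))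
  rw [fderiv_form_apply hG] at h3
  refine h2.congr_deriv ?_
  simp only [ContinuousLinearMap.flip_apply, add_apply, map_zero] at h3 ⊢
  rw [hs (deriv x r) a]
  linarith

/-- The first variation of the energy, in infinitesimal form: along a solution of the
Euler-Lagrange equation, the product of the tangent vector and the variation vector changes at half
the rate at which the energy changes under the variation. -/
theorem hasDerivAt_variation {h : ℝ × ℝ → E} {z : ℝ × ℝ} (hh : ContDiffAt ℝ 2 h z)
    (hG : DifferentiableAt ℝ G (h z)) (hs : ∀ v w, G (h z) v w = G (h z) w v)
    (hEL : ∀ w, HasDerivAt (fun r => G (h (z.1, r)) (fderiv ℝ h (z.1, r) (0, 1)) w)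
      (1 / 2 * fderiv ℝ (fun y => G y (fderiv ℝ h z (0, 1)) (fderiv ℝ h z (0, 1))) (h z) w) z.2) :
    ∃ D, HasDerivAt (fun e => G (h (e, z.2)) (fderiv ℝ h (e, z.2) (0, 1))
        (fderiv ℝ h (e, z.2) (0, 1))) D z.1 ∧
      HasDerivAt (fun r => G (h (z.1, r)) (fderiv ℝ h (z.1, r) (0, 1))
        (fderiv ℝ h (z.1, r) (1, 0))) (D / 2) z.2 := by
  obtain ⟨e₀, r₀⟩ := z
  have hd : HasFDerivAt h (fderiv ℝ h (e₀, r₀)) (e₀, r₀) :=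
    (hh.differentiableAt (by norm_num)).hasFDerivAt
  have hdd : HasFDerivAt (fderiv ℝ h) (fderiv ℝ (fderiv ℝ h) (e₀, r₀)) (e₀, r₀) :=
    ((hh.fderiv_right (m := 1) (by norm_num)).differentiableAt (by norm_num)).hasFDerivAt
  have hsym := hh.isSymmSndFDerivAt (by simp)
  have ce : HasDerivAt (fun e : ℝ => (e, r₀)) ((1 : ℝ), (0 : ℝ)) e₀ :=
    (hasDerivAt_id e₀).prodMk (hasDerivAt_const e₀ r₀)
  have cr : HasDerivAt (fun r : ℝ => (e₀, r)) ((0 : ℝ), (1 : ℝ)) r₀ :=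
    (hasDerivAt_const r₀ e₀).prodMk (hasDerivAt_id r₀)
  have hv : ∀ {γ : ℝ → ℝ × ℝ} {γ' : ℝ × ℝ} {s : ℝ}, HasDerivAt γ γ' s → γ s = (e₀, r₀) → ∀ v,
      HasDerivAt (fun s => fderiv ℝ h (γ s) v) (fderiv ℝ (fderiv ℝ h) (e₀, r₀) γ' v) s := by
    intro γ γ' s hγ hs v
    rw [← hs] at hdd ⊢
    simpa using (hdd.comp_hasDerivAt s hγ).clm_apply (hasDerivAt_const s v)
  have hGv : ∀ {γ : ℝ → ℝ × ℝ} {γ' : ℝ × ℝ} {s : ℝ}, HasDerivAt γ γ' s → γ s = (e₀, r₀) →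
      HasDerivAt (fun s => G (h (γ s)))
        (fderiv ℝ G (h (e₀, r₀)) (fderiv ℝ h (e₀, r₀) γ')) s := by
    intro γ γ' s hγ hs
    rw [← hs] at hd hG ⊢
    exact hasDerivAt_comp_curve (f := G) (x := fun s => h (γ s)) hG (hd.comp_hasDerivAt s hγ)
  have he := hv ce rfl (0, 1)
  have hr := hv cr rfl (1, 0)
  have hrr := hv cr rfl (0, 1)
  have hGe := hGv ce rfl
  have hGr := hGv cr rfl
  have h0 := hGe.clm_apply he
  refine ⟨_, h0.clm_apply he, ?_⟩
  have h1 := hGr.clm_apply hrr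
  have h3 := fun w => (hEL w).unique (h1.clm_apply (hasDerivAt_const r₀ w))
  have h4 := h3 (fderiv ℝ h (e₀, r₀) (1, 0))
  rw [fderiv_form_apply hG] at h4
  refine (h1.clm_apply hr).congr_deriv ?_
  have h5 := hsym (1, 0) (0, 1)
  simp only [ContinuousLinearMap.flip_apply, add_apply, map_zero,
    add_zero] at h4 h5 ⊢
  rw [h5]
  rw [hs (fderiv ℝ h (e₀, r₀) (0, 1)) ((fderiv ℝ (fderiv ℝ h) (e₀, r₀)) (0, 1) (1, 0))]
  rw [hs ((fderiv ℝ (fderiv ℝ h) (e₀, r₀)) (0, 1) (1, 0))] at *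
  linarith

end EulerLagrange

/-! ### Smooth families of curves -/

section Family

variable {M : Type*} [TopologicalSpace M] [ChartedSpace E4 M] [IsManifold (𝓡 4) ∞ M]
  {φ : OpenPartialHomeomorph M E4} {g : LorentzMetric M}
  {X : Type*} [NormedAddCommGroup X] [NormedSpace ℝ X] {O : Set X} {H : X → ℝ → M}
  {x : X} {r : ℝ}

/-- A family of curves `H x : [0,1] → M` that depends smoothly on the parameter `x ∈ O`; each curve
is smooth on a neighborhood of `[0,1]`. -/
structure IsSmoothFamily (O : Set X) (H : X → ℝ → M) : Prop where
  isOpen : IsOpen O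
  joint : ContMDiffOn 𝓘(ℝ, X × ℝ) (𝓡 4) ∞ (fun z : X × ℝ => H z.1 z.2) (O ×ˢ Icc (0 : ℝ) 1)
  curve : ∀ x ∈ O, ∀ r ∈ Icc (0 : ℝ) 1, ContMDiffAt 𝓘(ℝ, ℝ) (𝓡 4) ∞ (H x) r

namespace IsSmoothFamily

theorem uniqueDiffOn (hH : IsSmoothFamily O H) : UniqueDiffOn ℝ (O ×ˢ Icc (0 : ℝ) 1) :=
  hH.isOpen.uniqueDiffOn.prod (uniqueDiffOn_Icc one_pos)

theorem contDiffWithinAt_chart (hH : IsSmoothFamily O H) (hx : x ∈ O) (hr : r ∈ Icc (0 : ℝ) 1)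
    (hφ : φ ∈ atlas E4 M) (hs : H x r ∈ φ.source) :
    ContDiffWithinAt ℝ ∞ (fun z : X × ℝ => φ (H z.1 z.2)) (O ×ˢ Icc (0 : ℝ) 1) (x, r) := by
  rw [← contMDiffWithinAt_iff_contDiffWithinAt]
  exact ContMDiffAt.comp_contMDiffWithinAt (x, r) (contMDiffAt_chart hφ hs)
    (hH.joint (x, r) ⟨hx, hr⟩)

theorem eventually_mem_source (hH : IsSmoothFamily O H) (hx : x ∈ O) (hr : r ∈ Icc (0 : ℝ) 1)
    (hs : H x r ∈ φ.source) :
    ∀ᶠ z in 𝓝[O ×ˢ Icc (0 : ℝ) 1] (x, r), H z.1 z.2 ∈ φ.source :=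
  (hH.joint (x, r) ⟨hx, hr⟩).continuousWithinAt.eventually (φ.open_source.mem_nhds hs)

theorem deriv_chart (hH : IsSmoothFamily O H) (hx : x ∈ O) (hr : r ∈ Icc (0 : ℝ) 1)
    (hφ : φ ∈ atlas E4 M) (hs : H x r ∈ φ.source) :
    deriv (φ ∘ H x) r =
      fderivWithin ℝ (fun z : X × ℝ => φ (H z.1 z.2)) (O ×ˢ Icc (0 : ℝ) 1) (x, r) (0, 1) := by
  have h1 : HasDerivAt (φ ∘ H x) _ r := (differentiableAt_chart_comp hφ
    ((hH.curve x hx r hr).mdifferentiableAt (by simp)) hs).hasDerivAt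
  have h2 : HasFDerivWithinAt (fun z : X × ℝ => φ (H z.1 z.2)) _ (O ×ˢ Icc (0 : ℝ) 1) (x, r) :=
    ((hH.contDiffWithinAt_chart hx hr hφ hs).differentiableWithinAt (by simp)).hasFDerivWithinAt
  have h3 : HasDerivWithinAt (fun r : ℝ => (x, r)) ((0 : X), (1 : ℝ)) (Icc 0 1) r :=
    ((hasDerivAt_const r x).prodMk (hasDerivAt_id r)).hasDerivWithinAt
  have h4 := h2.comp_hasDerivWithinAt r h3 fun s hs => ⟨hx, hs⟩
  exact (uniqueDiffOn_Icc one_pos r hr).eq_deriv _ h1.hasDerivWithinAt h4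

theorem eventually_deriv_chart (hH : IsSmoothFamily O H) (hx : x ∈ O) (hr : r ∈ Icc (0 : ℝ) 1)
    (hφ : φ ∈ atlas E4 M) (hs : H x r ∈ φ.source) :
    ∀ᶠ z in 𝓝[O ×ˢ Icc (0 : ℝ) 1] (x, r), deriv (φ ∘ H z.1) z.2 =
      fderivWithin ℝ (fun z : X × ℝ => φ (H z.1 z.2)) (O ×ˢ Icc (0 : ℝ) 1) z (0, 1) := by
  filter_upwards [hH.eventually_mem_source hx hr hs, self_mem_nhdsWithin] with z hz hzS
  exact hH.deriv_chart hzS.1 hzS.2 hφ hz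

theorem contDiffWithinAt_fderiv (hH : IsSmoothFamily O H) (hx : x ∈ O) (hr : r ∈ Icc (0 : ℝ) 1)
    (hφ : φ ∈ atlas E4 M) (hs : H x r ∈ φ.source) (u : X × ℝ) :
    ContDiffWithinAt ℝ ∞ (fun z : X × ℝ => fderivWithin ℝ (fun z : X × ℝ => φ (H z.1 z.2))
      (O ×ˢ Icc (0 : ℝ) 1) z u) (O ×ˢ Icc (0 : ℝ) 1) (x, r) :=
  ((hH.contDiffWithinAt_chart hx hr hφ hs).fderivWithin_right (m := ∞) hH.uniqueDiffOn (by simp)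
    ⟨hx, hr⟩).clm_apply contDiffWithinAt_const

theorem contDiffWithinAt_deriv (hH : IsSmoothFamily O H) (hx : x ∈ O) (hr : r ∈ Icc (0 : ℝ) 1)
    (hφ : φ ∈ atlas E4 M) (hs : H x r ∈ φ.source) :
    ContDiffWithinAt ℝ ∞ (fun z : X × ℝ => deriv (φ ∘ H z.1) z.2) (O ×ˢ Icc (0 : ℝ) 1) (x, r) :=
  (hH.contDiffWithinAt_fderiv hx hr hφ hs (0, 1)).congr_of_eventuallyEq_of_mem
    (hH.eventually_deriv_chart hx hr hφ hs) ⟨hx, hr⟩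

/-- The squared velocity of a smooth family of curves is smooth. -/
theorem contDiffWithinAt_energy (hH : IsSmoothFamily O H) (hx : x ∈ O) (hr : r ∈ Icc (0 : ℝ) 1) :
    ContDiffWithinAt ℝ ∞ (fun z : X × ℝ => g.inner (H z.1 z.2) (velocity (H z.1) z.2)
      (velocity (H z.1) z.2)) (O ×ˢ Icc (0 : ℝ) 1) (x, r) := by
  have hφ := chart_mem_atlas E4 (H x r)
  have hs := mem_chart_source E4 (H x r)
  have hd := hH.contDiffWithinAt_deriv hx hr hφ hs
  have hG := ((contDiffAt_inChart (g := g) hφ ((chartAt E4 (H x r)).map_source hs)).comp_contDiffWithinAt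
    (x, r) (f := fun z : X × ℝ => chartAt E4 (H x r) (H z.1 z.2))
    (hH.contDiffWithinAt_chart hx hr hφ hs))
  refine ((hG.clm_apply hd).clm_apply hd).congr_of_eventuallyEq_of_mem ?_ ⟨hx, hr⟩
  filter_upwards [hH.eventually_mem_source hx hr hs, self_mem_nhdsWithin] with z hz hzS
  exact inner_velocity_velocity hφ ((hH.curve z.1 hzS.1 z.2 hzS.2).mdifferentiableAt (by simp)) hz

theorem continuousWithinAt_inner_field (hH : IsSmoothFamily O H) (hx : x ∈ O)
    (hr : r ∈ Icc (0 : ℝ) 1) (T : TimeOrientation g) :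
    ContinuousWithinAt (fun z : X × ℝ => g.inner (H z.1 z.2) (T.field (H z.1 z.2))
      (velocity (H z.1) z.2)) (O ×ˢ Icc (0 : ℝ) 1) (x, r) := by
  have hφ := chart_mem_atlas E4 (H x r)
  have hs := mem_chart_source E4 (H x r)
  have hd := (hH.contDiffWithinAt_deriv hx hr hφ hs).continuousWithinAt
  have hc := hH.contDiffWithinAt_chart hx hr hφ hs
  have hG := ((contDiffAt_inChart (g := g) hφ ((chartAt E4 (H x r)).map_source hs)).comp_contDiffWithinAt
    (x, r) (f := fun z : X × ℝ => chartAt E4 (H x r) (H z.1 z.2)) hc).continuousWithinAt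
  have hT := (contDiffAt_components hφ (n := 0) (by simp) hs
    (contMDiff_zero_iff.2 T.continuous).contMDiffAt).continuousAt.comp_continuousWithinAt
    (f := fun z : X × ℝ => chartAt E4 (H x r) (H z.1 z.2)) (x := (x, r)) hc.continuousWithinAt
  refine ((hG.clm_apply hT).clm_apply hd).congr_of_eventuallyEq_of_mem ?_ ⟨hx, hr⟩
  filter_upwards [hH.eventually_mem_source hx hr hs, self_mem_nhdsWithin] with z hz hzS
  have h1 := components_velocity hφ
    ((hH.curve z.1 hzS.1 z.2 hzS.2).mdifferentiableAt (by simp)) hz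
  rw [inner_eq_inChart hφ hz, h1]
  simp only [Function.comp_apply]
  rw [OpenPartialHomeomorph.left_inv _ hz]

end IsSmoothFamily

end Family

end

/-! ### Geodesic segments -/

section

section Geodesics

variable {M : Type*} [TopologicalSpace M] [ChartedSpace E4 M] [IsManifold (𝓡 4) ∞ M]
  {φ : OpenPartialHomeomorph M E4} {g : LorentzMetric M} {W : Set M} {p q : M} {c : ℝ → M}

theorem contDiffAt_chart_comp (hφ : φ ∈ atlas E4 M) {r : ℝ}
    (hc : ContMDiffAt 𝓘(ℝ, ℝ) (𝓡 4) ∞ c r) (hs : c r ∈ φ.source) : ContDiffAt ℝ ∞ (φ ∘ c) r := by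
  rw [← contMDiffAt_iff_contDiffAt]
  exact (contMDiffAt_chart hφ hs).comp r hc

theorem eventually_mdifferentiableAt {r : ℝ} (hc : ContMDiffAt 𝓘(ℝ, ℝ) (𝓡 4) ∞ c r) :
    ∀ᶠ s in 𝓝 r, MDifferentiableAt 𝓘(ℝ, ℝ) (𝓡 4) c s := by
  have : IsManifold (𝓡 4) 1 M := isManifold_one
  filter_upwards [(contMDiffAt_iff_contMDiffAt_nhds (n := 1) (by simp)).1
    (ContMDiffAt.of_le hc (by norm_num))] with s hs
  exact hs.mdifferentiableAt (by simp)

theorem contDiffAt_deriv {E : Type*} [NormedAddCommGroup E] [NormedSpace ℝ E] {f : ℝ → E} {r : ℝ}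
    (hf : ContDiffAt ℝ ∞ f r) : ContDiffAt ℝ ∞ (deriv f) r := by
  have := (hf.fderiv_right (m := ∞) (by simp)).clm_apply (contDiffAt_const (c := (1 : ℝ)))
  simpa only [fderiv_apply_one_eq_deriv] using this

theorem IsGeodesicSegment.hasDerivAt_energy (hc : IsGeodesicSegment g W p q c) {r : ℝ}
    (hr : r ∈ Icc (0 : ℝ) 1) :
    HasDerivAt (fun r => g.inner (c r) (velocity c r) (velocity c r)) 0 r := by
  have hφ := chart_mem_atlas E4 (c r)
  have hs := mem_chart_source E4 (c r)
  have hcd := contDiffAt_chart_comp hφ (hc.smooth r hr) hs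
  have h1 := Spacetime.hasDerivAt_energy (hcd.differentiableAt (by simp))
    ((contDiffAt_deriv hcd).differentiableAt (by simp)).hasDerivAt
    ((contDiffAt_inChart (g := g) hφ ((chartAt E4 (c r)).map_source hs)).differentiableAt (by simp))
    (fun v w => inChart_symm _ v w)
    (fun w => (hc.geodesic.self_of_nhdsSet r hr) _ hφ hs w)
  refine h1.congr_of_eventuallyEq ?_
  filter_upwards [eventually_mdifferentiableAt (hc.smooth r hr),
    (hc.smooth r hr).continuousAt.eventually ((chartAt E4 (c r)).open_source.mem_nhds hs)]
    with s h1 h2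
  exact inner_velocity_velocity hφ h1 h2

/-- The squared velocity is constant along a geodesic segment. -/
theorem IsGeodesicSegment.energy_eq (hc : IsGeodesicSegment g W p q c) {r s : ℝ}
    (hr : r ∈ Icc (0 : ℝ) 1) (hs : s ∈ Icc (0 : ℝ) 1) :
    g.inner (c r) (velocity c r) (velocity c r) = g.inner (c s) (velocity c s) (velocity c s) := by
  have h0 : ∀ x ∈ Icc (0 : ℝ) 1, g.inner (c x) (velocity c x) (velocity c x) =
      g.inner (c 0) (velocity c 0) (velocity c 0) :=
    constant_of_has_deriv_right_zero
      (fun x hx => (hc.hasDerivAt_energy hx).continuousAt.continuousWithinAt)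
      (fun x hx => (hc.hasDerivAt_energy ⟨hx.1, hx.2.le⟩).hasDerivWithinAt)
  rw [h0 r hr, h0 s hs]

/-- The first variation formula: the energy of a smooth family of geodesic segments changes only
through the end points. -/
theorem IsSmoothFamily.hasDerivAt_energy {O : Set ℝ} {H : ℝ → ℝ → M} (hH : IsSmoothFamily O H)
    (hgeo : ∀ e ∈ O, IsGeodesicSegment g W (H e 0) (H e 1) (H e)) {e : ℝ} (he : e ∈ O) :
    HasDerivAt (fun e => g.inner (H e 0) (velocity (H e) 0) (velocity (H e) 0))
      (2 * (g.inner (H e 1) (velocity (H e) 1) (velocity (fun e => H e 1) e) -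
        g.inner (H e 0) (velocity (H e) 0) (velocity (fun e => H e 0) e))) e := by
  set S := O ×ˢ Icc (0 : ℝ) 1 with hS
  set Q : ℝ → ℝ := fun r => g.inner (H e r) (velocity (H e) r) (velocity (fun e => H e r) e) with hQ
  have hO := hH.isOpen.mem_nhds he
  have h0 : (0 : ℝ) ∈ Icc (0 : ℝ) 1 := by simp
  -- the energy is differentiable in the parameter
  have hd : DifferentiableAt ℝ
      (fun e => g.inner (H e 0) (velocity (H e) 0) (velocity (H e) 0)) e := by
    have h1 := (hH.contDiffWithinAt_energy (g := g) he h0).comp e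
      (f := fun e : ℝ => (e, (0 : ℝ))) (s := O) (contDiff_prodMk_left (0 : ℝ)).contDiffWithinAt
      (fun x hx => ⟨hx, h0⟩)
    exact (h1.contDiffAt hO).differentiableAt (by simp)
  -- transversal vectors in a chart
  have hmd : ∀ r ∈ Icc (0 : ℝ) 1, ∀ e ∈ O,
      MDifferentiableAt 𝓘(ℝ, ℝ) (𝓡 4) (fun e => H e r) e := by
    intro r hr e he
    have h1 : ContMDiffWithinAt 𝓘(ℝ, ℝ) (𝓡 4) ∞ (fun e => H e r) O e :=
      ContMDiffWithinAt.comp (t := O ×ˢ Icc (0 : ℝ) 1) e (hH.joint (e, r) (mk_mem_prod he hr)) (f := fun e : ℝ => (e, r)) (s := O)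
        ((contDiff_prodMk_left r).contDiffWithinAt.contMDiffWithinAt) (fun x hx => mk_mem_prod hx hr)
    exact (h1.contMDiffAt (hH.isOpen.mem_nhds he)).mdifferentiableAt (by simp)
  have hQchart : ∀ φ ∈ atlas E4 M, ∀ r ∈ Icc (0 : ℝ) 1, H e r ∈ φ.source →
      Q r = g.inChart φ (φ (H e r)) (fderivWithin ℝ (fun z : ℝ × ℝ => φ (H z.1 z.2)) S (e, r) (0, 1))
        (fderivWithin ℝ (fun z : ℝ × ℝ => φ (H z.1 z.2)) S (e, r) (1, 0)) := by
    intro φ hφ r hr hs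
    rw [hQ]
    simp only
    rw [inner_eq_inChart hφ hs, components_velocity hφ
      ((hH.curve e he r hr).mdifferentiableAt (by simp)) hs, hH.deriv_chart he hr hφ hs]
    have h1 : components φ (H e r) (velocity (fun e => H e r) e) =
        deriv (φ ∘ fun e => H e r) e := components_velocity hφ (hmd r hr e he) hs
    rw [h1]
    congr 1
    have h2 := (differentiableAt_chart_comp hφ (hmd r hr e he) hs).hasDerivAt
    have h3 : HasFDerivWithinAt (fun z : ℝ × ℝ => φ (H z.1 z.2)) _ S (e, r) :=
      ((hH.contDiffWithinAt_chart he hr hφ hs).differentiableWithinAt (by simp)).hasFDerivWithinAt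
    have h4 : HasDerivWithinAt (fun e : ℝ => (e, r)) ((1 : ℝ), (0 : ℝ)) O e :=
      ((hasDerivAt_id e).prodMk (hasDerivAt_const e r)).hasDerivWithinAt
    have h5 := (h3.comp_hasDerivWithinAt e h4
      (fun s hs => (⟨hs, hr⟩ : (s, r) ∈ S))).hasDerivAt hO
    exact h2.unique h5
  have hQc : ContinuousOn Q (Icc 0 1) := by
    intro r hr
    have hφ := chart_mem_atlas E4 (H e r)
    have hs := mem_chart_source E4 (H e r)
    have ha := (hH.contDiffWithinAt_fderiv he hr hφ hs (0, 1)).continuousWithinAt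
    have hb := (hH.contDiffWithinAt_fderiv he hr hφ hs (1, 0)).continuousWithinAt
    have hG := ((contDiffAt_inChart (g := g) hφ
      ((chartAt E4 (H e r)).map_source hs)).comp_contDiffWithinAt
      (e, r) (f := fun z : ℝ × ℝ => chartAt E4 (H e r) (H z.1 z.2))
      (hH.contDiffWithinAt_chart he hr hφ hs)).continuousWithinAt
    have h1 : ContinuousWithinAt (fun r : ℝ => (e, r)) (Icc 0 1) r := by fun_prop
    have hev := h1.tendsto_nhdsWithin (t := S) (fun x hx => ⟨he, hx⟩)
    refine (ContinuousWithinAt.comp (f := fun r : ℝ => (e, r)) ((hG.clm_apply ha).clm_apply hb) h1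
      (fun x hx => ⟨he, hx⟩)).congr_of_eventuallyEq_of_mem ?_ hr
    filter_upwards [hev.eventually (hH.eventually_mem_source he hr hs), self_mem_nhdsWithin]
      with r' h2 h3
    exact hQchart _ hφ r' h3 h2
  have hQd : ∀ r ∈ Ioo (0 : ℝ) 1, HasDerivAt Q
      (deriv (fun e => g.inner (H e 0) (velocity (H e) 0) (velocity (H e) 0)) e / 2) r := by
    intro r hr
    have hr' : r ∈ Icc (0 : ℝ) 1 := Ioo_subset_Icc_self hr
    have hφ := chart_mem_atlas E4 (H e r)
    have hs := mem_chart_source E4 (H e r)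
    set φ := chartAt E4 (H e r)
    set h : ℝ × ℝ → E4 := fun z => φ (H z.1 z.2) with hh
    have hI : Icc (0 : ℝ) 1 ∈ 𝓝 r := Icc_mem_nhds hr.1 hr.2
    have hSn : S ∈ 𝓝 (e, r) := prod_mem_nhds hO hI
    have hcd : ContDiffAt ℝ ∞ h (e, r) := (hH.contDiffWithinAt_chart he hr' hφ hs).contDiffAt hSn
    have hsrc : ∀ᶠ z in 𝓝 (e, r), H z.1 z.2 ∈ φ.source := by
      have := hH.eventually_mem_source he hr' hs
      rwa [nhdsWithin_eq_nhds.2 hSn] at this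
    have hfd : ∀ᶠ z in 𝓝 (e, r), fderivWithin ℝ h S z = fderiv ℝ h z := by
      filter_upwards [eventually_mem_nhds_iff.2 hSn] with z hz
      exact fderivWithin_of_mem_nhds hz
    have cr : Tendsto (fun r : ℝ => (e, r)) (𝓝 r) (𝓝 (e, r)) :=
      (Continuous.prodMk_right e).tendsto r
    have ce : Tendsto (fun e : ℝ => (e, r)) (𝓝 e) (𝓝 (e, r)) :=
      (Continuous.prodMk_left r).tendsto e
    obtain ⟨D, hD1, hD2⟩ := hasDerivAt_variation (G := g.inChart φ) (z := (e, r))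
      (hcd.of_le (by norm_cast))
      ((contDiffAt_inChart (g := g) hφ (φ.map_source hs)).differentiableAt (by simp))
      (fun v w => inChart_symm _ v w) (fun w => by
        have h1 := (hgeo e he).geodesic.self_of_nhdsSet r hr' φ hφ hs w
        have h2 : deriv (φ ∘ H e) r = fderiv ℝ h (e, r) (0, 1) := by
          rw [hH.deriv_chart he hr' hφ hs, hfd.self_of_nhds]
        rw [h2] at h1
        refine h1.congr_of_eventuallyEq ?_
        filter_upwards [cr.eventually hsrc, cr.eventually hfd, hI] with s h3 h4 h5
        rw [hH.deriv_chart he h5 hφ h3, ← h4])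
    have h6 : deriv (fun e => g.inner (H e 0) (velocity (H e) 0) (velocity (H e) 0)) e = D := by
      rw [← hD1.deriv]
      apply EventuallyEq.deriv_eq
      filter_upwards [ce.eventually hsrc, ce.eventually hfd, hO] with e' h3 h4 h5
      rw [(hgeo e' h5).energy_eq h0 hr', inner_velocity_velocity hφ
        ((hH.curve e' h5 r hr').mdifferentiableAt (by simp)) h3, hH.deriv_chart h5 hr' hφ h3, ← h4]
    rw [h6]
    refine hD2.congr_of_eventuallyEq ?_
    filter_upwards [cr.eventually hsrc, cr.eventually hfd, hI] with s h3 h4 h5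
    rw [hQchart φ hφ s h5 h3]
    simp only [hh] at h4 ⊢
    rw [h4]
  obtain ⟨r, -, hr⟩ := exists_hasDerivAt_eq_slope Q _ one_pos hQc hQd
  have h2 : deriv (fun e => g.inner (H e 0) (velocity (H e) 0) (velocity (H e) 0)) e =
      2 * (Q 1 - Q 0) := by
    rw [sub_zero, div_one] at hr; linarith
  exact h2 ▸ hd.hasDerivAt

/-! ### Geodesically convex sets -/

/-- `Γ p q` is the unique geodesic segment in `W` from `p` to `q`, and it depends smoothly on
`p` and `q`. -/
def IsGeodesicFamily (g : LorentzMetric M) (W : Set M) (Γ : M → M → ℝ → M) : Prop :=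
  ContMDiffOn (((𝓡 4).prod (𝓡 4)).prod 𝓘(ℝ, ℝ)) (𝓡 4) ∞
      (fun z : (M × M) × ℝ ↦ Γ z.1.1 z.1.2 z.2) ((W ×ˢ W) ×ˢ Icc (0 : ℝ) 1) ∧
    ∀ p ∈ W, ∀ q ∈ W, IsGeodesicSegment g W p q (Γ p q) ∧
      ∀ c, IsGeodesicSegment g W p q c → EqOn c (Γ p q) (Icc 0 1)

variable {Γ : M → M → ℝ → M} {X : Type*} [NormedAddCommGroup X] [NormedSpace ℝ X] {O : Set X}
  {A B : X → M}

theorem IsGeodesicFamily.segment (hΓ : IsGeodesicFamily g W Γ) (hp : p ∈ W) (hq : q ∈ W) :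
    IsGeodesicSegment g W p q (Γ p q) := (hΓ.2 p hp q hq).1

theorem IsGeodesicFamily.isSmoothFamily (hΓ : IsGeodesicFamily g W Γ) (hO : IsOpen O)
    (hA : ContMDiffOn 𝓘(ℝ, X) (𝓡 4) ∞ A O) (hB : ContMDiffOn 𝓘(ℝ, X) (𝓡 4) ∞ B O)
    (hAW : MapsTo A O W) (hBW : MapsTo B O W) :
    IsSmoothFamily O (fun x => Γ (A x) (B x)) where
  isOpen := hO
  joint := by
    have h1 : ContMDiffOn 𝓘(ℝ, X × ℝ) 𝓘(ℝ, X) ∞ (fun z : X × ℝ => z.1) (O ×ˢ Icc (0 : ℝ) 1) :=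
      contDiff_fst.contMDiff.contMDiffOn
    have h2 : ContMDiffOn 𝓘(ℝ, X × ℝ) 𝓘(ℝ, ℝ) ∞ (fun z : X × ℝ => z.2) (O ×ˢ Icc (0 : ℝ) 1) :=
      contDiff_snd.contMDiff.contMDiffOn
    exact hΓ.1.comp (((hA.comp h1 fun z hz => hz.1).prodMk (hB.comp h1 fun z hz => hz.1)).prodMk h2)
      fun z hz => ⟨⟨hAW hz.1, hBW hz.1⟩, hz.2⟩
  curve x hx r hr := (hΓ.segment (hAW hx) (hBW hx)).smooth r hr

/-- The squared length `σ(p, q)` of the geodesic segment from `p` to `q`, with its sign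
(twice Synge's world function). -/
noncomputable def worldFunction (g : LorentzMetric M) (Γ : M → M → ℝ → M) (p q : M) : ℝ :=
  g.inner (Γ p q 0) (velocity (Γ p q) 0) (velocity (Γ p q) 0)

theorem IsGeodesicFamily.energy_eq_worldFunction (hΓ : IsGeodesicFamily g W Γ) (hp : p ∈ W)
    (hq : q ∈ W) {r : ℝ} (hr : r ∈ Icc (0 : ℝ) 1) :
    g.inner (Γ p q r) (velocity (Γ p q) r) (velocity (Γ p q) r) = worldFunction g Γ p q :=
  (hΓ.segment hp hq).energy_eq hr (by simp)

theorem IsGeodesicFamily.contDiffOn_worldFunction (hΓ : IsGeodesicFamily g W Γ) (hO : IsOpen O)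
    (hA : ContMDiffOn 𝓘(ℝ, X) (𝓡 4) ∞ A O) (hB : ContMDiffOn 𝓘(ℝ, X) (𝓡 4) ∞ B O)
    (hAW : MapsTo A O W) (hBW : MapsTo B O W) :
    ContDiffOn ℝ ∞ (fun x => worldFunction g Γ (A x) (B x)) O := by
  intro x hx
  exact ((hΓ.isSmoothFamily hO hA hB hAW hBW).contDiffWithinAt_energy (g := g) hx
    (r := 0) (by simp)).comp x (f := fun x : X => (x, (0 : ℝ))) (s := O)
    (contDiff_prodMk_left (0 : ℝ)).contDiffWithinAt (fun x hx => ⟨hx, by simp⟩)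

theorem IsGeodesicFamily.hasDerivAt_worldFunction {O : Set ℝ} {A B : ℝ → M}
    (hΓ : IsGeodesicFamily g W Γ) (hO : IsOpen O)
    (hA : ContMDiffOn 𝓘(ℝ, ℝ) (𝓡 4) ∞ A O) (hB : ContMDiffOn 𝓘(ℝ, ℝ) (𝓡 4) ∞ B O)
    (hAW : MapsTo A O W) (hBW : MapsTo B O W) {e : ℝ} (he : e ∈ O) :
    HasDerivAt (fun e => worldFunction g Γ (A e) (B e))
      (2 * (g.inner (Γ (A e) (B e) 1) (velocity (Γ (A e) (B e)) 1)
          (velocity (fun e => Γ (A e) (B e) 1) e) -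
        g.inner (Γ (A e) (B e) 0) (velocity (Γ (A e) (B e)) 0)
          (velocity (fun e => Γ (A e) (B e) 0) e))) e :=
  (hΓ.isSmoothFamily hO hA hB hAW hBW).hasDerivAt_energy (fun e he => by
    have h := hΓ.segment (hAW he) (hBW he)
    exact ⟨rfl, rfl, h.mem, h.smooth, h.geodesic⟩) he

/-- Curves that agree near `s` have the same velocity at `s`. The two velocities belong to tangent
spaces at points that are equal, but not by definition, so that the statement is put in terms of an
arbitrary property of tangent vectors. -/
theorem velocity_congr {c₁ c₂ : ℝ → M} {s : ℝ} (h : c₁ =ᶠ[𝓝 s] c₂)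
    (P : (x : M) → TangentSpace (𝓡 4) x → Prop) :
    P (c₁ s) (velocity c₁ s) ↔ P (c₂ s) (velocity c₂ s) := by
  have h1 : (⟨c₁ s, velocity c₁ s⟩ : TangentBundle (𝓡 4) M) = ⟨c₂ s, velocity c₂ s⟩ := by
    rw [TotalSpace.mk.injEq]
    refine ⟨h.eq_of_nhds, heq_of_eq ?_⟩
    exact congrArg (fun L : ℝ →L[ℝ] E4 => L 1) h.mfderiv_eq
  change (fun z : TangentBundle (𝓡 4) M => P z.1 z.2) ⟨c₁ s, velocity c₁ s⟩ ↔
    (fun z : TangentBundle (𝓡 4) M => P z.1 z.2) ⟨c₂ s, velocity c₂ s⟩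
  rw [h1]

theorem velocity_const (p : M) (s : ℝ) : velocity (fun _ => p) s = 0 := by
  rw [velocity, mfderiv_const]; rfl

/-- Moving the final point along `B`, the change of the world function has the sign of the product
of the tangent vectors. Here `P` is any property of the velocity of `B`. -/
theorem IsGeodesicFamily.hasDerivAt_worldFunction_right {O : Set ℝ} {B : ℝ → M}
    (hΓ : IsGeodesicFamily g W Γ) (hO : IsOpen O) (hp : p ∈ W)
    (hB : ContMDiffOn 𝓘(ℝ, ℝ) (𝓡 4) ∞ B O) (hBW : MapsTo B O W) {e : ℝ} (he : e ∈ O)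
    (P : (x : M) → TangentSpace (𝓡 4) x → Prop) (hP : P (B e) (velocity B e)) :
    ∃ u : TangentSpace (𝓡 4) (Γ p (B e) 1), P _ u ∧
      HasDerivAt (fun e => worldFunction g Γ p (B e))
        (2 * g.inner (Γ p (B e) 1) (velocity (Γ p (B e)) 1) u) e := by
  have h1 : (fun e => Γ p (B e) 1) =ᶠ[𝓝 e] B := by
    filter_upwards [hO.mem_nhds he] with s hs using (hΓ.segment hp (hBW hs)).target
  have h2 : (fun e => Γ p (B e) 0) =ᶠ[𝓝 e] fun _ => p := by
    filter_upwards [hO.mem_nhds he] with s hs using (hΓ.segment hp (hBW hs)).source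
  refine ⟨velocity (fun e => Γ p (B e) 1) e, (velocity_congr h1 P).2 hP, ?_⟩
  have h := hΓ.hasDerivAt_worldFunction hO (A := fun _ => p) contMDiffOn_const hB
    (fun _ _ => hp) hBW he
  have h3 := (velocity_congr h2 fun x v => v = 0).2 (velocity_const p e)
  simp only [h3, map_zero, sub_zero] at h
  exact h

/-- Moving the initial point along `A`; `P` is any property of the velocity of `A`. -/
theorem IsGeodesicFamily.hasDerivAt_worldFunction_left {O : Set ℝ} {A : ℝ → M}
    (hΓ : IsGeodesicFamily g W Γ) (hO : IsOpen O) (hq : q ∈ W)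
    (hA : ContMDiffOn 𝓘(ℝ, ℝ) (𝓡 4) ∞ A O) (hAW : MapsTo A O W) {e : ℝ} (he : e ∈ O)
    (P : (x : M) → TangentSpace (𝓡 4) x → Prop) (hP : P (A e) (velocity A e)) :
    ∃ u : TangentSpace (𝓡 4) (Γ (A e) q 0), P _ u ∧
      HasDerivAt (fun e => worldFunction g Γ (A e) q)
        (-(2 * g.inner (Γ (A e) q 0) (velocity (Γ (A e) q) 0) u)) e := by
  have h1 : (fun e => Γ (A e) q 0) =ᶠ[𝓝 e] A := by
    filter_upwards [hO.mem_nhds he] with s hs using (hΓ.segment (hAW hs) hq).source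
  have h2 : (fun e => Γ (A e) q 1) =ᶠ[𝓝 e] fun _ => q := by
    filter_upwards [hO.mem_nhds he] with s hs using (hΓ.segment (hAW hs) hq).target
  refine ⟨velocity (fun e => Γ (A e) q 0) e, (velocity_congr h1 P).2 hP, ?_⟩
  have h := hΓ.hasDerivAt_worldFunction hO (B := fun _ => q) hA contMDiffOn_const
    hAW (fun _ _ => hq) he
  have h3 := (velocity_congr h2 fun x v => v = 0).2 (velocity_const q e)
  simp only [h3, map_zero, zero_sub, mul_neg] at h
  exact h

end Geodesics

end

/-! ### Light signals between clocks -/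

section

/-- The implicit function theorem for an equation `S (s, t) = 0` between real variables, in the
case of an increasing solution `t = ψ s`. -/
theorem exists_increasing_implicit {S : ℝ × ℝ → ℝ} {s t a b : ℝ} (hS : ContDiffAt ℝ ∞ S (s, t))
    (h0 : S (s, t) = 0) (ha : HasDerivAt (fun x => S (x, t)) a s)
    (hb : HasDerivAt (fun x => S (s, x)) b t) (ha0 : 0 < a) (hb0 : b < 0) :
    ∃ ψ : ℝ → ℝ, ContDiffAt ℝ ∞ ψ s ∧ ψ s = t ∧ 0 < deriv ψ s ∧ ∀ᶠ x in 𝓝 s, S (x, ψ x) = 0 := by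
  have hd : HasFDerivAt S (fderiv ℝ S (s, t)) (s, t) :=
    (hS.differentiableAt (by simp)).hasFDerivAt
  have h1 : fderiv ℝ S (s, t) (1, 0) = a := (hd.comp_hasDerivAt s
    ((hasDerivAt_id s).prodMk (hasDerivAt_const s t))).unique ha
  have h2 : fderiv ℝ S (s, t) (0, 1) = b := (hd.comp_hasDerivAt t
    ((hasDerivAt_const t s).prodMk (hasDerivAt_id t))).unique hb
  have hinv : (fderiv ℝ S (s, t) ∘L .inr ℝ ℝ ℝ).IsInvertible := by
    refine ⟨ContinuousLinearEquiv.unitsEquivAut ℝ (Units.mk0 b hb0.ne), ?_⟩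
    ext
    simp [h2]
  have hn : (∞ : ℕ∞ω) ≠ 0 := by simp
  set ψ := hS.implicitFunction hn hinv
  have hψ : ContDiffAt ℝ ∞ ψ s := hS.contDiffAt_implicitFunction hn hinv
  have hψ0 : ψ s = t := hS.implicitFunction_apply_self hn hinv
  have hev : ∀ᶠ x in 𝓝 s, S (x, ψ x) = 0 := by
    have := hS.eventually_apply_implicitFunction hn hinv
    rwa [h0] at this
  refine ⟨ψ, hψ, hψ0, ?_, hev⟩
  have hψd : HasDerivAt ψ (deriv ψ s) s := (hψ.differentiableAt (by simp)).hasDerivAt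
  have h3 : HasDerivAt (fun x => S (x, ψ x)) (fderiv ℝ S (s, t) (1, deriv ψ s)) s := by
    rw [← hψ0] at hd ⊢
    exact hd.comp_hasDerivAt s ((hasDerivAt_id s).prodMk hψd)
  have h4 : fderiv ℝ S (s, t) (1, deriv ψ s) = 0 :=
    h3.unique ((hasDerivAt_const s (0 : ℝ)).congr_of_eventuallyEq hev)
  have h5 : ((1 : ℝ), deriv ψ s) = (1, 0) + deriv ψ s • ((0 : ℝ), (1 : ℝ)) := by simp
  rw [h5, map_add, map_smul, h1, h2, smul_eq_mul] at h4
  by_contra! hle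
  nlinarith [mul_nonneg_of_nonpos_of_nonpos hle hb0.le]

section Clocks

variable {M : Type*} [TopologicalSpace M] [ChartedSpace E4 M] [IsManifold (𝓡 4) ∞ M]
  {g : LorentzMetric M} {T : TimeOrientation g} {W : Set M} {Γ : M → M → ℝ → M} {p q : M}
  {A B : Clock T} {s t : ℝ}

/-- Light emitted by `A` at its reading `s` reaches `B`, through `W`, at its reading `t`. -/
def Signal (W : Set M) (A B : Clock T) (s t : ℝ) : Prop :=
  s ∈ A.dom ∧ t ∈ B.dom ∧ ∃ c, IsLightRay T W (A.toFun s) (B.toFun t) c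

theorem velocity_eq_of_eqOn {c c' : ℝ → M} (h : EqOn c c' (Icc 0 1)) {r : ℝ}
    (hr : r ∈ Icc (0 : ℝ) 1) (hc : MDifferentiableAt 𝓘(ℝ, ℝ) (𝓡 4) c r)
    (hc' : MDifferentiableAt 𝓘(ℝ, ℝ) (𝓡 4) c' r) (P : (x : M) → TangentSpace (𝓡 4) x → Prop) :
    P (c r) (velocity c r) ↔ P (c' r) (velocity c' r) := by
  have hu : UniqueMDiffWithinAt 𝓘(ℝ, ℝ) (Icc (0 : ℝ) 1) r :=
    (uniqueDiffOn_Icc one_pos r hr).uniqueMDiffWithinAt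
  have h1 : (⟨c r, velocity c r⟩ : TangentBundle (𝓡 4) M) = ⟨c' r, velocity c' r⟩ := by
    rw [TotalSpace.mk.injEq]
    refine ⟨h hr, heq_of_eq ?_⟩
    have h2 := MDifferentiable.mfderivWithin hc hu
    have h3 := MDifferentiable.mfderivWithin hc' hu
    have h4 : (mfderivWithin 𝓘(ℝ, ℝ) (𝓡 4) c (Icc 0 1) r : ℝ →L[ℝ] E4) =
      mfderivWithin 𝓘(ℝ, ℝ) (𝓡 4) c' (Icc 0 1) r := mfderivWithin_congr h (h hr)
    exact congrArg (fun L : ℝ →L[ℝ] E4 => L 1) (h2.symm.trans (h4.trans h3))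
  change (fun z : TangentBundle (𝓡 4) M => P z.1 z.2) ⟨c r, velocity c r⟩ ↔
    (fun z : TangentBundle (𝓡 4) M => P z.1 z.2) ⟨c' r, velocity c' r⟩
  rw [h1]

theorem IsGeodesicFamily.isLightRay_of_isLightRay (hΓ : IsGeodesicFamily g W Γ) (hp : p ∈ W)
    (hq : q ∈ W) {c : ℝ → M} (hc : IsLightRay T W p q c) : IsLightRay T W p q (Γ p q) := by
  refine ⟨hΓ.segment hp hq, fun r hr => ?_⟩
  exact (velocity_eq_of_eqOn ((hΓ.2 p hp q hq).2 c hc.1) hr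
    ((hc.1.smooth r hr).mdifferentiableAt (by simp))
    (((hΓ.segment hp hq).smooth r hr).mdifferentiableAt (by simp))
    (fun x v => g.inner x v v = 0 ∧ T.IsFuture x v)).1 (hc.2 r hr)

/-- A segment of the geodesic family is a light ray if its end points are at distance zero and it
is future-pointing. -/
theorem IsGeodesicFamily.isLightRay (hΓ : IsGeodesicFamily g W Γ) (hp : p ∈ W) (hq : q ∈ W)
    (h0 : worldFunction g Γ p q = 0)
    (hf : ∀ r ∈ Icc (0 : ℝ) 1, T.IsFuture _ (velocity (Γ p q) r)) : IsLightRay T W p q (Γ p q) :=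
  ⟨hΓ.segment hp hq, fun r hr => ⟨(hΓ.energy_eq_worldFunction hp hq hr).trans h0, hf r hr⟩⟩

theorem IsLightRay.worldFunction_eq_zero (h : IsLightRay T W p q (Γ p q)) :
    worldFunction g Γ p q = 0 := (h.2 0 (by simp)).1

theorem Clock.mem_trajectory (A : Clock T) (hs : s ∈ A.dom) : A.toFun s ∈ A.trajectory :=
  mem_image_of_mem _ hs

/-- The product of a future-pointing null vector with the velocity of a clock is negative. -/
theorem inner_neg_of_light {x : M} {k u : TangentSpace (𝓡 4) x}
    (hk : g.inner x k k = 0 ∧ T.IsFuture x k) (hu : g.inner x u u < 0 ∧ T.IsFuture x u) :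
    g.inner x k u < 0 := by
  rw [g.symm]
  exact (g.isLorentzForm x).neg_of_future (T.timelike x) hu.1 hk.1.le hu.2 hk.2

/-- Near a light signal from `A` to `B` there is a smooth, strictly increasing family of light
signals. -/
theorem IsGeodesicFamily.exists_signals (hΓ : IsGeodesicFamily g W Γ) (hA : A.trajectory ⊆ W)
    (hB : B.trajectory ⊆ W) (h : Signal W A B s t) :
    ∃ ψ : ℝ → ℝ, ContDiffAt ℝ ∞ ψ s ∧ ψ s = t ∧ 0 < deriv ψ s ∧
      ∀ᶠ x in 𝓝 s, Signal W A B x (ψ x) := by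
  obtain ⟨hs, ht, c, hc⟩ := h
  have hAW : MapsTo A.toFun A.dom W := fun x hx => hA (A.mem_trajectory hx)
  have hBW : MapsTo B.toFun B.dom W := fun x hx => hB (B.mem_trajectory hx)
  have hray := hΓ.isLightRay_of_isLightRay (hAW hs) (hBW ht) hc
  set O : Set (ℝ × ℝ) := A.dom ×ˢ B.dom
  have hO : IsOpen O := A.isOpen_dom.prod B.isOpen_dom
  have hst : (s, t) ∈ O := ⟨hs, ht⟩
  have hA' : ContMDiffOn 𝓘(ℝ, ℝ × ℝ) (𝓡 4) ∞ (fun z : ℝ × ℝ => A.toFun z.1) O :=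
    A.smooth.comp (contDiff_fst.contMDiff.contMDiffOn) fun z hz => hz.1
  have hB' : ContMDiffOn 𝓘(ℝ, ℝ × ℝ) (𝓡 4) ∞ (fun z : ℝ × ℝ => B.toFun z.2) O :=
    B.smooth.comp (contDiff_snd.contMDiff.contMDiffOn) fun z hz => hz.2
  have hAW' : MapsTo (fun z : ℝ × ℝ => A.toFun z.1) O W := fun z hz => hAW hz.1
  have hBW' : MapsTo (fun z : ℝ × ℝ => B.toFun z.2) O W := fun z hz => hBW hz.2
  have hS := (hΓ.contDiffOn_worldFunction hO hA' hB' hAW' hBW').contDiffAt (hO.mem_nhds hst)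
  obtain ⟨u, hu, hau⟩ := hΓ.hasDerivAt_worldFunction_left A.isOpen_dom (hBW ht) A.smooth hAW hs
    (fun x v => g.inner x v v < 0 ∧ T.IsFuture x v) ⟨A.timelike s hs, A.future s hs⟩
  obtain ⟨v, hv, hbv⟩ := hΓ.hasDerivAt_worldFunction_right B.isOpen_dom (hAW hs) B.smooth hBW ht
    (fun x v => g.inner x v v < 0 ∧ T.IsFuture x v) ⟨B.timelike t ht, B.future t ht⟩
  have hneg0 := inner_neg_of_light (hray.2 0 (by simp)) hu
  have hneg1 := inner_neg_of_light (hray.2 1 (by simp)) hv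
  obtain ⟨ψ, hψ, hψ0, hψd, hev⟩ := exists_increasing_implicit hS hray.worldFunction_eq_zero hau hbv
    (by linarith) (by linarith)
  refine ⟨ψ, hψ, hψ0, hψd, ?_⟩
  -- future-pointing vectors form an open set, and `[0,1]` is compact
  have hfut : ∀ᶠ z in 𝓝 (s, t), ∀ r ∈ Icc (0 : ℝ) 1, z ∈ O →
      g.inner _ (T.field (Γ (A.toFun z.1) (B.toFun z.2) r))
        (velocity (Γ (A.toFun z.1) (B.toFun z.2)) r) < 0 := by
    have hK := isCompact_Icc.eventually_forall_of_forall_eventually (x₀ := (s, t))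
      (K := Icc (0 : ℝ) 1) (P := fun z r => r ∈ Icc (0 : ℝ) 1 → z ∈ O →
      g.inner _ (T.field (Γ (A.toFun z.1) (B.toFun z.2) r))
        (velocity (Γ (A.toFun z.1) (B.toFun z.2)) r) < 0) (fun r hr => by
        have h1 := ((hΓ.isSmoothFamily hO hA' hB' hAW' hBW').continuousWithinAt_inner_field hst hr
          T).eventually (gt_mem_nhds (hray.2 r hr).2)
        rw [eventually_nhdsWithin_iff] at h1
        filter_upwards [h1] with z hz h2 h3 using hz ⟨h3, h2⟩)
    filter_upwards [hK] with z hz r hr using hz r hr hr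
  have hcont : Tendsto (fun x => (x, ψ x)) (𝓝 s) (𝓝 (s, t)) := by
    have := (continuousAt_id (x := s)).prodMk hψ.continuousAt
    rw [ContinuousAt, hψ0] at this
    exact this
  filter_upwards [hev, hcont.eventually hfut, hcont.eventually (hO.mem_nhds hst)] with x h1 h2 h3
  exact ⟨h3.1, h3.2, _, hΓ.isLightRay (hAW h3.1) (hBW h3.2) h1 fun r hr => h2 r hr h3⟩

end Clocks

/-! ### Monotone correspondences -/

/-- The graph of an increasing diffeomorphism from `I` onto `J`, given as a relation. -/
structure IsSmoothCorrespondence (I J : Set ℝ) (R : ℝ → ℝ → Prop) : Prop where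
  left : ∀ s ∈ I, ∃ t, R s t
  right : ∀ t ∈ J, ∃ s, R s t
  mem : ∀ s t, R s t → s ∈ I ∧ t ∈ J
  right_unique : ∀ s t t', R s t → R s t' → t = t'
  smooth : ∀ s t, R s t → ∃ ψ : ℝ → ℝ, ContDiffAt ℝ ∞ ψ s ∧ ψ s = t ∧ 0 < deriv ψ s ∧
      ∀ᶠ x in 𝓝 s, R x (ψ x)

section Clocks

variable {M : Type*} [TopologicalSpace M] [ChartedSpace E4 M] [IsManifold (𝓡 4) ∞ M]
  {g : LorentzMetric M} {T : TimeOrientation g} {W : Set M} {A B : Clock T}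

theorem InRadarNhd.symm (h : InRadarNhd W A B) : InRadarNhd W B A :=
  ⟨h.1, h.2.2.1, h.2.1, h.2.2.2.2, h.2.2.2.1⟩

theorem InRadarNhd.isSmoothCorrespondence (h : InRadarNhd W A B) :
    IsSmoothCorrespondence A.dom B.dom (Signal W A B) := by
  obtain ⟨⟨-, Γ, hΓ⟩, hA, hB, hAB, hBA⟩ := h
  refine ⟨fun s hs => ?_, fun t ht => ?_, fun s t h => ⟨h.1, h.2.1⟩, ?_, fun s t h => ?_⟩
  · obtain ⟨t, ht, c, hc⟩ := (hBA _ (A.mem_trajectory hs)).2.1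
    exact ⟨t, hs, ht, c, hc⟩
  · obtain ⟨s, hs, c, hc⟩ := (hAB _ (B.mem_trajectory ht)).1.1
    exact ⟨s, hs, ht, c, hc⟩
  · rintro s t t' ⟨hs, ht, c, hc⟩ ⟨-, ht', c', hc'⟩
    exact ((hBA _ (A.mem_trajectory hs)).2.2 t ht t' ht' c c' hc hc').1
  · exact IsGeodesicFamily.exists_signals (Γ := Γ) hΓ hA hB h

end Clocks

end

section

/-- The real function whose graph is the correspondence. -/
theorem IsSmoothCorrespondence.exists_fun {I J : Set ℝ} {R : ℝ → ℝ → Prop}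
    (h : IsSmoothCorrespondence I J R) :
    ∃ f : ℝ → ℝ, (∀ s t, R s t ↔ s ∈ I ∧ f s = t) ∧ ContDiffOn ℝ ∞ f I ∧
      (∀ s ∈ I, 0 < deriv f s) ∧ f '' I = J := by
  choose! f hf using h.left
  have hR : ∀ s t, R s t ↔ s ∈ I ∧ f s = t := fun s t =>
    ⟨fun hst => ⟨(h.mem s t hst).1, h.right_unique s _ _ (hf s (h.mem s t hst).1) hst⟩,
      fun hst => hst.2 ▸ hf s hst.1⟩
  have hloc : ∀ s ∈ I, ∃ ψ : ℝ → ℝ, ContDiffAt ℝ ∞ ψ s ∧ 0 < deriv ψ s ∧ f =ᶠ[𝓝 s] ψ := by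
    intro s hs
    obtain ⟨ψ, h1, -, h3, h4⟩ := h.smooth s (f s) (hf s hs)
    exact ⟨ψ, h1, h3, h4.mono fun x hx => ((hR x _).1 hx).2⟩
  refine ⟨f, hR, fun s hs => ?_, fun s hs => ?_, Subset.antisymm ?_ fun t ht => ?_⟩
  · obtain ⟨ψ, h1, -, h3⟩ := hloc s hs
    exact (h1.congr_of_eventuallyEq h3).contDiffWithinAt
  · obtain ⟨ψ, -, h2, h3⟩ := hloc s hs
    rwa [h3.deriv_eq]
  · rintro _ ⟨s, hs, rfl⟩
    exact (h.mem s _ (hf s hs)).2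
  · obtain ⟨s, hs⟩ := h.right t ht
    exact ⟨s, (hR s t).1 hs⟩

theorem strictMonoOn_of_deriv_pos' {I : Set ℝ} (hI : IsOpen I) (hc : I.OrdConnected) {f : ℝ → ℝ}
    (hf : ContDiffOn ℝ ∞ f I) (hd : ∀ s ∈ I, 0 < deriv f s) : StrictMonoOn f I :=
  strictMonoOn_of_deriv_pos hc.convex hf.continuousOn (by rwa [hI.interior_eq])

/-- An increasing function with smooth inverse. -/
theorem exists_smooth_inverse {I : Set ℝ} (hI : IsOpen I) (hc : I.OrdConnected) {f : ℝ → ℝ}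
    (hf : ContDiffOn ℝ ∞ f I) (hd : ∀ s ∈ I, 0 < deriv f s) :
    ∃ k : ℝ → ℝ, ContDiffOn ℝ ∞ k (f '' I) ∧ (∀ t ∈ f '' I, 0 < deriv k t) ∧
      (∀ s ∈ I, k (f s) = s) ∧ k '' (f '' I) = I := by
  have hm := strictMonoOn_of_deriv_pos' hI hc hf hd
  obtain ⟨k, hk, h1, h2, h3⟩ := IsSmoothCorrespondence.exists_fun (I := f '' I) (J := I)
    (R := fun t s => s ∈ I ∧ f s = t)
    { left := fun t ⟨s, hs, hst⟩ => ⟨s, hs, hst⟩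
      right := fun s hs => ⟨f s, hs, rfl⟩
      mem := fun t s h => ⟨⟨s, h.1, h.2⟩, h.1⟩
      right_unique := fun t s s' h h' => hm.injOn h.1 h'.1 (h.2.trans h'.2.symm)
      smooth := by
        rintro _ s ⟨hs, rfl⟩
        have hfs : ContDiffAt ℝ ∞ f s := hf.contDiffAt (hI.mem_nhds hs)
        have hS : ContDiffAt ℝ ∞ (fun z : ℝ × ℝ => z.1 - f z.2) (f s, s) :=
          contDiffAt_fst.sub (hfs.comp (f s, s) contDiffAt_snd)
        obtain ⟨ψ, h1, h2, h3, h4⟩ := exists_increasing_implicit (a := 1) (b := -deriv f s) hS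
          (sub_self _) ((hasDerivAt_id (f s)).sub_const (f s))
          (by simpa using (hfs.differentiableAt (by simp)).hasDerivAt.const_sub (f s))
          one_pos (neg_neg_of_pos (hd s hs))
        refine ⟨ψ, h1, h2, h3, ?_⟩
        have h5 : ∀ᶠ x in 𝓝 (f s), ψ x ∈ I :=
          h1.continuousAt.eventually (h2.symm ▸ hI.mem_nhds hs)
        filter_upwards [h4, h5] with x h6 h7 using ⟨h7, (sub_eq_zero.1 h6).symm⟩ }
  exact ⟨k, h1, h2, fun s hs => ((hk (f s) s).1 ⟨hs, rfl⟩).2, h3⟩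

/-! ### Conjugation of a fixed-point free diffeomorphism to a translation -/

/-- A smooth step function. -/
theorem exists_smooth_step {a b : ℝ} (hab : a < b) :
    ∃ R : ℝ → ℝ, ContDiff ℝ ∞ R ∧ (∀ t ≤ a, R t = 0) ∧ (∀ t, b ≤ t → R t = 1) ∧
      (∀ t, 0 ≤ deriv R t) ∧ ∀ t ∈ Ioo a b, 0 < deriv R t := by
  let β : ContDiffBump ((a + b) / 2) := ⟨(b - a) / 4, (b - a) / 2, by linarith, by linarith⟩
  have hcont : Continuous β := β.continuous
  have hball : Metric.ball ((a + b) / 2) β.rOut = Ioo a b := by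
    rw [Real.ball_eq_Ioo]; congr 1 <;> simp only [β] <;> ring
  have hsupp : Function.support β = Ioo a b := by rw [β.support_eq, hball]
  have hz : ∀ t, t ∉ Ioo a b → β t = 0 := fun t ht => by
    rw [← hsupp] at ht; exact Function.notMem_support.1 ht
  have hd : ∀ t, HasDerivAt (fun t => ∫ x in a..t, β x) (β t) t := fun t =>
    intervalIntegral.integral_hasDerivAt_right (hcont.intervalIntegrable _ _)
      (hcont.stronglyMeasurableAtFilter _ _) hcont.continuousAt
  set C := ∫ x in a..b, β x with hC
  have hCpos : 0 < C := by
    refine intervalIntegral.intervalIntegral_pos_of_pos_on (hcont.intervalIntegrable _ _)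
      (fun x hx => ?_) hab
    exact (β.nonneg).lt_of_ne fun h => by
      have : x ∈ Function.support β := hsupp ▸ hx
      exact this h.symm
  have hd' : ∀ t, HasDerivAt (fun t => C⁻¹ * ∫ x in a..t, β x) (C⁻¹ * β t) t :=
    fun t => (hd t).const_mul _
  refine ⟨fun t => C⁻¹ * ∫ x in a..t, β x, ?_, fun t ht => ?_, fun t ht => ?_, fun t => ?_,
    fun t ht => ?_⟩
  · rw [contDiff_infty_iff_deriv]
    refine ⟨fun t => (hd' t).differentiableAt, ?_⟩
    have : deriv (fun t => C⁻¹ * ∫ x in a..t, β x) = fun t => C⁻¹ * β t :=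
      funext fun t => (hd' t).deriv
    rw [this]
    exact contDiff_const.mul β.contDiff
  · have : ∫ x in a..t, β x = ∫ x in a..t, (0 : ℝ) := by
      refine intervalIntegral.integral_congr fun x hx => hz x fun h => ?_
      rw [uIcc_of_ge ht] at hx
      exact hx.2.not_gt h.1
    simp [this]
  · have h2 : ∫ x in b..t, β x = ∫ x in b..t, (0 : ℝ) := by
      refine intervalIntegral.integral_congr fun x hx => hz x fun h => ?_
      rw [uIcc_of_le ht] at hx
      exact hx.1.not_gt h.2
    have h3 := intervalIntegral.integral_add_adjacent_intervals
      (hcont.intervalIntegrable a b) (hcont.intervalIntegrable b t) (μ := MeasureTheory.volume)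
    rw [h2] at h3
    simp only [intervalIntegral.integral_zero, add_zero] at h3
    simp only
    rw [← h3, ← hC, inv_mul_cancel₀ hCpos.ne']
  · rw [(hd' t).deriv]
    exact mul_nonneg (inv_nonneg.2 hCpos.le) β.nonneg
  · rw [(hd' t).deriv]
    refine mul_pos (inv_pos.2 hCpos) (β.nonneg.lt_of_ne fun h => ?_)
    have : t ∈ Function.support β := hsupp ▸ ht
    exact this h.symm

section Conjugation

variable {I : Set ℝ} {h k : ℝ → ℝ} {t₀ : ℝ}

theorem exists_lt_iterate (hc : I.OrdConnected) (hI : IsOpen I) (hh : MapsTo h I I)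
    (hcont : ContinuousOn h I) (hlt : ∀ t ∈ I, t < h t) (h₀ : t₀ ∈ I) {t : ℝ} (ht : t ∈ I) :
    ∃ n, t < h^[n] t₀ := by
  by_contra! hle
  have hmem : ∀ n, h^[n] t₀ ∈ I := fun n => hh.iterate n h₀
  have hmono : Monotone fun n => h^[n] t₀ := monotone_nat_of_le_succ fun n => by
    rw [Function.iterate_succ_apply']; exact (hlt _ (hmem n)).le
  have hlim := tendsto_atTop_ciSup hmono ⟨t, by rintro _ ⟨n, rfl⟩; exact hle n⟩
  set L := ⨆ n, h^[n] t₀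
  have hL : L ∈ I := hc.out h₀ ht
    ⟨ge_of_tendsto' hlim fun n => hmono (Nat.zero_le n), le_of_tendsto' hlim hle⟩
  have h1 : Tendsto (fun n => h (h^[n] t₀)) atTop (𝓝 (h L)) :=
    ((hcont.continuousAt (hI.mem_nhds hL)).tendsto).comp hlim
  have h2 : Tendsto (fun n => h^[n + 1] t₀) atTop (𝓝 L) := hlim.comp (tendsto_add_atTop_nat 1)
  simp only [Function.iterate_succ_apply'] at h2
  exact (hlt L hL).ne (tendsto_nhds_unique h2 h1)

theorem contDiffOn_iterate (hh : MapsTo h I I) (hd : ContDiffOn ℝ ∞ h I) (n : ℕ) :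
    ContDiffOn ℝ ∞ (h^[n]) I := by
  induction n with
  | zero => exact contDiffOn_id
  | succ n ih => rw [Function.iterate_succ']; exact hd.comp ih (hh.iterate n)

theorem deriv_iterate_pos (hI : IsOpen I) (hh : MapsTo h I I) (hd : ContDiffOn ℝ ∞ h I)
    (hpos : ∀ t ∈ I, 0 < deriv h t) (n : ℕ) : ∀ t ∈ I, 0 < deriv (h^[n]) t := by
  induction n with
  | zero => intro t _; simp
  | succ n ih =>
    intro t ht
    have h1 := ((hd.contDiffAt (hI.mem_nhds (hh.iterate n ht))).differentiableAt (by simp))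
    have h2 := (((contDiffOn_iterate hh hd n).contDiffAt (hI.mem_nhds ht)).differentiableAt
      (by simp))
    rw [Function.iterate_succ', deriv_comp t h1 h2]
    exact mul_pos (hpos _ (hh.iterate n ht)) (ih t ht)

theorem iterate_left_inv (hh : MapsTo h I I) (hkh : ∀ t ∈ I, k (h t) = t) (n : ℕ) :
    ∀ t ∈ I, k^[n] (h^[n] t) = t := by
  induction n with
  | zero => intro t _; rfl
  | succ n ih =>
    intro t ht
    rw [Function.iterate_succ_apply' h, Function.iterate_succ_apply, hkh _ (hh.iterate n ht),
      ih t ht]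

theorem le_iterate (hh : MapsTo h I I) (hlt : ∀ t ∈ I, t < h t) (n : ℕ) :
    ∀ t ∈ I, t ≤ h^[n] t := by
  induction n with
  | zero => intro t _; rfl
  | succ n ih =>
    intro t ht
    rw [Function.iterate_succ_apply]
    exact (hlt t ht).le.trans (ih _ (hh ht))

/-- An increasing diffeomorphism `h` of an open interval that moves every point to the right becomes
the translation by `1` in a suitable smooth coordinate `τ`. The coordinate is the sum of the
translates of a smooth step function under the iterates of `h` and of its inverse `k`, normalized to
converge; near each point only finitely many terms are not constant. -/
theorem exists_coordinate_translation (hI : IsOpen I) (hc : I.OrdConnected) (hh : MapsTo h I I)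
    (hk : MapsTo k I I) (hkh : ∀ t ∈ I, k (h t) = t) (hhk : ∀ t ∈ I, h (k t) = t)
    (hd : ContDiffOn ℝ ∞ h I) (kd : ContDiffOn ℝ ∞ k I) (hpos : ∀ t ∈ I, 0 < deriv h t)
    (kpos : ∀ t ∈ I, 0 < deriv k t) (hlt : ∀ t ∈ I, t < h t) (h₀ : t₀ ∈ I) :
    ∃ τ : ℝ → ℝ, ContDiffOn ℝ ∞ τ I ∧ (∀ t ∈ I, 0 < deriv τ t) ∧
      (∀ t ∈ I, τ (h t) = τ t + 1) ∧ τ '' I = univ := by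
  have hmono := strictMonoOn_of_deriv_pos' hI hc hd hpos
  have kmono := strictMonoOn_of_deriv_pos' hI hc kd kpos
  have hmem : ∀ n, ∀ t ∈ I, h^[n] t ∈ I := fun n t ht => hh.iterate n ht
  have kmem : ∀ n, ∀ t ∈ I, k^[n] t ∈ I := fun n t ht => hk.iterate n ht
  have kle : ∀ t ∈ I, k t < t := fun t ht => by
    have := hlt _ (hk ht); rwa [hhk t ht] at this
  have kit : ∀ n, ∀ t ∈ I, k^[n] t ≤ t := fun n t ht => by
    have := le_iterate hh hlt n _ (kmem n t ht); rwa [iterate_left_inv hk hhk n t ht] at this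
  have kitm : ∀ n, StrictMonoOn (k^[n]) I := fun n =>
    strictMonoOn_of_deriv_pos' hI hc (contDiffOn_iterate hk kd n) (deriv_iterate_pos hI hk kd kpos n)
  obtain ⟨R, hR, hR0, hR1, hRd, hRd'⟩ := exists_smooth_step (a := t₀) (b := h (h t₀))
    ((hlt _ h₀).trans (hlt _ (hh h₀)))
  set b := h (h t₀) with hb
  -- the points that are moved beyond `t₀` by the `N`-th iterates
  let U : ℕ → Set ℝ := fun N => {t ∈ I | k^[N] t < t₀ ∧ t₀ < h^[N] t}
  have hUo : ∀ N, IsOpen (U N) := fun N => by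
    have h1 := (contDiffOn_iterate hh hd N).continuousOn.isOpen_inter_preimage hI
      (isOpen_Ioi (a := t₀))
    have h2 := (contDiffOn_iterate hk kd N).continuousOn.isOpen_inter_preimage hI
      (isOpen_Iio (a := t₀))
    have : U N = (I ∩ k^[N] ⁻¹' Iio t₀) ∩ (I ∩ h^[N] ⁻¹' Ioi t₀) := by
      ext t; simp only [U, mem_ofPred_eq, mem_inter_iff, mem_preimage, mem_Iio, mem_Ioi]; tauto
    rw [this]; exact h2.inter h1
  have hUmono : ∀ m N, m ≤ N → U m ⊆ U N := by
    rintro m N hmN t ⟨ht, h1, h2⟩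
    obtain ⟨j, rfl⟩ := Nat.exists_eq_add_of_le' hmN
    refine ⟨ht, ?_, ?_⟩
    · rw [Function.iterate_add_apply]; exact (kit j _ (kmem m t ht)).trans_lt h1
    · rw [Function.iterate_add_apply]; exact h2.trans_le (le_iterate hh hlt j _ (hmem m t ht))
  have hUex : ∀ t ∈ I, ∃ N, t ∈ U N := by
    intro t ht
    obtain ⟨m, hm⟩ := exists_lt_iterate hc hI hh hd.continuousOn hlt ht h₀
    obtain ⟨n, hn⟩ := exists_lt_iterate hc hI hh hd.continuousOn hlt h₀ ht
    have hn' : k^[n] t < t₀ := by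
      have := kitm n ht (hmem n t₀ h₀) hn; rwa [iterate_left_inv hh hkh n t₀ h₀] at this
    refine ⟨m + n, ht, ?_, ?_⟩
    · rw [Function.iterate_add_apply]; exact (kit m _ (kmem n t ht)).trans_lt hn'
    · rw [add_comm, Function.iterate_add_apply]
      exact hm.trans_le (le_iterate hh hlt n _ (hmem m t ht))
  have hbig : ∀ N, ∀ t ∈ U N, ∀ n, N + 2 ≤ n → b ≤ h^[n] t := by
    rintro N t ⟨ht, -, h2⟩ n hn
    obtain ⟨j, rfl⟩ := Nat.exists_eq_add_of_le' hn
    rw [Function.iterate_add_apply]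
    refine le_trans ?_ (le_iterate hh hlt j _ (hmem _ t ht))
    rw [add_comm N 2, Function.iterate_add_apply]
    exact (hmono (hh h₀) (hh (hmem N t ht)) (hmono h₀ (hmem N t ht) h2)).le
  have hsmall : ∀ N, ∀ t ∈ U N, ∀ n, N ≤ n → k^[n] t ≤ t₀ := by
    rintro N t ⟨ht, h1, -⟩ n hn
    obtain ⟨j, rfl⟩ := Nat.exists_eq_add_of_le' hn
    rw [Function.iterate_add_apply]
    exact (kit j _ (kmem N t ht)).trans h1.le
  let f : ℕ → ℝ → ℝ := fun n t => R (h^[n] t) - 1 + R (k^[n + 1] t)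
  have hf : ∀ N, ∀ t ∈ U N, ∑' n, f n t = ∑ n ∈ Finset.range (N + 2), f n t := by
    intro N t ht
    refine tsum_eq_sum fun n hn => ?_
    have hn' : N + 2 ≤ n := by simpa using hn
    simp only [f]
    rw [hR1 _ (hbig N t ht n hn'), hR0 _ (hsmall N t ht (n + 1) (by omega))]
    norm_num
  have hfd : ∀ n, ∀ t ∈ I, HasDerivAt (f n) (deriv R (h^[n] t) * deriv (h^[n]) t +
      deriv R (k^[n + 1] t) * deriv (k^[n + 1]) t) t := by
    intro n t ht
    have h1 := (((contDiffOn_iterate hh hd n).contDiffAt (hI.mem_nhds ht)).differentiableAt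
      (by simp)).hasDerivAt
    have h2 := (((contDiffOn_iterate hk kd (n + 1)).contDiffAt (hI.mem_nhds ht)).differentiableAt
      (by simp)).hasDerivAt
    have hRt : ∀ x, HasDerivAt R (deriv R x) x := fun x =>
      ((hR.contDiffAt (x := x)).differentiableAt (by simp)).hasDerivAt
    exact (((hRt _).comp t h1).sub_const 1).add ((hRt _).comp t h2)
  have hev : ∀ N, ∀ t ∈ U N, (fun t => ∑' n, f n t) =ᶠ[𝓝 t]
      fun t => ∑ n ∈ Finset.range (N + 2), f n t := fun N t ht => by
    filter_upwards [(hUo N).mem_nhds ht] with x hx using hf N x hx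
  have hsm : ContDiffOn ℝ ∞ (fun t => ∑' n, f n t) I := by
    intro t ht
    obtain ⟨N, hN⟩ := hUex t ht
    refine ((ContDiffAt.sum fun n _ => ?_).congr_of_eventuallyEq (hev N t hN)).contDiffWithinAt
    have h1 := (contDiffOn_iterate hh hd n).contDiffAt (hI.mem_nhds ht)
    have h2 := (contDiffOn_iterate hk kd (n + 1)).contDiffAt (hI.mem_nhds ht)
    exact ((hR.contDiffAt.comp t h1).sub contDiffAt_const).add (hR.contDiffAt.comp t h2)
  have htr : ∀ t ∈ I, (∑' n, f n (h t)) = (∑' n, f n t) + 1 := by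
    intro t ht
    obtain ⟨N₁, hN₁⟩ := hUex t ht
    obtain ⟨N₂, hN₂⟩ := hUex (h t) (hh ht)
    have h1 := hUmono N₁ (N₁ + N₂) (by omega) hN₁
    have h2 := hUmono N₂ (N₁ + N₂) (by omega) hN₂
    set N := N₁ + N₂
    rw [hf N t h1, hf N _ h2, ← sub_eq_iff_eq_add', ← Finset.sum_sub_distrib]
    have h3 : ∀ n ∈ Finset.range (N + 2), f n (h t) - f n t =
        (R (h^[n + 1] t) - R (h^[n] t)) + (R (k^[n] t) - R (k^[n + 1] t)) := by
      intro n _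
      simp only [f]
      rw [← Function.iterate_succ_apply h, Function.iterate_succ_apply k n (h t), hkh t ht]
      ring
    rw [Finset.sum_congr rfl h3, Finset.sum_add_distrib, Finset.sum_range_sub
      (fun n => R (h^[n] t)), Finset.sum_range_sub' (fun n => R (k^[n] t)),
      hR1 _ (hbig N t h1 (N + 2) le_rfl), hR0 _ (hsmall N t h1 (N + 2) (by omega))]
    simp
  refine ⟨fun t => ∑' n, f n t, hsm, fun t ht => ?_, htr, ?_⟩
  · obtain ⟨N, hN⟩ := hUex t ht
    have h1 := HasDerivAt.fun_sum (u := Finset.range (N + 2)) fun n _ => hfd n t ht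
    rw [(hev N t hN).deriv_eq, h1.deriv]
    have hnn1 : ∀ n, 0 ≤ deriv R (h^[n] t) * deriv (h^[n]) t := fun n =>
      mul_nonneg (hRd _) (deriv_iterate_pos hI hh hd hpos n t ht).le
    have hnn2 : ∀ n, 0 ≤ deriv R (k^[n + 1] t) * deriv (k^[n + 1]) t := fun n =>
      mul_nonneg (hRd _) (deriv_iterate_pos hI hk kd kpos (n + 1) t ht).le
    -- some iterate of `t` lies in the interval where the step function is increasing
    have hex : ∃ n, h^[n] t ∈ Ioo t₀ b ∨ k^[n + 1] t ∈ Ioo t₀ b := by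
      classical
      rcases le_or_gt t t₀ with hle | hgt
      · have hex : ∃ n, t₀ < h^[n] t := ⟨N, hN.2.2⟩
        have hs := Nat.find_spec hex
        rcases hn : Nat.find hex with _ | n
        · rw [hn] at hs; exact absurd hs hle.not_gt
        · rw [hn] at hs
          refine ⟨n + 1, Or.inl ⟨hs, ?_⟩⟩
          have h3 : h^[n] t ≤ t₀ := not_lt.1 (Nat.find_min hex (m := n) (by omega))
          rw [Function.iterate_succ_apply']
          exact (hmono.monotoneOn (hmem n t ht) h₀ h3).trans_lt (hlt _ (hh h₀))
      · have hex : ∃ n, k^[n] t < b :=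
          ⟨N, hN.2.1.trans ((hlt _ h₀).trans (hlt _ (hh h₀)))⟩
        have hs := Nat.find_spec hex
        rcases hn : Nat.find hex with _ | n
        · rw [hn] at hs; exact ⟨0, Or.inl ⟨hgt, hs⟩⟩
        · rw [hn] at hs
          refine ⟨n, Or.inr ⟨?_, hs⟩⟩
          have h3 : b ≤ k^[n] t := not_lt.1 (Nat.find_min hex (m := n) (by omega))
          rw [Function.iterate_succ_apply']
          refine lt_of_lt_of_le ?_ (kmono.monotoneOn (hh (hh h₀)) (kmem n t ht) h3)
          rw [hkh _ (hh h₀)]; exact hlt _ h₀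
    obtain ⟨n, hn⟩ := hex
    refine Finset.sum_pos' (fun n _ => add_nonneg (hnn1 n) (hnn2 n)) ⟨n, ?_, ?_⟩
    · rw [Finset.mem_range]
      by_contra! hle
      rcases hn with hn | hn
      · exact (hbig N t hN n hle).not_gt hn.2
      · exact (hsmall N t hN (n + 1) (by omega)).not_gt hn.1
    · rcases hn with hn | hn
      · exact add_pos_of_pos_of_nonneg (mul_pos (hRd' _ hn)
          (deriv_iterate_pos hI hh hd hpos n t ht)) (hnn2 n)
      · exact add_pos_of_nonneg_of_pos (hnn1 n) (mul_pos (hRd' _ hn)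
          (deriv_iterate_pos hI hk kd kpos (n + 1) t ht))
  · have hup : ∀ n : ℕ, ∑' m, f m (h^[n] t₀) = (∑' m, f m t₀) + n := by
      intro n
      induction n with
      | zero => simp
      | succ n ih =>
        rw [Function.iterate_succ_apply', htr _ (hmem n _ h₀), ih]; push_cast; ring
    have hdown : ∀ n : ℕ, ∑' m, f m (k^[n] t₀) = (∑' m, f m t₀) - n := by
      intro n
      induction n with
      | zero => simp
      | succ n ih =>
        have := htr _ (kmem (n + 1) _ h₀)
        rw [Function.iterate_succ_apply', hhk _ (kmem n _ h₀), ih] at this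
        rw [Function.iterate_succ_apply']
        push_cast; linarith
    have hoc : ((fun t => ∑' n, f n t) '' I).OrdConnected :=
      (hc.isPreconnected.image _ hsm.continuousOn).ordConnected
    refine eq_univ_of_forall fun y => ?_
    obtain ⟨n, hn⟩ := exists_nat_ge |y - ∑' m, f m t₀|
    refine hoc.out ⟨_, kmem n _ h₀, rfl⟩ ⟨_, hmem n _ h₀, rfl⟩ ⟨?_, ?_⟩
    · simp only; rw [hdown]; linarith [(abs_le.1 hn).1]
    · simp only; rw [hup]; linarith [(abs_le.1 hn).2]

end Conjugation

end

/-! ### Synchronization of two clocks -/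

section

section Reversal

variable {M : Type*} [TopologicalSpace M] [ChartedSpace E4 M] [IsManifold (𝓡 4) ∞ M]
  {g : LorentzMetric M} {T : TimeOrientation g} {W : Set M} {A B : Clock T} {p q : M} {c : ℝ → M}

theorem velocity_comp {c : ℝ → M} {θ : ℝ → ℝ} {s a : ℝ}
    (hc : MDifferentiableAt 𝓘(ℝ, ℝ) (𝓡 4) c (θ s)) (hθ : HasDerivAt θ a s) :
    velocity (c ∘ θ) s = a • velocity c (θ s) := by
  have h1 : HasMFDerivAt 𝓘(ℝ, ℝ) 𝓘(ℝ, ℝ) θ s (ContinuousLinearMap.toSpanSingleton ℝ a) :=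
    hθ.hasFDerivAt.hasMFDerivAt
  have h2 := (hc.hasMFDerivAt.comp s h1).mfderiv
  have h3 : velocity (c ∘ θ) s = mfderiv 𝓘(ℝ, ℝ) (𝓡 4) c (θ s) (a : ℝ) := by
    unfold velocity
    rw [h2]
    change mfderiv 𝓘(ℝ, ℝ) (𝓡 4) c (θ s) (ContinuousLinearMap.toSpanSingleton ℝ a 1) = _
    rw [ContinuousLinearMap.toSpanSingleton_apply, one_smul]
  rw [h3]
  have : (a : ℝ) = a • (1 : ℝ) := by simp
  have h4 := (mfderiv 𝓘(ℝ, ℝ) (𝓡 4) c (θ s)).map_smul a (1 : ℝ)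
  exact (congrArg (mfderiv 𝓘(ℝ, ℝ) (𝓡 4) c (θ s)) this).trans h4

theorem IsGeodesicSegment.reverse (hc : IsGeodesicSegment g W p q c) :
    IsGeodesicSegment g W q p (c ∘ fun r => 1 - r) := by
  have hI : MapsTo (fun r : ℝ => 1 - r) (Icc 0 1) (Icc 0 1) := fun r hr =>
    ⟨by linarith [hr.2], by linarith [hr.1]⟩
  have hcont : Continuous fun r : ℝ => 1 - r := by fun_prop
  refine ⟨by simp [hc.target], by simp [hc.source], fun s hs => hc.mem _ (hI hs),
    fun s hs => (hc.smooth _ (hI hs)).comp s (ContDiffAt.contMDiffAt (by fun_prop)), ?_⟩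
  filter_upwards [(hcont.tendsto_nhdsSet hI).eventually hc.geodesic] with s hs
  intro φ hφ hsφ w
  have hd : ∀ r, deriv (φ ∘ c ∘ fun r => 1 - r) r = -deriv (φ ∘ c) (1 - r) := fun r =>
    deriv_comp_const_sub (φ ∘ c) 1 r
  have h1 := ((hs φ hφ hsφ w).comp s ((hasDerivAt_id s).const_sub 1)).neg
  refine (h1.congr_of_eventuallyEq (Eventually.of_forall fun r => ?_)).congr_deriv ?_
  · simp only [Function.comp_apply, hd, map_neg, _root_.neg_apply, Pi.neg_apply]
  · simp only [Function.comp_apply, hd, map_neg, _root_.neg_apply, neg_neg]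
    ring

/-- An echo returns to the emitting clock at a reading different from that of the emission: a
reversed light ray is past-pointing. -/
theorem InRadarNhd.not_signal_of_signal (h : InRadarNhd W A B) {s t : ℝ} (h1 : Signal W A B s t)
    (h2 : Signal W B A t s) : False := by
  obtain ⟨⟨-, Γ, hΓ⟩, hA, hB, -, -⟩ := h
  obtain ⟨hs, ht, c, hc⟩ := h1
  obtain ⟨-, -, c', hc'⟩ := h2
  have hu := (hΓ.2 _ (hB (B.mem_trajectory ht)) _ (hA (A.mem_trajectory hs))).2
  have hr : (1 / 2 : ℝ) ∈ Icc (0 : ℝ) 1 := by constructor <;> norm_num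
  have hr' : (1 - 1 / 2 : ℝ) ∈ Icc (0 : ℝ) 1 := by constructor <;> norm_num
  have hcd := (hc.1.smooth _ hr').mdifferentiableAt (by simp)
  have h3 := (velocity_eq_of_eqOn (((hu _ hc.1.reverse).trans (hu _ hc'.1).symm)) hr
    ((hc.1.reverse.smooth _ hr).mdifferentiableAt (by simp))
    ((hc'.1.smooth _ hr).mdifferentiableAt (by simp)) (fun x v => T.IsFuture x v)).2 (hc'.2 _ hr).2
  have h4 : T.IsFuture (c (1 - 1 / 2)) (velocity (c ∘ fun r => 1 - r) (1 / 2)) := h3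
  rw [velocity_comp (θ := fun r => 1 - r) hcd ((hasDerivAt_id _).const_sub 1)] at h4
  have h5 := (hc.2 _ hr').2
  unfold TimeOrientation.IsFuture at h4 h5
  simp only [neg_smul, one_smul, map_neg] at h4
  linarith

/-- The clock `A`, read in the coordinate `u` with `t = θ u`. -/
noncomputable def Clock.reparam (A : Clock T) (θ : ℝ → ℝ) (hθ : ContDiff ℝ ∞ θ)
    (hpos : ∀ u, 0 < deriv θ u) (hrange : range θ = A.dom) : Clock T where
  dom := univ
  toFun := A.toFun ∘ θ
  isOpen_dom := isOpen_univ
  ordConnected_dom := ordConnected_univ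
  nonempty_dom := univ_nonempty
  smooth := A.smooth.comp hθ.contMDiff.contMDiffOn fun u _ => hrange ▸ mem_range_self u
  isEmbedding := by
    have hm : StrictMono θ := strictMono_of_deriv_pos hpos
    have h1 : Topology.IsEmbedding θ :=
      hm.isEmbedding_of_ordConnected (hrange ▸ A.ordConnected_dom)
    have h2 : Topology.IsEmbedding fun u : (univ : Set ℝ) =>
        (⟨θ u, hrange ▸ mem_range_self (u : ℝ)⟩ : A.dom) :=
      (h1.comp Topology.IsEmbedding.subtypeVal).codRestrict _ _
    exact A.isEmbedding.comp h2
  timelike := fun u _ => by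
    have hu : θ u ∈ A.dom := hrange ▸ mem_range_self u
    have h1 := ((A.smooth.contMDiffAt (A.isOpen_dom.mem_nhds hu))).mdifferentiableAt
      (by simp : (∞ : WithTop ℕ∞) ≠ 0)
    rw [velocity_comp h1 (hθ.contDiffAt.differentiableAt (by simp)).hasDerivAt]
    have := mul_neg_of_pos_of_neg (mul_pos (hpos u) (hpos u)) (A.timelike _ hu)
    simpa [mul_assoc] using this
  future := fun u _ => by
    have hu : θ u ∈ A.dom := hrange ▸ mem_range_self u
    have h1 := ((A.smooth.contMDiffAt (A.isOpen_dom.mem_nhds hu))).mdifferentiableAt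
      (by simp : (∞ : WithTop ℕ∞) ≠ 0)
    rw [velocity_comp h1 (hθ.contDiffAt.differentiableAt (by simp)).hasDerivAt]
    have := mul_neg_of_pos_of_neg (hpos u) (A.future _ hu)
    unfold TimeOrientation.IsFuture
    simpa using this

theorem Clock.reparam_isAdjustmentOf (A : Clock T) {θ : ℝ → ℝ} (hθ : ContDiff ℝ ∞ θ)
    (hpos : ∀ u, 0 < deriv θ u) (hrange : range θ = A.dom) :
    (A.reparam θ hθ hpos hrange).IsAdjustmentOf A :=
  ⟨θ, hθ.contDiffOn, fun u _ => hpos u, image_univ.trans hrange, fun _ _ => rfl⟩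

theorem Clock.isAdjustmentOf_refl (A : Clock T) : A.IsAdjustmentOf A :=
  ⟨id, contDiffOn_id, fun t _ => by simp, image_id _, fun _ _ => rfl⟩

theorem emits_iff_signal {s t : ℝ} (ht : t ∈ B.dom) :
    A.Emits W s (B.toFun t) ↔ Signal W A B s t := by
  simp [Clock.Emits, Signal, ht]

theorem receives_iff_signal {s t : ℝ} (ht : t ∈ B.dom) :
    A.Receives W s (B.toFun t) ↔ Signal W B A t s := by
  simp [Clock.Receives, Signal, ht]

end Reversal

/-- An increasing diffeomorphism of an open interval without fixed points is a translation by
`c = ±1` in a suitable coordinate, with inverse `θ`. -/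
theorem exists_translation {I : Set ℝ} {h : ℝ → ℝ} (hI : IsOpen I) (hc : I.OrdConnected)
    (hne : I.Nonempty) (hd : ContDiffOn ℝ ∞ h I) (hpos : ∀ t ∈ I, 0 < deriv h t)
    (himg : h '' I = I) (hfix : ∀ t ∈ I, h t ≠ t) :
    ∃ (θ : ℝ → ℝ) (c : ℝ), ContDiff ℝ ∞ θ ∧ (∀ u, 0 < deriv θ u) ∧ range θ = I ∧
      ∀ u, h (θ u) = θ (u + c) := by
  obtain ⟨t₀, h₀⟩ := hne
  obtain ⟨k, kd, kpos, hkh, kimg⟩ := exists_smooth_inverse hI hc hd hpos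
  rw [himg] at kd kpos kimg
  have hh : MapsTo h I I := fun t ht => himg ▸ mem_image_of_mem h ht
  have hk : MapsTo k I I := fun t ht => by
    have := mem_image_of_mem k ht; rwa [kimg] at this
  have hhk : ∀ t ∈ I, h (k t) = t := by
    intro t ht
    obtain ⟨s, hs, rfl⟩ : t ∈ h '' I := himg.symm ▸ ht
    rw [hkh s hs]
  suffices H : ∃ (τ : ℝ → ℝ) (c : ℝ), ContDiffOn ℝ ∞ τ I ∧ (∀ t ∈ I, 0 < deriv τ t) ∧
      (∀ t ∈ I, τ (h t) = τ t + c) ∧ τ '' I = univ by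
    obtain ⟨τ, c, τd, τpos, hτ, τimg⟩ := H
    obtain ⟨θ, θd, θpos, hθτ, θimg⟩ := exists_smooth_inverse hI hc τd τpos
    rw [τimg] at θd θpos θimg
    refine ⟨θ, c, contDiffOn_univ.1 θd, fun u => θpos u trivial, image_univ.symm.trans θimg,
      fun u => ?_⟩
    obtain ⟨t, ht, rfl⟩ : u ∈ τ '' I := τimg.symm ▸ trivial
    rw [hθτ t ht, ← hτ t ht, hθτ _ (hh ht)]
  have hdich : (∀ t ∈ I, t < h t) ∨ ∀ t ∈ I, h t < t := by
    have hsign : ∀ a ∈ I, ∀ b ∈ I, a < h a → h b < b → False := by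
      intro a ha b hb h1 h2
      obtain ⟨t, ht, h0⟩ := hc.isPreconnected.intermediate_value₂ ha hb continuousOn_id
        hd.continuousOn h1.le h2.le
      exact hfix t ht h0.symm
    rcases (hfix t₀ h₀).lt_or_gt with h1 | h1
    · exact Or.inr fun t ht => ((hfix t ht).lt_or_gt).resolve_right fun h2 =>
        hsign t ht t₀ h₀ h2 h1
    · exact Or.inl fun t ht => ((hfix t ht).lt_or_gt).resolve_left fun h2 =>
        hsign t₀ h₀ t ht h1 h2
  rcases hdich with hlt | hgt
  · obtain ⟨τ, h1, h2, h3, h4⟩ :=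
      exists_coordinate_translation hI hc hh hk hkh hhk hd kd hpos kpos hlt h₀
    exact ⟨τ, 1, h1, h2, h3, h4⟩
  · have klt : ∀ t ∈ I, t < k t := fun t ht => by
      have := hgt _ (hk ht); rwa [hhk t ht] at this
    obtain ⟨τ, h1, h2, h3, h4⟩ :=
      exists_coordinate_translation hI hc hk hh hhk hkh kd hd kpos hpos klt h₀
    refine ⟨τ, -1, h1, h2, fun t ht => ?_, h4⟩
    have := h3 _ (hh ht)
    rw [hkh t ht] at this
    linarith

section Pair

variable {M : Type*} [TopologicalSpace M] [ChartedSpace E4 M] [IsManifold (𝓡 4) ∞ M]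
  {g : LorentzMetric M} {T : TimeOrientation g} {W : Set M} {A B : Clock T}

theorem einsteinSynchronizedTo_of_signal {d : ℝ}
    (hAB : ∀ t ∈ B.dom, ∀ s, Signal W A B s t ↔ s = t - d)
    (hBA : ∀ t ∈ B.dom, ∀ s, Signal W B A t s ↔ s = t + d) : EinsteinSynchronizedTo W B A := by
  intro t ht
  simp only [emits_iff_signal ht, receives_iff_signal ht, hAB t ht, hBA t ht]
  exact ⟨⟨_, _, rfl, rfl⟩, by rintro s s' rfl rfl; ring⟩

/-- Two clocks in a radar neighborhood can be synchronized: the map that sends the emission of a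
light signal by `A` to the reception of its echo is a diffeomorphism without fixed points, hence a
translation for a suitable tick rate of `A`; the readings of `B` are then halfway. -/
theorem InRadarNhd.exists_synchronized (h : InRadarNhd W A B) :
    ∃ A' B' : Clock T, A'.IsAdjustmentOf A ∧ B'.IsAdjustmentOf B ∧
      EinsteinSynchronized W A' B' := by
  obtain ⟨f, hf, fd, fpos, fimg⟩ := h.isSmoothCorrespondence.exists_fun
  obtain ⟨k, hk, kd, kpos, kimg⟩ := h.symm.isSmoothCorrespondence.exists_fun
  have hfm : MapsTo f A.dom B.dom := fun t ht => fimg ▸ mem_image_of_mem f ht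
  have hkm : MapsTo k B.dom A.dom := fun t ht => kimg ▸ mem_image_of_mem k ht
  have finj := (strictMonoOn_of_deriv_pos' A.isOpen_dom A.ordConnected_dom fd fpos).injOn
  obtain ⟨θ, c, θd, θpos, θr, hθ⟩ := exists_translation (h := k ∘ f) A.isOpen_dom
    A.ordConnected_dom A.nonempty_dom (kd.comp fd hfm)
    (fun t ht => by
      have h1 := ((fd.contDiffAt (A.isOpen_dom.mem_nhds ht)).differentiableAt (by simp))
      have h2 := ((kd.contDiffAt (B.isOpen_dom.mem_nhds (hfm ht))).differentiableAt (by simp))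
      rw [deriv_comp t h2 h1]
      exact mul_pos (kpos _ (hfm ht)) (fpos t ht))
    (by rw [image_comp, fimg, kimg])
    (fun t ht h0 => h.not_signal_of_signal ((hf t (f t)).2 ⟨ht, rfl⟩)
      ((hk (f t) t).2 ⟨hfm ht, h0⟩))
  simp only [Function.comp_apply] at hθ
  have hθm : ∀ u, θ u ∈ A.dom := fun u => θr ▸ mem_range_self u
  have θinj : Function.Injective θ := (strictMono_of_deriv_pos θpos).injective
  set η : ℝ → ℝ := fun u => f (θ (u - c / 2)) with hη
  have hsub : ContDiff ℝ ∞ fun u : ℝ => u - c / 2 := by fun_prop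
  have ηd : ContDiff ℝ ∞ η := contDiffOn_univ.1
    (fd.comp (θd.comp hsub).contDiffOn fun u _ => hθm _)
  have ηpos : ∀ u, 0 < deriv η u := by
    intro u
    have h1 := ((θd.contDiffAt (x := u - c / 2)).differentiableAt (by simp)).hasDerivAt
    have h2 := ((fd.contDiffAt (A.isOpen_dom.mem_nhds (hθm (u - c / 2)))).differentiableAt
      (by simp)).hasDerivAt
    have h3 := h2.comp (u - c / 2) h1
    have h4 : HasDerivAt η _ u := h3.comp_sub_const u (c / 2)
    rw [h4.deriv]
    exact mul_pos (fpos _ (hθm _)) (θpos _)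
  have ηr : range η = B.dom := by
    rw [← fimg, ← θr]
    refine Subset.antisymm ?_ ?_
    · rintro _ ⟨u, rfl⟩; exact ⟨_, ⟨_, rfl⟩, rfl⟩
    · rintro _ ⟨_, ⟨u, rfl⟩, rfl⟩; exact ⟨u + c / 2, by simp [hη]⟩
  set A' := A.reparam θ θd θpos θr with hA'
  set B' := B.reparam η ηd ηpos ηr with hB'
  have hηm : ∀ u, η u ∈ B.dom := fun u => ηr ▸ mem_range_self u
  have hAB : ∀ u v, Signal W A' B' u v ↔ v = u + c / 2 := by
    intro u v
    have h1 : Signal W A' B' u v ↔ Signal W A B (θ u) (η v) := by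
      simp [Signal, hA', hB', Clock.reparam, hθm, hηm]
    rw [h1, hf, hη, and_iff_right (hθm u), finj.eq_iff (hθm _) (hθm _), θinj.eq_iff]
    constructor <;> intro h <;> linarith
  have hBA : ∀ u v, Signal W B' A' u v ↔ v = u + c / 2 := by
    intro u v
    have h1 : Signal W B' A' u v ↔ Signal W B A (η u) (θ v) := by
      simp [Signal, hA', hB', Clock.reparam, hθm, hηm]
    rw [h1, hk, and_iff_right (hηm u), hη]
    simp only
    rw [hθ, θinj.eq_iff]
    constructor <;> intro h <;> linarith
  refine ⟨A', B', A.reparam_isAdjustmentOf _ _ _, B.reparam_isAdjustmentOf _ _ _, ?_, ?_⟩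
  · exact einsteinSynchronizedTo_of_signal (d := c / 2)
      (fun t _ s => by rw [hBA]; constructor <;> intro h <;> linarith) (fun t _ s => hAB t s)
  · exact einsteinSynchronizedTo_of_signal (d := c / 2)
      (fun t _ s => by rw [hAB]; constructor <;> intro h <;> linarith) (fun t _ s => hBA t s)

end Pair

end

/-! ### Consequences of synchronization -/

section

theorem orbit_lt {I : Set ℝ} {h D : ℝ → ℝ} {a : ℝ} (hh : MapsTo h I I) (hm : StrictMonoOn h I)
    (hD : ∀ s ∈ I, h s = s + a * D s) (hDh : ∀ s ∈ I, D (h s) = D s) (n : ℕ) :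
    ∀ s ∈ I, ∀ s' ∈ I, s < s' → s + n * (a * D s) < s' + n * (a * D s') := by
  induction n with
  | zero => intro s _ s' _ h; simpa using h
  | succ n ih =>
    intro s hs s' hs' hlt
    have := ih _ (hh hs) _ (hh hs') (hm hs hs' hlt)
    rw [hDh s hs, hDh s' hs', hD s hs, hD s' hs'] at this
    push_cast
    linarith

/-- If an increasing bijection `h` of `I`, with inverse `k`, moves each point by `a D`, where `D` is
constant along the orbits, then `D` is constant, for the orbits would otherwise overtake one
another. -/
theorem eq_of_orbits {I : Set ℝ} {h k D : ℝ → ℝ} {a : ℝ} (ha : 0 < a) (hh : MapsTo h I I)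
    (hk : MapsTo k I I) (hhk : ∀ t ∈ I, h (k t) = t) (hm : StrictMonoOn h I)
    (hD : ∀ s ∈ I, h s = s + a * D s) (hDh : ∀ s ∈ I, D (h s) = D s) :
    ∀ s ∈ I, ∀ s' ∈ I, s < s' → D s = D s' := by
  have hDk : ∀ s ∈ I, D (k s) = D s := fun s hs => by rw [← hDh _ (hk hs), hhk s hs]
  have hkD : ∀ s ∈ I, k s = s + (-a) * D s := fun s hs => by
    have := hD _ (hk hs); rw [hhk s hs, hDk s hs] at this; linarith
  have km : StrictMonoOn k I := fun s hs s' hs' hlt => by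
    rw [← hm.lt_iff_lt (hk hs) (hk hs'), hhk s hs, hhk s' hs']; exact hlt
  intro s hs s' hs' hlt
  by_contra hne
  have hpos : 0 < a * |D s - D s'| := mul_pos ha (abs_pos.2 (sub_ne_zero.2 hne))
  obtain ⟨n, hn⟩ := exists_nat_gt ((s' - s) / (a * |D s - D s'|))
  rw [div_lt_iff₀ hpos] at hn
  have h1 := orbit_lt hh hm hD hDh n s hs s' hs' hlt
  have h2 := orbit_lt hk km hkD hDk n s hs s' hs' hlt
  rcases abs_choice (D s - D s') with h3 | h3 <;> rw [h3] at hn <;> linarith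

section Synchronized

variable {M : Type*} [TopologicalSpace M] [ChartedSpace E4 M] [IsManifold (𝓡 4) ∞ M]
  {g : LorentzMetric M} {T : TimeOrientation g} {W : Set M} {A B A' B' : Clock T}

theorem Clock.IsAdjustmentOf.trajectory_eq (h : A'.IsAdjustmentOf A) :
    A'.trajectory = A.trajectory := by
  obtain ⟨θ, -, -, himg, heq⟩ := h
  rw [Clock.trajectory, Clock.trajectory, heq.image_eq, image_comp, himg]

theorem HasRadarContact.of_adjustment (h : HasRadarContact W A B) (hA : A'.IsAdjustmentOf A)
    (hB : B'.IsAdjustmentOf B) : HasRadarContact W A' B' := by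
  intro b hb
  rw [hB.trajectory_eq] at hb
  obtain ⟨θ, hθ, hpos, himg, heq⟩ := hA
  have hinj := (strictMonoOn_of_deriv_pos' A'.isOpen_dom A'.ordConnected_dom hθ hpos).injOn
  have hm : MapsTo θ A'.dom A.dom := fun t ht => himg ▸ mem_image_of_mem θ ht
  have he : ∀ t ∈ A'.dom, A'.toFun t = A.toFun (θ t) := heq
  obtain ⟨⟨⟨t, ht, c, hc⟩, hu⟩, ⟨t', ht', c', hc'⟩, hu'⟩ := h b hb
  rw [← himg] at ht ht'
  obtain ⟨r, hr, rfl⟩ := ht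
  obtain ⟨r', hr', rfl⟩ := ht'
  refine ⟨⟨⟨r, hr, c, (he r hr).symm ▸ hc⟩, fun t ht t' ht' c c' hc hc' => ?_⟩,
    ⟨r', hr', c', (he r' hr').symm ▸ hc'⟩, fun t ht t' ht' c c' hc hc' => ?_⟩ <;>
  rw [he t ht] at hc <;> rw [he t' ht'] at hc'
  · have := hu _ (hm ht) _ (hm ht') c c' hc hc'
    exact ⟨hinj ht ht' this.1, this.2⟩
  · have := hu' _ (hm ht) _ (hm ht') c c' hc hc'
    exact ⟨hinj ht ht' this.1, this.2⟩

theorem InRadarNhd.of_adjustment (h : InRadarNhd W A B) (hA : A'.IsAdjustmentOf A)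
    (hB : B'.IsAdjustmentOf B) : InRadarNhd W A' B' :=
  ⟨h.1, hA.trajectory_eq ▸ h.2.1, hB.trajectory_eq ▸ h.2.2.1, h.2.2.2.1.of_adjustment hA hB,
    h.2.2.2.2.of_adjustment hB hA⟩

/-- Between two clocks that are Einstein synchronized with one another the signals take, in either
direction and at all times, the same time. -/
theorem EinsteinSynchronized.exists_delay (hs : EinsteinSynchronized W A B) (h : InRadarNhd W A B) :
    ∃ d : ℝ, (∀ s t, Signal W A B s t → t = s + d) ∧ ∀ t s, Signal W B A t s → s = t + d := by
  obtain ⟨f, hf, fd, fpos, fimg⟩ := h.isSmoothCorrespondence.exists_fun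
  obtain ⟨k, hk, kd, kpos, kimg⟩ := h.symm.isSmoothCorrespondence.exists_fun
  have hfm : MapsTo f A.dom B.dom := fun t ht => fimg ▸ mem_image_of_mem f ht
  have hkm : MapsTo k B.dom A.dom := fun t ht => kimg ▸ mem_image_of_mem k ht
  have hfmono := strictMonoOn_of_deriv_pos' A.isOpen_dom A.ordConnected_dom fd fpos
  have hkmono := strictMonoOn_of_deriv_pos' B.isOpen_dom B.ordConnected_dom kd kpos
  choose! f' hf' hff' using fun t (ht : t ∈ B.dom) => fimg.symm.subset ht
  choose! k' hk' hkk' using fun t (ht : t ∈ A.dom) => kimg.symm.subset ht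
  have h1 : ∀ s ∈ A.dom, k (f s) - f s = f s - s := fun s hsA =>
    (hs.2 (f s) (hfm hsA)).2 s (k (f s))
      ((emits_iff_signal (hfm hsA)).2 ((hf _ _).2 ⟨hsA, rfl⟩))
      ((receives_iff_signal (hfm hsA)).2 ((hk _ _).2 ⟨hfm hsA, rfl⟩))
  have h2 : ∀ t ∈ B.dom, f (k t) - k t = k t - t := fun t htB =>
    (hs.1 (k t) (hkm htB)).2 t (f (k t))
      ((emits_iff_signal (hkm htB)).2 ((hk _ _).2 ⟨htB, rfl⟩))
      ((receives_iff_signal (hkm htB)).2 ((hf _ _).2 ⟨hkm htB, rfl⟩))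
  have h3 := eq_of_orbits (h := k ∘ f) (k := f' ∘ k') (D := fun s => f s - s) two_pos
    (hkm.comp hfm) (fun t ht => hf' _ (hk' _ ht))
    (fun t ht => by simp only [Function.comp_apply]; rw [hff' _ (hk' _ ht), hkk' _ ht])
    (hkmono.comp hfmono hfm)
    (fun s hsA => by simp only [Function.comp_apply]; linarith [h1 s hsA])
    (fun s hsA => by
      simp only [Function.comp_apply]; linarith [h1 s hsA, h2 _ (hfm hsA)])
  have h4 : ∀ s ∈ A.dom, ∀ s' ∈ A.dom, f s - s = f s' - s' := by
    intro s hsA s' hsA'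
    rcases lt_trichotomy s s' with h | rfl | h
    · exact h3 s hsA s' hsA' h
    · rfl
    · exact (h3 s' hsA' s hsA h).symm
  obtain ⟨s₀, hs₀⟩ := A.nonempty_dom
  refine ⟨f s₀ - s₀, fun s t hst => ?_, fun t s hst => ?_⟩
  · obtain ⟨hsA, rfl⟩ := (hf s t).1 hst
    linarith [h4 s hsA s₀ hs₀]
  · obtain ⟨htB, rfl⟩ := (hk t s).1 hst
    linarith [h4 _ (hkm htB) s₀ hs₀, h2 t htB]

variable {K : Fin 3 → Clock T}

/-- The signals between the clocks `K i` behave like those between synchronized clocks: the echoes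
from two clocks to a third commute, and light takes equally long around the triangle in either
sense. -/
structure IsSynchronousTriple (W : Set M) (K : Fin 3 → Clock T) : Prop where
  echo : ∀ {s t₁ s₁ u₁ s₂ u₂ s₃ t₂ s₄ : ℝ}, Signal W (K 0) (K 1) s t₁ → Signal W (K 1) (K 0) t₁ s₁ →
    Signal W (K 0) (K 2) s₁ u₁ → Signal W (K 2) (K 0) u₁ s₂ →
    Signal W (K 0) (K 2) s u₂ → Signal W (K 2) (K 0) u₂ s₃ →
    Signal W (K 0) (K 1) s₃ t₂ → Signal W (K 1) (K 0) t₂ s₄ → s₂ = s₄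
  loop : ∀ {s t₁ u₁ s₁ u₂ t₂ s₂ : ℝ}, Signal W (K 0) (K 1) s t₁ → Signal W (K 1) (K 2) t₁ u₁ →
    Signal W (K 2) (K 0) u₁ s₁ → Signal W (K 0) (K 2) s u₂ → Signal W (K 2) (K 1) u₂ t₂ →
    Signal W (K 1) (K 0) t₂ s₂ → s₁ = s₂

theorem isSynchronousTriple (hK : Pairwise fun i j => InRadarNhd W (K i) (K j))
    (h : Synchronizable W K ⊤) : IsSynchronousTriple W K := by
  obtain ⟨K', hadj, hsync⟩ := h
  have hd : ∀ i j, i ≠ j → ∃ d : ℝ, (∀ s t, Signal W (K' i) (K' j) s t → t = s + d) ∧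
      ∀ t s, Signal W (K' j) (K' i) t s → s = t + d := fun i j hij =>
    (hsync i j hij).exists_delay ((hK hij).of_adjustment (hadj i) (hadj j))
  choose θ hθ hpos himg heq using hadj
  have hτ : ∀ i, ∃ τ : ℝ → ℝ, ∀ s ∈ (K i).dom, τ s ∈ (K' i).dom ∧ θ i (τ s) = s := by
    intro i
    choose! τ hτ using fun s (hs : s ∈ (K i).dom) => (himg i).symm.subset hs
    exact ⟨τ, hτ⟩
  choose τ hτ using hτ
  have hsig : ∀ i j s t, Signal W (K i) (K j) s t → Signal W (K' i) (K' j) (τ i s) (τ j t) := by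
    rintro i j s t ⟨hs, ht, c, hc⟩
    refine ⟨(hτ i s hs).1, (hτ j t ht).1, c, ?_⟩
    rw [heq i (hτ i s hs).1, heq j (hτ j t ht).1]
    simpa only [Function.comp_apply, (hτ i s hs).2, (hτ j t ht).2] using hc
  have hinj : ∀ i, ∀ s ∈ (K i).dom, ∀ s' ∈ (K i).dom, τ i s = τ i s' → s = s' := by
    intro i s hs s' hs' h
    rw [← (hτ i s hs).2, h, (hτ i s' hs').2]
  obtain ⟨a, ha, ha'⟩ := hd 0 1 (by decide)
  obtain ⟨b, hb, hb'⟩ := hd 0 2 (by decide)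
  obtain ⟨c, hc, hc'⟩ := hd 1 2 (by decide)
  refine ⟨fun h1 h2 h3 h4 h5 h6 h7 h8 => hinj 0 _ h4.2.1 _ h8.2.1 ?_,
    fun h1 h2 h3 h4 h5 h6 => hinj 0 _ h3.2.1 _ h6.2.1 ?_⟩
  · linarith [ha _ _ (hsig _ _ _ _ h1), ha' _ _ (hsig _ _ _ _ h2), hb _ _ (hsig _ _ _ _ h3),
      hb' _ _ (hsig _ _ _ _ h4), hb _ _ (hsig _ _ _ _ h5), hb' _ _ (hsig _ _ _ _ h6),
      ha _ _ (hsig _ _ _ _ h7), ha' _ _ (hsig _ _ _ _ h8)]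
  · linarith [ha _ _ (hsig _ _ _ _ h1), hc _ _ (hsig _ _ _ _ h2), hb' _ _ (hsig _ _ _ _ h3),
      hb _ _ (hsig _ _ _ _ h4), hc' _ _ (hsig _ _ _ _ h5), ha' _ _ (hsig _ _ _ _ h6)]

theorem synchronizable_edge {i j : Fin 3} (hij : i ≠ j) (h : InRadarNhd W (K i) (K j)) :
    Synchronizable W K (SimpleGraph.edge i j) := by
  obtain ⟨A', B', hA, hB, hs⟩ := h.exists_synchronized
  refine ⟨fun k => if k = i then A' else if k = j then B' else K k, fun k => ?_, fun k l hkl => ?_⟩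
  · simp only
    split_ifs with h1 h2
    · rwa [h1]
    · rwa [h2]
    · exact Clock.isAdjustmentOf_refl _
  · rw [SimpleGraph.edge_adj] at hkl
    rcases hkl.1 with ⟨rfl, rfl⟩ | ⟨rfl, rfl⟩
    · simpa [hij, hij.symm] using hs
    · have hs' : EinsteinSynchronized W B' A' := hs.symm
      simpa [hij, hij.symm] using hs'

/-- If three clocks cannot all be synchronized with one another, then adding the edges of the
triangle one by one, some selection of pairs excludes a further pair. -/
theorem exists_exclusion (hK : Pairwise fun i j => InRadarNhd W (K i) (K j))
    (h : ¬ Synchronizable W K ⊤) :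
    ∃ (S : SimpleGraph (Fin 3)) (i j : Fin 3), S ≠ ⊥ ∧ i ≠ j ∧ ¬ S.Adj i j ∧
      Synchronizable W K S ∧ Synchronizable W K (SimpleGraph.edge i j) ∧
      ¬ Synchronizable W K (S ⊔ SimpleGraph.edge i j) := by
  have hne : ∀ S : SimpleGraph (Fin 3), S.Adj 0 1 → S ≠ ⊥ := by
    rintro _ h rfl; exact h
  by_cases h1 : Synchronizable W K (SimpleGraph.edge 0 1 ⊔ SimpleGraph.edge 1 2)
  · refine ⟨_, 0, 2, hne _ ?_, by decide, ?_, h1, synchronizable_edge (by decide)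
      (hK (by decide)), fun h2 => h ?_⟩
    · simp [SimpleGraph.edge_adj]
    · simp [SimpleGraph.edge_adj]
    · have : SimpleGraph.edge 0 1 ⊔ SimpleGraph.edge 1 2 ⊔ SimpleGraph.edge 0 2 =
          (⊤ : SimpleGraph (Fin 3)) := by
        ext a b
        fin_cases a <;> fin_cases b <;> simp [SimpleGraph.edge_adj]
      rwa [this] at h2
  · refine ⟨SimpleGraph.edge 0 1, 1, 2, hne _ ?_, by decide, ?_, synchronizable_edge (by decide)
      (hK (by decide)), synchronizable_edge (by decide) (hK (by decide)), h1⟩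
    · simp [SimpleGraph.edge_adj]
    · simp [SimpleGraph.edge_adj]

end Synchronized

end

/-! ### Short geodesic segments in a chart -/

section

section Shortcuts

-- Shortcuts: instance resolution for spaces of multilinear forms is slow without them.
variable {E : Type*} [NormedAddCommGroup E] [NormedSpace ℝ E]

noncomputable instance dualGroup : NormedAddCommGroup (E →L[ℝ] ℝ) :=
  ContinuousLinearMap.toNormedAddCommGroup

noncomputable instance dualSpace : NormedSpace ℝ (E →L[ℝ] ℝ) := ContinuousLinearMap.toNormedSpace

noncomputable instance formGroup : NormedAddCommGroup (E →L[ℝ] E →L[ℝ] ℝ) :=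
  ContinuousLinearMap.toNormedAddCommGroup

noncomputable instance formSpace : NormedSpace ℝ (E →L[ℝ] E →L[ℝ] ℝ) :=
  ContinuousLinearMap.toNormedSpace

end Shortcuts

section Estimates

variable {E : Type*} [NormedAddCommGroup E] [NormedSpace ℝ E] {G : E → E →L[ℝ] E →L[ℝ] ℝ}

theorem norm_fderiv_form_le {x u v w : E} {B : ℝ} (hB : ‖fderiv ℝ G x‖ ≤ B) :
    |fderiv ℝ G x u v w| ≤ B * ‖u‖ * ‖v‖ * ‖w‖ := by
  have h1 := (fderiv ℝ G x u v).le_opNorm w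
  have h2 := (fderiv ℝ G x u).le_opNorm v
  have h3 := (fderiv ℝ G x).le_opNorm u
  rw [Real.norm_eq_abs] at h1
  have h4 : ‖fderiv ℝ G x‖ * ‖u‖ ≤ B * ‖u‖ := by gcongr
  calc _ ≤ _ := h1
    _ ≤ B * ‖u‖ * ‖v‖ * ‖w‖ := by
      gcongr
      exact h2.trans (by gcongr; exact h3.trans h4)

/-- The acceleration of a solution of the Euler-Lagrange equation is quadratic in its velocity. -/
theorem norm_acceleration_le {x : ℝ → E} {r K B : ℝ} {a : E} (hx : DifferentiableAt ℝ x r)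
    (ha : HasDerivAt (deriv x) a r) (hG : DifferentiableAt ℝ G (x r))
    (hEL : ∀ w, HasDerivAt (fun r => G (x r) (deriv x r) w)
      (1 / 2 * fderiv ℝ (fun y => G y (deriv x r) (deriv x r)) (x r) w) r)
    (hK : ∀ u, ‖u‖ ≤ K * ‖G (x r) u‖) (hK0 : 0 ≤ K) (hB : ‖fderiv ℝ G (x r)‖ ≤ B) :
    ‖a‖ ≤ K * (2 * B * ‖deriv x r‖ ^ 2) := by
  have hB0 : 0 ≤ B := (norm_nonneg _).trans hB
  have h0 : HasDerivAt (fun r => G (x r)) (fderiv ℝ G (x r) (deriv x r)) r :=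
    hasDerivAt_comp_curve (f := G) hG hx.hasDerivAt
  have h1 : HasDerivAt (fun r => G (x r) (deriv x r))
      (fderiv ℝ G (x r) (deriv x r) (deriv x r) + G (x r) a) r := h0.clm_apply ha
  refine (hK a).trans ?_
  gcongr
  refine ContinuousLinearMap.opNorm_le_bound _ (by positivity) fun w => ?_
  have h3 := (hEL w).unique (h1.clm_apply (hasDerivAt_const r w))
  rw [fderiv_form_apply hG] at h3
  simp only [ContinuousLinearMap.flip_apply, add_apply, map_zero, add_zero] at h3
  have h4 := abs_le.1 (norm_fderiv_form_le (u := w) (v := deriv x r) (w := deriv x r) hB)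
  have h5 := abs_le.1 (norm_fderiv_form_le (u := deriv x r) (v := deriv x r) (w := w) hB)
  have h6 : 0 ≤ B * ‖deriv x r‖ ^ 2 * ‖w‖ := by positivity
  rw [Real.norm_eq_abs, abs_le]
  constructor <;> nlinarith [h4.1, h4.2, h5.1, h5.2]

/-- Uniform nondegeneracy near a point. -/
theorem exists_forall_norm_le [FiniteDimensional ℝ E] {x₀ : E} (hG : ContinuousAt G x₀)
    (hinj : ∀ u, G x₀ u = 0 → u = 0) :
    ∃ K : ℝ, 0 ≤ K ∧ ∀ᶠ x in 𝓝 x₀, ∀ u, ‖u‖ ≤ K * ‖G x u‖ := by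
  obtain ⟨K, hK0, hK⟩ := LinearMap.exists_antilipschitzWith (G x₀ : E →ₗ[ℝ] E →L[ℝ] ℝ)
    (LinearMap.ker_eq_bot'.2 hinj)
  have h1 : ∀ u, ‖u‖ ≤ K * ‖G x₀ u‖ := fun u => by
    have := hK.le_mul_dist u 0; simpa using this
  have hKp : (0 : ℝ) < K := hK0
  have h2 : ∀ᶠ x in 𝓝 x₀, ‖G x - G x₀‖ < 1 / (2 * K) := by
    have := (hG.sub (continuousAt_const (y := G x₀))).norm
    refine this.eventually_lt_const (by simp [hKp])
  refine ⟨2 * K, by positivity, h2.mono fun x hx u => ?_⟩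
  have h3 : ‖G x₀ u‖ ≤ ‖G x u‖ + 1 / (2 * K) * ‖u‖ := by
    have h4 : G x₀ u = G x u - (G x - G x₀) u := by simp
    rw [h4]
    refine (norm_sub_le _ _).trans ?_
    gcongr
    exact ((G x - G x₀).le_opNorm u).trans (by gcongr)
  have h5 : K * ‖G x₀ u‖ ≤ K * ‖G x u‖ + 1 / 2 * ‖u‖ := by
    calc K * ‖G x₀ u‖ ≤ K * (‖G x u‖ + 1 / (2 * K) * ‖u‖) := by gcongr
      _ = _ := by field_simp
  linarith [h1 u]

end Estimates

section LocalGeodesics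

variable {M : Type*} [TopologicalSpace M] [ChartedSpace E4 M] [IsManifold (𝓡 4) ∞ M]
  {g : LorentzMetric M} {W : Set M} {φ : OpenPartialHomeomorph M E4} {Γ : M → M → ℝ → M}
  {y₀ : E4}

/-- The part of the target of the chart `φ` that corresponds to the open set `W`. -/
def chartDomain (φ : OpenPartialHomeomorph M E4) (W : Set M) : Set E4 := φ.target ∩ φ.symm ⁻¹' W

theorem isOpen_chartDomain (hW : IsOpen W) : IsOpen (chartDomain φ W) :=
  φ.isOpen_inter_preimage_symm hW

theorem IsGeodesicFamily.isSmoothFamily_chart (hΓ : IsGeodesicFamily g W Γ) (hφ : φ ∈ atlas E4 M)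
    {O : Set (E4 × E4)} (hO : IsOpen O) (h : O ⊆ chartDomain φ W ×ˢ chartDomain φ W) :
    IsSmoothFamily O (fun z : E4 × E4 => Γ (φ.symm z.1) (φ.symm z.2)) := by
  refine hΓ.isSmoothFamily hO ?_ ?_ (fun z hz => (h hz).1.2) (fun z hz => (h hz).2.2)
  · intro z hz
    exact ((contMDiffAt_chart_symm hφ (h hz).1.1).comp z
      contDiff_fst.contMDiff.contMDiffAt).contMDiffWithinAt
  · intro z hz
    exact ((contMDiffAt_chart_symm hφ (h hz).2.1).comp z
      contDiff_snd.contMDiff.contMDiffAt).contMDiffWithinAt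

theorem IsGeodesicFamily.const (hΓ : IsGeodesicFamily g W Γ) {p : M} (hp : p ∈ W) {r : ℝ}
    (hr : r ∈ Icc (0 : ℝ) 1) : Γ p p r = p := by
  refine ((hΓ.2 p hp p hp).2 (fun _ => p) ⟨rfl, rfl, fun _ _ => hp, fun s _ => contMDiffAt_const,
    Eventually.of_forall fun s ψ hψ hs w => ?_⟩ hr).symm
  have h1 : ψ ∘ (fun _ : ℝ => p) = fun _ => ψ p := rfl
  simp only [h1, deriv_const, map_zero]
  simpa using hasDerivAt_const s (0 : ℝ)

/-- A function that is continuous on a tube around `{x} × [0,1]` satisfies an open condition near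
`x` if it does so on `{x} × [0,1]`. -/
theorem eventually_forall_Icc {X : Type*} [TopologicalSpace X] {x : X} {O : Set X} (hO : O ∈ 𝓝 x)
    {P : X × ℝ → Prop}
    (h : ∀ r ∈ Icc (0 : ℝ) 1, ∀ᶠ z in 𝓝[O ×ˢ Icc (0 : ℝ) 1] (x, r), P z) :
    ∀ᶠ y in 𝓝 x, ∀ r ∈ Icc (0 : ℝ) 1, P (y, r) := by
  have h1 := isCompact_Icc.eventually_forall_of_forall_eventually (x₀ := x)
    (K := Icc (0 : ℝ) 1) (P := fun y r => y ∈ O → r ∈ Icc (0 : ℝ) 1 → P (y, r)) (fun r hr => by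
      filter_upwards [eventually_nhdsWithin_iff.1 (h r hr)] with z hz h1 h2 using hz ⟨h1, h2⟩)
  filter_upwards [h1, hO] with y hy hyO r hr using hy r hr hyO hr

theorem ball_prod_eq {E F : Type*} [PseudoMetricSpace E] [PseudoMetricSpace F] {x : E} {y : F}
    {p : E} {q : F} {ρ : ℝ} (hp : p ∈ Metric.ball x ρ) (hq : q ∈ Metric.ball y ρ) :
    (p, q) ∈ Metric.ball (x, y) ρ := by
  rw [← ball_prod_same]; exact ⟨hp, hq⟩

/-- In a chart, the geodesic segment from `p` to `q` is a straight line up to an error that is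
quadratic in `q - p`. -/
theorem IsGeodesicFamily.exists_estimate (hΓ : IsGeodesicFamily g W Γ) (hW : IsOpen W)
    (hφ : φ ∈ atlas E4 M) (hy : y₀ ∈ chartDomain φ W) {N : Set E4} (hN : N ∈ 𝓝 y₀) :
    ∃ ρ > 0, ∃ C ≥ 0, Metric.ball y₀ ρ ⊆ chartDomain φ W ∧
      ∀ p ∈ Metric.ball y₀ ρ, ∀ q ∈ Metric.ball y₀ ρ, ∀ r ∈ Icc (0 : ℝ) 1,
        Γ (φ.symm p) (φ.symm q) r ∈ φ.source ∧ φ (Γ (φ.symm p) (φ.symm q) r) ∈ N ∧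
        DifferentiableAt ℝ (φ ∘ Γ (φ.symm p) (φ.symm q)) r ∧
        ‖deriv (φ ∘ Γ (φ.symm p) (φ.symm q)) r‖ ≤ C * ‖q - p‖ ∧
        ‖deriv (φ ∘ Γ (φ.symm p) (φ.symm q)) r - (q - p)‖ ≤ C * ‖q - p‖ ^ 2 := by
  have hD : IsOpen (chartDomain φ W) := isOpen_chartDomain hW
  have hDD := hD.prod hD
  have hyy : (y₀, y₀) ∈ chartDomain φ W ×ˢ chartDomain φ W := ⟨hy, hy⟩
  have hH := hΓ.isSmoothFamily_chart hφ hDD Subset.rfl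
  set H := fun z : E4 × E4 => Γ (φ.symm z.1) (φ.symm z.2) with hHdef
  set S := (chartDomain φ W ×ˢ chartDomain φ W) ×ˢ Icc (0 : ℝ) 1 with hS
  have hG := contDiffAt_inChart (g := g) hφ hy.1
  obtain ⟨K, hK0, hK⟩ := exists_forall_norm_le hG.continuousAt fun u hu =>
    (isLorentzForm_inChart (g := g) hφ hy.1).eq_zero fun v => by
      rw [hu]; rfl
  set B := ‖fderiv ℝ (g.inChart φ) y₀‖ + 1 with hBdef
  have hB : ∀ᶠ y in 𝓝 y₀, ‖fderiv ℝ (g.inChart φ) y‖ ≤ B := by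
    have := ((hG.fderiv_right (m := ∞) (by simp)).continuousAt).norm
    exact (this.eventually_lt_const (lt_add_one _)).mono fun _ h => h.le
  have hconst : ∀ y ∈ chartDomain φ W, ∀ r ∈ Icc (0 : ℝ) 1, H (y, y) r = φ.symm y :=
    fun y hy r hr => hΓ.const hy.2 hr
  have hsrc : ∀ r ∈ Icc (0 : ℝ) 1, H (y₀, y₀) r ∈ φ.source := fun r hr => by
    rw [hconst y₀ hy r hr]; exact φ.map_target hy.1
  have hφH : ∀ r ∈ Icc (0 : ℝ) 1, φ (H (y₀, y₀) r) = y₀ := fun r hr => by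
    rw [hconst y₀ hy r hr]; exact φ.right_inv hy.1
  -- the velocity and its derivative
  set D : (E4 × E4) × ℝ → E4 := fun z => deriv (φ ∘ H z.1) z.2 with hDdef
  have hDc : ∀ r ∈ Icc (0 : ℝ) 1, ContDiffWithinAt ℝ ∞ D S ((y₀, y₀), r) := fun r hr =>
    hH.contDiffWithinAt_deriv hyy hr hφ (hsrc r hr)
  have hD'c : ∀ r ∈ Icc (0 : ℝ) 1, ContinuousWithinAt (fderivWithin ℝ D S) S ((y₀, y₀), r) :=
    fun r hr => ((hDc r hr).fderivWithin_right (m := ∞) hH.uniqueDiffOn (by simp)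
      ⟨hyy, hr⟩).continuousWithinAt
  obtain ⟨C, hC⟩ : ∃ C, ∀ r ∈ Icc (0 : ℝ) 1, ‖fderivWithin ℝ D S ((y₀, y₀), r)‖ ≤ C := by
    refine isCompact_Icc.exists_bound_of_continuousOn
      (f := fun r : ℝ => fderivWithin ℝ D S ((y₀, y₀), r)) fun r hr => ?_
    exact (hD'c r hr).comp (Continuous.continuousWithinAt (by fun_prop)) fun s hs => ⟨hyy, hs⟩
  have hOn : chartDomain φ W ×ˢ chartDomain φ W ∈ 𝓝 (y₀, y₀) := hDD.mem_nhds hyy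
  have e1 := eventually_forall_Icc hOn fun r hr => hH.eventually_mem_source hyy hr (hsrc r hr)
  have e2 : ∀ᶠ z in 𝓝 (y₀, y₀), ∀ r ∈ Icc (0 : ℝ) 1, φ (H z r) ∈ N ∧
      ‖fderiv ℝ (g.inChart φ) (φ (H z r))‖ ≤ B ∧
      ∀ u, ‖u‖ ≤ K * ‖g.inChart φ (φ (H z r)) u‖ :=
    eventually_forall_Icc hOn
      (P := fun z => φ (H z.1 z.2) ∈ N ∧ ‖fderiv ℝ (g.inChart φ) (φ (H z.1 z.2))‖ ≤ B ∧
        ∀ u, ‖u‖ ≤ K * ‖g.inChart φ (φ (H z.1 z.2)) u‖) fun r hr => by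
      have h1 : Tendsto (fun z : (E4 × E4) × ℝ => φ (H z.1 z.2)) (𝓝[S] ((y₀, y₀), r)) (𝓝 y₀) := by
        have := (hH.contDiffWithinAt_chart hyy hr hφ (hsrc r hr)).continuousWithinAt
        simpa only [ContinuousWithinAt, hφH r hr] using this
      exact h1.eventually (((show ∀ᶠ y in 𝓝 y₀, y ∈ N from hN)).and (hB.and hK))
  have e3 := eventually_forall_Icc hOn
    (P := fun z => ‖fderivWithin ℝ D S z‖ ≤ C + 1) fun r hr =>
      ((hD'c r hr).norm.eventually_lt_const ((hC r hr).trans_lt (lt_add_one C))).mono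
        fun _ h => h.le
  obtain ⟨ρ, hρ, hρ'⟩ := Metric.eventually_nhds_iff_ball.1 (e1.and (e2.and (e3.and hOn)))
  have hC0 : 0 ≤ C := (norm_nonneg _).trans (hC 0 (by simp))
  have hBp : 0 ≤ B := by positivity
  have hsub : Metric.ball y₀ ρ ⊆ chartDomain φ W := fun p hp =>
    (hρ' (p, p) (ball_prod_eq hp hp)).2.2.2.1
  -- the velocity is bounded by the difference of the end points
  have hv : ∀ p ∈ Metric.ball y₀ ρ, ∀ q ∈ Metric.ball y₀ ρ, ∀ r ∈ Icc (0 : ℝ) 1,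
      ‖D ((p, q), r)‖ ≤ (C + 1) * ‖q - p‖ := by
    intro p hp q hq r hr
    have hconv : Convex ℝ (Metric.ball (y₀, y₀) ρ ×ˢ Icc (0 : ℝ) 1) :=
      (convex_ball _ _).prod (convex_Icc 0 1)
    have hsubS : Metric.ball (y₀, y₀) ρ ×ˢ Icc (0 : ℝ) 1 ⊆ S := fun z hz =>
      ⟨(hρ' z.1 hz.1).2.2.2, hz.2⟩
    have hmv := hconv.norm_image_sub_le_of_norm_hasFDerivWithin_le (f := D)
      (f' := fderivWithin ℝ D S) (C := C + 1)
      (fun z hz => (((hH.contDiffWithinAt_deriv (hsubS hz).1 hz.2 hφ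
        ((hρ' z.1 hz.1).1 z.2 hz.2)).differentiableWithinAt (by simp)).hasFDerivWithinAt).mono
          hsubS)
      (fun z hz => (hρ' z.1 hz.1).2.2.1 z.2 hz.2)
      (x := ((p, p), r)) (y := ((p, q), r)) ⟨ball_prod_eq hp hp, hr⟩ ⟨ball_prod_eq hp hq, hr⟩
    have h0 : D ((p, p), r) = 0 := by
      have h1 : HasDerivAt (φ ∘ H (p, p)) (D ((p, p), r)) r :=
        (differentiableAt_chart_comp hφ ((hH.curve (p, p) ⟨hsub hp, hsub hp⟩ r hr).mdifferentiableAt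
          (by simp)) ((hρ' _ (ball_prod_eq hp hp)).1 r hr)).hasDerivAt
      have h2 : HasDerivWithinAt (φ ∘ H (p, p)) 0 (Icc 0 1) r :=
        (hasDerivWithinAt_const r (Icc 0 1) (φ (φ.symm p))).congr
          (fun s hs => congrArg φ (hconst p (hsub hp) s hs))
          (congrArg φ (hconst p (hsub hp) r hr))
      exact (uniqueDiffOn_Icc one_pos r hr).eq_deriv _ h1.hasDerivWithinAt h2
    rw [h0, sub_zero] at hmv
    refine hmv.trans_eq ?_
    simp [Prod.norm_def]
  set C₂ := K * (2 * B * (C + 1) ^ 2) with hC₂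
  have hC₂0 : 0 ≤ C₂ := by positivity
  refine ⟨ρ, hρ, max (C + 1) C₂, le_max_of_le_right hC₂0, hsub, fun p hp q hq r hr => ?_⟩
  have hz := hρ' (p, q) (ball_prod_eq hp hq)
  set c := φ ∘ H (p, q) with hc
  have hcd : ∀ s ∈ Icc (0 : ℝ) 1, ContDiffAt ℝ ∞ c s := fun s hs =>
    contDiffAt_chart_comp hφ (hH.curve (p, q) hz.2.2.2 s hs) (hz.1 s hs)
  have hseg := hΓ.segment (hsub hp).2 (hsub hq).2
  have hacc : ∀ s ∈ Icc (0 : ℝ) 1, ‖deriv (deriv c) s‖ ≤ C₂ * ‖q - p‖ ^ 2 := by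
    intro s hs
    have h1 := norm_acceleration_le ((hcd s hs).differentiableAt (by simp))
      ((contDiffAt_deriv (hcd s hs)).differentiableAt (by simp)).hasDerivAt
      ((contDiffAt_inChart (g := g) hφ (φ.map_source (hz.1 s hs))).differentiableAt (by simp))
      (fun w => (hseg.geodesic.self_of_nhdsSet s hs) _ hφ (hz.1 s hs) w)
      (hz.2.1 s hs).2.2 hK0 (hz.2.1 s hs).2.1
    refine h1.trans ?_
    have h2 : ‖deriv c s‖ ≤ (C + 1) * ‖q - p‖ := hv p hp q hq s hs
    calc K * (2 * B * ‖deriv c s‖ ^ 2) ≤ K * (2 * B * ((C + 1) * ‖q - p‖) ^ 2) := by gcongr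
      _ = _ := by rw [hC₂]; ring
  have hvar : ∀ s ∈ Icc (0 : ℝ) 1, ‖deriv c s - deriv c r‖ ≤ C₂ * ‖q - p‖ ^ 2 := by
    intro s hs
    have := (convex_Icc (0 : ℝ) 1).norm_image_sub_le_of_norm_hasDerivWithin_le (f := deriv c)
      (fun x hx => (((contDiffAt_deriv (hcd x hx)).differentiableAt
        (by simp)).hasDerivAt).hasDerivWithinAt) hacc hr hs
    refine this.trans (mul_le_of_le_one_right (by positivity) ?_)
    rw [Real.norm_eq_abs, abs_le]
    constructor <;> linarith [hr.1, hr.2, hs.1, hs.2]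
  have hfin : ‖(q - p) - deriv c r‖ ≤ C₂ * ‖q - p‖ ^ 2 := by
    have h1 := (convex_Icc (0 : ℝ) 1).norm_image_sub_le_of_norm_hasDerivWithin_le
      (f := fun s => c s - s • deriv c r) (f' := fun s => deriv c s - deriv c r)
      (fun x hx => by
        have h2 := ((hcd x hx).differentiableAt (by simp)).hasDerivAt
        have h3 := (hasDerivAt_id x).smul_const (deriv c r)
        exact ((h2.sub h3).congr_deriv (by rw [one_smul])).hasDerivWithinAt) hvar
      (left_mem_Icc.2 zero_le_one) (right_mem_Icc.2 zero_le_one)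
    have h2 : c 0 = p := by
      simp only [hc, Function.comp_apply, hHdef]
      rw [hseg.source]; exact φ.right_inv (hsub hp).1
    have h3 : c 1 = q := by
      simp only [hc, Function.comp_apply, hHdef]
      rw [hseg.target]; exact φ.right_inv (hsub hq).1
    simp only [h2, h3, one_smul, zero_smul, sub_zero, norm_one, mul_one] at h1
    rwa [sub_right_comm] at h1
  refine ⟨hz.1 r hr, (hz.2.1 r hr).1, (hcd r hr).differentiableAt (by simp),
    (hv p hp q hq r hr).trans ?_, ?_⟩
  · gcongr; exact le_max_left _ _
  · rw [norm_sub_rev]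
    refine hfin.trans ?_
    gcongr; exact le_max_right _ _

end LocalGeodesics

end

/-! ### Chronology of a convex neighborhood -/

section

section Chronology

variable {M : Type*} [TopologicalSpace M] [ChartedSpace E4 M] [IsManifold (𝓡 4) ∞ M]
  {g : LorentzMetric M} {T : TimeOrientation g} {W : Set M} {Γ : M → M → ℝ → M}
  {p q : M} {I : Set ℝ} {α : ℝ → M}

/-- A smooth curve in `W`, defined on an open interval, with timelike future-pointing tangent
vectors. -/
structure IsTimelikeCurve (T : TimeOrientation g) (W : Set M) (I : Set ℝ) (α : ℝ → M) : Prop where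
  isOpen : IsOpen I
  ordConnected : I.OrdConnected
  smooth : ContMDiffOn 𝓘(ℝ, ℝ) (𝓡 4) ∞ α I
  mem : MapsTo α I W
  timelike : ∀ t ∈ I, g.inner (α t) (velocity α t) (velocity α t) < 0
  future : ∀ t ∈ I, T.IsFuture (α t) (velocity α t)

theorem IsGeodesicFamily.continuousOn_inner_field (hΓ : IsGeodesicFamily g W Γ) (hp : p ∈ W)
    (hq : q ∈ W) (T : TimeOrientation g) :
    ContinuousOn (fun r => g.inner (Γ p q r) (T.field (Γ p q r)) (velocity (Γ p q) r))
      (Icc 0 1) := by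
  intro r hr
  have hH := hΓ.isSmoothFamily (X := ℝ) (O := univ) (A := fun _ => p) (B := fun _ => q)
    isOpen_univ contMDiffOn_const contMDiffOn_const (fun _ _ => hp) (fun _ _ => hq)
  exact (hH.continuousWithinAt_inner_field (x := 0) trivial hr T).comp (s := Icc (0 : ℝ) 1)
    (f := fun r : ℝ => ((0 : ℝ), r)) (Continuous.continuousWithinAt (by fun_prop))
    fun s hs => ⟨trivial, hs⟩

/-- A timelike geodesic segment does not change its time orientation. -/
theorem IsGeodesicFamily.isFuture_of_isFuture (hΓ : IsGeodesicFamily g W Γ) (hp : p ∈ W)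
    (hq : q ∈ W) (h : worldFunction g Γ p q < 0) (h0 : T.IsFuture _ (velocity (Γ p q) 0)) {r : ℝ}
    (hr : r ∈ Icc (0 : ℝ) 1) : T.IsFuture _ (velocity (Γ p q) r) := by
  have hc := hΓ.continuousOn_inner_field hp hq T
  by_contra hle
  obtain ⟨s, hs, h2⟩ := isPreconnected_Icc.intermediate_value₂ (left_mem_Icc.2 zero_le_one) hr hc
    continuousOn_const (le_of_lt h0) (not_lt.1 hle)
  have h3 := hΓ.energy_eq_worldFunction hp hq hs
  refine (g.isLorentzForm _).ne_zero_of_causal (T.timelike _) (h3.trans_lt h).le ?_ h2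
  intro h4
  rw [h4, map_zero] at h3
  exact h.ne h3.symm

/-- The event `q` lies in the chronological future of `p`, within the convex neighborhood. -/
def Precedes (T : TimeOrientation g) (Γ : M → M → ℝ → M) (p q : M) : Prop :=
  worldFunction g Γ p q < 0 ∧ T.IsFuture _ (velocity (Γ p q) 0)

/-- The world function changes monotonically as the final point moves to the future. -/
theorem IsGeodesicFamily.deriv_worldFunction_right_neg (hΓ : IsGeodesicFamily g W Γ)
    (hα : IsTimelikeCurve T W I α) (hp : p ∈ W) {t : ℝ} (ht : t ∈ I) (h : Precedes T Γ p (α t)) :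
    deriv (fun t => worldFunction g Γ p (α t)) t < 0 := by
  obtain ⟨u, hu, hd⟩ := hΓ.hasDerivAt_worldFunction_right hα.isOpen hp hα.smooth hα.mem ht
    (fun x v => g.inner x v v < 0 ∧ T.IsFuture x v) ⟨hα.timelike t ht, hα.future t ht⟩
  rw [hd.deriv]
  have h1 : (1 : ℝ) ∈ Icc (0 : ℝ) 1 := by simp
  have := (g.isLorentzForm _).neg_of_future (T.timelike _)
    ((hΓ.energy_eq_worldFunction hp (hα.mem ht) h1).trans_lt h.1) hu.1.le
    (hΓ.isFuture_of_isFuture hp (hα.mem ht) h.1 h.2 h1) hu.2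
  linarith

theorem IsGeodesicFamily.deriv_worldFunction_left_pos (hΓ : IsGeodesicFamily g W Γ)
    (hα : IsTimelikeCurve T W I α) (hq : q ∈ W) {t : ℝ} (ht : t ∈ I) (h : Precedes T Γ (α t) q) :
    0 < deriv (fun t => worldFunction g Γ (α t) q) t := by
  obtain ⟨u, hu, hd⟩ := hΓ.hasDerivAt_worldFunction_left hα.isOpen hq hα.smooth hα.mem ht
    (fun x v => g.inner x v v < 0 ∧ T.IsFuture x v) ⟨hα.timelike t ht, hα.future t ht⟩
  rw [hd.deriv]
  have := (g.isLorentzForm _).neg_of_future (T.timelike _) h.1 hu.1.le h.2 hu.2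
  linarith

theorem IsGeodesicFamily.eventually_precedes (hΓ : IsGeodesicFamily g W Γ) (hW : IsOpen W)
    (hα : IsTimelikeCurve T W I α) {s : ℝ} (hs : s ∈ I) :
    ∀ᶠ t in 𝓝[>] s, Precedes T Γ (α s) (α t) := by
  set φ := chartAt E4 (α s)
  have hφ : φ ∈ atlas E4 M := chart_mem_atlas E4 (α s)
  have hsrc : α s ∈ φ.source := mem_chart_source E4 (α s)
  set y₀ := φ (α s) with hy₀
  have hinv : φ.symm y₀ = α s := φ.left_inv hsrc
  have hy : y₀ ∈ chartDomain φ W := ⟨φ.map_source hsrc, by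
    rw [mem_preimage, hinv]; exact hα.mem hs⟩
  obtain ⟨ρ, hρ, C, hC, -, hest⟩ := hΓ.exists_estimate hW hφ hy univ_mem
  have hmd : MDifferentiableAt 𝓘(ℝ, ℝ) (𝓡 4) α s :=
    (hα.smooth.contMDiffAt (hα.isOpen.mem_nhds hs)).mdifferentiableAt (by simp)
  have hd : HasDerivAt (φ ∘ α) (deriv (φ ∘ α) s) s :=
    (differentiableAt_chart_comp hφ hmd hsrc).hasDerivAt
  set β := deriv (φ ∘ α) s with hβ
  have hcomp := components_velocity hφ hmd hsrc
  -- the initial velocity of the segment to `α t`, divided by `t - s`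
  set k : ℝ → E4 := fun t => (t - s)⁻¹ • deriv (φ ∘ Γ (α s) (α t)) 0 with hk
  have hslope : Tendsto (fun t => (t - s)⁻¹ • (φ (α t) - y₀)) (𝓝[>] s) (𝓝 β) :=
    (hasDerivAt_iff_tendsto_slope.1 hd).mono_left (nhdsWithin_mono _ fun t ht => ne_of_gt ht)
  have hnear : ∀ᶠ t in 𝓝[>] s, α t ∈ φ.source ∧ φ (α t) ∈ Metric.ball y₀ ρ := by
    refine nhdsWithin_le_nhds ?_
    exact (hmd.continuousAt.eventually (φ.open_source.mem_nhds hsrc)).and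
      (hd.continuousAt.eventually (Metric.ball_mem_nhds _ hρ))
  have hest' : ∀ᶠ t in 𝓝[>] s, DifferentiableAt ℝ (φ ∘ Γ (α s) (α t)) 0 ∧
      ‖k t - (t - s)⁻¹ • (φ (α t) - y₀)‖ ≤ C * ‖(t - s)⁻¹ • (φ (α t) - y₀)‖ * ‖φ (α t) - y₀‖ := by
    filter_upwards [hnear, self_mem_nhdsWithin] with t ht hts
    have hts' : 0 < t - s := sub_pos.2 hts
    obtain ⟨-, -, h1, -, h2⟩ := hest y₀ (Metric.mem_ball_self hρ) _ ht.2 0 (by simp)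
    rw [hinv, φ.left_inv ht.1] at h1 h2
    refine ⟨h1, ?_⟩
    rw [hk, ← smul_sub, norm_smul, norm_smul, norm_inv, Real.norm_eq_abs, abs_of_pos hts']
    calc _ ≤ (t - s)⁻¹ * (C * ‖φ (α t) - y₀‖ ^ 2) := by gcongr
      _ = _ := by ring
  have hk0 : Tendsto k (𝓝[>] s) (𝓝 β) := by
    have h1 : Tendsto (fun t => φ (α t) - y₀) (𝓝[>] s) (𝓝 0) := by
      have := (hd.continuousAt.tendsto.mono_left (nhdsWithin_le_nhds (s := Ioi s))).sub_const y₀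
      simpa [hy₀] using this
    have h2 : Tendsto (fun t => C * ‖(t - s)⁻¹ • (φ (α t) - y₀)‖ * ‖φ (α t) - y₀‖) (𝓝[>] s)
        (𝓝 0) := by
      simpa using (hslope.norm.const_mul C).mul h1.norm
    have h3 := squeeze_zero_norm' (hest'.mono fun t ht => ht.2) h2
    simpa using h3.add hslope
  have hG1 : Tendsto (fun t => g.inChart φ y₀ (k t) (k t)) (𝓝[>] s) (𝓝 (g.inChart φ y₀ β β)) :=
    ((((g.inChart φ y₀).continuous.clm_apply continuous_id).tendsto β).comp hk0)
  have hG2 : Tendsto (fun t => g.inChart φ y₀ (components φ (α s) (T.field (α s))) (k t)) (𝓝[>] s)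
      (𝓝 (g.inChart φ y₀ (components φ (α s) (T.field (α s))) β)) :=
    (((g.inChart φ y₀ _).continuous.tendsto β).comp hk0)
  have hβ1 : g.inChart φ y₀ β β < 0 := by
    have := hα.timelike s hs
    rwa [inner_eq_inChart hφ hsrc, hcomp] at this
  have hβ2 : g.inChart φ y₀ (components φ (α s) (T.field (α s))) β < 0 := by
    have := hα.future s hs
    unfold TimeOrientation.IsFuture at this
    rwa [inner_eq_inChart hφ hsrc, hcomp] at this
  filter_upwards [hG1.eventually_lt_const hβ1, hG2.eventually_lt_const hβ2, hest',
    self_mem_nhdsWithin, nhdsWithin_le_nhds (hα.isOpen.mem_nhds hs)] with t h1 h2 h3 hts ht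
  have hts' : 0 < (t - s)⁻¹ := inv_pos.2 (sub_pos.2 hts)
  have hseg := hΓ.segment (hα.mem hs) (hα.mem ht)
  have hsrc0 : Γ (α s) (α t) 0 ∈ φ.source := by rw [hseg.source]; exact hsrc
  have hvel := components_velocity hφ ((hseg.smooth 0 (by simp)).mdifferentiableAt (by simp)) hsrc0
  simp only [hk, map_smul, _root_.smul_apply, smul_eq_mul] at h1 h2
  unfold Precedes worldFunction TimeOrientation.IsFuture
  rw [inner_eq_inChart hφ hsrc0, inner_eq_inChart hφ hsrc0, hvel]
  have e0 : φ (Γ (α s) (α t) 0) = y₀ := by rw [hseg.source]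
  have e1 : components φ (Γ (α s) (α t) 0) (T.field (Γ (α s) (α t) 0)) =
      components φ (α s) (T.field (α s)) := by rw [hseg.source]
  rw [e0, e1]
  exact ⟨neg_of_mul_neg_right (neg_of_mul_neg_right h1 hts'.le) hts'.le,
    neg_of_mul_neg_right h2 hts'.le⟩

/-- Along a timelike curve, earlier events precede later events. -/
theorem IsGeodesicFamily.precedes (hΓ : IsGeodesicFamily g W Γ) (hW : IsOpen W)
    (hα : IsTimelikeCurve T W I α) {s t : ℝ} (hs : s ∈ I) (ht : t ∈ I) (hst : s < t) :
    Precedes T Γ (α s) (α t) := by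
  have hp := hα.mem hs
  set σ : ℝ → ℝ := fun t => worldFunction g Γ (α s) (α t) with hσ
  have hH := hΓ.isSmoothFamily (O := I) (A := fun _ => α s) (B := α) hα.isOpen contMDiffOn_const
    hα.smooth (fun _ _ => hp) hα.mem
  have hσd : ContDiffOn ℝ ∞ σ I := hΓ.contDiffOn_worldFunction (O := I) (A := fun _ => α s) (B := α)
    hα.isOpen contMDiffOn_const hα.smooth (fun _ _ => hp) hα.mem
  set f : ℝ → ℝ := fun t => g.inner (Γ (α s) (α t) 0) (T.field (Γ (α s) (α t) 0))
    (velocity (Γ (α s) (α t)) 0) with hf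
  have hfc : ContinuousOn f I := fun t ht =>
    (hH.continuousWithinAt_inner_field (x := t) (r := 0) ht (by simp) T).comp (s := I)
      (f := fun t : ℝ => (t, (0 : ℝ))) (Continuous.continuousWithinAt (by fun_prop))
      fun s hs => ⟨hs, by simp⟩
  obtain ⟨s', hs's, hs'⟩ : ∃ s' ∈ Ioc s t, ∀ x ∈ Ioc s s', Precedes T Γ (α s) (α x) := by
    obtain ⟨b, hb, hb'⟩ := (mem_nhdsGT_iff_exists_Ioo_subset' hst).1
      (hΓ.eventually_precedes hW hα hs)
    refine ⟨min ((s + b) / 2) t, ⟨lt_min (by linarith [mem_Ioi.1 hb]) hst, min_le_right _ _⟩,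
      fun x hx => hb' ⟨hx.1, ?_⟩⟩
    have := hx.2.trans (min_le_left _ _)
    linarith [mem_Ioi.1 hb]
  have hsub : Icc s' t ⊆ I := fun x hx => hα.ordConnected.out hs ht ⟨hs's.1.le.trans hx.1, hx.2⟩
  by_contra hnot
  -- the first time at which the property fails
  set Z := {x ∈ Icc s' t | ¬ (σ x < 0 ∧ f x < 0)} with hZ
  have hZc : IsClosed Z := by
    have h1 : Z = (Icc s' t ∩ σ ⁻¹' Ici 0) ∪ (Icc s' t ∩ f ⁻¹' Ici 0) := by
      ext x
      simp only [hZ, mem_ofPred_eq, mem_union, mem_inter_iff, mem_preimage, mem_Ici, not_and_or,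
        not_lt]
      tauto
    rw [h1]
    exact ((hσd.continuousOn.mono hsub).preimage_isClosed_of_isClosed isClosed_Icc isClosed_Ici).union
      ((hfc.mono hsub).preimage_isClosed_of_isClosed isClosed_Icc isClosed_Ici)
  have hZne : Z.Nonempty := ⟨t, ⟨hs's.2, le_rfl⟩, hnot⟩
  have hZb : BddBelow Z := ⟨s', fun x hx => hx.1.1⟩
  set x := sInf Z with hx
  have hxZ : x ∈ Z := hZc.csInf_mem hZne hZb
  have hgood : ∀ y ∈ Ico s' x, Precedes T Γ (α s) (α y) := by
    intro y hy
    by_contra h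
    exact hy.2.not_ge (csInf_le hZb ⟨⟨hy.1, hy.2.le.trans hxZ.1.2⟩, h⟩)
  have hlt : s' < x := hxZ.1.1.lt_of_ne fun h => hxZ.2 (h ▸ hs' s' ⟨hs's.1, le_rfl⟩)
  have hsubx : Icc s' x ⊆ I := (Icc_subset_Icc_right hxZ.1.2).trans hsub
  have hanti : AntitoneOn σ (Icc s' x) := by
    refine antitoneOn_of_deriv_nonpos (convex_Icc _ _) (hσd.continuousOn.mono hsubx) ?_ ?_
    · intro y hy
      exact ((hσd.contDiffAt (hα.isOpen.mem_nhds
        (hsubx (interior_subset hy)))).differentiableAt (by simp)).differentiableWithinAt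
    · intro y hy
      rw [interior_Icc] at hy
      exact (hΓ.deriv_worldFunction_right_neg hα hp (hsubx ⟨hy.1.le, hy.2.le⟩)
        (hgood y ⟨hy.1.le, hy.2⟩)).le
  have hσx : σ x < 0 :=
    (hanti (left_mem_Icc.2 hlt.le) (right_mem_Icc.2 hlt.le) hlt.le).trans_lt
      (hs' s' ⟨hs's.1, le_rfl⟩).1
  have hxI : x ∈ I := hsubx (right_mem_Icc.2 hlt.le)
  refine hxZ.2 ⟨hσx, lt_of_le_of_ne ?_ ?_⟩
  · have h1 : Tendsto f (𝓝[<] x) (𝓝 (f x)) :=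
      (hfc.continuousAt (hα.isOpen.mem_nhds hxI)).tendsto.mono_left nhdsWithin_le_nhds
    refine le_of_tendsto h1 ?_
    filter_upwards [Ioo_mem_nhdsLT hlt] with y hy using (hgood y ⟨hy.1.le, hy.2⟩).2.le
  · refine (g.isLorentzForm _).ne_zero_of_causal (T.timelike _) (le_of_lt hσx) fun h4 => ?_
    have h5 : σ x = 0 := by simp only [hσ, worldFunction]; rw [h4, map_zero]
    exact hσx.ne h5

theorem IsGeodesicFamily.worldFunction_self (hΓ : IsGeodesicFamily g W Γ) (hp : p ∈ W) :
    worldFunction g Γ p p = 0 := by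
  -- the segment is constant on `[0,1]`, hence has vanishing velocity at an inner point
  have hr : (1 / 2 : ℝ) ∈ Icc (0 : ℝ) 1 := by constructor <;> norm_num
  rw [← hΓ.energy_eq_worldFunction hp hp hr]
  have h1 : Γ p p =ᶠ[𝓝 (1 / 2)] fun _ => p := by
    filter_upwards [Icc_mem_nhds (a := (0 : ℝ)) (b := 1) (x := 1 / 2) (by norm_num) (by norm_num)]
      with s hs using hΓ.const hp hs
  rw [(velocity_congr h1 fun x v => v = 0).2 (velocity_const p _), map_zero]

theorem IsGeodesicFamily.strictAntiOn_worldFunction (hΓ : IsGeodesicFamily g W Γ) (hW : IsOpen W)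
    (hα : IsTimelikeCurve T W I α) {s : ℝ} (hs : s ∈ I) :
    StrictAntiOn (fun t => worldFunction g Γ (α s) (α t)) (I ∩ Ici s) := by
  have hp := hα.mem hs
  have hσd : ContDiffOn ℝ ∞ (fun t => worldFunction g Γ (α s) (α t)) I :=
    hΓ.contDiffOn_worldFunction (O := I) (A := fun _ => α s) (B := α)
      hα.isOpen contMDiffOn_const hα.smooth (fun _ _ => hp) hα.mem
  refine strictAntiOn_of_deriv_neg (hα.ordConnected.inter ordConnected_Ici).convex
    (hσd.continuousOn.mono inter_subset_left) fun t ht => ?_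
  rw [interior_inter, hα.isOpen.interior_eq, interior_Ici] at ht
  exact hΓ.deriv_worldFunction_right_neg hα hp ht.1 (hΓ.precedes hW hα hs ht.1 ht.2)

theorem IsGeodesicFamily.strictMonoOn_worldFunction (hΓ : IsGeodesicFamily g W Γ) (hW : IsOpen W)
    (hα : IsTimelikeCurve T W I α) {t : ℝ} (ht : t ∈ I) :
    StrictMonoOn (fun s => worldFunction g Γ (α s) (α t)) (I ∩ Iic t) := by
  have hq := hα.mem ht
  have hσd : ContDiffOn ℝ ∞ (fun s => worldFunction g Γ (α s) (α t)) I :=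
    hΓ.contDiffOn_worldFunction (O := I) (B := fun _ => α t) (A := α)
      hα.isOpen hα.smooth contMDiffOn_const hα.mem (fun _ _ => hq)
  refine strictMonoOn_of_deriv_pos (hα.ordConnected.inter ordConnected_Iic).convex
    (hσd.continuousOn.mono inter_subset_left) fun s hs => ?_
  rw [interior_inter, hα.isOpen.interior_eq, interior_Iic] at hs
  exact hΓ.deriv_worldFunction_left_pos hα hq hs.1 (hΓ.precedes hW hα hs.1 ht hs.2)

theorem IsGeodesicFamily.continuousAt_worldFunction_right (hΓ : IsGeodesicFamily g W Γ)
    (hW : IsOpen W) (hp : p ∈ W) (hq : q ∈ W) : ContinuousAt (fun q => worldFunction g Γ p q) q := by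
  have hφ := chart_mem_atlas E4 q
  have hs := mem_chart_source E4 q
  set φ := chartAt E4 q
  have hy : φ q ∈ chartDomain φ W := ⟨φ.map_source hs, by
    rw [mem_preimage, φ.left_inv hs]; exact hq⟩
  have h1 := (hΓ.contDiffOn_worldFunction (O := chartDomain φ W) (A := fun _ => p) (B := φ.symm)
    (isOpen_chartDomain hW) contMDiffOn_const
    (fun y hy => (contMDiffAt_chart_symm hφ hy.1).contMDiffWithinAt) (fun _ _ => hp)
    (fun y hy => hy.2)).continuousOn.continuousAt ((isOpen_chartDomain hW).mem_nhds hy)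
  refine (h1.comp (φ.continuousAt hs)).congr ?_
  filter_upwards [φ.open_source.mem_nhds hs] with x hx
  simp only [Function.comp_apply]; rw [φ.left_inv hx]

theorem IsGeodesicFamily.continuousAt_worldFunction_left (hΓ : IsGeodesicFamily g W Γ)
    (hW : IsOpen W) (hp : p ∈ W) (hq : q ∈ W) : ContinuousAt (fun p => worldFunction g Γ p q) p := by
  have hφ := chart_mem_atlas E4 p
  have hs := mem_chart_source E4 p
  set φ := chartAt E4 p
  have hy : φ p ∈ chartDomain φ W := ⟨φ.map_source hs, by
    rw [mem_preimage, φ.left_inv hs]; exact hp⟩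
  have h1 := (hΓ.contDiffOn_worldFunction (O := chartDomain φ W) (B := fun _ => q) (A := φ.symm)
    (isOpen_chartDomain hW)
    (fun y hy => (contMDiffAt_chart_symm hφ hy.1).contMDiffWithinAt) contMDiffOn_const
    (fun y hy => hy.2) (fun _ _ => hq)).continuousOn.continuousAt
      ((isOpen_chartDomain hW).mem_nhds hy)
  refine (h1.comp (φ.continuousAt hs)).congr ?_
  filter_upwards [φ.open_source.mem_nhds hs] with x hx
  simp only [Function.comp_apply]; rw [φ.left_inv hx]

/-- A timelike curve in a convex neighborhood is an embedding: the world function bounds it away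
from the event `α t` at all times that are not close to `t`. -/
theorem IsGeodesicFamily.isEmbedding (hΓ : IsGeodesicFamily g W Γ) (hW : IsOpen W)
    (hα : IsTimelikeCurve T W I α) : Topology.IsEmbedding (I.domRestrict α) := by
  have hinj : Function.Injective (I.domRestrict α) := by
    have key : ∀ s t : I, (s : ℝ) < t → α s ≠ α t := by
      intro s t hlt h
      have h1 := (hΓ.precedes hW hα s.2 t.2 hlt).1
      rw [h, hΓ.worldFunction_self (hα.mem t.2)] at h1
      exact lt_irrefl _ h1
    intro s t h
    rcases lt_trichotomy (s : ℝ) t with h1 | h1 | h1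
    · exact absurd h (key s t h1)
    · exact Subtype.ext h1
    · exact absurd h.symm (key t s h1)
  refine ⟨Topology.isInducing_iff_nhds.2 fun t => le_antisymm ?_ ?_, hinj⟩
  · exact map_le_iff_le_comap.1 (hα.smooth.continuousOn.domRestrict.tendsto t)
  · intro N hN
    obtain ⟨N', hN', hNN'⟩ := mem_nhds_subtype I t N |>.1 hN
    obtain ⟨ε, hε, hball⟩ := Metric.mem_nhds_iff.1 (inter_mem hN' (hα.isOpen.mem_nhds t.2))
    rw [Real.ball_eq_Ioo] at hball
    obtain ⟨t, ht⟩ := t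
    simp only at hball hN' ⊢
    have hs1 : t - ε / 2 ∈ I := (hball ⟨by linarith, by linarith⟩).2
    have hs2 : t + ε / 2 ∈ I := (hball ⟨by linarith, by linarith⟩).2
    have hp := hα.mem ht
    have h1 := (hΓ.continuousAt_worldFunction_right hW hp hp).eventually_const_lt
      (u := worldFunction g Γ (α t) (α (t + ε / 2))) (by
        simp only [hΓ.worldFunction_self hp]; exact (hΓ.precedes hW hα ht hs2 (by linarith)).1)
    have h2 := (hΓ.continuousAt_worldFunction_left hW hp hp).eventually_const_lt
      (u := worldFunction g Γ (α (t - ε / 2)) (α t)) (by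
        simp only [hΓ.worldFunction_self hp]; exact (hΓ.precedes hW hα hs1 ht (by linarith)).1)
    refine mem_comap.2 ⟨_, h1.and h2, ?_⟩
    rintro ⟨x, hx⟩ ⟨hx1, hx2⟩
    simp only [Set.domRestrict_apply] at hx1 hx2
    have hup : x < t + ε / 2 := by
      by_contra! hle
      exact hx1.not_ge ((hΓ.strictAntiOn_worldFunction hW hα ht).antitoneOn
        ⟨hs2, by simp; linarith⟩ ⟨hx, by simp; linarith⟩ hle)
    have hlo : t - ε / 2 < x := by
      by_contra! hle
      exact hx2.not_ge ((hΓ.strictMonoOn_worldFunction hW hα ht).monotoneOn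
        ⟨hx, by simp; linarith⟩ ⟨hs1, by simp; linarith⟩ hle)
    exact hNN' (hball ⟨by linarith, by linarith⟩).1

end Chronology

end

/-! ### The clocks of an observer field -/

section

section ObserverField

variable {M : Type*} [TopologicalSpace M] [ChartedSpace E4 M] [IsManifold (𝓡 4) ∞ M]
  {g : LorentzMetric M} {T : TimeOrientation g} {W U : Set M}
  {V : (x : M) → TangentSpace (𝓡 4) x} {I J : Set ℝ} {α β γ : ℝ → M} {s t : ℝ}

/-- A curve in `U`, defined on an open interval, that is an integral curve of `V`. -/
structure IsFlowLine (U : Set M) (V : (x : M) → TangentSpace (𝓡 4) x) (I : Set ℝ) (γ : ℝ → M) :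
    Prop where
  isOpen : IsOpen I
  ordConnected : I.OrdConnected
  mem : MapsTo γ I U
  integral : IsMIntegralCurveOn γ V I

theorem IsFlowLine.hasMFDerivAt (h : IsFlowLine U V I γ) (ht : t ∈ I) :
    HasMFDerivAt 𝓘(ℝ, ℝ) (𝓡 4) γ t ((1 : ℝ →L[ℝ] ℝ).smulRight (V (γ t))) :=
  (h.integral.isMIntegralCurveAt (h.isOpen.mem_nhds ht)).hasMFDerivAt

theorem IsFlowLine.velocity_eq (h : IsFlowLine U V I γ) (ht : t ∈ I) :
    velocity γ t = V (γ t) := by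
  have h1 := (h.hasMFDerivAt ht).mfderiv
  rw [velocity, h1]
  exact one_smul ℝ (V (γ t))

theorem IsFlowLine.hasDerivAt_chart (h : IsFlowLine U V I γ) {φ : OpenPartialHomeomorph M E4}
    (hφ : φ ∈ atlas E4 M) (ht : t ∈ I) (hs : γ t ∈ φ.source) :
    HasDerivAt (φ ∘ γ) (components φ (γ t) (V (γ t))) t := by
  have hmd := (h.hasMFDerivAt ht).mdifferentiableAt
  rw [← h.velocity_eq ht, components_velocity hφ hmd hs]
  exact (differentiableAt_chart_comp hφ hmd hs).hasDerivAt

theorem IsFlowLine.contMDiffOn (hV : IsObserverField T U V) (hU : IsOpen U)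
    (h : IsFlowLine U V I γ) : ContMDiffOn 𝓘(ℝ, ℝ) (𝓡 4) ∞ γ I := by
  intro t ht
  have hφ := chart_mem_atlas E4 (γ t)
  set φ := chartAt E4 (γ t)
  have hs : γ t ∈ φ.source := mem_chart_source E4 (γ t)
  set J := I ∩ γ ⁻¹' (φ.source) with hJ
  have hJo : IsOpen J := h.integral.continuousOn.isOpen_inter_preimage h.isOpen φ.open_source
  have hd : ∀ x ∈ J, HasDerivAt (φ ∘ γ) (components φ (γ x) (V (γ x))) x := fun x hx =>
    h.hasDerivAt_chart hφ hx.1 hx.2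
  have hdiff : DifferentiableOn ℝ (φ ∘ γ) J := fun x hx =>
    (hd x hx).differentiableAt.differentiableWithinAt
  have hn : ∀ n : ℕ, ContDiffOn ℝ n (φ ∘ γ) J := by
    intro n
    induction n with
    | zero => exact contDiffOn_zero.2 hdiff.continuousOn
    | succ n ih =>
      have h1 := (contDiffOn_succ_iff_deriv_of_isOpen (n := n) (f := φ ∘ γ) hJo).2
      refine (by norm_cast : ((n + 1 : ℕ) : WithTop ℕ∞) = (n : WithTop ℕ∞) + 1) ▸
        h1 ⟨hdiff, fun h => absurd h (by simp), ?_⟩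
      have h2 : ContDiffOn ℝ n (fun x => (fun y => components φ (φ.symm y) (V (φ.symm y)))
          ((φ ∘ γ) x)) J := by
        intro x hx
        have h3 := contDiffAt_components hφ (by norm_cast; exact le_top : (n : WithTop ℕ∞) ≤ ∞) hx.2
          ((hV.smooth.contMDiffAt (hU.mem_nhds (h.mem hx.1))).of_le
            (by norm_cast; exact le_top : (n : WithTop ℕ∞) ≤ ∞))
        exact h3.comp_contDiffWithinAt x (ih x hx)
      refine h2.congr fun x hx => ?_
      rw [(hd x hx).deriv]
      exact (congrArg (fun z => (components φ z (V z) : E4)) (φ.left_inv hx.2)).symm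
  have h1 : ContMDiffAt 𝓘(ℝ, ℝ) (𝓡 4) ∞ (φ.symm ∘ (φ ∘ γ)) t :=
    (contMDiffAt_chart_symm hφ (φ.map_source hs)).comp t
      (((contDiffOn_infty.2 hn).contDiffAt (hJo.mem_nhds ⟨ht, hs⟩)).contMDiffAt)
  refine (h1.congr_of_eventuallyEq ?_).contMDiffWithinAt
  filter_upwards [hJo.mem_nhds ⟨ht, hs⟩] with x hx using (φ.left_inv hx.2).symm

theorem IsFlowLine.isTimelikeCurve (hV : IsObserverField T U V) (hU : IsOpen U) (hUW : U ⊆ W)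
    (h : IsFlowLine U V I γ) : IsTimelikeCurve T W I γ where
  isOpen := h.isOpen
  ordConnected := h.ordConnected
  smooth := h.contMDiffOn hV hU
  mem := fun t ht => hUW (h.mem ht)
  timelike := fun t ht => by rw [h.velocity_eq ht]; exact hV.timelike _ (h.mem ht)
  future := fun t ht => by rw [h.velocity_eq ht]; exact hV.future _ (h.mem ht)

theorem IsFlowLine.mono (h : IsFlowLine U V I γ) (hJ : IsOpen J) (hJc : J.OrdConnected)
    (hJI : J ⊆ I) : IsFlowLine U V J γ :=
  ⟨hJ, hJc, h.mem.mono_left hJI, h.integral.mono hJI⟩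

theorem IsFlowLine.comp_add (h : IsFlowLine U V I γ) (d : ℝ) :
    IsFlowLine U V {t | t + d ∈ I} (γ ∘ (· + d)) where
  isOpen := h.isOpen.preimage (by fun_prop)
  ordConnected := ⟨fun x hx y hy z hz => h.ordConnected.out hx hy
    ⟨by linarith [hz.1], by linarith [hz.2]⟩⟩
  mem := fun t ht => h.mem ht
  integral := h.integral.comp_add d

/-- Integral curves of an observer field with a common value coincide. -/
theorem IsFlowLine.eqOn [T2Space M] (hV : IsObserverField T U V) (hU : IsOpen U)
    (hα : IsFlowLine U V I α) (hβ : IsFlowLine U V I β) (ht : t ∈ I) (h : α t = β t) :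
    EqOn α β I := by
  have : IsManifold (𝓡 4) 1 M := isManifold_one
  set u := {x ∈ I | α x = β x} with hu
  suffices I ⊆ u from fun x hx => (this hx).2
  refine hα.ordConnected.isPreconnected.subset_of_closure_inter_subset ?_ ⟨t, ht, ht, h⟩ ?_
  · rw [isOpen_iff_mem_nhds]
    rintro x ⟨hx, hxe⟩
    have hn := hα.isOpen.mem_nhds hx
    have := isMIntegralCurveAt_eventuallyEq_of_contMDiffAt_boundaryless
      ((hV.smooth.contMDiffAt (hU.mem_nhds (hα.mem hx))).of_le (by norm_num))
      (hα.integral.isMIntegralCurveAt hn) (hβ.integral.isMIntegralCurveAt hn) hxe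
    filter_upwards [hn, this] with y h1 h2 using ⟨h1, h2⟩
  · rintro x ⟨hxc, hx⟩
    refine ⟨hx, ?_⟩
    have hc1 := (hα.integral.continuousWithinAt hx).mono (sep_subset I fun x => α x = β x)
    have hc2 := (hβ.integral.continuousWithinAt hx).mono (sep_subset I fun x => α x = β x)
    have : (𝓝[u] x).NeBot := mem_closure_iff_nhdsWithin_neBot.1 hxc
    exact tendsto_nhds_unique_of_eventuallyEq hc1 hc2
      (eventually_nhdsWithin_of_forall fun y hy => hy.2)

/-- Every integral curve of an observer field extends to a maximal one, and this is a clock. -/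
theorem exists_clock [T2Space M] (hV : IsObserverField T U V) (hU : IsOpen U) (hUW : U ⊆ W)
    (hW : IsConvexNhd g W) (hγ : IsFlowLine U V I γ) (ht : t ∈ I) :
    ∃ A : Clock T, A.IsClockOf U V ∧
      ∀ J α, IsFlowLine U V J α → t ∈ J → α t = γ t → J ⊆ A.dom ∧ EqOn A.toFun α J := by
  have hM : IsManifold (𝓡 4) 1 M := isManifold_one
  -- integral curves with the prescribed value at `t`; by uniqueness they agree where they overlap,
  -- so they can be glued to a curve on the union `D` of their domains
  let good : Set ℝ → (ℝ → M) → Prop := fun J α => IsFlowLine U V J α ∧ t ∈ J ∧ α t = γ t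
  set D : Set ℝ := ⋃₀ {J | ∃ α, good J α} with hD
  have hDo : IsOpen D := isOpen_sUnion (by rintro J ⟨α, hα⟩; exact hα.1.isOpen)
  have hDc : D.OrdConnected := (isPreconnected_sUnion t _ (by rintro J ⟨α, hα⟩; exact hα.2.1)
    (by rintro J ⟨α, hα⟩; exact hα.1.ordConnected.isPreconnected)).ordConnected
  have hex : ∀ x, ∃ (J : Set ℝ) (α : ℝ → M), x ∈ D → good J α ∧ x ∈ J := by
    intro x
    by_cases hx : x ∈ D
    · obtain ⟨J, ⟨α, hα⟩, hxJ⟩ := hx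
      exact ⟨J, α, fun _ => ⟨hα, hxJ⟩⟩
    · exact ⟨∅, γ, fun h => absurd h hx⟩
  choose J α hJα using hex
  set δ : ℝ → M := fun x => α x x with hδ
  have heq : ∀ J' α', good J' α' → EqOn δ α' J' := by
    intro J' α' h x hx
    obtain ⟨h1, hxJ⟩ := hJα x ⟨J', ⟨α', h⟩, hx⟩
    have ho := h1.1.isOpen.inter h.1.isOpen
    have hc := h1.1.ordConnected.inter h.1.ordConnected
    exact (h1.1.mono ho hc inter_subset_left).eqOn hV hU (h.1.mono ho hc inter_subset_right)
      ⟨h1.2.1, h.2.1⟩ (h1.2.2.trans h.2.2.symm) ⟨hxJ, hx⟩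
  have hline : IsFlowLine U V D δ := by
    refine ⟨hDo, hDc, fun x hx => ?_, (isMIntegralCurveOn_iff_isMIntegralCurveAt hDo).2 fun x hx => ?_⟩
    · obtain ⟨h1, hxJ⟩ := hJα x hx
      exact h1.1.mem hxJ
    · obtain ⟨h1, hxJ⟩ := hJα x hx
      have hn := h1.1.isOpen.mem_nhds hxJ
      have he : EqOn δ (α x) (J x) := heq _ _ h1
      refine isMIntegralCurveAt_iff.2 ⟨J x, hn, fun y hy => ?_⟩
      have h2 := (h1.1.integral y hy).congr_of_eventuallyEq
        (eventually_nhdsWithin_of_forall fun z hz => he hz) (he hy)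
      have h3 : ∀ z : M, z = α x y → (∀ L : ℝ →L[ℝ] E4,
          L = ((1 : ℝ →L[ℝ] ℝ).smulRight (V (α x y) : E4)) →
          L = ((1 : ℝ →L[ℝ] ℝ).smulRight (V z : E4))) := by
        rintro z rfl L hL; exact hL
      have h4 := h3 (δ y) (he hy) _ rfl
      rw [← show ((1 : ℝ →L[ℝ] ℝ).smulRight (V (α x y) : E4)) =
        ((1 : ℝ →L[ℝ] ℝ).smulRight (V (δ y) : E4)) from h4]
      exact h2
  obtain ⟨hWo, Γ, hΓ⟩ := hW
  have htl := hline.isTimelikeCurve hV hU hUW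
  let A : Clock T :=
    { dom := D
      toFun := δ
      isOpen_dom := hDo
      ordConnected_dom := hDc
      nonempty_dom := ⟨t, I, ⟨γ, hγ, ht, rfl⟩, ht⟩
      smooth := htl.smooth
      isEmbedding := IsGeodesicFamily.isEmbedding (Γ := Γ) hΓ hWo htl
      timelike := htl.timelike
      future := htl.future }
  refine ⟨A, ⟨⟨image_subset_iff.2 hline.mem, hline.integral⟩, fun B hB hAB hEq => ?_⟩,
    fun J' α' h1 h2 h3 => ⟨fun x hx => ⟨J', ⟨α', h1, h2, h3⟩, hx⟩, heq J' α' ⟨h1, h2, h3⟩⟩⟩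
  have htD : t ∈ D := ⟨I, ⟨γ, hγ, ht, rfl⟩, ht⟩
  refine Subset.antisymm (fun x hx => ⟨B.dom, ⟨B.toFun, ⟨B.isOpen_dom, B.ordConnected_dom,
    fun y hy => hB.1 (B.mem_trajectory hy), hB.2⟩, hAB htD, ?_⟩, hx⟩) hAB
  exact (hEq htD).symm.trans (heq I γ ⟨hγ, ht, rfl⟩ ht)

theorem Clock.IsIntegralCurveIn.isFlowLine {A : Clock T} (h : A.IsIntegralCurveIn U V) :
    IsFlowLine U V A.dom A.toFun :=
  ⟨A.isOpen_dom, A.ordConnected_dom, fun _ hx => h.1 (A.mem_trajectory hx), h.2⟩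

/-- If two clocks of an observer field meet, the trajectory of one contains that of the other; by
symmetry the trajectories coincide. -/
theorem trajectory_subset_of_meet [T2Space M] (hV : IsObserverField T U V) (hU : IsOpen U)
    (hUW : U ⊆ W) (hW : IsConvexNhd g W) {A B : Clock T} (hA : A.IsClockOf U V)
    (hB : B.IsClockOf U V) (h : ¬ Disjoint A.trajectory B.trajectory) :
    B.trajectory ⊆ A.trajectory := by
  obtain ⟨_, ⟨s, hs, rfl⟩, ⟨t, ht, hst⟩⟩ := not_disjoint_iff.1 h
  obtain ⟨C, hC, hmax⟩ := exists_clock hV hU hUW hW hA.1.isFlowLine hs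
  obtain ⟨h1, h2⟩ := hmax _ _ hA.1.isFlowLine hs rfl
  have h3 : C.dom = A.dom := hA.2 C hC.1 h1 h2.symm
  -- the readings of `B` are shifted to agree with those of `A` at the common event
  obtain ⟨h4, h5⟩ := hmax _ _ (hB.1.isFlowLine.comp_add (t - s))
    (by simpa using ht) (by simpa using hst)
  rintro _ ⟨x, hx, rfl⟩
  have hx' : x - (t - s) ∈ {y | y + (t - s) ∈ B.dom} := by simpa using hx
  refine ⟨x - (t - s), h3 ▸ h4 hx', ?_⟩
  rw [← h2 (h3 ▸ h4 hx'), h5 hx']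
  simp

/-- Clocks through events that are not chronologically related are disjoint. -/
theorem disjoint_of_spacelike [T2Space M] (hV : IsObserverField T U V) (hU : IsOpen U)
    (hUW : U ⊆ W) (hW : IsConvexNhd g W) {Γ : M → M → ℝ → M} (hΓ : IsGeodesicFamily g W Γ)
    {A B : Clock T} (hA : A.IsClockOf U V) (hB : B.IsClockOf U V) (hs : s ∈ A.dom) (ht : t ∈ B.dom)
    (h1 : 0 < worldFunction g Γ (A.toFun s) (B.toFun t))
    (h2 : 0 < worldFunction g Γ (B.toFun t) (A.toFun s)) :
    Disjoint A.trajectory B.trajectory := by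
  by_contra h
  obtain ⟨x, hx, hxt⟩ := trajectory_subset_of_meet hV hU hUW hW hA hB h (B.mem_trajectory ht)
  have hα := hA.1.isFlowLine.isTimelikeCurve hV hU hUW
  rw [← hxt] at h1 h2
  rcases lt_trichotomy s x with h3 | h3 | h3
  · exact h1.not_gt (hΓ.precedes hW.1 hα hs hx h3).1
  · rw [h3, hΓ.worldFunction_self (hα.mem hx)] at h1; exact lt_irrefl _ h1
  · exact h2.not_gt (hΓ.precedes hW.1 hα hx hs h3).1

end ObserverField

end

/-! ### First-order expansions -/

section

section Jets

variable {E F : Type*} [NormedAddCommGroup E] [NormedSpace ℝ E] [NormedAddCommGroup F]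
  [NormedSpace ℝ F] {f f' : ℝ → E} {a a' b b' : E}

/-- The function `f`, of a small positive parameter `ε`, is `a + ε b + o(ε)`. -/
def HasJet (f : ℝ → E) (a b : E) : Prop :=
  Tendsto (fun ε : ℝ => ε⁻¹ • (f ε - a)) (𝓝[>] 0) (𝓝 b)

theorem eventually_pos : ∀ᶠ ε : ℝ in 𝓝[>] 0, 0 < ε := self_mem_nhdsWithin

theorem tendsto_id_zero : Tendsto (fun ε : ℝ => ε) (𝓝[>] 0) (𝓝 0) :=
  tendsto_id.mono_left nhdsWithin_le_nhds

namespace HasJet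

theorem congr (h : HasJet f a b) (hf : f' =ᶠ[𝓝[>] 0] f) : HasJet f' a b :=
  Tendsto.congr' (hf.mono fun ε h => by simp only [h]) h

theorem tendsto (h : HasJet f a b) : Tendsto f (𝓝[>] 0) (𝓝 a) := by
  have h1 : Tendsto (fun ε : ℝ => ε • (ε⁻¹ • (f ε - a)) + a) (𝓝[>] 0) (𝓝 ((0 : ℝ) • b + a)) :=
    (tendsto_id_zero.smul h).add_const a
  rw [zero_smul, zero_add] at h1
  refine h1.congr' (eventually_pos.mono fun ε hε => ?_)
  rw [smul_inv_smul₀ hε.ne', sub_add_cancel]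

theorem unique (h : HasJet f a b) (h' : HasJet f a b') : b = b' := tendsto_nhds_unique h h'

theorem const : HasJet (fun _ => a) a 0 := by simp [HasJet]

theorem sub (h : HasJet f a b) (h' : HasJet f' a' b') :
    HasJet (fun ε => f ε - f' ε) (a - a') (b - b') := by
  refine (Tendsto.sub h h').congr fun ε => ?_
  rw [← smul_sub, sub_sub_sub_comm]

/-- An affine function of the parameter. -/
theorem affine (a b : E) : HasJet (fun ε => a + ε • b) a b := by
  refine tendsto_const_nhds.congr' (eventually_pos.mono fun ε hε => ?_)
  simp only [add_sub_cancel_left, inv_smul_smul₀ hε.ne']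

end HasJet

end Jets

/-! ### Short pieces of integral curves -/

section Flow

variable {E : Type*} [NormedAddCommGroup E] [NormedSpace ℝ E] {v : E → E} {y₀ y : E} {A : E →L[ℝ] E}

/-- Integral curves exist for a common time near a point, and stay near that point. -/
theorem exists_local_flow [CompleteSpace E] (hv : ContDiffAt ℝ 1 v y₀) {N : Set E} (hN : N ∈ 𝓝 y₀) :
    ∃ ρ > 0, ∃ τ > 0, ∀ y ∈ Metric.ball y₀ ρ, ∃ x : ℝ → E, x 0 = y ∧
      ∀ t ∈ Ioo (-τ) τ, x t ∈ N ∧ HasDerivAt x (v (x t)) t := by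
  obtain ⟨e, he, a, r, L, K, hr, h⟩ := IsPicardLindelof.of_contDiffAt_one hv
  obtain ⟨x, hx, hc⟩ := (h 0).exists_forall_mem_closedBall_eq_hasDerivWithinAt_continuousOn
  simp only [zero_sub, zero_add] at hx hc
  have hmem : Metric.closedBall y₀ (r : ℝ) ×ˢ Icc (-e) e ∈ 𝓝 (y₀, (0 : ℝ)) :=
    prod_mem_nhds (Metric.closedBall_mem_nhds _ hr) (Icc_mem_nhds (by linarith) he)
  have h0 : x (y₀, 0) = y₀ := (hx y₀ (Metric.mem_closedBall_self r.2)).1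
  have h1 : ∀ᶠ z in 𝓝 (y₀, (0 : ℝ)), x z ∈ N :=
    (hc.continuousAt hmem).eventually (by rw [h0]; exact hN)
  obtain ⟨δ, hδ, hδ'⟩ := Metric.eventually_nhds_iff_ball.1 h1
  refine ⟨min δ r, lt_min hδ hr, min δ e, lt_min hδ he, fun y hy => ⟨fun t => x (y, t), ?_,
    fun t ht => ⟨hδ' _ ?_, ?_⟩⟩⟩
  · exact (hx y (Metric.ball_subset_closedBall (Metric.ball_subset_ball (min_le_right _ _) hy))).1
  · refine ball_prod_eq (Metric.ball_subset_ball (min_le_left _ _) hy) ?_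
    rw [Real.ball_eq_Ioo]
    have := min_le_left δ e
    exact ⟨by linarith [ht.1], by linarith [ht.2]⟩
  · have h2 := min_le_right δ e
    have h3 : -e < t := by linarith [ht.1]
    have h4 : t < e := by linarith [ht.2]
    exact ((hx y (Metric.ball_subset_closedBall (Metric.ball_subset_ball (min_le_right _ _) hy))).2
      t ⟨h3.le, h4.le⟩).hasDerivAt (Icc_mem_nhds h3 h4)

/-- Integral curves `x ε` that start at `y₀ + ε y`, seen in the magnification by `ε⁻¹`, are
parabolas up to terms of higher order, uniformly on bounded time intervals. -/
theorem exists_flow_expansion {x : ℝ → ℝ → E} {τ L : ℝ} (hτ : 0 < τ) (hA : HasFDerivAt v A y₀)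
    (h0 : ∀ᶠ ε in 𝓝[>] 0, x ε 0 = y₀ + ε • y)
    (hx : ∀ᶠ ε in 𝓝[>] 0, ∀ t ∈ Ioo (-τ) τ, ‖v (x ε t)‖ ≤ L ∧ HasDerivAt (x ε) (v (x ε t)) t)
    {R : ℝ} (hR : 0 < R) {η : ℝ} (hη : 0 < η) :
    ∀ᶠ ε in 𝓝[>] 0, ∀ t ∈ Icc (-R) R,
      ‖ε⁻¹ • (x ε (ε * t) - y₀) - (y + t • v y₀ + ε • (t • A y + (1 / 2 * t ^ 2) • A (v y₀)))‖
        ≤ η * ε := by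
  set B := ‖y‖ + |L| * R with hB
  have hB0 : 0 ≤ B := by positivity
  set c := η / (4 * R * (B + 1)) with hc
  have hcp : 0 < c := by positivity
  set B' := (‖A‖ + c) * B * R with hB'
  have hB'0 : 0 ≤ B' := by positivity
  obtain ⟨δ, hδ, hlin⟩ := Metric.eventually_nhds_iff_ball.1 (hA.isLittleO.def hcp)
  have e1 : ∀ᶠ ε : ℝ in 𝓝[>] 0, ε * (R + 1) < τ ∧ ε * (B + 1) < δ ∧ ε * (‖A‖ * B' + 1) * R * 2 < η := by
    have hcont : ∀ C : ℝ, Tendsto (fun ε : ℝ => ε * C) (𝓝[>] 0) (𝓝 0) := fun C => by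
      simpa using tendsto_id_zero.mul_const C
    refine ((hcont _).eventually_lt_const hτ).and (((hcont _).eventually_lt_const hδ).and ?_)
    filter_upwards [(hcont ((‖A‖ * B' + 1) * R * 2)).eventually_lt_const hη] with ε h
    linarith
  filter_upwards [h0, hx, e1, eventually_pos] with ε h0 hx e1 hε
  set Y : ℝ → E := fun t => ε⁻¹ • (x ε (ε * t) - y₀) with hY
  have hin : ∀ t ∈ Icc (-R) R, ε * t ∈ Ioo (-τ) τ := fun t ht =>
    ⟨by nlinarith [ht.1], by nlinarith [ht.2]⟩
  have hYd : ∀ t ∈ Icc (-R) R, HasDerivAt Y (v (x ε (ε * t))) t := by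
    intro t ht
    have h1 := (hx _ (hin t ht)).2.scomp t ((hasDerivAt_id t).const_mul ε)
    have h2 := (h1.sub_const y₀).const_smul ε⁻¹
    refine h2.congr_deriv ?_
    rw [mul_one, inv_smul_smul₀ hε.ne']
  have hY0 : Y 0 = y := by
    simp only [hY, mul_zero, h0, add_sub_cancel_left, inv_smul_smul₀ hε.ne']
  have hxY : ∀ t, x ε (ε * t) = y₀ + ε • Y t := fun t => by
    simp only [hY, smul_inv_smul₀ hε.ne', add_sub_cancel]
  have h0R : (0 : ℝ) ∈ Icc (-R) R := ⟨by linarith, hR.le⟩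
  have habs : ∀ t ∈ Icc (-R) R, ‖t - 0‖ ≤ R := fun t ht => by
    rw [sub_zero, Real.norm_eq_abs]; exact abs_le.2 ht
  -- a bound of the displacement
  have hYB : ∀ t ∈ Icc (-R) R, ‖Y t‖ ≤ B := by
    intro t ht
    have h1 := (convex_Icc (-R) R).norm_image_sub_le_of_norm_hasDerivWithin_le (C := |L|)
      (fun s hs => (hYd s hs).hasDerivWithinAt)
      (fun s hs => (hx _ (hin s hs)).1.trans (le_abs_self L)) h0R ht
    rw [hY0] at h1
    calc ‖Y t‖ = ‖y + (Y t - y)‖ := by rw [add_sub_cancel]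
      _ ≤ ‖y‖ + |L| * R := (norm_add_le _ _).trans (by
        gcongr; exact h1.trans (by gcongr; exact habs t ht))
  have hvlin : ∀ t ∈ Icc (-R) R, ‖v (x ε (ε * t)) - v y₀ - ε • A (Y t)‖ ≤ c * (ε * B) := by
    intro t ht
    have h1 : ‖ε • Y t‖ ≤ ε * B := by
      rw [norm_smul, Real.norm_eq_abs, abs_of_pos hε]; gcongr; exact hYB t ht
    have h2 := hlin (y₀ + ε • Y t) (by
      rw [Metric.mem_ball, dist_eq_norm, add_sub_cancel_left]
      nlinarith [e1.2.1])
    rw [add_sub_cancel_left, map_smul] at h2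
    rw [hxY]
    exact h2.trans (by gcongr)
  -- the linear approximation
  have hY1 : ∀ t ∈ Icc (-R) R, ‖Y t - (y + t • v y₀)‖ ≤ ε * B' := by
    intro t ht
    have h1 := (convex_Icc (-R) R).norm_image_sub_le_of_norm_hasDerivWithin_le
      (f := fun t => Y t - t • v y₀) (C := (‖A‖ + c) * (ε * B))
      (fun s hs => ((hYd s hs).sub ((hasDerivAt_id s).smul_const (v y₀))).hasDerivWithinAt)
      (fun s hs => by
        have h2 : v (x ε (ε * s)) - (1 : ℝ) • v y₀ =
            (v (x ε (ε * s)) - v y₀ - ε • A (Y s)) + ε • A (Y s) := by rw [one_smul]; abel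
        rw [h2, add_mul, add_comm (‖A‖ * _)]
        refine (norm_add_le _ _).trans (add_le_add (hvlin s hs) ?_)
        rw [norm_smul, Real.norm_eq_abs, abs_of_pos hε]
        calc ε * ‖A (Y s)‖ ≤ ε * (‖A‖ * B) := by
              gcongr; exact (A.le_opNorm _).trans (by gcongr; exact hYB s hs)
          _ = _ := by ring) h0R ht
    simp only [hY0, zero_smul, sub_zero] at h1
    have h3 : Y t - (y + t • v y₀) = Y t - t • v y₀ - y := by abel
    rw [h3]
    refine h1.trans ?_
    have := habs t ht
    rw [sub_zero] at this
    calc (‖A‖ + c) * (ε * B) * ‖t‖ ≤ (‖A‖ + c) * (ε * B) * R := by gcongr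
      _ = _ := by rw [hB']; ring
  intro t ht
  have h1 := (convex_Icc (-R) R).norm_image_sub_le_of_norm_hasDerivWithin_le
    (f := fun t => Y t - (t • v y₀ + ε • (t • A y + (1 / 2 * t ^ 2) • A (v y₀))))
    (f' := fun t => v (x ε (ε * t)) - (v y₀ + ε • (A y + t • A (v y₀))))
    (C := c * (ε * B) + ε * (‖A‖ * (ε * B')))
    (fun s hs => by
      have h2 := ((((hasDerivAt_id s).smul_const (A y)).add
        ((((hasDerivAt_id s).pow 2).const_mul (1 / 2 : ℝ)).smul_const (A (v y₀)))).const_smul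
          ε)
      refine (((hYd s hs).sub (((hasDerivAt_id s).smul_const (v y₀)).add h2)).congr_deriv
        ?_).hasDerivWithinAt
      simp only [one_smul, id, Nat.cast_ofNat, mul_one]
      norm_num
      rw [show (1 / 2 * (2 * s) : ℝ) = s by ring])
    (fun s hs => by
      have h2 : v (x ε (ε * s)) - (v y₀ + ε • (A y + s • A (v y₀))) =
          (v (x ε (ε * s)) - v y₀ - ε • A (Y s)) + ε • A (Y s - (y + s • v y₀)) := by
        simp only [map_sub, map_add, map_smul, smul_sub, smul_add]; abel
      rw [h2]
      refine (norm_add_le _ _).trans (add_le_add (hvlin s hs) ?_)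
      rw [norm_smul, Real.norm_eq_abs, abs_of_pos hε]
      gcongr
      exact (A.le_opNorm _).trans (by gcongr; exact hY1 s hs)) h0R ht
  simp only [hY0, zero_smul, sub_zero, add_zero, smul_zero, ne_eq, OfNat.ofNat_ne_zero,
    not_false_eq_true, zero_pow, mul_zero] at h1
  have h3 : Y t - (y + t • v y₀ + ε • (t • A y + (1 / 2 * t ^ 2) • A (v y₀))) =
    Y t - (t • v y₀ + ε • (t • A y + (1 / 2 * t ^ 2) • A (v y₀))) - y := by abel
  rw [h3]
  refine h1.trans ?_
  have ht' := habs t ht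
  rw [sub_zero] at ht'
  have h4 : c * B * R ≤ η / 4 := by
    rw [hc, div_mul_eq_mul_div, div_mul_eq_mul_div, div_le_div_iff₀ (by positivity) (by norm_num)]
    nlinarith [mul_pos hη hR]
  calc _ ≤ (c * (ε * B) + ε * (‖A‖ * (ε * B'))) * R := by gcongr
    _ = ε * (c * B * R) + ε * (ε * (‖A‖ * B') * R) := by ring
    _ ≤ ε * (η / 4) + ε * (η / 2) := by
      gcongr
      have : 0 < ε * R := mul_pos hε hR
      nlinarith [e1.2.2]
    _ ≤ η * ε := by nlinarith

/-- The expansion of the position on the integral curve at the time `ε s ε`. -/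
theorem hasJet_flow {x : ℝ → ℝ → E} {τ L : ℝ} (hτ : 0 < τ) (hA : HasFDerivAt v A y₀)
    (h0 : ∀ᶠ ε in 𝓝[>] 0, x ε 0 = y₀ + ε • y)
    (hx : ∀ᶠ ε in 𝓝[>] 0, ∀ t ∈ Ioo (-τ) τ, ‖v (x ε t)‖ ≤ L ∧ HasDerivAt (x ε) (v (x ε t)) t)
    {s : ℝ → ℝ} {s₀ s₁ : ℝ} (hs : HasJet s s₀ s₁) :
    HasJet (fun ε => ε⁻¹ • (x ε (ε * s ε) - y₀)) (y + s₀ • v y₀)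
      (s₁ • v y₀ + s₀ • A y + (1 / 2 * s₀ ^ 2) • A (v y₀)) := by
  have hst := hs.tendsto
  set P : ℝ → ℝ → E := fun ε t => y + t • v y₀ + ε • (t • A y + (1 / 2 * t ^ 2) • A (v y₀))
  have h1 : Tendsto (fun ε => ε⁻¹ • (ε⁻¹ • (x ε (ε * s ε) - y₀) - P ε (s ε))) (𝓝[>] 0) (𝓝 0) := by
    rw [Metric.tendsto_nhds]
    intro η hη
    have hR : ∀ᶠ ε in 𝓝[>] 0, s ε ∈ Icc (-(|s₀| + 1)) (|s₀| + 1) :=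
      hst.eventually (Icc_mem_nhds (by linarith [neg_abs_le s₀]) (by linarith [le_abs_self s₀]))
    filter_upwards [exists_flow_expansion hτ hA h0 hx (R := |s₀| + 1) (by positivity)
      (half_pos hη), hR, eventually_pos] with ε h1 h2 hε
    rw [dist_zero_right, norm_smul, norm_inv, Real.norm_eq_abs, abs_of_pos hε, inv_mul_lt_iff₀ hε]
    exact (h1 _ h2).trans_lt (by nlinarith)
  have h2 : HasJet (fun ε => P ε (s ε)) (y + s₀ • v y₀)
      (s₁ • v y₀ + (s₀ • A y + (1 / 2 * s₀ ^ 2) • A (v y₀))) := by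
    have h3 : Tendsto (fun ε => (ε⁻¹ • (s ε - s₀)) • v y₀ +
        (s ε • A y + (1 / 2 * s ε ^ 2) • A (v y₀))) (𝓝[>] 0)
        (𝓝 (s₁ • v y₀ + (s₀ • A y + (1 / 2 * s₀ ^ 2) • A (v y₀)))) :=
      (Tendsto.smul_const hs _).add ((hst.smul_const _).add
        (((hst.pow 2).const_mul _).smul_const _))
    refine h3.congr' (eventually_pos.mono fun ε hε => ?_)
    have h4 : P ε (s ε) - (y + s₀ • v y₀) =
        (s ε - s₀) • v y₀ + ε • (s ε • A y + (1 / 2 * s ε ^ 2) • A (v y₀)) := by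
      simp only [P, sub_smul]; abel
    simp only [h4, smul_add, inv_smul_smul₀ hε.ne', smul_eq_mul, mul_smul]
  have h5 := Tendsto.add h1 h2
  rw [zero_add, ← add_assoc] at h5
  refine h5.congr fun ε => ?_
  rw [← smul_add, sub_add_sub_cancel]

end Flow

end

/-! ### Expansion of the world function -/

section

open Asymptotics

section WorldFunction

variable {M : Type*} [TopologicalSpace M] [ChartedSpace E4 M] [IsManifold (𝓡 4) ∞ M]
  {g : LorentzMetric M} {W : Set M} {φ : OpenPartialHomeomorph M E4} {Γ : M → M → ℝ → M}
  {y₀ x₁ x₁' x₂ x₂' : E4} {u u' : ℝ → E4}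

/-- The geodesic segment, in the chart `φ`, between the events at the positions `y₀ + ε u` and
`y₀ + ε u'`. -/
noncomputable def shortSegment (φ : OpenPartialHomeomorph M E4) (Γ : M → M → ℝ → M) (y₀ : E4)
    (u u' : ℝ → E4) (ε : ℝ) : ℝ → E4 :=
  φ ∘ Γ (φ.symm (y₀ + ε • u ε)) (φ.symm (y₀ + ε • u' ε))

/-- The world function between the events at the positions `y₀ + ε u` and `y₀ + ε u'`. -/
noncomputable def shortWorldFunction (g : LorentzMetric M) (φ : OpenPartialHomeomorph M E4)
    (Γ : M → M → ℝ → M) (y₀ : E4) (u u' : ℝ → E4) (ε : ℝ) : ℝ :=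
  worldFunction g Γ (φ.symm (y₀ + ε • u ε)) (φ.symm (y₀ + ε • u' ε))

theorem tendsto_base (hu : Tendsto u (𝓝[>] 0) (𝓝 x₁)) (y₀ : E4) :
    Tendsto (fun ε => y₀ + ε • u ε) (𝓝[>] 0) (𝓝 y₀) := by
  simpa using (tendsto_id_zero.smul hu).const_add y₀

theorem IsGeodesicFamily.eventually_short (hΓ : IsGeodesicFamily g W Γ) (hW : IsOpen W)
    (hφ : φ ∈ atlas E4 M) (hy : y₀ ∈ chartDomain φ W) (hu : Tendsto u (𝓝[>] 0) (𝓝 x₁))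
    (hu' : Tendsto u' (𝓝[>] 0) (𝓝 x₁')) :
    ∃ K, ∀ᶠ ε in 𝓝[>] 0,
      (y₀ + ε • u ε ∈ chartDomain φ W ∧ y₀ + ε • u' ε ∈ chartDomain φ W) ∧
      ∀ r ∈ Icc (0 : ℝ) 1,
        Γ (φ.symm (y₀ + ε • u ε)) (φ.symm (y₀ + ε • u' ε)) r ∈ φ.source ∧
        DifferentiableAt ℝ (shortSegment φ Γ y₀ u u' ε) r ∧
        ‖ε⁻¹ • deriv (shortSegment φ Γ y₀ u u' ε) r - (u' ε - u ε)‖ ≤ K * ε ∧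
        ‖ε⁻¹ • (shortSegment φ Γ y₀ u u' ε r - y₀) - (u ε + r • (u' ε - u ε))‖ ≤ K * ε := by
  obtain ⟨ρ, hρ, C, hC, hsub, hest⟩ := hΓ.exists_estimate hW hφ hy univ_mem
  set b := ‖x₁' - x₁‖ + 1
  have h1 : ∀ᶠ ε in 𝓝[>] 0, ‖u' ε - u ε‖ < b :=
    (hu'.sub hu).norm.eventually_lt_const (lt_add_one _)
  refine ⟨C * b ^ 2, ?_⟩
  filter_upwards [h1, (tendsto_base hu y₀).eventually (Metric.ball_mem_nhds y₀ hρ),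
    (tendsto_base hu' y₀).eventually (Metric.ball_mem_nhds y₀ hρ), eventually_pos]
    with ε h1 hp hq hε
  have hΔ : (y₀ + ε • u' ε) - (y₀ + ε • u ε) = ε • (u' ε - u ε) := by
    rw [add_sub_add_left_eq_sub, smul_sub]
  have hest' := fun r hr => hest _ hp _ hq r hr
  have hdb : ∀ r ∈ Icc (0 : ℝ) 1,
      ‖ε⁻¹ • deriv (shortSegment φ Γ y₀ u u' ε) r - (u' ε - u ε)‖ ≤ C * b ^ 2 * ε := by
    intro r hr
    obtain ⟨-, -, -, -, h2⟩ := hest' r hr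
    rw [hΔ] at h2
    have h3 : ε⁻¹ • deriv (shortSegment φ Γ y₀ u u' ε) r - (u' ε - u ε) =
        ε⁻¹ • (deriv (shortSegment φ Γ y₀ u u' ε) r - ε • (u' ε - u ε)) := by
      rw [smul_sub, inv_smul_smul₀ hε.ne']
    rw [h3, norm_smul, norm_inv, Real.norm_eq_abs, abs_of_pos hε, inv_mul_le_iff₀ hε]
    refine h2.trans ?_
    rw [norm_smul, Real.norm_eq_abs, abs_of_pos hε]
    calc C * (ε * ‖u' ε - u ε‖) ^ 2 ≤ C * (ε * b) ^ 2 := by gcongr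
      _ = _ := by ring
  refine ⟨⟨hsub hp, hsub hq⟩, fun r hr => ⟨(hest' r hr).1, (hest' r hr).2.2.1, hdb r hr, ?_⟩⟩
  have hmv := (convex_Icc (0 : ℝ) 1).norm_image_sub_le_of_norm_hasDerivWithin_le
    (f := fun s => ε⁻¹ • (shortSegment φ Γ y₀ u u' ε s - y₀) - s • (u' ε - u ε))
    (fun s hs => ((((hest' s hs).2.2.1.hasDerivAt.sub_const y₀).const_smul ε⁻¹).sub
      ((hasDerivAt_id s).smul_const (u' ε - u ε))).hasDerivWithinAt)
    (fun s hs => by rw [one_smul]; exact hdb s hs) (left_mem_Icc.2 zero_le_one) hr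
  have h0 : shortSegment φ Γ y₀ u u' ε 0 = y₀ + ε • u ε := by
    simp only [shortSegment, Function.comp_apply]
    rw [(hΓ.segment (hsub hp).2 (hsub hq).2).source]
    exact φ.right_inv (hsub hp).1
  simp only [h0, add_sub_cancel_left, inv_smul_smul₀ hε.ne', zero_smul, sub_zero] at hmv
  refine (le_of_eq ?_).trans (hmv.trans ?_)
  · congr 1; abel
  · rw [Real.norm_eq_abs, abs_of_nonneg hr.1]
    exact mul_le_of_le_one_right (by positivity) hr.2

/-- Convergence for `ε → 0`, uniformly in the parameter of the segments. -/
abbrev shortFilter : Filter (ℝ × ℝ) := 𝓝[>] 0 ×ˢ 𝓟 (Icc 0 1)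

theorem eventually_shortFilter {P : ℝ × ℝ → Prop} :
    (∀ᶠ z in shortFilter, P z) ↔ ∀ᶠ ε in 𝓝[>] (0 : ℝ), ∀ r ∈ Icc (0 : ℝ) 1, P (ε, r) :=
  eventually_prod_principal_iff

theorem tendsto_zero_of_norm_le {E : Type*} [NormedAddCommGroup E] {f : ℝ × ℝ → E} {K : ℝ}
    (h : ∀ᶠ z in shortFilter, ‖f z‖ ≤ K * z.1) : Tendsto f shortFilter (𝓝 0) := by
  refine squeeze_zero_norm' h ?_
  have : Tendsto (fun z : ℝ × ℝ => K * z.1) shortFilter (𝓝 (K * 0)) :=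
    (tendsto_id_zero.comp tendsto_fst).const_mul K
  rwa [mul_zero] at this

theorem IsGeodesicFamily.tendsto_short (hΓ : IsGeodesicFamily g W Γ) (hW : IsOpen W)
    (hφ : φ ∈ atlas E4 M) (hy : y₀ ∈ chartDomain φ W) (hu : Tendsto u (𝓝[>] 0) (𝓝 x₁))
    (hu' : Tendsto u' (𝓝[>] 0) (𝓝 x₁')) :
    Tendsto (fun z : ℝ × ℝ => z.1⁻¹ • deriv (shortSegment φ Γ y₀ u u' z.1) z.2) shortFilter
        (𝓝 (x₁' - x₁)) ∧
      Tendsto (fun z : ℝ × ℝ => z.1⁻¹ • (shortSegment φ Γ y₀ u u' z.1 z.2 - y₀) -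
        (x₁ + z.2 • (x₁' - x₁))) shortFilter (𝓝 0) ∧
      Tendsto (fun z : ℝ × ℝ => shortSegment φ Γ y₀ u u' z.1 z.2) shortFilter (𝓝 y₀) := by
  obtain ⟨K, hK⟩ := hΓ.eventually_short hW hφ hy hu hu'
  have hD : Tendsto (fun z : ℝ × ℝ => u' z.1 - u z.1) shortFilter (𝓝 (x₁' - x₁)) :=
    (hu'.sub hu).comp tendsto_fst
  have hrb : ∀ {f : ℝ × ℝ → E4}, Tendsto f shortFilter (𝓝 0) →
      Tendsto (fun z => z.2 • f z) shortFilter (𝓝 0) := by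
    intro f hf
    refine squeeze_zero_norm' (eventually_shortFilter.2 (Eventually.of_forall fun ε r hr => ?_))
      (tendsto_norm_zero.comp hf)
    rw [norm_smul, Real.norm_eq_abs, abs_of_nonneg hr.1]
    exact mul_le_of_le_one_left (norm_nonneg _) hr.2
  have h1 := tendsto_zero_of_norm_le (f := fun z : ℝ × ℝ =>
      z.1⁻¹ • deriv (shortSegment φ Γ y₀ u u' z.1) z.2 - (u' z.1 - u z.1))
    (eventually_shortFilter.2 (hK.mono fun ε h r hr => (h.2 r hr).2.2.1))
  have h2 := tendsto_zero_of_norm_le (f := fun z : ℝ × ℝ =>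
      z.1⁻¹ • (shortSegment φ Γ y₀ u u' z.1 z.2 - y₀) - (u z.1 + z.2 • (u' z.1 - u z.1)))
    (eventually_shortFilter.2 (hK.mono fun ε h r hr => (h.2 r hr).2.2.2))
  have h3 : Tendsto (fun z : ℝ × ℝ => z.1⁻¹ • (shortSegment φ Γ y₀ u u' z.1 z.2 - y₀) -
        (x₁ + z.2 • (x₁' - x₁))) shortFilter (𝓝 0) := by
    have h4 : Tendsto (fun z : ℝ × ℝ => u z.1 - x₁) shortFilter (𝓝 0) := by
      simpa using (hu.comp tendsto_fst).sub_const x₁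
    have h5 : Tendsto (fun z : ℝ × ℝ => (u' z.1 - u z.1) - (x₁' - x₁)) shortFilter (𝓝 0) := by
      simpa using hD.sub_const (x₁' - x₁)
    have h6 := (h2.add h4).add (hrb h5)
    simp only [add_zero] at h6
    refine h6.congr fun z => ?_
    rw [smul_sub z.2 (u' z.1 - u z.1)]; abel
  refine ⟨by simpa using h1.add hD, h3, ?_⟩
  have h7 : Tendsto (fun z : ℝ × ℝ => z.2 • (z.1 • (x₁' - x₁))) shortFilter (𝓝 0) := by
    refine hrb ?_
    have := (tendsto_id_zero.smul_const (x₁' - x₁)).comp (tendsto_fst (f := 𝓝[>] (0 : ℝ))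
      (g := 𝓟 (Icc (0 : ℝ) 1)))
    rwa [zero_smul] at this
  have h8 : Tendsto (fun z : ℝ × ℝ => z.1 • x₁) shortFilter (𝓝 0) := by
    have := (tendsto_id_zero.smul_const x₁).comp (tendsto_fst (f := 𝓝[>] (0 : ℝ))
      (g := 𝓟 (Icc (0 : ℝ) 1)))
    rwa [zero_smul] at this
  have h9 := ((((tendsto_id_zero.comp tendsto_fst).smul h3).add h8).add h7).const_add y₀
  simp only [smul_zero, add_zero] at h9
  refine h9.congr' (eventually_shortFilter.2 (eventually_pos.mono fun ε hε r hr => ?_))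
  simp only [Function.comp_apply, smul_sub, smul_inv_smul₀ (ne_of_gt hε), smul_add,
    smul_comm r ε]
  abel

theorem IsGeodesicFamily.eventually_energy (hΓ : IsGeodesicFamily g W Γ) (hW : IsOpen W)
    (hφ : φ ∈ atlas E4 M) (hy : y₀ ∈ chartDomain φ W) (hu : Tendsto u (𝓝[>] 0) (𝓝 x₁))
    (hu' : Tendsto u' (𝓝[>] 0) (𝓝 x₁')) :
    ∀ᶠ ε in 𝓝[>] 0, ∀ r ∈ Icc (0 : ℝ) 1, (ε ^ 2)⁻¹ * shortWorldFunction g φ Γ y₀ u u' ε =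
      g.inChart φ (shortSegment φ Γ y₀ u u' ε r) (ε⁻¹ • deriv (shortSegment φ Γ y₀ u u' ε) r)
        (ε⁻¹ • deriv (shortSegment φ Γ y₀ u u' ε) r) := by
  obtain ⟨K, hK⟩ := hΓ.eventually_short hW hφ hy hu hu'
  filter_upwards [hK, eventually_pos] with ε h hε r hr
  have hseg := hΓ.segment h.1.1.2 h.1.2.2
  rw [shortWorldFunction, ← hΓ.energy_eq_worldFunction h.1.1.2 h.1.2.2 hr,
    inner_velocity_velocity hφ ((hseg.smooth r hr).mdifferentiableAt (by simp)) (h.2 r hr).1]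
  simp only [map_smul, _root_.smul_apply, smul_eq_mul, shortSegment, Function.comp_apply]
  field_simp

theorem tendsto_zero_add {E ι : Type*} [NormedAddCommGroup E] {l : Filter ι} {a b : ι → E}
    (ha : Tendsto a l (𝓝 0)) (hb : Tendsto b l (𝓝 0)) : Tendsto (fun i => a i + b i) l (𝓝 0) := by
  simpa using ha.add hb

theorem tendsto_form_apply {E ι : Type*} [NormedAddCommGroup E] [NormedSpace ℝ E] {l : Filter ι}
    {B : ι → E →L[ℝ] E →L[ℝ] ℝ} {B₀ : E →L[ℝ] E →L[ℝ] ℝ} {a b : ι → E} {a₀ b₀ : E}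
    (hB : Tendsto B l (𝓝 B₀)) (ha : Tendsto a l (𝓝 a₀)) (hb : Tendsto b l (𝓝 b₀)) :
    Tendsto (fun i => B i (a i) (b i)) l (𝓝 (B₀ a₀ b₀)) :=
  have h : Continuous fun p : (E →L[ℝ] E →L[ℝ] ℝ) × E × E => p.1 p.2.1 p.2.2 :=
    (continuous_fst.clm_apply continuous_snd.fst).clm_apply continuous_snd.snd
  (h.tendsto (B₀, a₀, b₀)).comp (hB.prodMk_nhds (ha.prodMk_nhds hb))

theorem tendsto_form {G : E4 → E4 →L[ℝ] E4 →L[ℝ] ℝ} (hG : ContinuousAt G y₀) {ι : Type*}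
    {l : Filter ι} {c a b : ι → E4} {a₀ b₀ : E4} (hc : Tendsto c l (𝓝 y₀)) (ha : Tendsto a l (𝓝 a₀))
    (hb : Tendsto b l (𝓝 b₀)) :
    Tendsto (fun i => G (c i) (a i) (b i)) l (𝓝 (G y₀ a₀ b₀)) := by
  exact tendsto_form_apply (B := fun i => G (c i)) (hG.tendsto.comp hc) ha hb

theorem IsGeodesicFamily.tendsto_worldFunction (hΓ : IsGeodesicFamily g W Γ) (hW : IsOpen W)
    (hφ : φ ∈ atlas E4 M) (hy : y₀ ∈ chartDomain φ W) (hu : Tendsto u (𝓝[>] 0) (𝓝 x₁))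
    (hu' : Tendsto u' (𝓝[>] 0) (𝓝 x₁')) :
    Tendsto (fun ε => (ε ^ 2)⁻¹ * shortWorldFunction g φ Γ y₀ u u' ε) (𝓝[>] 0)
      (𝓝 (g.inChart φ y₀ (x₁' - x₁) (x₁' - x₁))) := by
  obtain ⟨h1, -, h3⟩ := hΓ.tendsto_short hW hφ hy hu hu'
  have h4 := tendsto_form (contDiffAt_inChart (g := g) hφ hy.1).continuousAt h3 h1 h1
  have h5 : Tendsto (fun ε : ℝ => (ε, (0 : ℝ))) (𝓝[>] 0) shortFilter :=
    tendsto_id.prodMk (tendsto_principal.2 (Eventually.of_forall fun ε => by simp))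
  refine (h4.comp h5).congr' ?_
  filter_upwards [hΓ.eventually_energy hW hφ hy hu hu'] with ε hε
  exact (hε 0 (by simp)).symm


theorem tendsto_difference_quotient {F : Type*} [NormedAddCommGroup F] [NormedSpace ℝ F]
    {G : E4 → F} {DG : E4 →L[ℝ] F} (hG : HasFDerivAt G DG y₀) {c : ℝ × ℝ → E4} {a b : E4}
    (hc : Tendsto c shortFilter (𝓝 y₀))
    (hpos : Tendsto (fun z : ℝ × ℝ => z.1⁻¹ • (c z - y₀) - (a + z.2 • b)) shortFilter (𝓝 0)) :
    Tendsto (fun z : ℝ × ℝ => z.1⁻¹ • (G (c z) - G y₀) - DG (a + z.2 • b)) shortFilter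
      (𝓝 0) := by
  have h1 : (fun z : ℝ × ℝ => c z - y₀) =O[shortFilter] fun z => z.1 := by
    have h2 : (fun z : ℝ × ℝ => z.1⁻¹ • (c z - y₀)) =O[shortFilter] fun _ => (1 : ℝ) := by
      have h3 : (fun z : ℝ × ℝ => a + z.2 • b) =O[shortFilter] fun _ => (1 : ℝ) := by
        refine IsBigO.of_bound (‖a‖ + ‖b‖) (eventually_shortFilter.2
          (Eventually.of_forall fun ε r hr => ?_))
        rw [norm_one, mul_one]
        refine (norm_add_le _ _).trans (add_le_add le_rfl ?_)
        rw [norm_smul, Real.norm_eq_abs, abs_of_nonneg hr.1]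
        exact mul_le_of_le_one_left (norm_nonneg _) hr.2
      exact ((hpos.isBigO_one ℝ).add h3).congr_left fun z => by abel
    refine ((isBigO_refl (fun z : ℝ × ℝ => z.1) shortFilter).smul h2).congr' ?_ ?_
    · refine eventually_shortFilter.2 (eventually_pos.mono fun ε hε r _ => ?_)
      simp only [smul_inv_smul₀ (ne_of_gt hε)]
    · exact Eventually.of_forall fun z => by simp
  have h2 := ((hG.isLittleO.comp_tendsto hc).trans_isBigO h1).tendsto_inv_smul_nhds_zero
  have h3 : Tendsto (fun z : ℝ × ℝ => DG (z.1⁻¹ • (c z - y₀) - (a + z.2 • b)))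
      shortFilter (𝓝 0) := by
    have := (DG.continuous.tendsto 0).comp hpos
    rwa [map_zero] at this
  refine (tendsto_zero_add h2 h3).congr fun z => ?_
  simp only [Function.comp_apply, map_sub, map_smul, smul_sub]
  abel

theorem tendsto_quadratic {v : ℝ × ℝ → E4} {D : E4} (B : E4 →L[ℝ] E4 →L[ℝ] ℝ)
    (hv : Tendsto v shortFilter (𝓝 D)) :
    Tendsto (fun z => B (v z) (v z) - B D D) shortFilter (𝓝 0) := by
  have := (tendsto_form_apply (tendsto_const_nhds (x := B)) hv hv).sub_const (B D D)
  rwa [sub_self] at this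

/-- Expansion of `ε⁻¹ (G(c)(v, v) - G(y₀)(D, D))` for `c = y₀ + ε (a + r b) + o(ε)` and a velocity
`v = D + ε (θ + ξ)`, where `θ` is only known to be bounded. -/
theorem tendsto_energy_quotient {G : E4 → E4 →L[ℝ] E4 →L[ℝ] ℝ}
    {DG : E4 →L[ℝ] E4 →L[ℝ] E4 →L[ℝ] ℝ} (hG : HasFDerivAt G DG y₀)
    (hsymm : ∀ a b, G y₀ a b = G y₀ b a) {c v θ ξ : ℝ × ℝ → E4} {a b D D₂ : E4} {K : ℝ}
    (hc : Tendsto c shortFilter (𝓝 y₀))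
    (hpos : Tendsto (fun z : ℝ × ℝ => z.1⁻¹ • (c z - y₀) - (a + z.2 • b)) shortFilter (𝓝 0))
    (hv : Tendsto v shortFilter (𝓝 D)) (hvD : ∀ᶠ z in shortFilter, v z - D = z.1 • (θ z + ξ z))
    (hθ : ∀ᶠ z in shortFilter, ‖θ z‖ ≤ K) (hξ : Tendsto ξ shortFilter (𝓝 D₂)) :
    Tendsto (fun z : ℝ × ℝ => 2 * G y₀ D (θ z) + 2 * G y₀ D D₂ + DG (a + z.2 • b) D D
      - z.1⁻¹ * (G (c z) (v z) (v z) - G y₀ D D)) shortFilter (𝓝 0) := by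
  have t1 : Tendsto (fun z => 2 * G y₀ D (D₂ - ξ z)) shortFilter (𝓝 0) := by
    have h1 : Tendsto (fun z => D₂ - ξ z) shortFilter (𝓝 0) := by
      have := hξ.const_sub D₂
      rwa [sub_self] at this
    have := (((G y₀ D).continuous.tendsto 0).comp h1).const_mul 2
    rwa [map_zero, mul_zero] at this
  have hvD' : Tendsto (fun z => v z - D) shortFilter (𝓝 0) := by
    have := hv.sub_const D
    rwa [sub_self] at this
  have t2 : Tendsto (fun z => G y₀ (v z - D) (θ z + ξ z)) shortFilter (𝓝 0) := by
    have h1 : Tendsto (fun z => ‖G y₀‖ * ‖v z - D‖ * (K + ‖ξ z‖)) shortFilter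
        (𝓝 (‖G y₀‖ * ‖(0 : E4)‖ * (K + ‖D₂‖))) :=
      (hvD'.norm.const_mul _).mul (hξ.norm.const_add K)
    rw [norm_zero, mul_zero, zero_mul] at h1
    refine squeeze_zero_norm' (hθ.mono fun z hz => ?_) h1
    refine ((G y₀).le_opNorm₂ _ _).trans ?_
    gcongr
    exact (norm_add_le _ _).trans (by gcongr)
  have t3 : Tendsto (fun z : ℝ × ℝ => (z.1⁻¹ • (G (c z) - G y₀) - DG (a + z.2 • b))
      (v z) (v z)) shortFilter (𝓝 0) :=
    tendsto_form_apply (tendsto_difference_quotient hG hc hpos) hv hv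
  have t4 := tendsto_quadratic (DG a) hv
  have t5 : Tendsto (fun z : ℝ × ℝ => z.2 * (DG b (v z) (v z) - DG b D D)) shortFilter
      (𝓝 0) := by
    refine squeeze_zero_norm' (eventually_shortFilter.2 (Eventually.of_forall fun ε r hr => ?_))
      (tendsto_norm_zero.comp (tendsto_quadratic (DG b) hv))
    rw [norm_mul, Real.norm_eq_abs, abs_of_nonneg hr.1]
    exact mul_le_of_le_one_left (norm_nonneg _) hr.2
  have t := (((t1.sub t2).sub t3).sub t4).sub t5
  simp only [sub_zero] at t
  have hz : ∀ᶠ z : ℝ × ℝ in shortFilter, 0 < z.1 :=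
    eventually_shortFilter.2 (eventually_pos.mono fun ε hε r _ => hε)
  refine t.congr' ?_
  filter_upwards [hvD, hz] with z e2 hz
  have e3 : G y₀ (v z) (v z) = G y₀ D D + 2 * G y₀ D (v z - D) + G y₀ (v z - D) (v z - D) := by
    simp only [map_sub, _root_.sub_apply]
    rw [hsymm (v z) D]; ring
  have e5 : G y₀ D (v z - D) = z.1 * G y₀ D (θ z + ξ z) := by
    rw [e2, map_smul, smul_eq_mul]
  have e6 : G y₀ (v z - D) (v z - D) = z.1 * G y₀ (v z - D) (θ z + ξ z) := by
    conv_lhs => rw [e2]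
    rw [map_smul, smul_eq_mul, ← e2]
  have e4 : z.1⁻¹ * (G y₀ (v z) (v z) - G y₀ D D) =
      2 * G y₀ D (θ z + ξ z) + G y₀ (v z - D) (θ z + ξ z) := by
    rw [e3, e5, e6]; field_simp; ring
  have e7 : z.1⁻¹ * (G (c z) (v z) (v z) - G y₀ D D) =
      z.1⁻¹ * (G (c z) (v z) (v z) - G y₀ (v z) (v z)) +
      z.1⁻¹ * (G y₀ (v z) (v z) - G y₀ D D) := by ring
  rw [e7, e4]
  generalize v z - D = q
  simp only [_root_.sub_apply, _root_.smul_apply, smul_eq_mul, map_add, map_sub, map_smul,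
    _root_.add_apply]
  ring

/-- The second term of the expansion of the world function. It is obtained from the conservation of
energy along the segment, averaged over the segment: the unknown deviation of the segment from a
straight line then drops out. -/
theorem IsGeodesicFamily.hasJet_worldFunction (hΓ : IsGeodesicFamily g W Γ) (hW : IsOpen W)
    (hφ : φ ∈ atlas E4 M) (hy : y₀ ∈ chartDomain φ W) (hu : HasJet u x₁ x₂)
    (hu' : HasJet u' x₁' x₂') :
    HasJet (fun ε => (ε ^ 2)⁻¹ * shortWorldFunction g φ Γ y₀ u u' ε)
      (g.inChart φ y₀ (x₁' - x₁) (x₁' - x₁))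
      (2 * g.inChart φ y₀ (x₁' - x₁) (x₂' - x₂) +
        1 / 2 * fderiv ℝ (g.inChart φ) y₀ (x₁ + x₁') (x₁' - x₁) (x₁' - x₁)) := by
  have hut := hu.tendsto
  have hut' := hu'.tendsto
  obtain ⟨K, hK⟩ := hΓ.eventually_short hW hφ hy hut hut'
  obtain ⟨hv, hpos, hcy⟩ := hΓ.tendsto_short hW hφ hy hut hut'
  have hen := hΓ.eventually_energy hW hφ hy hut hut'
  have hGd : HasFDerivAt (g.inChart φ) (fderiv ℝ (g.inChart φ) y₀) y₀ :=
    ((contDiffAt_inChart (g := g) hφ hy.1).differentiableAt (by simp)).hasFDerivAt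
  have hsymm : ∀ a b, g.inChart φ y₀ a b = g.inChart φ y₀ b a := fun a b => inChart_symm y₀ a b
  have hξt : Tendsto (fun z : ℝ × ℝ => z.1⁻¹ • ((u' z.1 - u z.1) - (x₁' - x₁))) shortFilter
      (𝓝 (x₂' - x₂)) := (hu'.sub hu).comp tendsto_fst
  have key := tendsto_energy_quotient (K := K) (c := fun z => shortSegment φ Γ y₀ u u' z.1 z.2)
    (θ := fun z => z.1⁻¹ • (z.1⁻¹ • deriv (shortSegment φ Γ y₀ u u' z.1) z.2 -
      (u' z.1 - u z.1)))
    hGd hsymm hcy hpos hv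
    (eventually_shortFilter.2 (eventually_pos.mono fun ε hε r _ => by
      simp only [← smul_add, smul_inv_smul₀ (ne_of_gt hε)]; abel))
    (eventually_shortFilter.2 (by
      filter_upwards [hK, eventually_pos] with ε h hε r hr
      rw [norm_smul, norm_inv, Real.norm_eq_abs, abs_of_pos hε, inv_mul_le_iff₀ hε, mul_comm]
      exact (h.2 r hr).2.2.1)) hξt
  replace key := key.congr' (f₂ := fun z : ℝ × ℝ => 2 * g.inChart φ y₀ (x₁' - x₁)
      (z.1⁻¹ • (z.1⁻¹ • deriv (shortSegment φ Γ y₀ u u' z.1) z.2 - (u' z.1 - u z.1))) +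
      2 * g.inChart φ y₀ (x₁' - x₁) (x₂' - x₂) +
      fderiv ℝ (g.inChart φ) y₀ (x₁ + z.2 • (x₁' - x₁)) (x₁' - x₁) (x₁' - x₁) -
      z.1⁻¹ * ((z.1 ^ 2)⁻¹ * shortWorldFunction g φ Γ y₀ u u' z.1 -
        g.inChart φ y₀ (x₁' - x₁) (x₁' - x₁)))
    (eventually_shortFilter.2 (hen.mono fun ε h r hr => by
      simp only [h r hr]))
  clear hξt hv hpos hcy hen hGd hsymm
  generalize hG0 : g.inChart φ y₀ = G₀ at *
  generalize hDG : fderiv ℝ (g.inChart φ) y₀ = DG at *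
  rw [HasJet, Metric.tendsto_nhds]
  intro η hη
  have key' := eventually_shortFilter.1 (Metric.tendsto_nhds.1 key _ (half_pos hη))
  filter_upwards [key', hK, eventually_pos] with ε hk hK hε
  have hseg := hΓ.segment hK.1.1.2 hK.1.2.2
  have h0 : shortSegment φ Γ y₀ u u' ε 0 = y₀ + ε • u ε := by
    simp only [shortSegment, Function.comp_apply]
    rw [hseg.source]; exact φ.right_inv hK.1.1.1
  have h1 : shortSegment φ Γ y₀ u u' ε 1 = y₀ + ε • u' ε := by
    simp only [shortSegment, Function.comp_apply]
    rw [hseg.target]; exact φ.right_inv hK.1.2.1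
  have hd : ∀ r ∈ Icc (0 : ℝ) 1, DifferentiableAt ℝ (shortSegment φ Γ y₀ u u' ε) r :=
    fun r hr => (hK.2 r hr).2.1
  clear hK hseg key key'
  revert hk h0 h1 hd
  generalize shortSegment φ Γ y₀ u u' ε = c
  generalize (ε ^ 2)⁻¹ * shortWorldFunction g φ Γ y₀ u u' ε = S
  generalize u ε = p
  generalize u' ε = q
  intro hk h0 h1 hd
  -- the limit `key` concerns the derivative of the following function of `r`; its values at both
  -- ends are known, whatever the deviation from a straight line is in between
  have hmv := (convex_Icc (0 : ℝ) 1).norm_image_sub_le_of_norm_hasDerivWithin_le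
    (f := fun r => 2 * G₀ (x₁' - x₁) (ε⁻¹ • (ε⁻¹ • c r - r • (q - p))) +
      (r * (2 * G₀ (x₁' - x₁) (x₂' - x₂)) + (r * DG x₁ (x₁' - x₁) (x₁' - x₁) +
        1 / 2 * r ^ 2 * DG (x₁' - x₁) (x₁' - x₁) (x₁' - x₁)) -
        r * (ε⁻¹ * (S - G₀ (x₁' - x₁) (x₁' - x₁)))))
    (C := η / 2) (fun r hr => by
      have d1 := ((((hd r hr).hasDerivAt.const_smul ε⁻¹).sub
        ((hasDerivAt_id r).smul_const (q - p))).const_smul ε⁻¹)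
      have d2 := (((G₀ (x₁' - x₁)).hasFDerivAt.comp_hasDerivAt r d1).const_mul 2)
      have d3 := ((hasDerivAt_id r).mul_const (2 * G₀ (x₁' - x₁) (x₂' - x₂)))
      have d4 := ((hasDerivAt_id r).mul_const (DG x₁ (x₁' - x₁) (x₁' - x₁))).add
        ((((hasDerivAt_id r).pow 2).const_mul (1 / 2 : ℝ)).mul_const
          (DG (x₁' - x₁) (x₁' - x₁) (x₁' - x₁)))
      have d5 := (hasDerivAt_id r).mul_const (ε⁻¹ * (S - G₀ (x₁' - x₁) (x₁' - x₁)))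
      exact (d2.add ((d3.add d4).sub d5)).hasDerivWithinAt)
    (fun r hr => by
      have := hk r hr
      rw [dist_zero_right] at this
      refine (le_of_eq ?_).trans this.le
      congr 1
      generalize x₁' - x₁ = D
      simp only [one_smul, id, map_add, map_smul, _root_.add_apply, _root_.smul_apply,
        smul_eq_mul, Nat.cast_ofNat]
      ring) (left_mem_Icc.2 zero_le_one) (right_mem_Icc.2 zero_le_one)
  have e0 : ε⁻¹ • (y₀ + ε • q) - (q - p) = ε⁻¹ • (y₀ + ε • p) := by
    simp only [smul_add, inv_smul_smul₀ hε.ne']; abel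
  simp only [h0, h1, one_smul, zero_smul, sub_zero, e0, one_mul, zero_mul, norm_one, mul_one,
    one_pow, ne_eq, OfNat.ofNat_ne_zero, not_false_eq_true, zero_pow, mul_zero, add_zero,
    add_sub_cancel_left] at hmv
  rw [dist_eq_norm, norm_sub_rev]
  refine lt_of_le_of_lt (le_of_eq_of_le ?_ hmv) (half_lt_self hη)
  congr 1
  have e2 : x₁ + x₁' = (2 : ℝ) • x₁ + (x₁' - x₁) := by rw [two_smul]; abel
  rw [e2]
  generalize x₁' - x₁ = D
  simp only [map_add, map_smul, _root_.add_apply, _root_.smul_apply, smul_eq_mul]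
  ring

end WorldFunction

end

/-! ### Light signals between neighboring clocks of an observer field -/

section

section LightJet

variable {M : Type*} [TopologicalSpace M] [ChartedSpace E4 M] [IsManifold (𝓡 4) ∞ M]
  {g : LorentzMetric M} {T : TimeOrientation g} {W U : Set M}
  {V : (x : M) → TangentSpace (𝓡 4) x} {φ : OpenPartialHomeomorph M E4} {Γ : M → M → ℝ → M}
  {y₀ y y' x₁ x₁' : E4} {u u' : ℝ → E4} {A B : ℝ → Clock T} {τ : ℝ}

/-- The components of a vector field in the chart `φ`, as a function on the coordinate space. -/
noncomputable def fieldInChart (V : (x : M) → TangentSpace (𝓡 4) x)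
    (φ : OpenPartialHomeomorph M E4) (y : E4) : E4 :=
  components φ (φ.symm y) (V (φ.symm y))

theorem contDiffAt_fieldInChart (hV : IsObserverField T U V) (hU : IsOpen U) (hφ : φ ∈ atlas E4 M)
    (hy : y ∈ chartDomain φ U) : ContDiffAt ℝ ∞ (fieldInChart V φ) y := by
  have h := contDiffAt_components hφ le_rfl (φ.map_target hy.1)
    (hV.smooth.contMDiffAt (hU.mem_nhds hy.2))
  rwa [φ.right_inv hy.1] at h

theorem inChart_fieldInChart (hφ : φ ∈ atlas E4 M) (hy : y ∈ φ.target) (w : E4) :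
    g.inChart φ y (fieldInChart V φ y) w =
      g.inner (φ.symm y) (V (φ.symm y)) (ofComponents φ y w) := by
  rw [inChart_apply, fieldInChart, ofComponents_components hφ hy]

theorem fieldInChart_timelike (hV : IsObserverField T U V) (hφ : φ ∈ atlas E4 M)
    (hy : y ∈ chartDomain φ U) :
    g.inChart φ y (fieldInChart V φ y) (fieldInChart V φ y) < 0 := by
  rw [inChart_fieldInChart hφ hy.1, fieldInChart, ofComponents_components hφ hy.1]
  exact hV.timelike _ hy.2

/-- A family of clocks `A ε` of `V` that pass, at the reading `0`, through the events at the
positions `y₀ + ε y` in the chart `φ`, and that run within the chart at least during the fixed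
interval `(-τ, τ)` of readings. -/
def IsClockFamily (U : Set M) (V : (x : M) → TangentSpace (𝓡 4) x)
    (φ : OpenPartialHomeomorph M E4) (y₀ : E4) (τ : ℝ) (y : E4) (A : ℝ → Clock T) : Prop :=
  ∃ L : ℝ, ∀ᶠ ε in 𝓝[>] 0, (A ε).IsClockOf U V ∧ φ ((A ε).toFun 0) = y₀ + ε • y ∧
    ∀ t ∈ Ioo (-τ) τ, t ∈ (A ε).dom ∧ (A ε).toFun t ∈ φ.source ∧
      ‖fieldInChart V φ (φ ((A ε).toFun t))‖ ≤ L ∧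
      HasDerivAt (φ ∘ (A ε).toFun) (fieldInChart V φ (φ ((A ε).toFun t))) t

theorem exists_clockFamily [T2Space M] (hV : IsObserverField T U V) (hU : IsOpen U) (hUW : U ⊆ W)
    (hW : IsConvexNhd g W) (hφ : φ ∈ atlas E4 M) (hy : y₀ ∈ chartDomain φ U) :
    ∃ τ > 0, ∀ y, ∃ A : ℝ → Clock T, IsClockFamily U V φ y₀ τ y A := by
  have hv := contDiffAt_fieldInChart hV hU hφ hy
  set L := ‖fieldInChart V φ y₀‖ + 1
  have hN : chartDomain φ U ∩ {y | ‖fieldInChart V φ y‖ < L} ∈ 𝓝 y₀ :=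
    inter_mem ((isOpen_chartDomain hU).mem_nhds hy)
      (hv.continuousAt.norm.eventually_lt_const (lt_add_one _))
  obtain ⟨ρ, hρ, τ, hτ, hflow⟩ := exists_local_flow (hv.of_le (by simp)) hN
  have hclock : ∀ p ∈ Metric.ball y₀ ρ, ∃ A : Clock T, A.IsClockOf U V ∧ φ (A.toFun 0) = p ∧
      ∀ t ∈ Ioo (-τ) τ, t ∈ A.dom ∧ A.toFun t ∈ φ.source ∧
        ‖fieldInChart V φ (φ (A.toFun t))‖ ≤ L ∧
        HasDerivAt (φ ∘ A.toFun) (fieldInChart V φ (φ (A.toFun t))) t := by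
    intro p hp
    obtain ⟨x, hx0, hx⟩ := hflow p hp
    have h0 : (0 : ℝ) ∈ Ioo (-τ) τ := ⟨by linarith, hτ⟩
    have hfl : IsFlowLine U V (Ioo (-τ) τ) (φ.symm ∘ x) := by
      refine ⟨isOpen_Ioo, ordConnected_Ioo, fun t ht => (hx t ht).1.1.2, fun t ht => ?_⟩
      obtain ⟨⟨⟨h1, h2⟩, -⟩, h3⟩ := hx t ht
      have h4 := ((contMDiffAt_chart_symm hφ h1).mdifferentiableAt (by simp)).hasMFDerivAt.comp t
        h3.hasFDerivAt.hasMFDerivAt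
      refine HasMFDerivAt.hasMFDerivWithinAt ?_
      refine h4.congr_mfderiv (ContinuousLinearMap.ext_ring ?_)
      refine Eq.symm ?_
      exact (one_smul ℝ (V (φ.symm (x t)))).trans ((ofComponents_components hφ h1 _).symm.trans
        (congrArg (ofComponents φ (x t)) (one_smul ℝ (fieldInChart V φ (x t))).symm))
    obtain ⟨A, hA, hmax⟩ := exists_clock hV hU hUW hW hfl h0
    obtain ⟨hdom, heq⟩ := hmax _ _ hfl h0 rfl
    have hφA : ∀ t ∈ Ioo (-τ) τ, φ (A.toFun t) = x t := fun t ht => by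
      rw [heq ht]; exact φ.right_inv (hx t ht).1.1.1
    refine ⟨A, hA, by rw [hφA 0 h0, hx0], fun t ht => ⟨hdom ht, ?_, ?_, ?_⟩⟩
    · rw [heq ht]; exact φ.map_target (hx t ht).1.1.1
    · rw [hφA t ht]; exact (hx t ht).1.2.le
    · rw [hφA t ht]
      refine (hx t ht).2.congr_of_eventuallyEq ?_
      filter_upwards [isOpen_Ioo.mem_nhds ht] with r hr using hφA r hr
  refine ⟨τ, hτ, fun y => ?_⟩
  have hev : ∀ᶠ ε in 𝓝[>] (0 : ℝ), y₀ + ε • y ∈ Metric.ball y₀ ρ :=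
    (tendsto_base tendsto_const_nhds y₀).eventually (Metric.ball_mem_nhds y₀ hρ)
  have : Nonempty (Clock T) := ⟨(hclock y₀ (Metric.mem_ball_self hρ)).choose⟩
  choose! A hA using hclock
  exact ⟨fun ε => A (y₀ + ε • y), L, hev.mono fun ε hε => hA _ hε⟩

/-- The rescaled position of the clock `A ε` at the rescaled reading `s ε`. -/
noncomputable def clockPosition (φ : OpenPartialHomeomorph M E4) (y₀ : E4) (A : ℝ → Clock T)
    (s : ℝ → ℝ) (ε : ℝ) : E4 :=
  ε⁻¹ • (φ ((A ε).toFun (ε * s ε)) - y₀)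

theorem eventually_reading {s : ℝ → ℝ} {s₀ : ℝ} (hτ : 0 < τ) (hs : Tendsto s (𝓝[>] 0) (𝓝 s₀)) :
    ∀ᶠ ε in 𝓝[>] 0, ε * s ε ∈ Ioo (-τ) τ := by
  have h := tendsto_id_zero.mul hs
  rw [zero_mul] at h
  exact h (Ioo_mem_nhds (by linarith) hτ)

theorem IsClockFamily.eventually_position (hA : IsClockFamily U V φ y₀ τ y A) (hτ : 0 < τ)
    {s : ℝ → ℝ} {s₀ : ℝ} (hs : Tendsto s (𝓝[>] 0) (𝓝 s₀)) :
    ∀ᶠ ε in 𝓝[>] 0, ε * s ε ∈ (A ε).dom ∧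
      φ.symm (y₀ + ε • clockPosition φ y₀ A s ε) = (A ε).toFun (ε * s ε) := by
  obtain ⟨L, hL⟩ := hA
  filter_upwards [hL, eventually_reading hτ hs, eventually_pos] with ε h hr hε
  obtain ⟨h1, h2, -⟩ := h.2.2 _ hr
  refine ⟨h1, ?_⟩
  rw [clockPosition, smul_inv_smul₀ hε.ne', add_sub_cancel]
  exact φ.left_inv h2

theorem IsClockFamily.hasJet_position (hA : IsClockFamily U V φ y₀ τ y A) (hτ : 0 < τ)
    (hV : IsObserverField T U V) (hU : IsOpen U) (hφ : φ ∈ atlas E4 M) (hy : y₀ ∈ chartDomain φ U)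
    {s : ℝ → ℝ} {s₀ s₁ : ℝ} (hs : HasJet s s₀ s₁) :
    HasJet (clockPosition φ y₀ A s) (y + s₀ • fieldInChart V φ y₀)
      (s₁ • fieldInChart V φ y₀ + s₀ • fderiv ℝ (fieldInChart V φ) y₀ y +
        (1 / 2 * s₀ ^ 2) • fderiv ℝ (fieldInChart V φ) y₀ (fieldInChart V φ y₀)) := by
  obtain ⟨L, hL⟩ := hA
  exact hasJet_flow (x := fun ε => φ ∘ (A ε).toFun) (L := L) hτ
    ((contDiffAt_fieldInChart hV hU hφ hy).differentiableAt (by simp)).hasFDerivAt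
    (hL.mono fun ε h => h.2.1)
    (hL.mono fun ε h t ht => ⟨(h.2.2 t ht).2.2.1, (h.2.2 t ht).2.2.2⟩) hs

/-- A short null geodesic segment is a light ray as soon as its initial displacement is
future-pointing to zeroth order. -/
theorem IsGeodesicFamily.eventually_isLightRay (hΓ : IsGeodesicFamily g W Γ) (hW : IsOpen W)
    (hV : IsObserverField T U V) (hU : IsOpen U) (hUW : U ⊆ W) (hφ : φ ∈ atlas E4 M)
    (hy : y₀ ∈ chartDomain φ U) (hu : Tendsto u (𝓝[>] 0) (𝓝 x₁))
    (hu' : Tendsto u' (𝓝[>] 0) (𝓝 x₁'))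
    (hD : g.inChart φ y₀ (fieldInChart V φ y₀) (x₁' - x₁) < 0) :
    ∀ᶠ ε in 𝓝[>] 0, shortWorldFunction g φ Γ y₀ u u' ε = 0 →
      IsLightRay T W (φ.symm (y₀ + ε • u ε)) (φ.symm (y₀ + ε • u' ε))
        (Γ (φ.symm (y₀ + ε • u ε)) (φ.symm (y₀ + ε • u' ε))) := by
  have hyW : y₀ ∈ chartDomain φ W := ⟨hy.1, hUW hy.2⟩
  obtain ⟨K, hK⟩ := hΓ.eventually_short hW hφ hyW hu hu'
  obtain ⟨h1, -, h3⟩ := hΓ.tendsto_short hW hφ hyW hu hu'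
  have hv : ContinuousAt (fieldInChart V φ) y₀ := (contDiffAt_fieldInChart hV hU hφ hy).continuousAt
  have hG : ContinuousAt (g.inChart φ) y₀ := (contDiffAt_inChart (g := g) hφ hy.1).continuousAt
  have h4 := eventually_shortFilter.1
    ((tendsto_form hG h3 (hv.tendsto.comp h3) h1).eventually_lt_const hD)
  have h5 := eventually_shortFilter.1 (h3.eventually ((isOpen_chartDomain hU).mem_nhds hy))
  filter_upwards [hK, h4, h5, eventually_pos] with ε h h4 h5 hε h0
  refine hΓ.isLightRay h.1.1.2 h.1.2.2 h0 fun r hr => ?_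
  have hseg := hΓ.segment h.1.1.2 h.1.2.2
  have hmd := (hseg.smooth r hr).mdifferentiableAt (by simp)
  obtain ⟨hsrc, hdiff, -⟩ := h.2 r hr
  have h5' := h5 r hr
  have h4' := h4 r hr
  simp only [shortSegment, Function.comp_apply] at h5' h4'
  have hen := hΓ.energy_eq_worldFunction h.1.1.2 h.1.2.2 hr
  have hcU := h5'.2
  rw [mem_preimage, φ.left_inv hsrc] at hcU
  set c := Γ (φ.symm (y₀ + ε • u ε)) (φ.symm (y₀ + ε • u' ε)) with hc
  have hneg : g.inner (c r) (V (c r)) (velocity c r) < 0 := by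
    rw [inner_eq_inChart hφ hsrc, components_velocity hφ hmd hsrc]
    rw [map_smul, smul_eq_mul, fieldInChart, φ.left_inv hsrc] at h4'
    exact neg_of_mul_neg_right h4' (inv_pos.2 hε).le
  exact (g.isLorentzForm (c r)).neg_of_neg (T.timelike _) (hV.timelike _ hcU) (hV.future _ hcU)
    (hen.trans h0).le hneg

theorem IsClockFamily.eventually_disjoint [T2Space M] (hA : IsClockFamily U V φ y₀ τ y A)
    (hB : IsClockFamily U V φ y₀ τ y' B) (hτ : 0 < τ) (hV : IsObserverField T U V) (hU : IsOpen U)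
    (hUW : U ⊆ W) (hW : IsConvexNhd g W) (hφ : φ ∈ atlas E4 M) (hy : y₀ ∈ chartDomain φ U)
    (hr : 0 < g.inChart φ y₀ (y' - y) (y' - y)) :
    ∀ᶠ ε in 𝓝[>] 0, Disjoint (A ε).trajectory (B ε).trajectory := by
  obtain ⟨hWo, Γ, hΓ⟩ := hW
  have hyW : y₀ ∈ chartDomain φ W := ⟨hy.1, hUW hy.2⟩
  have h0 : Tendsto (fun _ : ℝ => (0 : ℝ)) (𝓝[>] 0) (𝓝 0) := tendsto_const_nhds
  have h0' : HasJet (fun _ : ℝ => (0 : ℝ)) 0 0 := HasJet.const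
  have ha := (hA.hasJet_position hτ hV hU hφ hy h0').tendsto
  have hb := (hB.hasJet_position hτ hV hU hφ hy h0').tendsto
  rw [zero_smul, add_zero] at ha hb
  have h1 := (IsGeodesicFamily.tendsto_worldFunction hΓ hWo hφ hyW ha hb).eventually_const_lt hr
  rw [← neg_sub y y', map_neg, map_neg, _root_.neg_apply, neg_neg] at hr
  have h2 := (IsGeodesicFamily.tendsto_worldFunction hΓ hWo hφ hyW hb ha).eventually_const_lt hr
  have pA := hA.eventually_position hτ h0
  have pB := hB.eventually_position hτ h0
  obtain ⟨L, hL⟩ := hA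
  obtain ⟨L', hL'⟩ := hB
  filter_upwards [h1, h2, pA, pB, hL, hL', eventually_pos] with ε h1 h2 pA pB hA hB hε
  rw [shortWorldFunction, pA.2, pB.2] at h1
  rw [shortWorldFunction, pA.2, pB.2] at h2
  have hε2 : 0 < (ε ^ 2)⁻¹ := by positivity
  exact disjoint_of_spacelike hV hU hUW ⟨hWo, Γ, hΓ⟩ hΓ hA.1 hB.1 pA.1 pB.1
    (pos_of_mul_pos_right h1 hε2.le) (pos_of_mul_pos_right h2 hε2.le)

end LightJet

end

/-! ### Expansion of the travel time of light -/

section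

section LightShift

/-- The derivative of the form field `G` along the vector field `v`, at a point where `G`, `v` have
the values `G`, `v` and the derivatives `DG`, `A`: the Lie derivative, as a function of two
vectors. -/
noncomputable def lieForm (G : E4 →L[ℝ] E4 →L[ℝ] ℝ) (DG : E4 →L[ℝ] E4 →L[ℝ] E4 →L[ℝ] ℝ) (v : E4)
    (A : E4 →L[ℝ] E4) (a b : E4) : ℝ :=
  DG v a b + G (A a) b + G a (A b)

/-- The second term in the expansion of the travel time of a light signal, for a signal sent at the
rescaled reading `s` from the position `y` to the position `y'`, where `d` is the first term. -/
noncomputable def lightShift (G : E4 →L[ℝ] E4 →L[ℝ] ℝ) (DG : E4 →L[ℝ] E4 →L[ℝ] E4 →L[ℝ] ℝ) (v : E4)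
    (A : E4 →L[ℝ] E4) (y y' : E4) (d s : ℝ) : ℝ :=
  ((s + d / 2) * lieForm G DG v A (y' - y + d • v) (y' - y + d • v) +
    d * G (y' - y + d • v) (A (y + y')) +
    1 / 2 * DG (y + y') (y' - y + d • v) (y' - y + d • v)) / (2 * d * -G v v)

/-- The second term in the expansion of the world function between a clock at `y` and a clock at
`y'`, for the positions at the time `s` of departure and at the presumed time of arrival: it is
proportional to the deviation `δ` of the arrival from the shift `lightShift`. -/
theorem lightShift_identity {G : E4 →L[ℝ] E4 →L[ℝ] ℝ} {DG : E4 →L[ℝ] E4 →L[ℝ] E4 →L[ℝ] ℝ} {v : E4}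
    {A : E4 →L[ℝ] E4} (hsymm : ∀ a b, G a b = G b a) {y y' : E4} (hr : G v (y' - y) = 0) {d : ℝ}
    (hd : d ≠ 0) (hv : G v v ≠ 0) (s s₁ δ : ℝ) :
    2 * G (y' + (s + d) • v - (y + s • v))
        ((s₁ + (lightShift G DG v A y y' d s + δ)) • v + (s + d) • A y' +
          (1 / 2 * (s + d) ^ 2) • A v - (s₁ • v + s • A y + (1 / 2 * s ^ 2) • A v)) +
      1 / 2 * DG (y + s • v + (y' + (s + d) • v)) (y' + (s + d) • v - (y + s • v))
        (y' + (s + d) • v - (y + s • v)) = 2 * d * G v v * δ := by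
  have e1 : y' + (s + d) • v - (y + s • v) = y' - y + d • v := by rw [add_smul]; abel
  have hΔ : G (y' - y + d • v) v = d * G v v := by
    rw [hsymm, map_add, hr, map_smul, smul_eq_mul, zero_add]
  have hψ : lightShift G DG v A y y' d s * (2 * d * -G v v) =
      (s + d / 2) * lieForm G DG v A (y' - y + d • v) (y' - y + d • v) +
    d * G (y' - y + d • v) (A (y + y')) +
    1 / 2 * DG (y + y') (y' - y + d • v) (y' - y + d • v) :=
    div_mul_cancel₀ _ (mul_ne_zero (mul_ne_zero two_ne_zero hd) (neg_ne_zero.2 hv))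
  rw [e1]
  have e2 : (s₁ + (lightShift G DG v A y y' d s + δ)) • v + (s + d) • A y' +
      (1 / 2 * (s + d) ^ 2) • A v - (s₁ • v + s • A y + (1 / 2 * s ^ 2) • A v) =
      (lightShift G DG v A y y' d s + δ) • v + (s + d / 2) • A (y' - y + d • v) +
        (d / 2) • A (y + y') := by
    simp only [map_add, map_sub, map_smul]
    module
  have e3 : y + s • v + (y' + (s + d) • v) = (2 * (s + d / 2)) • v + (y + y') := by module
  rw [e2, e3]
  generalize lightShift G DG v A y y' d s = ψ at *
  rw [lieForm, hsymm (A _)] at hψ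
  revert hΔ hψ
  generalize y' - y + d • v = Δ
  generalize y + y' = Y
  intro hΔ hψ
  simp only [map_add, map_smul, _root_.add_apply, _root_.smul_apply, smul_eq_mul] at hψ ⊢
  rw [hΔ]
  linear_combination -hψ

end LightShift

section LightJet

variable {M : Type*} [TopologicalSpace M] [ChartedSpace E4 M] [IsManifold (𝓡 4) ∞ M]
  {g : LorentzMetric M} {T : TimeOrientation g} {W U : Set M}
  {V : (x : M) → TangentSpace (𝓡 4) x} {φ : OpenPartialHomeomorph M E4} {Γ : M → M → ℝ → M}
  {y₀ y y' x₁ x₁' : E4} {u u' : ℝ → E4} {A B : ℝ → Clock T} {τ : ℝ}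

theorem IsClockFamily.tendsto_position (hA : IsClockFamily U V φ y₀ τ y A) (hτ : 0 < τ)
    (hV : IsObserverField T U V) (hU : IsOpen U) (hφ : φ ∈ atlas E4 M) (hy : y₀ ∈ chartDomain φ U)
    {s : ℝ → ℝ} {s₀ : ℝ} (hs : Tendsto s (𝓝[>] 0) (𝓝 s₀)) :
    Tendsto (clockPosition φ y₀ A s) (𝓝[>] 0) (𝓝 (y + s₀ • fieldInChart V φ y₀)) := by
  have h1 := (hA.hasJet_position hτ hV hU hφ hy (HasJet.const (a := s₀))).tendsto
  obtain ⟨L, hL⟩ := hA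
  have h2 : Tendsto (fun ε => L * |s ε - s₀|) (𝓝[>] 0) (𝓝 0) := by
    have := ((hs.sub_const s₀).abs).const_mul L
    rwa [sub_self, abs_zero, mul_zero] at this
  have h3 : Tendsto (fun ε => clockPosition φ y₀ A s ε - clockPosition φ y₀ A (fun _ => s₀) ε)
      (𝓝[>] 0) (𝓝 0) := by
    refine squeeze_zero_norm' ?_ h2
    filter_upwards [hL, eventually_reading hτ hs,
      eventually_reading hτ (tendsto_const_nhds (x := s₀)), eventually_pos] with ε h hr hr' hε
    have h4 := (convex_Ioo (-τ) τ).norm_image_sub_le_of_norm_hasDerivWithin_le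
      (fun t ht => (h.2.2 t ht).2.2.2.hasDerivWithinAt) (fun t ht => (h.2.2 t ht).2.2.1) hr' hr
    rw [clockPosition, clockPosition, ← smul_sub, sub_sub_sub_cancel_right, norm_smul, norm_inv,
      Real.norm_eq_abs, abs_of_pos hε, inv_mul_le_iff₀ hε]
    refine h4.trans (le_of_eq ?_)
    rw [← mul_sub, Real.norm_eq_abs, abs_mul, abs_of_pos hε]
    ring
  have h5 := h3.add h1
  rw [zero_add] at h5
  exact h5.congr fun ε => sub_add_cancel _ _

theorem IsClockFamily.eventually_mapsTo (hA : IsClockFamily U V φ y₀ τ y A) :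
    ∀ᶠ ε in 𝓝[>] 0, (A ε).trajectory ⊆ U := by
  obtain ⟨L, hL⟩ := hA
  exact hL.mono fun ε h => h.1.1.1

/-- Expansion of the world function between two clocks, at readings that are a light signal apart up
to the correction `δ` of second order. -/
theorem hasJet_worldFunction_clocks (hA : IsClockFamily U V φ y₀ τ y A)
    (hB : IsClockFamily U V φ y₀ τ y' B) (hτ : 0 < τ) (hV : IsObserverField T U V) (hU : IsOpen U)
    (hUW : U ⊆ W) (hW : IsOpen W) (hΓ : IsGeodesicFamily g W Γ) (hφ : φ ∈ atlas E4 M)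
    (hy : y₀ ∈ chartDomain φ U)
    (hr : g.inChart φ y₀ (fieldInChart V φ y₀) (y' - y) = 0) {d : ℝ} (hd0 : 0 < d)
    (hd : g.inChart φ y₀ (y' - y) (y' - y) =
      d ^ 2 * -g.inChart φ y₀ (fieldInChart V φ y₀) (fieldInChart V φ y₀))
    {s : ℝ → ℝ} {s₀ s₁ : ℝ} (hs : HasJet s s₀ s₁) (δ : ℝ) {t : ℝ → ℝ}
    (ht : HasJet t (s₀ + d) (s₁ + (lightShift (g.inChart φ y₀) (fderiv ℝ (g.inChart φ) y₀)
        (fieldInChart V φ y₀) (fderiv ℝ (fieldInChart V φ) y₀) y y' d s₀ + δ))) :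
    Tendsto (fun ε => ε⁻¹ * ((ε ^ 2)⁻¹ *
        worldFunction g Γ ((A ε).toFun (ε * s ε)) ((B ε).toFun (ε * t ε)))) (𝓝[>] 0)
      (𝓝 (2 * d * g.inChart φ y₀ (fieldInChart V φ y₀) (fieldInChart V φ y₀) * δ)) := by
  have hsymm : ∀ a b, g.inChart φ y₀ a b = g.inChart φ y₀ b a := fun a b => inChart_symm y₀ a b
  have hvneg := fieldInChart_timelike hV hφ hy
  have ja := hA.hasJet_position hτ hV hU hφ hy hs
  have jb := hB.hasJet_position hτ hV hU hφ hy ht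
  have j := hΓ.hasJet_worldFunction hW hφ ⟨hy.1, hUW hy.2⟩ ja jb
  have pA := hA.eventually_position hτ hs.tendsto
  have pB := hB.eventually_position hτ ht.tendsto
  rw [lightShift_identity hsymm hr hd0.ne' hvneg.ne] at j
  have hz : g.inChart φ y₀ (y' + (s₀ + d) • fieldInChart V φ y₀ - (y + s₀ • fieldInChart V φ y₀))
      (y' + (s₀ + d) • fieldInChart V φ y₀ - (y + s₀ • fieldInChart V φ y₀)) = 0 := by
    have e1 : y' + (s₀ + d) • fieldInChart V φ y₀ - (y + s₀ • fieldInChart V φ y₀) =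
        y' - y + d • fieldInChart V φ y₀ := by rw [add_smul]; abel
    rw [e1]
    revert hr hd
    generalize y' - y = r
    intro hr hd
    simp only [map_add, map_smul, _root_.add_apply, _root_.smul_apply, smul_eq_mul]
    rw [hsymm r (fieldInChart V φ y₀), hr, hd]
    ring
  rw [hz] at j
  refine Tendsto.congr' ?_ j
  filter_upwards [pA, pB] with ε pA pB
  rw [shortWorldFunction, pA.2, pB.2, sub_zero, smul_eq_mul]

/-- Light signals between neighboring clocks of an observer field: expansion of the time of arrival
in terms of the time of emission. -/
theorem exists_signal_jet (hA : IsClockFamily U V φ y₀ τ y A) (hB : IsClockFamily U V φ y₀ τ y' B)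
    (hτ : 0 < τ) (hV : IsObserverField T U V) (hU : IsOpen U) (hUW : U ⊆ W)
    (hW : IsConvexNhd g W) (hφ : φ ∈ atlas E4 M) (hy : y₀ ∈ chartDomain φ U)
    (hAB : ∀ᶠ ε in 𝓝[>] 0, InRadarNhd W (A ε) (B ε))
    (hr : g.inChart φ y₀ (fieldInChart V φ y₀) (y' - y) = 0) {d : ℝ} (hd0 : 0 < d)
    (hd : g.inChart φ y₀ (y' - y) (y' - y) =
      d ^ 2 * -g.inChart φ y₀ (fieldInChart V φ y₀) (fieldInChart V φ y₀))
    {s : ℝ → ℝ} {s₀ s₁ : ℝ} (hs : HasJet s s₀ s₁) :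
    ∃ t : ℝ → ℝ, HasJet t (s₀ + d) (s₁ + lightShift (g.inChart φ y₀) (fderiv ℝ (g.inChart φ) y₀)
        (fieldInChart V φ y₀) (fderiv ℝ (fieldInChart V φ) y₀) y y' d s₀) ∧
      ∀ᶠ ε in 𝓝[>] 0, Signal W (A ε) (B ε) (ε * s ε) (ε * t ε) := by
  obtain ⟨hWo, Γ, hΓ'⟩ := id hW
  have hΓ : IsGeodesicFamily g W Γ := hΓ'
  have hvneg := fieldInChart_timelike (g := g) hV hφ hy
  have pA := hA.eventually_position hτ hs.tendsto
  have hex : ∀ ε : ℝ, ∃ t : ℝ, 0 < ε → ε * s ε ∈ (A ε).dom → InRadarNhd W (A ε) (B ε) →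
      Signal W (A ε) (B ε) (ε * s ε) (ε * t) := by
    intro ε
    by_cases h : 0 < ε ∧ ε * s ε ∈ (A ε).dom ∧ InRadarNhd W (A ε) (B ε)
    · obtain ⟨z, hz⟩ := h.2.2.isSmoothCorrespondence.left _ h.2.1
      exact ⟨ε⁻¹ * z, fun _ _ _ => by rwa [mul_inv_cancel_left₀ h.1.ne']⟩
    · exact ⟨0, fun h1 h2 h3 => absurd ⟨h1, h2, h3⟩ h⟩
  -- the actual time of arrival
  choose t ht using hex
  have hsig : ∀ᶠ ε in 𝓝[>] 0, Signal W (A ε) (B ε) (ε * s ε) (ε * t ε) := by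
    filter_upwards [eventually_pos, pA, hAB] with ε h1 h2 h3 using ht ε h1 h2.1 h3
  refine ⟨t, ?_, hsig⟩
  set ψ := lightShift (g.inChart φ y₀) (fderiv ℝ (g.inChart φ) y₀)
        (fieldInChart V φ y₀) (fderiv ℝ (fieldInChart V φ) y₀) y y' d s₀ with hψ
  rw [HasJet, Metric.tendsto_nhds]
  intro η' hη'
  set η := η' / 2 with hη
  have hη0 : 0 < η := half_pos hη'
  -- the readings between which the signal arrives
  set lo : ℝ → ℝ := fun ε => (s₀ + d) + ε • (s₁ + (ψ + -η)) with hlo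
  set hi : ℝ → ℝ := fun ε => (s₀ + d) + ε • (s₁ + (ψ + η)) with hhi
  have jlo : HasJet lo (s₀ + d) (s₁ + (ψ + -η)) := HasJet.affine _ _
  have jhi : HasJet hi (s₀ + d) (s₁ + (ψ + η)) := HasJet.affine _ _
  have wlo := (hasJet_worldFunction_clocks hA hB hτ hV hU hUW hWo hΓ hφ hy hr hd0 hd hs (-η)
    jlo).eventually_const_lt (u := 0) (by nlinarith [mul_pos hd0 hη0])
  have whi := (hasJet_worldFunction_clocks hA hB hτ hV hU hUW hWo hΓ hφ hy hr hd0 hd hs η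
    jhi).eventually_lt_const (u := 0) (by nlinarith [mul_pos hd0 hη0])
  have hzero : ∀ᶠ ε in 𝓝[>] 0, ∃ z ∈ Icc (lo ε) (hi ε),
      worldFunction g Γ ((A ε).toFun (ε * s ε)) ((B ε).toFun (ε * z)) = 0 := by
    have pB := hB.eventually_mapsTo
    have pA' := hA.eventually_mapsTo
    obtain ⟨L, hL⟩ := id hB
    filter_upwards [wlo, whi, pA, pA', pB, hL, eventually_reading hτ jlo.tendsto,
      eventually_reading hτ jhi.tendsto, eventually_pos] with ε wlo whi pA pA' pB hL rlo rhi hε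
    have hε2 : 0 < (ε ^ 2)⁻¹ := by positivity
    have wlo' := pos_of_mul_pos_right (pos_of_mul_pos_right wlo (inv_pos.2 hε).le) hε2.le
    have whi' := neg_of_mul_neg_right (neg_of_mul_neg_right whi (inv_pos.2 hε).le) hε2.le
    have hle : lo ε ≤ hi ε := by
      simp only [hlo, hhi, smul_eq_mul]; nlinarith
    have hcont : ContinuousOn (fun z => worldFunction g Γ ((A ε).toFun (ε * s ε))
        ((B ε).toFun (ε * z))) (Icc (lo ε) (hi ε)) := by
      intro z hz
      have hzI : ε * z ∈ Ioo (-τ) τ :=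
        ordConnected_Ioo.out rlo rhi ⟨by gcongr; exact hz.1, by gcongr; exact hz.2⟩
      have hzd := (hL.2.2 _ hzI).1
      have hBc : ContinuousAt (B ε).toFun (ε * z) :=
        ((B ε).smooth.contMDiffAt ((B ε).isOpen_dom.mem_nhds hzd)).continuousAt
      have h1 := hΓ.continuousAt_worldFunction_right hWo
        (hUW (pA' ((A ε).mem_trajectory pA.1))) (hUW (pB ((B ε).mem_trajectory hzd)))
      have h2 : ContinuousAt (fun z => (B ε).toFun (ε * z)) z :=
        ContinuousAt.comp (f := fun z => ε * z) hBc (by fun_prop)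
      exact (ContinuousAt.comp (f := fun z => (B ε).toFun (ε * z)) h1 h2).continuousWithinAt
    obtain ⟨z, hz, hz0⟩ := intermediate_value_Icc' hle hcont ⟨whi'.le, wlo'.le⟩
    exact ⟨z, hz, hz0⟩
  have hex : ∀ ε : ℝ, ∃ z : ℝ, (∃ z ∈ Icc (lo ε) (hi ε),
      worldFunction g Γ ((A ε).toFun (ε * s ε)) ((B ε).toFun (ε * z)) = 0) →
      z ∈ Icc (lo ε) (hi ε) ∧
        worldFunction g Γ ((A ε).toFun (ε * s ε)) ((B ε).toFun (ε * z)) = 0 := by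
    intro ε
    by_cases h : ∃ z ∈ Icc (lo ε) (hi ε),
      worldFunction g Γ ((A ε).toFun (ε * s ε)) ((B ε).toFun (ε * z)) = 0
    · obtain ⟨z, hz⟩ := h
      exact ⟨z, fun _ => hz⟩
    · exact ⟨0, fun h' => absurd h' h⟩
  -- a zero of the world function between `lo` and `hi`, which have opposite signs
  choose z hz using hex
  replace hz := hzero.mono fun ε h => hz ε h
  have hzt : Tendsto z (𝓝[>] 0) (𝓝 (s₀ + d)) :=
    tendsto_of_tendsto_of_tendsto_of_le_of_le' jlo.tendsto jhi.tendsto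
      (hz.mono fun ε h => h.1.1) (hz.mono fun ε h => h.1.2)
  have pB := hB.eventually_position hτ hzt
  have hlight := hΓ.eventually_isLightRay hWo hV hU hUW hφ hy
    (hA.tendsto_position hτ hV hU hφ hy hs.tendsto) (hB.tendsto_position hτ hV hU hφ hy hzt) (by
      have e1 : y' + (s₀ + d) • fieldInChart V φ y₀ - (y + s₀ • fieldInChart V φ y₀) =
          y' - y + d • fieldInChart V φ y₀ := by rw [add_smul]; abel
      rw [e1, map_add, hr, map_smul, smul_eq_mul, zero_add]
      exact mul_neg_of_pos_of_neg hd0 hvneg)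
  filter_upwards [hz, pA, pB, hlight, hsig, hAB, eventually_pos]
    with ε hz pA pB hlight hsig hAB hε
  rw [shortWorldFunction, pA.2, pB.2] at hlight
  have hsig' : Signal W (A ε) (B ε) (ε * s ε) (ε * z ε) := ⟨pA.1, pB.1, _, hlight hz.2⟩
  -- at the zero a light ray arrives, and there is only one
  have htz : t ε = z ε :=
    mul_left_cancel₀ hε.ne' (hAB.isSmoothCorrespondence.right_unique _ _ _ hsig hsig')
  rw [htz, Real.dist_eq, smul_eq_mul]
  have h1 := hz.1.1
  have h2 := hz.1.2
  simp only [hlo, hhi, smul_eq_mul] at h1 h2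
  have h3 : ε⁻¹ * (z ε - (s₀ + d)) - (s₁ + ψ) =
      ε⁻¹ * (z ε - (s₀ + d) - ε * (s₁ + ψ)) := by
    field_simp
  rw [h3, abs_mul, abs_of_pos (inv_pos.2 hε), inv_mul_lt_iff₀ hε]
  refine lt_of_le_of_lt (b := ε * η) (abs_le.2 ⟨?_, ?_⟩) ?_
  · linarith
  · linarith
  · gcongr; exact half_lt_self hη'

end LightJet

end

/-! ### Consequences of synchronizability -/

section

section Algebra

variable {G : E4 →L[ℝ] E4 →L[ℝ] ℝ} {DG : E4 →L[ℝ] E4 →L[ℝ] E4 →L[ℝ] ℝ} {v b c : E4}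
  {A : E4 →L[ℝ] E4}

theorem lieForm_symm (hsymm : ∀ a b, G a b = G b a) (hD : ∀ u a b, DG u a b = DG u b a)
    (a b : E4) : lieForm G DG v A a b = lieForm G DG v A b a := by
  rw [lieForm, lieForm, hD v a b, hsymm (A a) b, hsymm a (A b)]; ring

theorem lieForm_add_smul (hsymm : ∀ a b, G a b = G b a) (hD : ∀ u a b, DG u a b = DG u b a)
    (r : E4) (d : ℝ) : lieForm G DG v A (r + d • v) (r + d • v) =
      lieForm G DG v A r r + 2 * d * lieForm G DG v A r v + d ^ 2 * lieForm G DG v A v v := by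
  simp only [lieForm, map_add, map_smul, _root_.add_apply, _root_.smul_apply, smul_eq_mul]
  rw [hD v v r, hsymm v (A r), hsymm (A v) r]
  ring

theorem lieForm_neg (r : E4) : lieForm G DG v A (-r) (-r) = lieForm G DG v A r r := by
  simp [lieForm]

theorem lieForm_neg_left (r w : E4) : lieForm G DG v A (-r) w = -lieForm G DG v A r w := by
  simp only [lieForm, map_neg, _root_.neg_apply]; ring

theorem lieForm_neg_right (r w : E4) : lieForm G DG v A r (-w) = -lieForm G DG v A r w := by
  simp only [lieForm, map_neg]; ring

/-- The total shift of a round trip `y → y' → y`, as a function of the time of departure `s`. -/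
theorem lightShift_roundTrip (hsymm : ∀ a b, G a b = G b a) (hD : ∀ u a b, DG u a b = DG u b a)
    (hv : G v v ≠ 0) {d : ℝ} (hd : d ≠ 0) (y y' : E4) (s s' : ℝ) :
    lightShift G DG v A y y' d (s + s') + lightShift G DG v A y' y d (s + s' + d) -
      (lightShift G DG v A y y' d s + lightShift G DG v A y' y d (s + d)) =
      s' * (lieForm G DG v A (y' - y) (y' - y) + d ^ 2 * lieForm G DG v A v v) / (d * -G v v) := by
  have e : y - y' = -(y' - y) := by abel
  simp only [lightShift, lieForm_add_smul hsymm hD, e, lieForm_neg_left,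
    lieForm_neg_right, neg_neg]
  have hn : -G v v ≠ 0 := neg_ne_zero.2 hv
  generalize -G v v = n at *
  field_simp
  ring

/-- The condition that two echoes commute, for the expansions of the travel times. -/
theorem lieForm_mul_eq (hsymm : ∀ a b, G a b = G b a) (hD : ∀ u a b, DG u a b = DG u b a)
    (hv : G v v ≠ 0) {d₁ d₂ : ℝ} (hd₁ : d₁ ≠ 0) (hd₂ : d₂ ≠ 0)
    (hb : G b b = d₁ ^ 2 * -G v v) (hc : G c c = d₂ ^ 2 * -G v v)
    (h : lightShift G DG v A 0 b d₁ 0 + lightShift G DG v A b 0 d₁ d₁ +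
        lightShift G DG v A 0 c d₂ (2 * d₁) + lightShift G DG v A c 0 d₂ (2 * d₁ + d₂) =
      lightShift G DG v A 0 c d₂ 0 + lightShift G DG v A c 0 d₂ d₂ +
        lightShift G DG v A 0 b d₁ (2 * d₂) + lightShift G DG v A b 0 d₁ (2 * d₂ + d₁)) :
    lieForm G DG v A b b * G c c = lieForm G DG v A c c * G b b := by
  have h1 := lightShift_roundTrip (A := A) hsymm hD hv hd₁ 0 b 0 (2 * d₂)
  have h2 := lightShift_roundTrip (A := A) hsymm hD hv hd₂ 0 c 0 (2 * d₁)
  simp only [zero_add, sub_zero] at h1 h2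
  have h3 : 2 * d₂ * (lieForm G DG v A b b + d₁ ^ 2 * lieForm G DG v A v v) / (d₁ * -G v v) =
      2 * d₁ * (lieForm G DG v A c c + d₂ ^ 2 * lieForm G DG v A v v) / (d₂ * -G v v) := by
    rw [← h1, ← h2]; linear_combination -h
  rw [hb, hc]
  have hn : -G v v ≠ 0 := neg_ne_zero.2 hv
  generalize -G v v = n at *
  field_simp at h3
  linear_combination n * h3

/-- The shift of the travel time from `y` to `y'` without shear, where the Lie derivative of the
metric is `k` times the metric in the direction `y' - y`. The second fraction is the same for a
signal in the opposite direction. -/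
theorem lightShift_eq (hsymm : ∀ a b, G a b = G b a) (hD : ∀ u a b, DG u a b = DG u b a)
    (hv : G v v ≠ 0) {d k : ℝ} (hd : d ≠ 0) {y y' : E4}
    (hk : lieForm G DG v A (y' - y) (y' - y) = k * (d ^ 2 * -G v v)) (s : ℝ) :
    lightShift G DG v A y y' d s =
      ((s + d / 2) * (d * (k * -G v v + lieForm G DG v A v v) +
          2 * lieForm G DG v A (y' - y) v) + G (y' - y) (A (y + y')) + DG (y + y') (y' - y) v) /
        (2 * -G v v) +
      (d ^ 2 * G v (A (y + y')) + 1 / 2 * DG (y + y') (y' - y) (y' - y) +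
        d ^ 2 / 2 * DG (y + y') v v) / (2 * d * -G v v) := by
  rw [lightShift, lieForm_add_smul hsymm hD, hk]
  have hn : -G v v ≠ 0 := neg_ne_zero.2 hv
  generalize -G v v = n at *
  have h1 : ∀ Y r : E4, DG Y (r + d • v) (r + d • v) = DG Y r r + 2 * d * DG Y r v +
      d ^ 2 * DG Y v v := fun Y r => by
    simp only [map_add, map_smul, _root_.add_apply, _root_.smul_apply, smul_eq_mul]
    rw [hD Y v r]; ring
  rw [h1, map_add, map_smul, _root_.add_apply, _root_.smul_apply, smul_eq_mul]
  field_simp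
  ring

/-- Without shear, the difference between the shifts of two signals in opposite directions. -/
theorem lightShift_sub_reverse (hsymm : ∀ a b, G a b = G b a) (hD : ∀ u a b, DG u a b = DG u b a)
    (hv : G v v ≠ 0) {d k : ℝ} (hd : d ≠ 0) {y y' : E4}
    (hk : lieForm G DG v A (y' - y) (y' - y) = k * (d ^ 2 * -G v v)) (s s' : ℝ) :
    (lightShift G DG v A y y' d s - lightShift G DG v A y' y d s') * -G v v =
      1 / 2 * (s - s') * (d * (k * -G v v + lieForm G DG v A v v)) +
        (s + s' + d) * lieForm G DG v A (y' - y) v +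
        G (y' - y) (A (y + y')) + DG (y + y') (y' - y) v := by
  have e : y - y' = -(y' - y) := by abel
  have hk' : lieForm G DG v A (y - y') (y - y') = k * (d ^ 2 * -G v v) := by
    rw [e, lieForm_neg, hk]
  rw [lightShift_eq hsymm hD hv hd hk, lightShift_eq hsymm hD hv hd hk', add_comm y' y, e,
    lieForm_neg_left]
  have hn : -G v v ≠ 0 := neg_ne_zero.2 hv
  generalize -G v v = n at *
  simp only [map_neg, _root_.neg_apply]
  field_simp
  ring

/-- The condition that a signal running around a triangle takes the same time in both directions,
for the expansions of the travel times: on the orthogonal complement of `v` the exterior derivative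
of the one-form dual to `v` vanishes. -/
theorem curl_eq (hsymm : ∀ a b, G a b = G b a) (hD : ∀ u a b, DG u a b = DG u b a)
    (hv : G v v ≠ 0) {d₁ d₂ d₃ k : ℝ} (hd₁ : d₁ ≠ 0) (hd₂ : d₂ ≠ 0) (hd₃ : d₃ ≠ 0)
    (hb : lieForm G DG v A b b = k * (d₁ ^ 2 * -G v v))
    (hbc : lieForm G DG v A (c - b) (c - b) = k * (d₂ ^ 2 * -G v v))
    (hc : lieForm G DG v A c c = k * (d₃ ^ 2 * -G v v))
    (h : lightShift G DG v A 0 b d₁ 0 + lightShift G DG v A b c d₂ d₁ +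
        lightShift G DG v A c 0 d₃ (d₁ + d₂) =
      lightShift G DG v A 0 c d₃ 0 + lightShift G DG v A c b d₂ d₃ +
        lightShift G DG v A b 0 d₁ (d₃ + d₂)) :
    G c (A b) + DG b c v = G b (A c) + DG c b v := by
  have h1 := lightShift_sub_reverse (A := A) (y := 0) (y' := b) hsymm hD hv hd₁
    (by rwa [sub_zero]) 0 (d₃ + d₂)
  have h2 := lightShift_sub_reverse hsymm hD hv hd₂ hbc d₁ d₃
  have h3 := lightShift_sub_reverse (A := A) (y := 0) (y' := c) hsymm hD hv hd₃
    (by rwa [sub_zero]) 0 (d₁ + d₂)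
  have hl : lieForm G DG v A (c - b) v = lieForm G DG v A c v - lieForm G DG v A b v := by
    simp only [lieForm, map_sub, _root_.sub_apply]; ring
  rw [hl] at h2
  simp only [map_add, map_sub, map_zero, _root_.add_apply, _root_.sub_apply, _root_.zero_apply]
    at h1 h2 h3
  have h4 : lightShift G DG v A 0 b d₁ 0 - lightShift G DG v A b 0 d₁ (d₃ + d₂) +
      (lightShift G DG v A b c d₂ d₁ - lightShift G DG v A c b d₂ d₃) -
      (lightShift G DG v A 0 c d₃ 0 - lightShift G DG v A c 0 d₃ (d₁ + d₂)) = 0 := by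
    linear_combination h
  simp only [zero_add, sub_zero] at h1 h2 h3
  linear_combination -h1 - h2 + h3 + (-G v v) * h4

/-- The covariant derivative of the field `v` along `u`, paired with `w`. -/
noncomputable def covForm (G : E4 →L[ℝ] E4 →L[ℝ] ℝ) (DG : E4 →L[ℝ] E4 →L[ℝ] E4 →L[ℝ] ℝ) (v : E4)
    (A : E4 →L[ℝ] E4) (u w : E4) : ℝ :=
  G (A u) w + 1 / 2 * (DG v u w + DG u v w - DG w v u)

theorem covForm_eq (hsymm : ∀ a b, G a b = G b a) (hD : ∀ u a b, DG u a b = DG u b a)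
    (hcurl : G c (A b) + DG b c v = G b (A c) + DG c b v) :
    covForm G DG v A b c = 1 / 2 * lieForm G DG v A b c := by
  rw [covForm, lieForm, hsymm b (A c), hD b v c, hD c v b]
  rw [hsymm c (A b), hsymm b (A c)] at hcurl
  linear_combination 1 / 2 * hcurl

end Algebra

section Synchronization

variable {M : Type*} [TopologicalSpace M] [ChartedSpace E4 M] [IsManifold (𝓡 4) ∞ M]
  {g : LorentzMetric M} {T : TimeOrientation g} {W U : Set M}
  {V : (x : M) → TangentSpace (𝓡 4) x} {φ : OpenPartialHomeomorph M E4} {y₀ : E4}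

/-- The relations between the expansions of the travel times that follow if the clocks of an
observer field can be synchronized: three clocks through the positions `y₀ + ε y i` are used, for
`ε → 0`. -/
theorem lightShift_relations [T2Space M] (hV : IsObserverField T U V) (hU : IsOpen U) (hUW : U ⊆ W)
    (hW : IsConvexNhd g W) (hφ : φ ∈ atlas E4 M) (hy : y₀ ∈ chartDomain φ U)
    (hrad : ∀ A B : Clock T, A.IsClockOf U V → B.IsClockOf U V →
      Disjoint A.trajectory B.trajectory → InRadarNhd W A B)
    (hsync : ∀ K : Fin 3 → Clock T, (∀ i, (K i).IsClockOf U V) →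
      (Pairwise fun i j => Disjoint (K i).trajectory (K j).trajectory) → Synchronizable W K ⊤)
    {y : Fin 3 → E4} {d : Fin 3 → Fin 3 → ℝ}
    (hr : ∀ i j, g.inChart φ y₀ (fieldInChart V φ y₀) (y j - y i) = 0)
    (hd0 : ∀ i j, i ≠ j → 0 < d i j)
    (hd : ∀ i j, g.inChart φ y₀ (y j - y i) (y j - y i) =
      d i j ^ 2 * -g.inChart φ y₀ (fieldInChart V φ y₀) (fieldInChart V φ y₀)) :
    let ψ : Fin 3 → Fin 3 → ℝ → ℝ := fun i j =>
      lightShift (g.inChart φ y₀) (fderiv ℝ (g.inChart φ) y₀)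
        (fieldInChart V φ y₀) (fderiv ℝ (fieldInChart V φ) y₀) (y i) (y j) (d i j)
    ψ 0 1 0 + ψ 1 0 (d 0 1) + ψ 0 2 (d 0 1 + d 1 0) + ψ 2 0 (d 0 1 + d 1 0 + d 0 2) =
        ψ 0 2 0 + ψ 2 0 (d 0 2) + ψ 0 1 (d 0 2 + d 2 0) + ψ 1 0 (d 0 2 + d 2 0 + d 0 1) ∧
      ψ 0 1 0 + ψ 1 2 (d 0 1) + ψ 2 0 (d 0 1 + d 1 2) =
        ψ 0 2 0 + ψ 2 1 (d 0 2) + ψ 1 0 (d 0 2 + d 2 1) := by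
  intro ψ
  have hvneg := fieldInChart_timelike (g := g) hV hφ hy
  obtain ⟨τ, hτ, hfam⟩ := exists_clockFamily hV hU hUW hW hφ hy
  choose K hK using fun i => hfam (y i)
  have hdisj : ∀ᶠ ε in 𝓝[>] 0, Pairwise fun i j =>
      Disjoint (K i ε).trajectory (K j ε).trajectory := by
    have : ∀ i j, ∀ᶠ ε in 𝓝[>] 0, i ≠ j → Disjoint (K i ε).trajectory (K j ε).trajectory := by
      intro i j
      by_cases h : i = j
      · exact Eventually.of_forall fun ε h' => absurd h h'
      · refine ((hK i).eventually_disjoint (hK j) hτ hV hU hUW hW hφ hy ?_).mono fun ε h _ => h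
        rw [hd]
        have := hd0 i j h
        have h2 : 0 < -g.inChart φ y₀ (fieldInChart V φ y₀) (fieldInChart V φ y₀) := by linarith
        positivity
    filter_upwards [eventually_all.2 fun i => eventually_all.2 (this i)] with ε h i j hij
      using h i j hij
  have hcl : ∀ᶠ ε in 𝓝[>] 0, ∀ i, (K i ε).IsClockOf U V :=
    eventually_all.2 fun i => (hK i).choose_spec.mono fun ε h => h.1
  have htriple : ∀ᶠ ε in 𝓝[>] 0, (Pairwise fun i j => InRadarNhd W (K i ε) (K j ε)) ∧
      IsSynchronousTriple W (fun i => K i ε) := by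
    filter_upwards [hdisj, hcl] with ε h1 h2
    have h3 : Pairwise fun i j => InRadarNhd W (K i ε) (K j ε) :=
      fun i j hij => hrad _ _ (h2 i) (h2 j) (h1 hij)
    exact ⟨h3, isSynchronousTriple h3 (hsync _ h2 h1)⟩
  have leg : ∀ i j, i ≠ j → ∀ {s : ℝ → ℝ} {s₀ s₁ : ℝ}, HasJet s s₀ s₁ → ∃ t : ℝ → ℝ,
      HasJet t (s₀ + d i j) (s₁ + ψ i j s₀) ∧
      ∀ᶠ ε in 𝓝[>] 0, Signal W (K i ε) (K j ε) (ε * s ε) (ε * t ε) :=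
    fun i j hij s s₀ s₁ hs => exists_signal_jet (hK i) (hK j) hτ hV hU hUW hW hφ hy
      (htriple.mono fun ε h => h.1 hij) (hr i j) (hd0 i j hij) (hd i j) hs
  have h01 : (0 : Fin 3) ≠ 1 := by decide
  have h02 : (0 : Fin 3) ≠ 2 := by decide
  have h12 : (1 : Fin 3) ≠ 2 := by decide
  have j0 : HasJet (fun _ : ℝ => (0 : ℝ)) 0 0 := HasJet.const
  have conclude : ∀ {s s' : ℝ → ℝ} {a b a' b' : ℝ}, HasJet s a b → HasJet s' a' b' →
      (∀ᶠ ε in 𝓝[>] 0, ε * s ε = ε * s' ε) → b = b' := by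
    intro s s' a b a' b' h h' he
    have he' : s' =ᶠ[𝓝[>] 0] s := by
      filter_upwards [he, eventually_pos] with ε h1 h2
      exact (mul_left_cancel₀ h2.ne' h1).symm
    have h2 := h.congr he'
    have h3 : a' = a := tendsto_nhds_unique h'.tendsto h2.tendsto
    subst h3
    exact h2.unique h'
  constructor
  · obtain ⟨t₁, a1, b1⟩ := leg 0 1 h01 j0
    obtain ⟨t₂, a2, b2⟩ := leg 1 0 h01.symm a1
    obtain ⟨t₃, a3, b3⟩ := leg 0 2 h02 a2
    obtain ⟨t₄, a4, b4⟩ := leg 2 0 h02.symm a3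
    obtain ⟨u₁, p1, q1⟩ := leg 0 2 h02 j0
    obtain ⟨u₂, p2, q2⟩ := leg 2 0 h02.symm p1
    obtain ⟨u₃, p3, q3⟩ := leg 0 1 h01 p2
    obtain ⟨u₄, p4, q4⟩ := leg 1 0 h01.symm p3
    have := conclude a4 p4 (by
      filter_upwards [htriple, b1, b2, b3, b4, q1, q2, q3, q4] with ε h b1 b2 b3 b4 q1 q2 q3 q4
      exact h.2.echo b1 b2 b3 b4 q1 q2 q3 q4)
    simpa only [zero_add] using this
  · obtain ⟨t₁, a1, b1⟩ := leg 0 1 h01 j0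
    obtain ⟨t₂, a2, b2⟩ := leg 1 2 h12 a1
    obtain ⟨t₃, a3, b3⟩ := leg 2 0 h02.symm a2
    obtain ⟨u₁, p1, q1⟩ := leg 0 2 h02 j0
    obtain ⟨u₂, p2, q2⟩ := leg 2 1 h12.symm p1
    obtain ⟨u₃, p3, q3⟩ := leg 1 0 h01.symm p2
    have := conclude a3 p3 (by
      filter_upwards [htriple, b1, b2, b3, q1, q2, q3] with ε h b1 b2 b3 q1 q2 q3
      exact h.2.loop b1 b2 b3 q1 q2 q3)
    simpa only [zero_add] using this

theorem fderiv_inChart_symm (hφ : φ ∈ atlas E4 M) {y : E4} (hy : y ∈ φ.target) (u a b : E4) :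
    fderiv ℝ (g.inChart φ) y u a b = fderiv ℝ (g.inChart φ) y u b a := by
  have hG := (contDiffAt_inChart (g := g) hφ hy).differentiableAt (by simp)
  have h := fderiv_form_apply (v := a) (w := b) hG
  simp only [inChart_symm _ a b] at h
  rw [fderiv_form_apply hG] at h
  exact (congrArg (fun f : E4 →L[ℝ] ℝ => f u) h).symm

/-- If the clocks of an observer field can be synchronized, then the covariant derivative of the
field is, on its orthogonal complement, a multiple of the identity: the congruence of clocks has
neither rotation nor shear. -/
theorem exists_covForm_eq [T2Space M] (hV : IsObserverField T U V) (hU : IsOpen U) (hUW : U ⊆ W)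
    (hW : IsConvexNhd g W) (hφ : φ ∈ atlas E4 M) (hy : y₀ ∈ chartDomain φ U)
    (hrad : ∀ A B : Clock T, A.IsClockOf U V → B.IsClockOf U V →
      Disjoint A.trajectory B.trajectory → InRadarNhd W A B)
    (hsync : ∀ K : Fin 3 → Clock T, (∀ i, (K i).IsClockOf U V) →
      (Pairwise fun i j => Disjoint (K i).trajectory (K j).trajectory) → Synchronizable W K ⊤) :
    ∃ μ : ℝ, ∀ u w, g.inChart φ y₀ (fieldInChart V φ y₀) u = 0 →
      g.inChart φ y₀ (fieldInChart V φ y₀) w = 0 →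
      covForm (g.inChart φ y₀) (fderiv ℝ (g.inChart φ) y₀) (fieldInChart V φ y₀)
        (fderiv ℝ (fieldInChart V φ) y₀) u w = μ * g.inChart φ y₀ u w := by
  have hv := fieldInChart_timelike (g := g) hV hφ hy
  have hL : IsLorentzForm (g.inChart φ y₀) := isLorentzForm_inChart hφ hy.1
  have hsymm : ∀ a b, g.inChart φ y₀ a b = g.inChart φ y₀ b a := fun a b => inChart_symm y₀ a b
  have hD := fun u a b => fderiv_inChart_symm (g := g) hφ hy.1 u a b
  have rel := fun {y : Fin 3 → E4} {d} => lightShift_relations (y := y) (d := d) hV hU hUW hW hφ hy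
    hrad hsync
  generalize g.inChart φ y₀ = G at *
  generalize fderiv ℝ (g.inChart φ) y₀ = DG at *
  generalize fieldInChart V φ y₀ = v at *
  generalize fderiv ℝ (fieldInChart V φ) y₀ = A at *
  have hn : 0 < -G v v := by linarith
  -- the travel time of light, to first order
  let δ : E4 → ℝ := fun r => √(G r r / -G v v)
  have hδ : ∀ r, G v r = 0 → G r r = δ r ^ 2 * -G v v := fun r hr => by
    have : 0 ≤ G r r / -G v v := div_nonneg (hL.nonneg_of_orthogonal hv hr) hn.le
    rw [Real.sq_sqrt this, div_mul_cancel₀ _ hn.ne']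
  have hδ0 : ∀ r, G v r = 0 → r ≠ 0 → 0 < δ r := fun r hr h0 =>
    Real.sqrt_pos.2 (div_pos (hL.pos_of_orthogonal hv hr h0) hn)
  have hδn : ∀ r, δ (-r) = δ r := fun r => by simp [δ]
  have main : ∀ b c, G v b = 0 → G v c = 0 → b ≠ 0 → c ≠ 0 → b ≠ c →
      lieForm G DG v A b b * G c c = lieForm G DG v A c c * G b b ∧
      ∀ k, (∀ r, G v r = 0 → lieForm G DG v A r r = k * G r r) →
        G c (A b) + DG b c v = G b (A c) + DG c b v := by
    intro b c hb hc hb0 hc0 hbc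
    have hy : ∀ i, G v ((![0, b, c] : Fin 3 → E4) i) = 0 := by
      intro i; fin_cases i
      · simp
      · simpa using hb
      · simpa using hc
    have hr : ∀ i j, G v ((![0, b, c] : Fin 3 → E4) j - (![0, b, c] : Fin 3 → E4) i) = 0 :=
      fun i j => by rw [map_sub, hy, hy, sub_zero]
    have hinj : ∀ i j, i ≠ j → (![0, b, c] : Fin 3 → E4) j - (![0, b, c] : Fin 3 → E4) i ≠ 0 := by
      intro i j hij
      rw [sub_ne_zero]
      fin_cases i <;> fin_cases j <;> first
        | exact absurd rfl hij
        | simp [hb0, hc0, hbc, hb0.symm, hc0.symm, hbc.symm]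
    have h := rel (y := ![0, b, c])
      (d := fun i j => δ ((![0, b, c] : Fin 3 → E4) j - (![0, b, c] : Fin 3 → E4) i)) hr
      (fun i j hij => hδ0 _ (hr i j) (hinj i j hij)) (fun i j => hδ _ (hr i j))
    have e : b - c = -(c - b) := by abel
    simp only [Matrix.cons_val_zero, Matrix.cons_val_one, Matrix.cons_val, sub_zero, zero_sub, e,
      hδn] at h
    have d1 := (hδ0 b hb hb0).ne'
    have d2 := (hδ0 c hc hc0).ne'
    have hcb : G v (c - b) = 0 := by rw [map_sub, hb, hc, sub_zero]
    have d3 := (hδ0 (c - b) hcb (sub_ne_zero.2 hbc.symm)).ne'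
    -- the echo relation compares the Lie derivative of the metric in the directions `b` and `c`, and
    -- the loop relation yields the vanishing of the rotation
    refine ⟨lieForm_mul_eq hsymm hD hv.ne d1 d2 (hδ b hb) (hδ c hc) ?_, fun k hk => ?_⟩
    · simpa only [two_mul] using h.1
    · exact curl_eq (k := k) hsymm hD hv.ne d1 d3 d2 (by rw [hk b hb, ← hδ b hb])
        (by rw [hk _ hcb, ← hδ _ hcb]) (by rw [hk c hc, ← hδ c hc]) h.2
  obtain ⟨k, hk⟩ : ∃ k, ∀ r, G v r = 0 → lieForm G DG v A r r = k * G r r := by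
    by_cases h : ∃ b, G v b = 0 ∧ b ≠ 0
    · obtain ⟨b, hb, hb0⟩ := h
      have hbb := (hL.pos_of_orthogonal hv hb hb0).ne'
      refine ⟨lieForm G DG v A b b / G b b, fun r hr => ?_⟩
      by_cases hr0 : r = 0
      · simp [hr0, lieForm]
      by_cases hbr : b = r
      · rw [← hbr, div_mul_cancel₀ _ hbb]
      · have := (main b r hb hr hb0 hr0 hbr).1
        field_simp
        linarith
    · push Not at h
      exact ⟨0, fun r hr => by simp [h r hr, lieForm]⟩
  refine ⟨k / 2, fun u w hu hw => ?_⟩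
  -- polarization
  have hpol : lieForm G DG v A u w = k * G u w := by
    have h1 := hk (u + w) (by rw [map_add, hu, hw, add_zero])
    have h2 := hk u hu
    have h3 := hk w hw
    have h4 := lieForm_symm (A := A) (v := v) hsymm hD u w
    have h5 : lieForm G DG v A (u + w) (u + w) = lieForm G DG v A u u + lieForm G DG v A u w +
        lieForm G DG v A w u + lieForm G DG v A w w := by
      simp only [lieForm, map_add, _root_.add_apply]; ring
    simp only [map_add, _root_.add_apply] at h1
    rw [hsymm w u] at h1
    linarith
  rw [covForm_eq hsymm hD, hpol]
  · ring
  · by_cases hu0 : u = 0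
    · simp [hu0]
    by_cases hw0 : w = 0
    · simp [hw0]
    by_cases huw : u = w
    · rw [huw]
    · exact (main u w hu hw hu0 hw0 huw).2 k hk

end Synchronization

end

/-! ### The Pontryagin form -/

section

section Wedge

variable {E F : Type*} [AddCommGroup E] [Module ℝ E] [AddCommGroup F] [Module ℝ F]

/-- The wedge product of an `F`-valued two-form `R` with itself, for a symmetric bilinear form `K` on
`F`, up to a numerical factor. -/
def wedgeSquare (K : F → F → ℝ) (R : E → E → F) (a b c d : E) : ℝ :=
  K (R a b) (R c d) + K (R a c) (R d b) + K (R a d) (R b c)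

theorem wedgeSquare_eq_zero {K : F →ₗ[ℝ] F →ₗ[ℝ] ℝ} (hK : ∀ x y, K x y = K y x)
    {R : E →ₗ[ℝ] E →ₗ[ℝ] F} (hR : ∀ a, R a a = 0) (e : Module.Basis (Fin 4) ℝ E)
    (h : wedgeSquare (fun x y => K x y) (fun a b => R a b) (e 0) (e 1) (e 2) (e 3) = 0)
    (a b c d : E) : wedgeSquare (fun x y => K x y) (fun a b => R a b) a b c d = 0 := by
  have hR' : ∀ a b, R a b = -R b a := fun a b => by
    have := hR (a + b)
    simp only [map_add, LinearMap.add_apply, hR, zero_add, add_zero] at this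
    exact eq_neg_of_add_eq_zero_right this
  let f : E [⋀^Fin 4]→ₗ[ℝ] ℝ :=
    { toFun := fun u => wedgeSquare (fun x y => K x y) (fun a b => R a b) (u 0) (u 1) (u 2) (u 3)
      map_update_add' := by
        intro inst u i x y
        have : inst = instDecidableEqFin 4 := Subsingleton.elim _ _
        subst this
        fin_cases i <;> simp [wedgeSquare] <;> ring
      map_update_smul' := by
        intro inst u i x y
        have : inst = instDecidableEqFin 4 := Subsingleton.elim _ _
        subst this
        fin_cases i <;> simp [wedgeSquare] <;> ring
      map_eq_zero_of_eq' := by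
        have key : ∀ {a b c d : E}, a = b ∨ a = c ∨ a = d ∨ b = c ∨ b = d ∨ c = d →
            wedgeSquare (fun x y => K x y) (fun a b => R a b) a b c d = 0 := by
          rintro a b c d (rfl | rfl | rfl | rfl | rfl | rfl)
          · simp only [wedgeSquare, hR, map_zero, LinearMap.zero_apply]
            rw [hR' d a, map_neg, hK (R a c)]; ring
          · simp only [wedgeSquare, hR, map_zero, LinearMap.zero_apply]
            rw [hR' b a, map_neg, hK (R a b)]; ring
          · simp only [wedgeSquare, hR, map_zero, LinearMap.zero_apply]
            rw [hR' c a, map_neg, hK (R a b)]; ring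
          · simp only [wedgeSquare, hR, map_zero]
            rw [hR' d b, map_neg]; ring
          · simp only [wedgeSquare, hR, map_zero]
            rw [hR' c b, map_neg]; ring
          · simp only [wedgeSquare, hR, map_zero]
            rw [hR' c b, map_neg]; ring
        intro u i j hij hne
        refine key ?_
        fin_cases i <;> fin_cases j <;> first
          | exact absurd rfl hne
          | (simp only [Fin.reduceFinMk, Fin.zero_eta, Fin.mk_one, Fin.isValue] at hij
             simp [hij]) }
  have hf : f = 0 := by
    rw [f.eq_smul_basis_det e, show f e = 0 from h, zero_smul]
  have := congrArg (fun f : E [⋀^Fin 4]→ₗ[ℝ] ℝ => f ![a, b, c, d]) hf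
  simpa [f] using this

end Wedge

section TracePair

variable {E : Type*} [NormedAddCommGroup E] [NormedSpace ℝ E] {G : E →L[ℝ] E →L[ℝ] ℝ}
  {S : (E →L[ℝ] ℝ) →L[ℝ] E}

/-- The trace of the product of the endomorphisms that arise from two bilinear forms by raising an
index with `S`. -/
noncomputable def tracePair (S : (E →L[ℝ] ℝ) →L[ℝ] E) :
    (E →L[ℝ] E →L[ℝ] ℝ) →ₗ[ℝ] (E →L[ℝ] E →L[ℝ] ℝ) →ₗ[ℝ] ℝ :=
  LinearMap.mk₂ ℝ (fun α β => LinearMap.trace ℝ E ((S ∘L α).toLinearMap ∘ₗ (S ∘L β).toLinearMap))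
    (fun α α' β => by
      rw [ContinuousLinearMap.comp_add, ContinuousLinearMap.toLinearMap_add, LinearMap.add_comp,
        map_add])
    (fun c α β => by
      rw [ContinuousLinearMap.comp_smul, ContinuousLinearMap.toLinearMap_smul, LinearMap.smul_comp,
        map_smul])
    (fun α β β' => by
      rw [ContinuousLinearMap.comp_add, ContinuousLinearMap.toLinearMap_add, LinearMap.comp_add,
        map_add])
    (fun c α β => by
      rw [ContinuousLinearMap.comp_smul, ContinuousLinearMap.toLinearMap_smul, LinearMap.comp_smul,
        map_smul])

theorem tracePair_symm (α β : E →L[ℝ] E →L[ℝ] ℝ) : tracePair S α β = tracePair S β α :=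
  LinearMap.trace_mul_comm ℝ (S ∘L α).toLinearMap (S ∘L β).toLinearMap

/-- An orthogonal frame whose vectors, except for the first one, are unit vectors. -/
structure IsFrame (G : E →L[ℝ] E →L[ℝ] ℝ) (e : Fin 4 → E) : Prop where
  zero : G (e 0) (e 0) ≠ 0
  succ : ∀ i, i ≠ 0 → G (e i) (e i) = 1
  orthogonal : ∀ i j, i ≠ j → G (e i) (e j) = 0

theorem IsFrame.ne_zero {e : Fin 4 → E} (he : IsFrame G e) (i : Fin 4) : G (e i) (e i) ≠ 0 := by
  by_cases h : i = 0
  · rw [h]; exact he.zero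
  · rw [he.succ i h]; exact one_ne_zero

theorem IsFrame.repr {e : Module.Basis (Fin 4) ℝ E} (he : IsFrame G e) (x : E) (i : Fin 4) :
    e.repr x i = G x (e i) / G (e i) (e i) := by
  rw [eq_div_iff (he.ne_zero i)]
  conv_rhs => rw [← e.sum_repr x]
  rw [map_sum, _root_.sum_apply, Finset.sum_eq_single i]
  · simp
  · intro j _ hj
    simp [he.orthogonal j i hj]
  · simp

theorem IsFrame.tracePair_eq {e : Module.Basis (Fin 4) ℝ E} (he : IsFrame G e)
    (hS : ∀ f z, G (S f) z = f z) (α β : E →L[ℝ] E →L[ℝ] ℝ) :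
    tracePair S α β = ∑ i, ∑ j, β (e i) (e j) * α (e j) (e i) /
      (G (e j) (e j) * G (e i) (e i)) := by
  have h1 : tracePair S α β =
      LinearMap.trace ℝ E ((S ∘L α).toLinearMap ∘ₗ (S ∘L β).toLinearMap) := rfl
  rw [h1, LinearMap.trace_eq_matrix_trace ℝ e, Matrix.trace]
  refine Finset.sum_congr rfl fun i _ => ?_
  rw [Matrix.diag_apply, LinearMap.toMatrix_apply, he.repr]
  have h2 : G (((S ∘L α).toLinearMap ∘ₗ (S ∘L β).toLinearMap) (e i)) (e i) =
      α (S (β (e i))) (e i) := hS _ _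
  rw [h2]
  have h3 : S (β (e i)) = ∑ j, (β (e i) (e j) / G (e j) (e j)) • e j := by
    conv_lhs => rw [← e.sum_repr (S (β (e i)))]
    refine Finset.sum_congr rfl fun j _ => ?_
    rw [he.repr, hS]
  rw [h3, map_sum, _root_.sum_apply, Finset.sum_div]
  refine Finset.sum_congr rfl fun j _ => ?_
  rw [map_smul, _root_.smul_apply, smul_eq_mul]
  have := he.ne_zero i
  have := he.ne_zero j
  field_simp

theorem IsFrame.tracePair_eq_of_skew {e : Module.Basis (Fin 4) ℝ E} (he : IsFrame G e)
    (hS : ∀ f z, G (S f) z = f z) {α β : E →L[ℝ] E →L[ℝ] ℝ} (hα : ∀ x y, α x y = -α y x)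
    (hβ : ∀ x y, β x y = -β y x) :
    tracePair S α β = -2 * ((α (e 0) (e 1) * β (e 0) (e 1) + α (e 0) (e 2) * β (e 0) (e 2) +
        α (e 0) (e 3) * β (e 0) (e 3)) / G (e 0) (e 0) +
      (α (e 1) (e 2) * β (e 1) (e 2) + α (e 2) (e 3) * β (e 2) (e 3) +
        α (e 1) (e 3) * β (e 1) (e 3))) := by
  have hα0 : ∀ x, α x x = 0 := fun x => by linarith [hα x x]
  have h0 := he.zero
  rw [he.tracePair_eq hS]
  simp only [Fin.sum_univ_four, hα0, mul_zero, zero_div, he.succ 1 (by decide),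
    he.succ 2 (by decide), he.succ 3 (by decide)]
  rw [hα (e 1) (e 0), hα (e 2) (e 0), hα (e 3) (e 0), hα (e 2) (e 1), hα (e 3) (e 1),
    hα (e 3) (e 2), hβ (e 1) (e 0), hβ (e 2) (e 0), hβ (e 3) (e 0), hβ (e 2) (e 1),
    hβ (e 3) (e 1), hβ (e 3) (e 2)]
  field_simp
  ring

/-- If the curvature form, applied to the first vector of a frame, has the structure that a
rotation-free and shear-free congruence enforces, then its Pontryagin form vanishes on the frame. -/
theorem IsFrame.wedgeSquare_eq_zero {e : Module.Basis (Fin 4) ℝ E} (he : IsFrame G e)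
    (hS : ∀ f z, G (S f) z = f z) {R : E → E → E →L[ℝ] E →L[ℝ] ℝ} (hR : ∀ u v, R u v = -R v u)
    (hskew : ∀ u v w z, R u v w z = -R u v z w) (hpair : ∀ u v w z, R u v w z = R w z u v)
    {κ : E → ℝ} (hκ : ∀ u v w, G (e 0) u = 0 → G (e 0) v = 0 → G (e 0) w = 0 →
      R u v (e 0) w = κ u * G v w - κ v * G u w) :
    wedgeSquare (fun x y => tracePair S x y) R (e 0) (e 1) (e 2) (e 3) = 0 := by
  have o1 := he.orthogonal 0 1 (by decide)
  have o2 := he.orthogonal 0 2 (by decide)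
  have o3 := he.orthogonal 0 3 (by decide)
  have o12 := he.orthogonal 1 2 (by decide)
  have o21 := he.orthogonal 2 1 (by decide)
  have o13 := he.orthogonal 1 3 (by decide)
  have o31 := he.orthogonal 3 1 (by decide)
  have o23 := he.orthogonal 2 3 (by decide)
  have o32 := he.orthogonal 3 2 (by decide)
  have n1 := he.succ 1 (by decide)
  have n2 := he.succ 2 (by decide)
  have n3 := he.succ 3 (by decide)
  have hR' : ∀ u v w z, R u v w z = -R v u w z := fun u v w z => by rw [hR u v]; rfl
  have k : ∀ i j l, G (e 0) (e i) = 0 → G (e 0) (e j) = 0 → G (e 0) (e l) = 0 →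
      R (e 0) (e l) (e i) (e j) = κ (e i) * G (e j) (e l) - κ (e j) * G (e i) (e l) :=
    fun i j l hi hj hl => by rw [hpair, hκ _ _ _ hi hj hl]
  have hE : ∀ i j, R (e 0) (e i) (e 0) (e j) = R (e 0) (e j) (e 0) (e i) := fun i j => hpair _ _ _ _
  simp only [wedgeSquare, he.tracePair_eq_of_skew hS (hskew _ _) (hskew _ _)]
  rw [hκ (e 2) (e 3) (e 1) o2 o3 o1, hκ (e 2) (e 3) (e 2) o2 o3 o2, hκ (e 2) (e 3) (e 3) o2 o3 o3,
    hκ (e 3) (e 1) (e 1) o3 o1 o1, hκ (e 3) (e 1) (e 2) o3 o1 o2, hκ (e 3) (e 1) (e 3) o3 o1 o3,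
    hκ (e 1) (e 2) (e 1) o1 o2 o1, hκ (e 1) (e 2) (e 2) o1 o2 o2, hκ (e 1) (e 2) (e 3) o1 o2 o3,
    k 1 2 1 o1 o2 o1, k 2 3 1 o2 o3 o1, k 1 3 1 o1 o3 o1, k 1 2 2 o1 o2 o2, k 2 3 2 o2 o3 o2,
    k 1 3 2 o1 o3 o2, k 1 2 3 o1 o2 o3, k 2 3 3 o2 o3 o3, k 1 3 3 o1 o3 o3,
    hR' (e 3) (e 1) (e 1) (e 2), hR' (e 3) (e 1) (e 2) (e 3), hR' (e 3) (e 1) (e 1) (e 3),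
    hpair (e 1) (e 3) (e 1) (e 2), hpair (e 2) (e 3) (e 1) (e 2), hpair (e 2) (e 3) (e 1) (e 3),
    hE 2 1, hE 3 1, hE 3 2]
  simp only [o12, o21, o13, o31, o23, o32, n1, n2, n3]
  ring

end TracePair

section Frame

variable {b : E4 →L[ℝ] E4 →L[ℝ] ℝ} {v : E4}

theorem exists_orthogonal {n : ℕ} (hn : n < 4) (f : Fin n → E4 →L[ℝ] ℝ) :
    ∃ x : E4, x ≠ 0 ∧ ∀ i, f i x = 0 := by
  let L : E4 →ₗ[ℝ] Fin n → ℝ := LinearMap.pi fun i => (f i).toLinearMap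
  have h : LinearMap.ker L ≠ ⊥ := LinearMap.ker_ne_bot_of_finrank_lt (by simpa using hn)
  obtain ⟨x, hx, hx0⟩ := Submodule.exists_mem_ne_zero_of_ne_bot h
  exact ⟨x, hx0, fun i => congrFun (LinearMap.mem_ker.1 hx) i⟩

theorem IsLorentzForm.exists_unit (hb : IsLorentzForm b) (hv : b v v < 0) {n : ℕ} (hn : n < 3)
    (f : Fin n → E4) : ∃ x : E4, b v x = 0 ∧ b x x = 1 ∧ ∀ i, b (f i) x = 0 := by
  obtain ⟨x, hx0, hx⟩ := exists_orthogonal (n := n + 1) (by omega)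
    (Fin.cons (b v) fun i => b (f i))
  have hvx : b v x = 0 := hx 0
  have hpos := hb.pos_of_orthogonal hv hvx hx0
  refine ⟨(√(b x x))⁻¹ • x, ?_, ?_, fun i => ?_⟩
  · rw [map_smul, hvx, smul_zero]
  · have h := Real.mul_self_sqrt hpos.le
    have h0 : √(b x x) ≠ 0 := (Real.sqrt_pos.2 hpos).ne'
    rw [map_smul, map_smul, _root_.smul_apply, smul_eq_mul, smul_eq_mul]
    field_simp
    rw [sq, h]
  · have : b (f i) x = 0 := hx i.succ
    rw [map_smul, this, smul_zero]

/-- A timelike vector extends to an orthogonal frame, by the Gram–Schmidt process. -/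
theorem IsLorentzForm.exists_frame (hb : IsLorentzForm b) (hs : ∀ x y, b x y = b y x)
    (hv : b v v < 0) : ∃ e : Module.Basis (Fin 4) ℝ E4, e 0 = v ∧ IsFrame b e := by
  obtain ⟨x, x1, x2, -⟩ := hb.exists_unit hv (n := 0) (by omega) ![]
  obtain ⟨y, y1, y2, y3⟩ := hb.exists_unit hv (n := 1) (by omega) ![x]
  obtain ⟨z, z1, z2, z3⟩ := hb.exists_unit hv (n := 2) (by omega) ![x, y]
  have y3' : b x y = 0 := by simpa using y3 0
  have z3' : b x z = 0 := by simpa using z3 0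
  have z4' : b y z = 0 := by simpa using z3 1
  let f : Fin 4 → E4 := ![v, x, y, z]
  have hf : IsFrame b f := by
    refine ⟨hv.ne, fun i hi => ?_, fun i j hij => ?_⟩
    · fin_cases i
      · exact absurd rfl hi
      · exact x2
      · exact y2
      · exact z2
    · fin_cases i <;> fin_cases j <;> first
        | exact absurd rfl hij
        | assumption
        | (rw [hs]; assumption)
  have hli : LinearIndependent ℝ f := by
    rw [Fintype.linearIndependent_iff]
    intro g hg i
    have h1 := congrArg (fun x => b x (f i)) hg
    simp only [map_sum, map_smul, _root_.sum_apply, _root_.smul_apply, smul_eq_mul, map_zero,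
      _root_.zero_apply] at h1
    rw [Finset.sum_eq_single i (fun j _ hj => by rw [hf.orthogonal j i hj, mul_zero])
      (by simp)] at h1
    exact (mul_eq_zero.1 h1).resolve_right (hf.ne_zero i)
  refine ⟨basisOfLinearIndependentOfCardEqFinrank hli (by simp), by simp [f], ?_⟩
  rwa [coe_basisOfLinearIndependentOfCardEqFinrank]

end Frame

end

/-! ### The curvature form -/

section

section Curvature

variable {E : Type*} [NormedAddCommGroup E] [NormedSpace ℝ E] {G : E →L[ℝ] E →L[ℝ] ℝ}
  {S : (E →L[ℝ] ℝ) →L[ℝ] E} {DG : E →L[ℝ] E →L[ℝ] E →L[ℝ] ℝ}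
  {HG : E →L[ℝ] E →L[ℝ] E →L[ℝ] E →L[ℝ] ℝ}

/-- The Christoffel symbols, as an endomorphism for every first argument, of a metric with first
derivative `DG` and inverse `S`. -/
noncomputable def christoffel (S : (E →L[ℝ] ℝ) →L[ℝ] E) (DG : E →L[ℝ] E →L[ℝ] E →L[ℝ] ℝ) (u : E) :
    E →L[ℝ] E :=
  S ∘L ((1 / 2 : ℝ) • (DG u + DG.flip u - (DG.flip u).flip))

/-- The curvature tensor `G(R(u, v) w, z)` with all indices lowered, in terms of the values `G`,
`DG`, `HG` of a metric and its first two derivatives. -/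
noncomputable def curvatureForm (S : (E →L[ℝ] ℝ) →L[ℝ] E) (G : E →L[ℝ] E →L[ℝ] ℝ)
    (DG : E →L[ℝ] E →L[ℝ] E →L[ℝ] ℝ) (HG : E →L[ℝ] E →L[ℝ] E →L[ℝ] E →L[ℝ] ℝ) (u v : E) :
    E →L[ℝ] E →L[ℝ] ℝ :=
  (1 / 2 : ℝ) • ((HG u).flip v - ((HG u).flip v).flip - ((HG v).flip u - ((HG v).flip u).flip)) +
    (G.bilinearComp (christoffel S DG u) (christoffel S DG v) -
      G.bilinearComp (christoffel S DG v) (christoffel S DG u))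

theorem curvatureForm_apply (u v w z : E) : curvatureForm S G DG HG u v w z =
    1 / 2 * (HG u w v z - HG u z v w - (HG v w u z - HG v z u w)) +
      (G (christoffel S DG u w) (christoffel S DG v z) -
        G (christoffel S DG v w) (christoffel S DG u z)) := rfl

theorem inner_christoffel (hS : ∀ f z, G (S f) z = f z) (u w z : E) :
    G (christoffel S DG u w) z = 1 / 2 * (DG u w z + DG w u z - DG z u w) :=
  hS _ _

theorem christoffel_symm (hD : ∀ u a b, DG u a b = DG u b a) (u w : E) :
    christoffel S DG u w = christoffel S DG w u := by
  refine congrArg S (ContinuousLinearMap.ext fun z => ?_)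
  change 1 / 2 * (DG u w z + DG w u z - DG z u w) = 1 / 2 * (DG w u z + DG u w z - DG z w u)
  rw [hD z u w]; ring

theorem curvatureForm_swap (u v : E) : curvatureForm S G DG HG u v = -curvatureForm S G DG HG v u := by
  refine ContinuousLinearMap.ext fun w => ContinuousLinearMap.ext fun z => ?_
  rw [_root_.neg_apply, _root_.neg_apply, curvatureForm_apply, curvatureForm_apply]
  ring

theorem curvatureForm_skew (hG : ∀ a b, G a b = G b a) (u v w z : E) :
    curvatureForm S G DG HG u v w z = -curvatureForm S G DG HG u v z w := by
  rw [curvatureForm_apply, curvatureForm_apply, hG (christoffel S DG u z),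
    hG (christoffel S DG v z)]
  ring

theorem curvatureForm_pair (hG : ∀ a b, G a b = G b a) (hD : ∀ u a b, DG u a b = DG u b a)
    (hH : ∀ u v a b, HG u v a b = HG u v b a) (hH' : ∀ u v, HG u v = HG v u) (u v w z : E) :
    curvatureForm S G DG HG u v w z = curvatureForm S G DG HG w z u v := by
  rw [curvatureForm_apply, curvatureForm_apply, christoffel_symm hD w u, christoffel_symm hD w v,
    christoffel_symm hD z u, christoffel_symm hD z v, hH' w u, hH' w v, hH' z u, hH' z v,
    hG (christoffel S DG u z), hH u w z v, hH v w z u, hH u z w v, hH v z w u]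
  ring

theorem curvatureForm_add (u u' v : E) : curvatureForm S G DG HG (u + u') v =
    curvatureForm S G DG HG u v + curvatureForm S G DG HG u' v := by
  have h : ∀ w, christoffel S DG (u + u') w = christoffel S DG u w + christoffel S DG u' w :=
    fun w => by
      change S ((1 / 2 : ℝ) • (DG (u + u') w + DG w (u + u') - (DG.flip (u + u')).flip w)) =
        S ((1 / 2 : ℝ) • (DG u w + DG w u - (DG.flip u).flip w)) +
        S ((1 / 2 : ℝ) • (DG u' w + DG w u' - (DG.flip u').flip w))
      rw [← map_add, ← smul_add]
      congr 2
      refine ContinuousLinearMap.ext fun z => ?_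
      simp only [map_add, _root_.add_apply, _root_.sub_apply, ContinuousLinearMap.flip_apply]
      ring
  refine ContinuousLinearMap.ext fun w => ContinuousLinearMap.ext fun z => ?_
  rw [_root_.add_apply, _root_.add_apply, curvatureForm_apply, curvatureForm_apply,
    curvatureForm_apply, h, h]
  simp only [map_add, _root_.add_apply]
  ring

theorem curvatureForm_smul (c : ℝ) (u v : E) : curvatureForm S G DG HG (c • u) v =
    c • curvatureForm S G DG HG u v := by
  have h : ∀ w, christoffel S DG (c • u) w = c • christoffel S DG u w :=
    fun w => by
      change S ((1 / 2 : ℝ) • (DG (c • u) w + DG w (c • u) - (DG.flip (c • u)).flip w)) =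
        c • S ((1 / 2 : ℝ) • (DG u w + DG w u - (DG.flip u).flip w))
      rw [← map_smul, smul_comm c]
      congr 2
      refine ContinuousLinearMap.ext fun z => ?_
      simp only [map_smul, _root_.add_apply, _root_.sub_apply, _root_.smul_apply, smul_eq_mul,
        ContinuousLinearMap.flip_apply]
      ring
  refine ContinuousLinearMap.ext fun w => ContinuousLinearMap.ext fun z => ?_
  rw [_root_.smul_apply, _root_.smul_apply, curvatureForm_apply, curvatureForm_apply, h, h]
  simp only [map_smul, _root_.smul_apply, smul_eq_mul]
  ring

theorem curvatureForm_add_right (u v v' : E) : curvatureForm S G DG HG u (v + v') =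
    curvatureForm S G DG HG u v + curvatureForm S G DG HG u v' := by
  rw [curvatureForm_swap, curvatureForm_add, neg_add, ← curvatureForm_swap, ← curvatureForm_swap]

theorem curvatureForm_smul_right (c : ℝ) (u v : E) : curvatureForm S G DG HG u (c • v) =
    c • curvatureForm S G DG HG u v := by
  rw [curvatureForm_swap, curvatureForm_smul, ← smul_neg, ← curvatureForm_swap]

/-- The Pontryagin form `tr R ∧ R`, up to a numerical factor, of a metric with the value `G`, the
first derivative `DG` and the second derivative `HG`; `S` is the inverse of `G`. -/
noncomputable def pontryagin (S : (E →L[ℝ] ℝ) →L[ℝ] E) (G : E →L[ℝ] E →L[ℝ] ℝ)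
    (DG : E →L[ℝ] E →L[ℝ] E →L[ℝ] ℝ) (HG : E →L[ℝ] E →L[ℝ] E →L[ℝ] E →L[ℝ] ℝ) (a b c d : E) : ℝ :=
  wedgeSquare (fun x y => tracePair S x y) (curvatureForm S G DG HG) a b c d

theorem pontryagin_eq_zero_of_basis {e : Module.Basis (Fin 4) ℝ E}
    (h : pontryagin S G DG HG (e 0) (e 1) (e 2) (e 3) = 0) (a b c d : E) :
    pontryagin S G DG HG a b c d = 0 := by
  refine wedgeSquare_eq_zero (K := tracePair S) tracePair_symm
    (R := LinearMap.mk₂ ℝ (curvatureForm S G DG HG) curvatureForm_add curvatureForm_smul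
      curvatureForm_add_right curvatureForm_smul_right) (fun a => ?_) e h a b c d
  refine ContinuousLinearMap.ext fun w => ContinuousLinearMap.ext fun z => ?_
  have h1 : curvatureForm S G DG HG a a w z = -curvatureForm S G DG HG a a w z :=
    congrArg (fun f : E →L[ℝ] E →L[ℝ] ℝ => f w z) (curvatureForm_swap a a)
  exact self_eq_neg.1 h1

end Curvature

section Congruence

variable {E : Type*} [NormedAddCommGroup E] [NormedSpace ℝ E] {G : E → E →L[ℝ] E →L[ℝ] ℝ}
  {S : (E →L[ℝ] ℝ) →L[ℝ] E} {v : E → E} {y : E}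

/-- The covariant derivative of the vector field `v`, with the index lowered, as a field of bilinear
forms. -/
noncomputable def covField (G : E → E →L[ℝ] E →L[ℝ] ℝ) (v : E → E) (y : E) : E →L[ℝ] E →L[ℝ] ℝ :=
  G y ∘L fderiv ℝ v y + (1 / 2 : ℝ) • (fderiv ℝ G y (v y) + (fderiv ℝ G y).flip (v y) -
    ((fderiv ℝ G y).flip (v y)).flip)

theorem covField_apply (y u w : E) : covField G v y u w = G y (fderiv ℝ v y u) w +
    1 / 2 * (fderiv ℝ G y (v y) u w + fderiv ℝ G y u (v y) w - fderiv ℝ G y w (v y) u) := rfl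

theorem hasFDerivAt_covField_apply (hG : ContDiffAt ℝ 2 G y) (hv : ContDiffAt ℝ 2 v y)
    {a c : E → E} {a' c' : E →L[ℝ] E} (ha : HasFDerivAt a a' y) (hc : HasFDerivAt c c' y) :
    ∃ L : E →L[ℝ] ℝ, HasFDerivAt (fun y => covField G v y (a y) (c y)) L y ∧
      ∀ u, L u = fderiv ℝ G y u (fderiv ℝ v y (a y)) (c y) +
        G y (fderiv ℝ (fderiv ℝ v) y u (a y)) (c y) +
        1 / 2 * (fderiv ℝ (fderiv ℝ G) y u (v y) (a y) (c y) +
          fderiv ℝ G y (fderiv ℝ v y u) (a y) (c y) +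
          (fderiv ℝ (fderiv ℝ G) y u (a y) (v y) (c y) +
            fderiv ℝ G y (a y) (fderiv ℝ v y u) (c y)) -
          (fderiv ℝ (fderiv ℝ G) y u (c y) (v y) (a y) +
            fderiv ℝ G y (c y) (fderiv ℝ v y u) (a y))) +
        (covField G v y (a' u) (c y) + covField G v y (a y) (c' u)) := by
  have dG : HasFDerivAt G (fderiv ℝ G y) y := (hG.differentiableAt (by simp)).hasFDerivAt
  have dv : HasFDerivAt v (fderiv ℝ v y) y := (hv.differentiableAt (by simp)).hasFDerivAt
  have ddG : HasFDerivAt (fderiv ℝ G) (fderiv ℝ (fderiv ℝ G) y) y :=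
    ((hG.fderiv_right (m := 1) (by norm_num)).differentiableAt (by simp)).hasFDerivAt
  have ddv : HasFDerivAt (fderiv ℝ v) (fderiv ℝ (fderiv ℝ v) y) y :=
    ((hv.fderiv_right (m := 1) (by norm_num)).differentiableAt (by simp)).hasFDerivAt
  have h1 := (dG.clm_apply (ddv.clm_apply ha)).clm_apply hc
  have h2 := ((ddG.clm_apply dv).clm_apply ha).clm_apply hc
  have h3 := ((ddG.clm_apply ha).clm_apply dv).clm_apply hc
  have h4 := ((ddG.clm_apply hc).clm_apply dv).clm_apply ha
  refine ⟨_, h1.add (((h2.add h3).sub h4).const_mul (1 / 2)), fun u => ?_⟩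
  simp only [covField_apply, _root_.add_apply, _root_.sub_apply, _root_.smul_apply, smul_eq_mul,
    ContinuousLinearMap.comp_apply, ContinuousLinearMap.flip_apply, map_add]
  ring

theorem fderiv_form_symm (hG : DifferentiableAt ℝ G y)
    (hsymm : ∀ᶠ z in 𝓝 y, ∀ a b, G z a b = G z b a) (u a b : E) :
    fderiv ℝ G y u a b = fderiv ℝ G y u b a := by
  have h : fderiv ℝ (fun z => G z a b) y = fderiv ℝ (fun z => G z b a) y :=
    Filter.EventuallyEq.fderiv_eq (hsymm.mono fun z h => h a b)
  rw [fderiv_form_apply hG, fderiv_form_apply hG] at h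
  exact congrArg (fun f : E →L[ℝ] ℝ => f u) h

theorem fderiv_fderiv_form_symm (hG : ContDiffAt ℝ 2 G y)
    (hsymm : ∀ᶠ z in 𝓝 y, ∀ a b, G z a b = G z b a) (u w a b : E) :
    fderiv ℝ (fderiv ℝ G) y u w a b = fderiv ℝ (fderiv ℝ G) y u w b a := by
  have ddG : HasFDerivAt (fderiv ℝ G) (fderiv ℝ (fderiv ℝ G) y) y :=
    ((hG.fderiv_right (m := 1) (by norm_num)).differentiableAt (by simp)).hasFDerivAt
  have h1 := ddG.clm_apply (hasFDerivAt_const w y)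
  have h2 := fderiv_form_symm (G := fun z => fderiv ℝ G z w) h1.differentiableAt (by
    have h3 : ∀ᶠ z in 𝓝 y, ContDiffAt ℝ 2 G z := hG.eventually (by simp)
    filter_upwards [h3, hsymm.eventually_nhds] with z h3 h4
    exact fderiv_form_symm (h3.differentiableAt (by simp)) h4 w) u a b
  rw [h1.fderiv] at h2
  simpa using h2

/-- The Ricci identity. -/
theorem ricci_identity (hG : ContDiffAt ℝ 2 G y) (hv : ContDiffAt ℝ 2 v y)
    (hsymm : ∀ a b, G y a b = G y b a) (hS : ∀ f z, G y (S f) z = f z)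
    (hD : ∀ u a b, fderiv ℝ G y u a b = fderiv ℝ G y u b a)
    (hH : ∀ u w, fderiv ℝ (fderiv ℝ G) y u w = fderiv ℝ (fderiv ℝ G) y w u)
    (hH' : ∀ u w a b, fderiv ℝ (fderiv ℝ G) y u w a b = fderiv ℝ (fderiv ℝ G) y u w b a)
    (hB : ∀ u w, fderiv ℝ (fderiv ℝ v) y u w = fderiv ℝ (fderiv ℝ v) y w u) (u b c : E) :
    curvatureForm S (G y) (fderiv ℝ G y) (fderiv ℝ (fderiv ℝ G) y) u b (v y) c =
      fderiv ℝ (fun y => covField G v y b c) y u - fderiv ℝ (fun y => covField G v y u c) y b -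
      covField G v y b (christoffel S (fderiv ℝ G y) u c) +
      covField G v y u (christoffel S (fderiv ℝ G y) b c) := by
  obtain ⟨L, hL, hLu⟩ := hasFDerivAt_covField_apply hG hv (hasFDerivAt_const b y)
    (hasFDerivAt_const c y)
  obtain ⟨L', hL', hLu'⟩ := hasFDerivAt_covField_apply hG hv (hasFDerivAt_const u y)
    (hasFDerivAt_const c y)
  rw [hL.fderiv, hL'.fderiv, hLu, hLu']
  have hN : ∀ w X, covField G v y w X = G y X (fderiv ℝ v y w) +
      G y (christoffel S (fderiv ℝ G y) w (v y)) X := fun w X => by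
    rw [covField_apply, inner_christoffel hS, hsymm X, hD X w (v y)]
    ring
  simp only [_root_.zero_apply, map_zero, add_zero]
  rw [hN, hN, inner_christoffel hS u c, inner_christoffel hS b c, curvatureForm_apply,
    hB b u, hH b u]
  rw [hD u c, hD b c, hD c u, hD c b, hD _ u c, hD _ b c, hH' u c b, hH' b c u]
  ring

/-- The curvature of a metric that admits a rotation-free and shear-free congruence. -/
theorem exists_curvature_eq (hG : ContDiffAt ℝ 2 G y) (hv : ContDiffAt ℝ 2 v y)
    (hsymm : ∀ z a b, G z a b = G z b a) (hS : ∀ f z, G y (S f) z = f z)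
    (hv0 : G y (v y) (v y) ≠ 0) {e : E} (he : G y (v y) e = 0) (he0 : G y e e ≠ 0) {μ : E → ℝ}
    (hμ : ∀ᶠ z in 𝓝 y, ∀ a c, G z (v z) a = 0 → G z (v z) c = 0 →
      covField G v z a c = μ z * G z a c) :
    ∃ κ : E → ℝ, ∀ a b c, G y (v y) a = 0 → G y (v y) b = 0 → G y (v y) c = 0 →
      curvatureForm S (G y) (fderiv ℝ G y) (fderiv ℝ (fderiv ℝ G) y) a b (v y) c =
        κ a * G y b c - κ b * G y a c := by
  have dG : HasFDerivAt G (fderiv ℝ G y) y := (hG.differentiableAt (by simp)).hasFDerivAt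
  have dv : HasFDerivAt v (fderiv ℝ v y) y := (hv.differentiableAt (by simp)).hasFDerivAt
  -- projection to the orthogonal complement of `v`
  set p : E → E → E := fun a z => a - (G z (v z) a * (G z (v z) (v z))⁻¹) • v z with hp
  have hθ : ∀ᶠ z in 𝓝 y, G z (v z) (v z) ≠ 0 :=
    ((dG.clm_apply dv).clm_apply dv).continuousAt.eventually_ne hv0
  have hpo : ∀ᶠ z in 𝓝 y, ∀ a, G z (v z) (p a z) = 0 := by
    filter_upwards [hθ] with z hz a
    simp only [hp, map_sub, map_smul, smul_eq_mul, inv_mul_cancel_right₀ hz, sub_self]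
  have hp0 : ∀ a, G y (v y) a = 0 → p a y = a := fun a ha => by simp [hp, ha]
  have hpd : ∀ a, G y (v y) a = 0 → ∃ L : E →L[ℝ] E, HasFDerivAt (p a) L y ∧ ∀ u, L u =
      -((fderiv ℝ G y u (v y) a + G y (fderiv ℝ v y u) a) / G y (v y) (v y)) • v y := by
    intro a ha
    have h1 := (dG.clm_apply dv).clm_apply (hasFDerivAt_const a y)
    have h2 := (dG.clm_apply dv).clm_apply dv
    have h3 := (h1.mul ((hasDerivAt_inv hv0).comp_hasFDerivAt y h2)).smul dv
    refine ⟨_, h3.const_sub a, fun u => ?_⟩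
    simp [ha]
    congr 1
    field_simp
    ring
  have hGd : ∀ {a c : E → E} {a' c' : E →L[ℝ] E}, HasFDerivAt a a' y → HasFDerivAt c c' y →
      ∃ L : E →L[ℝ] ℝ, HasFDerivAt (fun z => G z (a z) (c z)) L y ∧ ∀ u, L u =
        fderiv ℝ G y u (a y) (c y) + G y (a' u) (c y) + G y (a y) (c' u) := by
    intro a c a' c' ha hc
    refine ⟨_, (dG.clm_apply ha).clm_apply hc, fun u => ?_⟩
    simp
    ring
  -- the factor `μ` is differentiable
  obtain ⟨m, hm⟩ : ∃ m : E →L[ℝ] ℝ, HasFDerivAt μ m y := by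
    obtain ⟨L, hL, -⟩ := hpd e he
    obtain ⟨N', hN', -⟩ := hasFDerivAt_covField_apply hG hv hL hL
    obtain ⟨G', hG', -⟩ := hGd hL hL
    have hne : G y (p e y) (p e y) ≠ 0 := by rw [hp0 e he]; exact he0
    refine ⟨_, (hN'.mul ((hasDerivAt_inv hne).comp_hasFDerivAt y hG')).congr_of_eventuallyEq ?_⟩
    filter_upwards [hμ, hpo, hG'.continuousAt.eventually_ne hne] with z h1 h2 h3
    simp only [Pi.mul_apply, Function.comp_apply]
    rw [h1 _ _ (h2 e) (h2 e), mul_inv_cancel_right₀ h3]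
  have hμy := hμ.self_of_nhds
  -- the equation for `μ` holds for the projections of constant vectors, near `y`; it is
  -- differentiated at `y`
  have hder : ∀ u a c, G y (v y) a = 0 → G y (v y) c = 0 →
      fderiv ℝ (fun z => covField G v z a c) y u = m u * G y a c + μ y * fderiv ℝ G y u a c +
        (fderiv ℝ G y u (v y) a + G y (fderiv ℝ v y u) a) / G y (v y) (v y) *
          covField G v y (v y) c +
        (fderiv ℝ G y u (v y) c + G y (fderiv ℝ v y u) c) / G y (v y) (v y) *
          covField G v y a (v y) := by
    intro u a c ha hc
    obtain ⟨La, hLa, ea⟩ := hpd a ha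
    obtain ⟨Lc, hLc, ec⟩ := hpd c hc
    obtain ⟨L, hL, eL⟩ := hasFDerivAt_covField_apply hG hv hLa hLc
    obtain ⟨K, hK, eK⟩ := hasFDerivAt_covField_apply hG hv (hasFDerivAt_const a y)
      (hasFDerivAt_const c y)
    obtain ⟨G', hG', eG⟩ := hGd hLa hLc
    have heq : (fun z => covField G v z (p a z) (p c z)) =ᶠ[𝓝 y]
        fun z => μ z * G z (p a z) (p c z) := by
      filter_upwards [hμ, hpo] with z h1 h2 using h1 _ _ (h2 a) (h2 c)
    have h1 := (hL.congr_of_eventuallyEq heq.symm).unique (hm.mul hG')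
    have h2 : L u = (μ y • G' + G y (p a y) (p c y) • m) u := by rw [h1]
    rw [eL, hp0 a ha, hp0 c hc, _root_.add_apply, _root_.smul_apply, _root_.smul_apply, eG,
      hp0 a ha, hp0 c hc, ea, ec] at h2
    rw [hK.fderiv, eK]
    simp only [_root_.zero_apply, map_zero, add_zero, map_smul, _root_.smul_apply, smul_eq_mul,
      hc, hsymm y a (v y), ha, mul_zero] at h2 ⊢
    linear_combination h2
  refine ⟨fun u => m u - μ y * (covField G v y u (v y) / G y (v y) (v y)), fun u b c hu hb hc => ?_⟩
  have hD := fderiv_form_symm dG.differentiableAt (Eventually.of_forall hsymm)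
  rw [ricci_identity hG hv (hsymm y) hS hD (hG.isSymmSndFDerivAt (by simp)).eq
    (fderiv_fderiv_form_symm hG (Eventually.of_forall hsymm)) (hv.isSymmSndFDerivAt (by simp)).eq, hder u b c hb hc, hder b u c hu hc]
  have hN : ∀ b X, G y (v y) b = 0 → covField G v y b X = μ y * G y b X +
      G y (v y) X / G y (v y) (v y) * covField G v y b (v y) := by
    intro b X hb
    have h1 := hμy b (p X y) hb (hpo.self_of_nhds X)
    simp only [hp, map_sub, map_smul, smul_eq_mul, hsymm y b (v y), hb, mul_zero, sub_zero] at h1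
    linear_combination h1
  have hθd : ∀ u b, G y (v y) u = 0 → fderiv ℝ G y u (v y) b + G y (fderiv ℝ v y u) b =
      covField G v y u b + G y (v y) (christoffel S (fderiv ℝ G y) u b) := by
    intro u b hu
    rw [hsymm y (v y), inner_christoffel hS, covField_apply, hD u b, hD b u, hD (v y) u b]
    ring
  rw [hN b (christoffel _ _ _ _) hb, hN u (christoffel _ _ _ _) hu, hθd u b hu, hθd b u hb, hθd u c hu, hθd b c hb, hμy u b hu hb,
    hμy b u hb hu, hμy u c hu hc, hμy b c hb hc, hsymm y b u,
    christoffel_symm hD b u, hsymm y b (christoffel S _ u c), hsymm y u (christoffel S _ b c),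
    inner_christoffel hS, inner_christoffel hS, hD b u c, hD u c b, hD c b u]
  ring

end Congruence

section Inverse

theorem IsLorentzForm.exists_equiv {b : E4 →L[ℝ] E4 →L[ℝ] ℝ} (hb : IsLorentzForm b) :
    ∃ f : E4 ≃L[ℝ] (E4 →L[ℝ] ℝ), (f : E4 →L[ℝ] E4 →L[ℝ] ℝ) = b := by
  have hinj : Function.Injective b := by
    refine (injective_iff_map_eq_zero b).2 fun x hx => hb.eq_zero fun w => ?_
    rw [hx, _root_.zero_apply]
  have hfin : Module.finrank ℝ E4 = Module.finrank ℝ (E4 →L[ℝ] ℝ) := by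
    rw [← LinearMap.toContinuousLinearMap.finrank_eq (M := E4 →ₗ[ℝ] ℝ)]
    exact (Subspace.dual_finrank_eq (K := ℝ) (V := E4)).symm
  refine ⟨(LinearEquiv.ofInjectiveOfFinrankEq b.toLinearMap hinj hfin).toContinuousLinearEquiv, ?_⟩
  ext1 x
  rfl

/-- Raising an index with the inverse of a metric. -/
theorem IsLorentzForm.inverse_apply {b : E4 →L[ℝ] E4 →L[ℝ] ℝ} (hb : IsLorentzForm b)
    (f : E4 →L[ℝ] ℝ) (z : E4) : b (b.inverse f) z = f z := by
  obtain ⟨e, rfl⟩ := hb.exists_equiv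
  rw [ContinuousLinearMap.inverse_equiv]
  simp

end Inverse

section Synchronization

variable {M : Type*} [TopologicalSpace M] [ChartedSpace E4 M] [IsManifold (𝓡 4) ∞ M]
  {g : LorentzMetric M} {T : TimeOrientation g} {W U : Set M}
  {V : (x : M) → TangentSpace (𝓡 4) x} {φ : OpenPartialHomeomorph M E4} {y₀ : E4}

/-- The Pontryagin form of a metric, at the position `y` in the chart `φ`. -/
noncomputable def LorentzMetric.pontryaginForm (g : LorentzMetric M)
    (φ : OpenPartialHomeomorph M E4) (y a b c d : E4) : ℝ :=
  pontryagin (g.inChart φ y).inverse (g.inChart φ y) (fderiv ℝ (g.inChart φ) y)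
    (fderiv ℝ (fderiv ℝ (g.inChart φ)) y) a b c d

/-- Where the clocks of an observer field can be synchronized, the Pontryagin form vanishes. -/
theorem pontryaginForm_eq_zero [T2Space M] (hV : IsObserverField T U V) (hU : IsOpen U)
    (hUW : U ⊆ W) (hW : IsConvexNhd g W) (hφ : φ ∈ atlas E4 M) (hy : y₀ ∈ chartDomain φ U)
    (hrad : ∀ A B : Clock T, A.IsClockOf U V → B.IsClockOf U V →
      Disjoint A.trajectory B.trajectory → InRadarNhd W A B)
    (hsync : ∀ K : Fin 3 → Clock T, (∀ i, (K i).IsClockOf U V) →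
      (Pairwise fun i j => Disjoint (K i).trajectory (K j).trajectory) → Synchronizable W K ⊤)
    (a b c d : E4) : g.pontryaginForm φ y₀ a b c d = 0 := by
  have hL : IsLorentzForm (g.inChart φ y₀) := isLorentzForm_inChart hφ hy.1
  have hsymm : ∀ z a b, g.inChart φ z a b = g.inChart φ z b a := fun z a b => inChart_symm z a b
  have hv := fieldInChart_timelike (g := g) hV hφ hy
  have h2 : (2 : ℕ∞ω) ≤ ∞ := ENat.LEInfty.out
  have hG : ContDiffAt ℝ 2 (g.inChart φ) y₀ := (contDiffAt_inChart hφ hy.1).of_le h2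
  have hvd : ContDiffAt ℝ 2 (fieldInChart V φ) y₀ :=
    (contDiffAt_fieldInChart hV hU hφ hy).of_le h2
  obtain ⟨e, he0, he⟩ := hL.exists_frame (hsymm y₀) hv
  have hS := hL.inverse_apply
  choose! μ hμ using fun y (hy : y ∈ chartDomain φ U) =>
    exists_covForm_eq hV hU hUW hW hφ hy hrad hsync
  obtain ⟨κ, hκ⟩ := exists_curvature_eq hG hvd hsymm hS hv.ne (e := e 1)
    (by rw [← he0]; exact he.orthogonal 0 1 (by decide))
    (by rw [he.succ 1 (by decide)]; exact one_ne_zero) (μ := μ)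
    (by filter_upwards [(isOpen_chartDomain hU).mem_nhds hy] with z hz using hμ z hz)
  have hD := fderiv_form_symm (hG.differentiableAt (by simp)) (Eventually.of_forall hsymm)
  have hH := fderiv_fderiv_form_symm hG (Eventually.of_forall hsymm)
  refine pontryagin_eq_zero_of_basis (e := e) ?_ a b c d
  exact he.wedgeSquare_eq_zero hS curvatureForm_swap (curvatureForm_skew (hsymm y₀))
    (curvatureForm_pair (hsymm y₀) hD hH (hG.isSymmSndFDerivAt (by simp)).eq) (κ := κ)
    (by rw [he0]; exact hκ)

end Synchronization

end

/-! ### Perturbation of the Pontryagin form -/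

section

section Perturbation

variable {E : Type*} [NormedAddCommGroup E] [NormedSpace ℝ E] {G : E →L[ℝ] E →L[ℝ] ℝ}
  {S : (E →L[ℝ] ℝ) →L[ℝ] E} {DG : E →L[ℝ] E →L[ℝ] E →L[ℝ] ℝ}
  {HG K : E →L[ℝ] E →L[ℝ] E →L[ℝ] E →L[ℝ] ℝ}

theorem christoffel_zero (u w : E) : christoffel S 0 u w = 0 := by
  have h : christoffel S 0 u w = S ((1 / 2 : ℝ) • (0 + 0 - 0)) := rfl
  rw [h, add_zero, sub_zero, smul_zero, map_zero]

theorem curvatureForm_add_smul (t : ℝ) (u v : E) : curvatureForm S G DG (HG + t • K) u v =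
    curvatureForm S G DG HG u v + t • curvatureForm S G 0 K u v := by
  refine ContinuousLinearMap.ext fun w => ContinuousLinearMap.ext fun z => ?_
  rw [_root_.add_apply, _root_.add_apply, _root_.smul_apply, _root_.smul_apply, smul_eq_mul,
    curvatureForm_apply, curvatureForm_apply, curvatureForm_apply]
  simp only [christoffel_zero, map_zero, _root_.add_apply, _root_.smul_apply, smul_eq_mul]
  ring

/-- Along a line of second derivatives of the metric the Pontryagin form is a quadratic polynomial,
whose leading coefficient does not depend on the 2-jet one starts from. -/
theorem exists_pontryagin_add_smul (a b c d : E) : ∃ p : ℝ, ∀ t : ℝ,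
    pontryagin S G DG (HG + t • K) a b c d =
      pontryagin S G DG HG a b c d + t * p + t ^ 2 * pontryagin S G 0 K a b c d := by
  have h : ∀ R Q : E → E → E →L[ℝ] E →L[ℝ] ℝ, ∃ p : ℝ, ∀ t : ℝ,
      wedgeSquare (fun x y => tracePair S x y) (fun u v => R u v + t • Q u v) a b c d =
        wedgeSquare (fun x y => tracePair S x y) R a b c d + t * p +
          t ^ 2 * wedgeSquare (fun x y => tracePair S x y) Q a b c d := by
    intro R Q
    refine ⟨tracePair S (R a b) (Q c d) + tracePair S (Q a b) (R c d) +
      (tracePair S (R a c) (Q d b) + tracePair S (Q a c) (R d b)) +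
      (tracePair S (R a d) (Q b c) + tracePair S (Q a d) (R b c)), fun t => ?_⟩
    simp only [wedgeSquare, map_add, map_smul, LinearMap.add_apply, LinearMap.smul_apply,
      smul_eq_mul]
    ring
  obtain ⟨p, hp⟩ := h (curvatureForm S G DG HG) (curvatureForm S G 0 K)
  refine ⟨p, fun t => ?_⟩
  rw [pontryagin, pontryagin, pontryagin, ← hp]
  simp only [wedgeSquare, curvatureForm_add_smul]

/-- If the leading coefficient does not vanish, arbitrarily small changes of the second derivatives
make the Pontryagin form nonzero. -/
theorem frequently_pontryagin_ne_zero {a b c d : E} (h : pontryagin S G 0 K a b c d ≠ 0) :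
    ∃ᶠ t in 𝓝 (0 : ℝ), pontryagin S G DG (HG + t • K) a b c d ≠ 0 := by
  obtain ⟨p, hp⟩ := exists_pontryagin_add_smul (S := S) (G := G) (DG := DG) (HG := HG) (K := K)
    a b c d
  rw [Filter.Frequently]
  intro hev
  simp only [ne_eq, not_not] at hev
  obtain ⟨r, hr, hball⟩ := Metric.eventually_nhds_iff.1 hev
  have key : ∀ s : ℝ, |s| < r → pontryagin S G DG HG a b c d + s * p +
      s ^ 2 * pontryagin S G 0 K a b c d = 0 := fun s hs => by
    rw [← hp]; exact hball (by rwa [Real.dist_eq, sub_zero])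
  -- the second difference of the polynomial
  have h0 := key 0 (by simpa using hr)
  have h1 := key (r / 2) (by rw [abs_of_pos (half_pos hr)]; exact half_lt_self hr)
  have h2 := key (-(r / 2)) (by rw [abs_neg, abs_of_pos (half_pos hr)]; exact half_lt_self hr)
  have h3 : r ^ 2 * pontryagin S G 0 K a b c d = 0 := by linear_combination 2 * h1 + 2 * h2 - 4 * h0
  exact h ((mul_eq_zero.1 h3).resolve_left (pow_ne_zero 2 hr.ne'))

/-- A second derivative of the metric for which the Pontryagin form does not vanish. -/
theorem IsFrame.pontryagin_ne_zero {e : Module.Basis (Fin 4) ℝ E} (he : IsFrame G e)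
    (hS : ∀ f z, G (S f) z = f z) (hG : ∀ a b, G a b = G b a)
    (hK : ∀ u v a b, K u v a b = 2 * (e.coord 1 u * e.coord 1 v * (e.coord 0 a * e.coord 0 b)) +
      (e.coord 0 u * e.coord 2 v + e.coord 2 u * e.coord 0 v) *
        (e.coord 1 a * e.coord 3 b + e.coord 3 a * e.coord 1 b)) :
    pontryagin S G 0 K (e 0) (e 1) (e 2) (e 3) ≠ 0 := by
  have hc : ∀ i j, e.coord i (e j) = if j = i then 1 else 0 := fun i j => by
    rw [Module.Basis.coord_apply, Module.Basis.repr_self, Finsupp.single_apply]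
  have hsk := fun u v => curvatureForm_skew (S := S) (DG := 0) (HG := K) hG u v
  have h0 := he.zero
  have hR : ∀ i j k l, curvatureForm S G 0 K (e i) (e j) (e k) (e l) =
      1 / 2 * (K (e i) (e k) (e j) (e l) - K (e i) (e l) (e j) (e k) -
        (K (e j) (e k) (e i) (e l) - K (e j) (e l) (e i) (e k))) := fun i j k l => by
    rw [curvatureForm_apply]
    simp only [christoffel_zero, map_zero, sub_zero, add_zero]
  simp only [pontryagin, wedgeSquare, he.tracePair_eq_of_skew hS (hsk _ _) (hsk _ _), hR, hK, hc]
  simp [h0]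

end Perturbation

section Open

/-- Symmetric forms near a Lorentzian form are Lorentzian. -/
theorem IsLorentzForm.eventually {b : E4 →L[ℝ] E4 →L[ℝ] ℝ} (hb : IsLorentzForm b) :
    ∀ᶠ c in 𝓝 b, (∀ u w, c u w = c w u) → IsLorentzForm c := by
  obtain ⟨-, v, hv, hpos⟩ := hb
  have hc : ∀ u w : E4, Continuous fun b : E4 →L[ℝ] E4 →L[ℝ] ℝ => b u w := fun u w => by fun_prop
  have h1 : ∀ᶠ c : E4 →L[ℝ] E4 →L[ℝ] ℝ in 𝓝 b, c v v < 0 :=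
    (hc v v).continuousAt.eventually_lt_const hv
  have hc2 : Continuous fun p : (E4 →L[ℝ] E4 →L[ℝ] ℝ) × E4 => max |p.1 v p.2| (p.1 p.2 p.2) := by
    refine Continuous.max (Continuous.abs ?_) ?_
    · exact ((continuous_fst.clm_apply continuous_const).clm_apply continuous_snd)
    · exact ((continuous_fst.clm_apply continuous_snd).clm_apply continuous_snd)
  have h2 : ∀ᶠ c : E4 →L[ℝ] E4 →L[ℝ] ℝ in 𝓝 b, ∀ w ∈ Metric.sphere (0 : E4) 1,
      0 < max |c v w| (c w w) := by
    refine (isCompact_sphere (0 : E4) 1).eventually_forall_of_forall_eventually fun w hw => ?_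
    refine hc2.continuousAt.eventually_const_lt ?_
    have hw0 : w ≠ 0 := by
      rintro rfl
      simp at hw
    by_cases h : b v w = 0
    · exact lt_max_of_lt_right (hpos w h hw0)
    · exact lt_max_of_lt_left (abs_pos.2 h)
  filter_upwards [h1, h2] with c h1 h2 hs
  refine ⟨hs, v, h1, fun w hw hw0 => ?_⟩
  have hn : 0 < ‖w‖ := norm_pos_iff.2 hw0
  have h3 := h2 (‖w‖⁻¹ • w) (by simp [norm_smul, hn.ne'])
  rw [map_smul, hw, smul_zero, abs_zero] at h3
  have h4 := (lt_max_iff.1 h3).resolve_left (lt_irrefl _)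
  rw [map_smul, map_smul, _root_.smul_apply, smul_eq_mul, smul_eq_mul] at h4
  have hi : 0 < ‖w‖⁻¹ := inv_pos.2 hn
  exact pos_of_mul_pos_right (pos_of_mul_pos_right h4 hi.le) hi.le

variable {X : Type*} [TopologicalSpace X] {G : X → E4 →L[ℝ] E4 →L[ℝ] ℝ}
  {S : X → (E4 →L[ℝ] ℝ) →L[ℝ] E4} {DG : X → E4 →L[ℝ] E4 →L[ℝ] E4 →L[ℝ] ℝ}
  {HG : X → E4 →L[ℝ] E4 →L[ℝ] E4 →L[ℝ] E4 →L[ℝ] ℝ}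

theorem continuous_inverse (hG : Continuous G) (hL : ∀ x, IsLorentzForm (G x)) :
    Continuous fun x => (G x).inverse := by
  rw [continuous_iff_continuousAt]
  intro x
  obtain ⟨f, hf⟩ := (hL x).exists_equiv
  have h := (contDiffAt_map_inverse (𝕜 := ℝ) (n := 0) f).continuousAt
  rw [hf] at h
  exact ContinuousAt.comp (f := G) h hG.continuousAt

theorem continuous_tracePair {α β : X → E4 →L[ℝ] E4 →L[ℝ] ℝ} (hS : Continuous S)
    (hα : Continuous α) (hβ : Continuous β) : Continuous fun x => tracePair (S x) (α x) (β x) := by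
  have h1 : Continuous fun x => (S x ∘L α x) ∘L (S x ∘L β x) :=
    (hS.clm_comp hα).clm_comp (hS.clm_comp hβ)
  let tr : (E4 →L[ℝ] E4) →ₗ[ℝ] ℝ := LinearMap.trace ℝ E4 ∘ₗ ContinuousLinearMap.coeLM ℝ
  have h2 : Continuous tr := tr.continuous_of_finiteDimensional
  exact h2.comp h1

theorem continuous_curvatureForm (hS : Continuous S) (hG : Continuous G)
    (hD : ∀ u w z, Continuous fun x => DG x u w z)
    (hH : ∀ u v w z, Continuous fun x => HG x u v w z) (u v : E4) :
    Continuous fun x => curvatureForm (S x) (G x) (DG x) (HG x) u v := by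
  have hΓ : ∀ u w, Continuous fun x => christoffel (S x) (DG x) u w := fun u w => by
    refine hS.clm_apply (g := fun x => ((1 / 2 : ℝ) • (DG x u + (DG x).flip u -
      ((DG x).flip u).flip)) w) (continuous_clm_apply.2 fun z => ?_)
    exact (((hD u w z).add (hD w u z)).sub (hD z u w)).const_mul (1 / 2)
  refine continuous_clm_apply.2 fun w => continuous_clm_apply.2 fun z => ?_
  simp only [curvatureForm_apply]
  exact ((((hH u w v z).sub (hH u z v w)).sub ((hH v w u z).sub (hH v z u w))).const_mul _).add
    (((hG.clm_apply (hΓ u w)).clm_apply (hΓ v z)).sub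
      ((hG.clm_apply (hΓ v w)).clm_apply (hΓ u z)))

theorem continuous_pontryagin (hS : Continuous S) (hG : Continuous G)
    (hD : ∀ u w z, Continuous fun x => DG x u w z)
    (hH : ∀ u v w z, Continuous fun x => HG x u v w z) (a b c d : E4) :
    Continuous fun x => pontryagin (S x) (G x) (DG x) (HG x) a b c d := by
  have h := continuous_curvatureForm hS hG hD hH
  exact ((continuous_tracePair hS (h _ _) (h _ _)).add (continuous_tracePair hS (h _ _) (h _ _))).add
    (continuous_tracePair hS (h _ _) (h _ _))

end Open

end

/-! ### The topology of the space of metrics -/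

section

variable {M : Type*} [TopologicalSpace M] [ChartedSpace E4 M] [IsManifold (𝓡 4) ∞ M]
  {g : LorentzMetric M} {φ : OpenPartialHomeomorph M E4} {y : E4}

section Open

theorem continuous_iteratedFDeriv_inChart (hφ : φ ∈ atlas E4 M) (hy : y ∈ φ.target) (v w : E4)
    (k : ℕ) : Continuous fun g : LorentzMetric M =>
      iteratedFDeriv ℝ k (fun y => g.inChart φ y v w) y := by
  have h1 : Continuous fun g : LorentzMetric M =>
      UniformOnFun.ofFun {K : Set E4 | IsCompact K ∧ K ⊆ φ.target}
        (iteratedFDeriv ℝ k (fun y ↦ g.inChart φ y v w)) := by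
    rw [continuous_iff_le_induced]
    exact iInf₂_le_of_le φ hφ (iInf₂_le_of_le v w (iInf_le _ k))
  have h2 : ({y} : Set E4) ∈ {K : Set E4 | IsCompact K ∧ K ⊆ φ.target} :=
    ⟨isCompact_singleton, singleton_subset_iff.2 hy⟩
  exact (UniformOnFun.uniformContinuous_eval_of_mem _ _ (mem_singleton y) h2).continuous.comp h1

theorem iteratedFDeriv_inChart_apply (hφ : φ ∈ atlas E4 M) (hy : y ∈ φ.target) (v w : E4)
    (k : ℕ) (m : Fin k → E4) : iteratedFDeriv ℝ k (fun y => g.inChart φ y v w) y m =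
      iteratedFDeriv ℝ k (g.inChart φ) y m v w := by
  let ev : (E4 →L[ℝ] E4 →L[ℝ] ℝ) →L[ℝ] ℝ :=
    (ContinuousLinearMap.apply ℝ ℝ w) ∘L (ContinuousLinearMap.apply ℝ (E4 →L[ℝ] ℝ) v)
  have h := ev.iteratedFDeriv_comp_left (contDiffAt_inChart (g := g) hφ hy) (i := k)
    (by exact_mod_cast le_top)
  exact congrArg (fun L => L m) h

theorem continuous_pontryaginForm (hφ : φ ∈ atlas E4 M) (hy : y ∈ φ.target) (a b c d : E4) :
    Continuous fun g : LorentzMetric M => g.pontryaginForm φ y a b c d := by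
  have hk : ∀ (k : ℕ) (m : Fin k → E4) (v w : E4), Continuous fun g : LorentzMetric M =>
      iteratedFDeriv ℝ k (g.inChart φ) y m v w := fun k m v w => by
    have := (ContinuousMultilinearMap.apply ℝ (fun _ : Fin k => E4) ℝ m).continuous.comp
      (continuous_iteratedFDeriv_inChart hφ hy v w k)
    refine this.congr fun g => iteratedFDeriv_inChart_apply hφ hy v w k m
  have h0 : Continuous fun g : LorentzMetric M => g.inChart φ y :=
    continuous_clm_apply.2 fun v => continuous_clm_apply.2 fun w =>
      (hk 0 0 v w).congr fun g => by rw [iteratedFDeriv_zero_apply]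
  refine continuous_pontryagin (continuous_inverse h0 fun g => isLorentzForm_inChart hφ hy) h0
    (fun u v w => ?_) (fun u u' v w => ?_) a b c d
  · exact (hk 1 ![u] v w).congr fun g => by rw [iteratedFDeriv_one_apply]; rfl
  · exact (hk 2 ![u, u'] v w).congr fun g => by rw [iteratedFDeriv_two_apply]; rfl

end Open

section Limit

/-- Metrics that approach `g` along a line converge to `g` in the `C^∞` topology. -/
theorem LorentzMetric.tendsto_of_inner_eq {γ : ℝ → LorentzMetric M}
    {h : (x : M) → TangentSpace (𝓡 4) x → TangentSpace (𝓡 4) x → ℝ}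
    (hγ : ∀ᶠ t in 𝓝 (0 : ℝ), ∀ x u v, (γ t).inner x u v = g.inner x u v + t * h x u v) :
    Tendsto γ (𝓝 0) (𝓝 g) := by
  -- the direction `h` is a multiple of a difference of metrics, and hence smooth
  obtain ⟨s, hs, hs0⟩ := ((hγ.filter_mono (nhdsWithin_le_nhds (s := {0}ᶜ))).and
    self_mem_nhdsWithin).exists
  rw [mem_singleton_iff] at hs0
  simp only [nhds_iInf, nhds_induced, tendsto_iInf, tendsto_comap_iff]
  intro φ hφ v w k
  rw [UniformOnFun.tendsto_iff_tendstoUniformlyOn]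
  rintro K ⟨hK, hKφ⟩
  set a : E4 → ℝ := fun y => g.inChart φ y v w with ha
  set b : E4 → ℝ := fun y => s⁻¹ * ((γ s).inChart φ y v w - g.inChart φ y v w) with hb
  have hac : ContDiffOn ℝ ∞ a φ.target := contDiffOn_inChart_apply hφ v w
  have hbc : ContDiffOn ℝ ∞ b φ.target := contDiffOn_const.mul
    ((contDiffOn_inChart_apply hφ v w).sub (contDiffOn_inChart_apply hφ v w))
  have hle : (k : ℕ∞ω) ≤ ∞ := by exact_mod_cast le_top
  have hbk : ContinuousOn (iteratedFDeriv ℝ k b) K := by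
    refine ContinuousOn.mono ?_ hKφ
    exact (hbc.continuousOn_iteratedFDerivWithin hle φ.open_target.uniqueDiffOn).congr
      fun y hy => (iteratedFDerivWithin_of_isOpen k φ.open_target hy).symm
  obtain ⟨C, hC⟩ := hK.exists_bound_of_continuousOn hbk
  have hmain : ∀ᶠ t in 𝓝 (0 : ℝ), ∀ y ∈ K, iteratedFDeriv ℝ k (fun y => (γ t).inChart φ y v w) y =
      iteratedFDeriv ℝ k a y + t • iteratedFDeriv ℝ k b y := by
    filter_upwards [hγ] with t ht y hy
    have h1 : (fun y => (γ t).inChart φ y v w) = a + t • b := by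
      funext y
      simp only [Pi.add_apply, Pi.smul_apply, smul_eq_mul, ha, hb, inChart_apply, ht, hs]
      field_simp
      ring
    have hay := (hac.contDiffAt (φ.open_target.mem_nhds (hKφ hy))).of_le hle
    have hby := (hbc.contDiffAt (φ.open_target.mem_nhds (hKφ hy))).of_le hle
    have hby' : ContDiffAt ℝ k (t • b) y := hby.const_smul t
    rw [h1, iteratedFDeriv_add_apply hay hby', iteratedFDeriv_const_smul_apply hby]
  rw [Metric.tendstoUniformlyOn_iff]
  intro ε hε
  have hsmall : ∀ᶠ t in 𝓝 (0 : ℝ), |t| * (|C| + 1) < ε := by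
    have : Continuous fun t : ℝ => |t| * (|C| + 1) := by fun_prop
    exact this.continuousAt.eventually_lt_const (by simpa using hε)
  filter_upwards [hmain, hsmall] with t ht hte y hy
  change dist (iteratedFDeriv ℝ k a y) (iteratedFDeriv ℝ k (fun y => (γ t).inChart φ y v w) y) < ε
  rw [ht y hy, dist_self_add_right, norm_smul, Real.norm_eq_abs]
  refine lt_of_le_of_lt ?_ hte
  gcongr
  exact (hC y hy).trans ((le_abs_self C).trans (by linarith))

end Limit

section Sections

theorem contMDiffAt_form {f : M → E4 →L[ℝ] E4 →L[ℝ] ℝ} {x : M}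
    (hf : ∀ v w, ContMDiffAt (𝓡 4) 𝓘(ℝ, ℝ) ∞ (fun x => f x v w) x) :
    ContMDiffAt (𝓡 4) 𝓘(ℝ, E4 →L[ℝ] E4 →L[ℝ] ℝ) ∞ f x := by
  let e : Module.Basis (Fin 4) ℝ E4 := (EuclideanSpace.basisFun (Fin 4) ℝ).toBasis
  let Φ : (E4 →L[ℝ] E4 →L[ℝ] ℝ) →ₗ[ℝ] (Fin 4 → Fin 4 → ℝ) :=
    { toFun := fun b i j => b (e i) (e j)
      map_add' := fun _ _ => rfl
      map_smul' := fun _ _ => rfl }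
  have hΦ : Φ.ker = ⊥ := by
    rw [LinearMap.ker_eq_bot']
    intro b hb
    have h0 : ∀ i, (b (e i)).toLinearMap = 0 := fun i => e.ext fun j => congrFun (congrFun hb i) j
    have h1 : b.toLinearMap = 0 := e.ext fun i =>
      ContinuousLinearMap.ext fun w => congrArg (fun L : E4 →ₗ[ℝ] ℝ => L w) (h0 i)
    exact ContinuousLinearMap.ext fun v => congrArg (fun L : E4 →ₗ[ℝ] E4 →L[ℝ] ℝ => L v) h1
  obtain ⟨Ψ, hΨ⟩ := Φ.exists_leftInverse_of_injective hΦ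
  have h1 : ContMDiffAt (𝓡 4) 𝓘(ℝ, Fin 4 → Fin 4 → ℝ) ∞ (fun x => Φ (f x)) x :=
    contMDiffAt_pi_space.2 fun i => contMDiffAt_pi_space.2 fun j => hf (e i) (e j)
  have h2 := (LinearMap.toContinuousLinearMap Ψ).contMDiff (n := ∞) |>.contMDiffAt.comp x h1
  refine h2.congr_of_eventuallyEq (Eventually.of_forall fun z => ?_)
  exact (congrArg (fun L => L (f z)) hΨ).symm

/-- A field of bilinear forms is smooth if it is smooth on smooth vector fields. -/
theorem contMDiffAt_form_section
    {h : (x : M) → TangentSpace (𝓡 4) x →L[ℝ] TangentSpace (𝓡 4) x →L[ℝ] ℝ} {x : M}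
    (hh : ∀ X Y : (x : M) → TangentSpace (𝓡 4) x,
      ContMDiffAt (𝓡 4) (𝓡 4).tangent ∞ (fun x => (⟨x, X x⟩ : TangentBundle (𝓡 4) M)) x →
      ContMDiffAt (𝓡 4) (𝓡 4).tangent ∞ (fun x => (⟨x, Y x⟩ : TangentBundle (𝓡 4) M)) x →
      ContMDiffAt (𝓡 4) 𝓘(ℝ, ℝ) ∞ (fun x => h x (X x) (Y x)) x) :
    ContMDiffAt (𝓡 4) ((𝓡 4).prod 𝓘(ℝ, E4 →L[ℝ] E4 →L[ℝ] ℝ)) ∞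
      (fun x => TotalSpace.mk' (E4 →L[ℝ] E4 →L[ℝ] ℝ) x (h x)) x := by
  rw [contMDiffAt_hom_bundle]
  refine ⟨contMDiffAt_id, contMDiffAt_form fun v w => ?_⟩
  let e := trivializationAt E4 (TangentSpace (𝓡 4) : M → Type _) x
  have hx : x ∈ e.baseSet := mem_baseSet_trivializationAt E4 (TangentSpace (𝓡 4)) x
  have hX : ∀ v : E4, ContMDiffAt (𝓡 4) (𝓡 4).tangent ∞
      (fun x => (⟨x, e.symm x v⟩ : TangentBundle (𝓡 4) M)) x := fun v => by
    have h1 := (e.contMDiffOn_symm (IB := 𝓡 4) (n := ∞)).contMDiffAt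
      (x := (x, v)) (e.open_target.mem_nhds (e.mem_target.2 hx))
    refine (h1.comp x (contMDiffAt_id.prodMk contMDiffAt_const)).congr_of_eventuallyEq ?_
    filter_upwards [e.open_baseSet.mem_nhds hx] with z hz
    exact e.mk_symm hz v
  refine (hh _ _ (hX v) (hX w)).congr_of_eventuallyEq ?_
  filter_upwards [e.open_baseSet.mem_nhds hx] with z hz
  rw [inCoordinates_apply_eq₂ hz hz (Set.mem_univ _)]
  have h2 : ∀ r : ℝ, (trivializationAt ℝ (Bundle.Trivial M ℝ) x).linearMapAt ℝ z r = r :=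
    fun r => by simp
  exact h2 _

end Sections

end

/-! ### Local perturbations of a metric -/

section

section Pullback

variable {E F : Type*} [AddCommGroup E] [Module ℝ E] [TopologicalSpace E] [AddCommGroup F]
  [Module ℝ F] [TopologicalSpace F]

theorem IsLorentzForm.congr_equiv {b : E →L[ℝ] E →L[ℝ] ℝ} {c : F →L[ℝ] F →L[ℝ] ℝ}
    (hb : IsLorentzForm b) {L : F → E} {L' : E →L[ℝ] F} (hL : ∀ u, L' (L u) = u)
    (hL' : ∀ u, L (L' u) = u) (h : ∀ u v, c u v = b (L u) (L v)) : IsLorentzForm c := by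
  obtain ⟨hs, v, hv, hpos⟩ := hb
  refine ⟨fun u w => by rw [h, h, hs], L' v, by rwa [h, hL'], fun w hw hw0 => ?_⟩
  rw [h, hL'] at hw
  rw [h]
  refine hpos _ hw fun h0 => hw0 ?_
  rw [← hL w, h0, map_zero]

end Pullback

variable {M : Type*} [TopologicalSpace M] [ChartedSpace E4 M] [IsManifold (𝓡 4) ∞ M]
  {g : LorentzMetric M} {φ : OpenPartialHomeomorph M E4} {χ : M → ℝ}
  {ζ : E4 → E4 →L[ℝ] E4 →L[ℝ] ℝ}

/-- The field of bilinear forms on `M` with components `χ ζ` in the chart `φ`. -/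
noncomputable def chartForm (φ : OpenPartialHomeomorph M E4) (χ : M → ℝ)
    (ζ : E4 → E4 →L[ℝ] E4 →L[ℝ] ℝ) (x : M) :
    TangentSpace (𝓡 4) x →L[ℝ] TangentSpace (𝓡 4) x →L[ℝ] ℝ :=
  let D : E4 →L[ℝ] E4 := components φ x
  let B : E4 →L[ℝ] E4 →L[ℝ] ℝ := χ x • ζ (φ x)
  B.bilinearComp D D

theorem chartForm_apply (x : M) (u v : TangentSpace (𝓡 4) x) : chartForm φ χ ζ x u v =
    χ x * ζ (φ x) (components φ x u) (components φ x v) := rfl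

theorem contMDiffAt_chartForm_apply (hφ : φ ∈ atlas E4 M) (hχ : ContMDiff (𝓡 4) 𝓘(ℝ, ℝ) ∞ χ)
    (hsupp : tsupport χ ⊆ φ.source) (hζ : ContDiff ℝ ∞ ζ)
    {X Y : (x : M) → TangentSpace (𝓡 4) x} {x : M}
    (hX : ContMDiffAt (𝓡 4) (𝓡 4).tangent ∞ (fun x => (⟨x, X x⟩ : TangentBundle (𝓡 4) M)) x)
    (hY : ContMDiffAt (𝓡 4) (𝓡 4).tangent ∞ (fun x => (⟨x, Y x⟩ : TangentBundle (𝓡 4) M)) x) :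
    ContMDiffAt (𝓡 4) 𝓘(ℝ, ℝ) ∞ (fun x => chartForm φ χ ζ x (X x) (Y x)) x := by
  by_cases hx : x ∈ φ.source
  · set f : E4 → ℝ := fun y => ζ y (components φ (φ.symm y) (X (φ.symm y)))
      (components φ (φ.symm y) (Y (φ.symm y))) with hf
    have h1 : ContDiffAt ℝ ∞ f (φ x) :=
      (hζ.contDiffAt.clm_apply (contDiffAt_components hφ le_rfl hx hX)).clm_apply
        (contDiffAt_components hφ le_rfl hx hY)
    have h2 := (contMDiffAt_iff_contDiffAt.2 h1).comp x (contMDiffAt_chart hφ hx)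
    refine ((hχ x).mul h2).congr_of_eventuallyEq ?_
    filter_upwards [φ.open_source.mem_nhds hx] with z hz
    obtain ⟨y, hy, rfl⟩ : ∃ y ∈ φ.target, φ.symm y = z := ⟨φ z, φ.map_source hz, φ.left_inv hz⟩
    change _ = χ (φ.symm y) * f (φ (φ.symm y))
    rw [chartForm_apply, φ.right_inv hy]
  · refine (contMDiffAt_const (c := (0 : ℝ))).congr_of_eventuallyEq ?_
    filter_upwards [notMem_tsupport_iff_eventuallyEq.1 fun h => hx (hsupp h)] with z hz
    rw [chartForm_apply, hz, Pi.zero_apply, zero_mul]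

theorem contMDiff_add_chartForm (hφ : φ ∈ atlas E4 M) (hχ : ContMDiff (𝓡 4) 𝓘(ℝ, ℝ) ∞ χ)
    (hsupp : tsupport χ ⊆ φ.source) (hζ : ContDiff ℝ ∞ ζ) (t : ℝ) :
    ContMDiff (𝓡 4) ((𝓡 4).prod 𝓘(ℝ, E4 →L[ℝ] E4 →L[ℝ] ℝ)) ∞
      (fun x => TotalSpace.mk' (E4 →L[ℝ] E4 →L[ℝ] ℝ) x
        (g.inner x + t • chartForm φ χ ζ x)) := fun x => by
  refine contMDiffAt_form_section fun X Y hX hY => ?_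
  have h1 := ContMDiffAt.clm_bundle_apply₂ (E₃ := Bundle.Trivial M ℝ) (F₃ := ℝ)
    (b := fun x => x) (ψ := fun x => g.inner x) (g.smooth x) hX hY
  rw [contMDiffAt_totalSpace] at h1
  exact h1.2.add (contMDiffAt_const.mul (contMDiffAt_chartForm_apply hφ hχ hsupp hζ hX hY))

theorem eventually_isLorentzForm_add_chartForm (hφ : φ ∈ atlas E4 M) (hχ : Continuous χ)
    (hcomp : HasCompactSupport χ) (hsupp : tsupport χ ⊆ φ.source) (hζ : Continuous ζ)
    (hsymm : ∀ y u v, ζ y u v = ζ y v u) :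
    ∀ᶠ t in 𝓝 (0 : ℝ), ∀ x, IsLorentzForm (g.inner x + t • chartForm φ χ ζ x) := by
  have hC : IsCompact (φ '' tsupport χ) := hcomp.isCompact.image_of_continuousOn
    (φ.continuousOn.mono hsupp)
  have h1 : ∀ᶠ t in 𝓝 (0 : ℝ), ∀ y ∈ φ '' tsupport χ,
      IsLorentzForm (g.inChart φ y + t • χ (φ.symm y) • ζ y) := by
    refine hC.eventually_forall_of_forall_eventually ?_
    rintro _ ⟨x, hx, rfl⟩
    have hy : φ x ∈ φ.target := φ.map_source (hsupp hx)
    have hG : ContinuousAt (fun z : ℝ × E4 => g.inChart φ z.2) (0, φ x) :=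
      ContinuousAt.comp (f := Prod.snd) (x := ((0 : ℝ), φ x)) (g := g.inChart φ)
        (contDiffAt_inChart hφ hy).continuousAt continuousAt_snd
    have hχ' : ContinuousAt (fun z : ℝ × E4 => χ (φ.symm z.2)) (0, φ x) :=
      ContinuousAt.comp (f := Prod.snd) (x := ((0 : ℝ), φ x)) (g := fun y => χ (φ.symm y))
        (hχ.continuousAt.comp (φ.continuousAt_symm hy)) continuousAt_snd
    have hc : ContinuousAt (fun z : ℝ × E4 => g.inChart φ z.2 + z.1 • χ (φ.symm z.2) • ζ z.2)
        (0, φ x) :=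
      hG.add (continuousAt_fst.smul (hχ'.smul (hζ.comp continuous_snd).continuousAt))
    have h2 : ∀ᶠ c in 𝓝 (g.inChart φ (φ x) + (0 : ℝ) • χ (φ.symm (φ x)) • ζ (φ x)),
        (∀ u w, c u w = c w u) → IsLorentzForm c := by
      have h0 : g.inChart φ (φ x) + (0 : ℝ) • χ (φ.symm (φ x)) • ζ (φ x) = g.inChart φ (φ x) :=
        ContinuousLinearMap.ext fun u => ContinuousLinearMap.ext fun v => by
          change g.inChart φ (φ x) u v + 0 * (χ (φ.symm (φ x)) * ζ (φ x) u v) = _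
          rw [zero_mul, add_zero]
      rw [h0]
      exact (isLorentzForm_inChart hφ hy).eventually
    filter_upwards [hc.eventually h2] with z hz
    refine hz fun u w => ?_
    simp only [_root_.add_apply, _root_.smul_apply, inChart_symm z.2 u w, hsymm z.2 u w]
  filter_upwards [h1] with t ht x
  by_cases hx : x ∈ tsupport χ
  · obtain ⟨y, hy, rfl⟩ : ∃ y ∈ φ.target, φ.symm y = x :=
      ⟨φ x, φ.map_source (hsupp hx), φ.left_inv (hsupp hx)⟩
    refine (ht y ⟨_, hx, φ.right_inv hy⟩).congr_equiv (L := components φ (φ.symm y))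
      (L' := ofComponents φ y) (ofComponents_components hφ hy) (components_ofComponents hφ hy)
      fun u v => ?_
    have h3 : g.inner (φ.symm y) u v = g.inChart φ y (components φ (φ.symm y) u)
        (components φ (φ.symm y) v) := by
      rw [inner_eq_inChart hφ (φ.map_target hy), φ.right_inv hy]
    have h4 : chartForm φ χ ζ (φ.symm y) u v = χ (φ.symm y) *
        ζ y (components φ (φ.symm y) u) (components φ (φ.symm y) v) := by
      rw [chartForm_apply, φ.right_inv hy]
    rw [_root_.add_apply, _root_.add_apply, _root_.smul_apply, _root_.smul_apply, h3, h4]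
    rfl
  · have h0 : g.inner x + t • chartForm φ χ ζ x = g.inner x := by
      refine ContinuousLinearMap.ext fun u => ContinuousLinearMap.ext fun v => ?_
      change g.inner x u v + t * chartForm φ χ ζ x u v = _
      rw [chartForm_apply, image_eq_zero_of_notMem_tsupport hx, zero_mul, mul_zero, add_zero]
    rw [h0]
    exact g.isLorentzForm x

/-- Every symmetric perturbation of the components of a metric at a point is realized by metrics
that converge to the given one. -/
theorem LorentzMetric.exists_perturbation [T2Space M] (g : LorentzMetric M) (x₀ : M)
    (hζ : ContDiff ℝ ∞ ζ) (hsymm : ∀ y u v, ζ y u v = ζ y v u) :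
    ∃ γ : ℝ → LorentzMetric M, Tendsto γ (𝓝 0) (𝓝 g) ∧ ∀ᶠ t in 𝓝 (0 : ℝ),
      (γ t).inChart (chartAt E4 x₀) =ᶠ[𝓝 (chartAt E4 x₀ x₀)]
        fun y => g.inChart (chartAt E4 x₀) y + t • ζ y := by
  obtain ⟨χ⟩ : Nonempty (SmoothBumpFunction (𝓡 4) x₀) := inferInstance
  set φ := chartAt E4 x₀ with hφdef
  have hφ : φ ∈ atlas E4 M := chart_mem_atlas E4 x₀
  have hx₀ : x₀ ∈ φ.source := mem_chart_source E4 x₀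
  have hsupp : tsupport χ ⊆ φ.source := χ.tsupport_subset_chartAt_source
  have hL := eventually_isLorentzForm_add_chartForm (g := g) hφ χ.continuous χ.hasCompactSupport
    hsupp hζ.continuous hsymm
  classical
  let γ : ℝ → LorentzMetric M := fun t =>
    if h : ∀ x, IsLorentzForm (g.inner x + t • chartForm φ χ ζ x) then
      { inner := fun x => g.inner x + t • chartForm φ χ ζ x
        symm := fun x => (h x).1
        lorentzian := fun x => (h x).2
        smooth := contMDiff_add_chartForm hφ χ.contMDiff hsupp hζ t }
    else g
  have hγ : ∀ᶠ t in 𝓝 (0 : ℝ), ∀ x, (γ t).inner x = g.inner x + t • chartForm φ χ ζ x := by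
    filter_upwards [hL] with t ht x
    simp only [γ, dif_pos ht]
  refine ⟨γ, LorentzMetric.tendsto_of_inner_eq (h := fun x u v => chartForm φ χ ζ x u v)
    (hγ.mono fun t ht x u v => ?_), hγ.mono fun t ht => ?_⟩
  · rw [ht]; rfl
  · have h1 : Tendsto φ.symm (𝓝 (φ x₀)) (𝓝 x₀) := by
      have := φ.continuousAt_symm (φ.map_source hx₀)
      rwa [ContinuousAt, φ.left_inv hx₀] at this
    filter_upwards [φ.open_target.mem_nhds (φ.map_source hx₀),
      h1.eventually χ.eventuallyEq_one] with y hy hχ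
    refine ContinuousLinearMap.ext fun u => ContinuousLinearMap.ext fun v => ?_
    have h2 : chartForm φ χ ζ (φ.symm y) (ofComponents φ y u) (ofComponents φ y v) = ζ y u v := by
      rw [chartForm_apply, hχ, Pi.one_apply, one_mul, φ.right_inv hy,
        components_ofComponents hφ hy, components_ofComponents hφ hy]
    rw [inChart_apply, ht]
    have h3 : (g.inner (φ.symm y) + t • chartForm φ χ ζ (φ.symm y)) (ofComponents φ y u)
        (ofComponents φ y v) = g.inner (φ.symm y) (ofComponents φ y u) (ofComponents φ y v) +
          t * chartForm φ χ ζ (φ.symm y) (ofComponents φ y u) (ofComponents φ y v) := rfl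
    rw [h3, h2]
    rfl

end

/-! ### Generic metrics -/

section

section Quadratic

variable {E : Type*} [NormedAddCommGroup E] [NormedSpace ℝ E]

theorem hasFDerivAt_quadratic (K : E →L[ℝ] E →L[ℝ] E →L[ℝ] E →L[ℝ] ℝ)
    (hK : ∀ u v a b, K u v a b = K v u a b) (y₀ y : E) :
    HasFDerivAt (fun y => (1 / 2 : ℝ) • K (y - y₀) (y - y₀)) (K (y - y₀)) y := by
  have h1 : HasFDerivAt (fun y => y - y₀) (ContinuousLinearMap.id ℝ E) y :=
    (hasFDerivAt_id y).sub_const y₀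
  have h2 : HasFDerivAt (fun y => K (y - y₀)) (K ∘L ContinuousLinearMap.id ℝ E) y :=
    K.hasFDerivAt.comp y h1
  refine ((h2.clm_apply h1).const_smul (1 / 2 : ℝ)).congr_fderiv ?_
  refine ContinuousLinearMap.ext fun u => ContinuousLinearMap.ext fun a =>
    ContinuousLinearMap.ext fun b => ?_
  change 1 / 2 * (K (y - y₀) u a b + K u (y - y₀) a b) = K (y - y₀) u a b
  rw [hK u]
  ring

theorem contDiff_quadratic (K : E →L[ℝ] E →L[ℝ] E →L[ℝ] E →L[ℝ] ℝ) (y₀ : E) :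
    ContDiff ℝ ∞ fun y => (1 / 2 : ℝ) • K (y - y₀) (y - y₀) := by
  have h : ContDiff ℝ ∞ fun y : E => y - y₀ := contDiff_id.sub contDiff_const
  exact ((K.contDiff.comp h).clm_apply h).const_smul _

set_option synthInstance.maxHeartbeats 200000 in
set_option maxHeartbeats 1000000 in
theorem fderiv_fderiv_add_quadratic {G : E → E →L[ℝ] E →L[ℝ] ℝ} {y₀ : E} (hG : ContDiffAt ℝ 2 G y₀)
    {K : E →L[ℝ] E →L[ℝ] E →L[ℝ] E →L[ℝ] ℝ} (hK : ∀ u v a b, K u v a b = K v u a b) (t : ℝ) :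
    fderiv ℝ (fun y => G y + t • (1 / 2 : ℝ) • K (y - y₀) (y - y₀)) y₀ = fderiv ℝ G y₀ ∧
    fderiv ℝ (fderiv ℝ (fun y => G y + t • (1 / 2 : ℝ) • K (y - y₀) (y - y₀))) y₀ =
      fderiv ℝ (fderiv ℝ G) y₀ + t • K := by
  have h1 : ∀ᶠ y in 𝓝 y₀, fderiv ℝ (fun y => G y + t • (1 / 2 : ℝ) • K (y - y₀) (y - y₀)) y =
      fderiv ℝ G y + t • K (y - y₀) := by
    filter_upwards [hG.eventually (by simp)] with y hy
    exact ((hy.differentiableAt (by simp)).hasFDerivAt.add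
      ((hasFDerivAt_quadratic K hK y₀ y).const_smul t)).fderiv
  refine ⟨?_, ?_⟩
  · rw [h1.self_of_nhds]
    refine ContinuousLinearMap.ext fun u => ContinuousLinearMap.ext fun a =>
      ContinuousLinearMap.ext fun b => ?_
    change fderiv ℝ G y₀ u a b + t * K (y₀ - y₀) u a b = fderiv ℝ G y₀ u a b
    rw [sub_self, map_zero]
    change _ + t * (0 : ℝ) = _
    rw [mul_zero, add_zero]
  · rw [EventuallyEq.fderiv_eq h1]
    have h2 : HasFDerivAt (fun y => K (y - y₀)) (K ∘L ContinuousLinearMap.id ℝ E) y₀ :=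
      K.hasFDerivAt.comp y₀ ((hasFDerivAt_id y₀).sub_const y₀)
    have h3 := ((hG.fderiv_right (m := 1) (by norm_num)).differentiableAt (by simp)).hasFDerivAt
    exact (h3.add (h2.const_smul t)).fderiv

set_option synthInstance.maxHeartbeats 200000 in
/-- The second derivative of the metric that is used in `IsFrame.pontryagin_ne_zero`. -/
theorem exists_multilinear (f : Fin 4 → E →L[ℝ] ℝ) :
    ∃ K : E →L[ℝ] E →L[ℝ] E →L[ℝ] E →L[ℝ] ℝ, ∀ u v a b,
      K u v a b = 2 * (f 1 u * f 1 v * (f 0 a * f 0 b)) +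
        (f 0 u * f 2 v + f 2 u * f 0 v) * (f 1 a * f 3 b + f 3 a * f 1 b) := by
  let A : E →L[ℝ] E →L[ℝ] ℝ := (f 0).smulRight ((2 : ℝ) • f 0)
  let B : E →L[ℝ] E →L[ℝ] ℝ := (f 1).smulRight (f 3) + (f 3).smulRight (f 1)
  let C : Fin 4 → E →L[ℝ] E →L[ℝ] E →L[ℝ] ℝ := fun i => (f i).smulRight B
  let C' : E →L[ℝ] E →L[ℝ] E →L[ℝ] ℝ := (f 1).smulRight A
  let K₁ : E →L[ℝ] E →L[ℝ] E →L[ℝ] E →L[ℝ] ℝ := (f 1).smulRight C'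
  let K₂ : E →L[ℝ] E →L[ℝ] E →L[ℝ] E →L[ℝ] ℝ := (f 0).smulRight (C 2)
  let K₃ : E →L[ℝ] E →L[ℝ] E →L[ℝ] E →L[ℝ] ℝ := (f 2).smulRight (C 0)
  refine ⟨K₁ + (K₂ + K₃), fun u v a b => ?_⟩
  change f 1 u * (f 1 v * (f 0 a * (2 * f 0 b))) +
    (f 0 u * (f 2 v * (f 1 a * f 3 b + f 3 a * f 1 b)) +
      f 2 u * (f 0 v * (f 1 a * f 3 b + f 3 a * f 1 b))) = _
  ring

end Quadratic

variable {M : Type*} [TopologicalSpace M] [ChartedSpace E4 M] [IsManifold (𝓡 4) ∞ M]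

/-- A metric is a limit of metrics with a nonvanishing Pontryagin form at a given point. -/
theorem mem_closure_pontryaginForm_ne_zero [T2Space M] (g : LorentzMetric M) (x₀ : M) :
    g ∈ closure {g : LorentzMetric M | ∃ a b c d,
      g.pontryaginForm (chartAt E4 x₀) (chartAt E4 x₀ x₀) a b c d ≠ 0} := by
  have hφ : chartAt E4 x₀ ∈ atlas E4 M := chart_mem_atlas E4 x₀
  have hy₀ : chartAt E4 x₀ x₀ ∈ (chartAt E4 x₀).target := mem_chart_target E4 x₀
  set φ := chartAt E4 x₀ with hφdef
  set y₀ := φ x₀ with hy₀def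
  have hb : IsLorentzForm (g.inChart φ y₀) := isLorentzForm_inChart hφ hy₀
  obtain ⟨v, hv, -⟩ := hb.2
  obtain ⟨e, -, he⟩ := hb.exists_frame hb.1 hv
  obtain ⟨K, hK⟩ := exists_multilinear fun i => LinearMap.toContinuousLinearMap (e.coord i)
  simp only [LinearMap.coe_toContinuousLinearMap'] at hK
  have hKs : ∀ u v a b, K u v a b = K v u a b := fun u v a b => by rw [hK, hK]; ring
  obtain ⟨γ, hγ, hγ'⟩ := g.exists_perturbation x₀ (contDiff_quadratic K y₀) fun y u v => by
    change 1 / 2 * K (y - y₀) (y - y₀) u v = 1 / 2 * K (y - y₀) (y - y₀) v u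
    rw [hK, hK]; ring
  refine mem_closure_of_frequently_of_tendsto ?_ hγ
  have hne := frequently_pontryagin_ne_zero (DG := fderiv ℝ (g.inChart φ) y₀)
    (HG := fderiv ℝ (fderiv ℝ (g.inChart φ)) y₀)
    (he.pontryagin_ne_zero (S := (g.inChart φ y₀).inverse) hb.inverse_apply hb.1 hK)
  refine (hne.and_eventually hγ').mono fun t ht => ⟨e 0, e 1, e 2, e 3, ?_⟩
  obtain ⟨h1, h2⟩ := ht
  obtain ⟨h3, h4⟩ := fderiv_fderiv_add_quadratic ((contDiffAt_inChart (g := g) hφ hy₀).of_le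
    ENat.LEInfty.out) hKs t
  have h5 : (γ t).inChart φ y₀ = g.inChart φ y₀ := by
    refine h2.self_of_nhds.trans (ContinuousLinearMap.ext fun u => ContinuousLinearMap.ext fun v => ?_)
    change g.inChart φ y₀ u v + t * (1 / 2 * K (y₀ - y₀) (y₀ - y₀) u v) = g.inChart φ y₀ u v
    rw [hK, sub_self]
    simp
  rw [LorentzMetric.pontryaginForm, h5, h2.fderiv_eq, (h2.fderiv (𝕜 := ℝ)).fderiv_eq, h3, h4]
  exact h1

/-- For a generic metric the Pontryagin form does not vanish on any nonempty open set. -/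
theorem eventually_residual_pontryaginForm_ne_zero [T2Space M] [SecondCountableTopology M] :
    ∀ᶠ g in residual (LorentzMetric M), ∀ U : Set M, IsOpen U → U.Nonempty →
      ∃ φ ∈ atlas E4 M, ∃ y ∈ chartDomain φ U, ∃ a b c d, g.pontryaginForm φ y a b c d ≠ 0 := by
  let D : Set M → Set (LorentzMetric M) := fun B => {g | ∃ φ ∈ atlas E4 M, ∃ y ∈ chartDomain φ B,
    ∃ a b c d, g.pontryaginForm φ y a b c d ≠ 0}
  have hD : ∀ B, D B = ⋃ φ ∈ atlas E4 M, ⋃ y ∈ chartDomain φ B, ⋃ (a) (b) (c) (d),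
      {g : LorentzMetric M | g.pontryaginForm φ y a b c d ≠ 0} := fun B => by
    ext g; simp only [D, mem_iUnion, mem_ofPred_eq, exists_prop]
  have hopen : ∀ B, IsOpen (D B) := fun B => by
    rw [hD]
    exact isOpen_biUnion fun φ hφ => isOpen_biUnion fun y hy => isOpen_iUnion fun a =>
      isOpen_iUnion fun b => isOpen_iUnion fun c => isOpen_iUnion fun d =>
        isOpen_ne_fun (continuous_pontryaginForm hφ hy.1 a b c d) continuous_const
  have hdense : ∀ B : Set M, B.Nonempty → Dense (D B) := by
    rintro B ⟨x, hx⟩ g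
    refine closure_mono ?_ (mem_closure_pontryaginForm_ne_zero g x)
    rintro g' hg'
    refine ⟨chartAt E4 x, chart_mem_atlas E4 x, chartAt E4 x x, ⟨mem_chart_target E4 x, ?_⟩, hg'⟩
    rwa [mem_preimage, (chartAt E4 x).left_inv (mem_chart_source E4 x)]
  have hall : ∀ᶠ g in residual (LorentzMetric M), ∀ B ∈ TopologicalSpace.countableBasis M,
      g ∈ D B := by
    rw [eventually_countable_ball (TopologicalSpace.countable_countableBasis M)]
    intro B hB
    exact residual_of_dense_open (hopen B)
      (hdense B (TopologicalSpace.nonempty_of_mem_countableBasis hB))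
  filter_upwards [hall] with g hg U hU hne
  obtain ⟨x, hx⟩ := hne
  obtain ⟨B, hB, -, hBU⟩ := (TopologicalSpace.isBasis_countableBasis M).exists_subset_of_mem_open
    hx hU
  obtain ⟨φ, hφ, y, hy, h⟩ := hg B hB
  exact ⟨φ, hφ, y, ⟨hy.1, hBU hy.2⟩, h⟩

end

end Spacetime

open Spacetime in
theorem proposition2p4 (M : Type*) [TopologicalSpace M] [T2Space M] [SecondCountableTopology M]
    [ChartedSpace E4 M] [IsManifold (𝓡 4) ∞ M] :
    ∀ᶠ g in residual (LorentzMetric M), ∀ T : TimeOrientation g, ∀ W : Set M,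
      -- any single pair of clocks can be synchronized
      (∀ A B : Clock T, Disjoint A.trajectory B.trajectory → InRadarNhd W A B →
        ∃ A' B' : Clock T, A'.IsAdjustmentOf A ∧ B'.IsAdjustmentOf B ∧
          EinsteinSynchronized W A' B') ∧
      -- in every observer field a selection of pairs excludes the synchronization of another pair
      (∀ (U : Set M) (V : (x : M) → TangentSpace (𝓡 4) x),
        IsOpen U → U.Nonempty → U ⊆ W → IsConvexNhd g W → IsObserverField T U V →
        (∀ A B : Clock T, A.IsClockOf U V → B.IsClockOf U V →
          Disjoint A.trajectory B.trajectory → InRadarNhd W A B) →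
        ∃ K : Fin 3 → Clock T, (∀ i, (K i).IsClockOf U V) ∧
          (Pairwise fun i j ↦ Disjoint (K i).trajectory (K j).trajectory) ∧
          ∃ (S : SimpleGraph (Fin 3)) (i j : Fin 3), S ≠ ⊥ ∧ i ≠ j ∧ ¬ S.Adj i j ∧
            Synchronizable W K S ∧ Synchronizable W K (SimpleGraph.edge i j) ∧
            ¬ Synchronizable W K (S ⊔ SimpleGraph.edge i j)) := by
  filter_upwards [eventually_residual_pontryaginForm_ne_zero (M := M)] with g hg T W
  refine ⟨fun A B hAB h => ?_, fun U V hU hne hUW hW hV hrad => ?_⟩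
  · exact h.exists_synchronized
  · by_contra hcon
    obtain ⟨φ, hφ, y, hy, a, b, c, d, h⟩ := hg U hU hne
    refine h (pontryaginForm_eq_zero hV hU hUW hW hφ hy hrad (fun K hK hd => ?_) a b c d)
    by_contra hK'
    exact hcon ⟨K, hK, hd, exists_exclusion (fun i j hij => hrad _ _ (hK i) (hK j) (hd hij)) hK'⟩
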